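/- Let $\varphi=LR$ with $L=\begin{pmatrix}1&1\\0&1\end{pmatrix}$, $R=\begin{pmatrix}1&0\\1&1\end{pmatrix}$, acting on the once-punctured torus $\Sigma=(\mathbb R^2/\mathbb Z^2)\setminus\{0\}$, and let $M_\varphi=\Sigma\times[0,1]/\big((x,0)\sim(\varphi(x),1)\big)$ be the once-punctured torus bundle. Its meridian is the loop around the puncture of a fibre; filling $M_\varphi$ along the meridian gives the closed torus bundle $\overline M_\varphi$ with monodromy $LR$, whose core $K$ is the closed curve swept out by the puncture $0$. For $\theta\in(0,2\pi)$, a hyperbolic cone structure on $M_\varphi$ along the meridian with cone angle $\theta$ is a hyperbolic structure on $M_\varphi=\overline M_\varphi\setminus K$ such that every point of $K$ has a neighbourhood in $\overline M_\varphi$ that is modelled, isometrically off $K$ and with $K$ corresponding to the axis, on an open subset of the hyperbolic cone with metric $dr^2+\sinh^2 r\,d\phi^2+\cosh^2 r\,dt^2$, $\phi\in\mathbb R/\theta\mathbb Z$, with singular axis $r=0$. For $\theta=0$ it is a complete hyperbolic structure on $M_\varphi$. For $z\in\mathbb C\setminus\{0,1\}$ put $z'=\frac1{1-z}$, $z''=1-\frac1z$,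 and, with principal logarithms, $$H(\mu_1)=2(\log z_1''-\log z_1'),\qquad H(\mu_2)=2(\log z_2'-\log z_2''),$$ $$H(e)=\log z_1+2\log z_1'+\log z_2+2\log z_2'.$$ For $\eta_v\in(-\pi,\pi)$ let $B=e^{\eta_v\sqrt{-1}}$ and $$z_1(\eta_v)=\frac{(2-B)+\sqrt{(2-B)^2-4}}2,\qquad z_2(\eta_v)=\frac{(2-B^{-1})+\sqrt{(2-B^{-1})^2-4}}2,$$ where the square roots are the branches that are continuous in $\eta_v\in(-\pi,\pi)$ and equal to $\sqrt{-3}=\sqrt3\,\sqrt{-1}$ at $\eta_v=0$, that is, $\sqrt{(2-B)^2-4}=\sqrt{-1}\,\sqrt{4-(2-B)^2}$ with the principal root on the right (and likewise for $B^{-1}$). **Lemma.** The functions $z_1,z_2$ are continuous on $(-\pi,\pi)$ with $z_1(0)=z_2(0)=e^{\pi\sqrt{-1}/3}$, and for every $\eta_v\in(-\pi,\pi)$: 1. $z_1=z_1(\eta_v)$ and $z_2=z_2(\eta_v)$ solve $z_1^2-(2-B)z_1+1=0$ and $z_2^2-(2-B^{-1})z_2+1=0$, the cone-angle equations $H(\mu_1)=H(\mu_2)=2\eta_v\sqrt{-1}$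 and the edge equation $H(e)=2\pi\sqrt{-1}$; 2. $\mathrm{Im}(z_1(\eta_v))>0$ and $\mathrm{Im}(z_2(\eta_v))>0$, and the triangulation is geometric: $M_\varphi$ has a hyperbolic cone structure along the meridian with cone angle $2|\eta_v|$ which is decomposed, face to face, into two hyperbolic ideal tetrahedra with shape parameters $z_1(\eta_v)$ and $z_2(\eta_v)$. In particular, for every $\theta=2|\eta_v|\in[0,2\pi)$, $M_\varphi$ admits a hyperbolic cone structure along the meridian with cone angle $\theta$. -/

import Mathlib

open Set Filter Topology Manifold

noncomputable section

/-! ### Mapping tori and the once-punctured torus bundle with monodromy `LR` -/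

/-- The relation on `X × ℝ` generated by `(x, t) ∼ (φ x, t + 1)`. -/
def mappingTorusSetoid {X : Type} [TopologicalSpace X] (φ : X ≃ₜ X) : Setoid (X × ℝ) where
  r p q := ∃ n : ℤ, q = ((φ ^ n) p.1, p.2 + n)
  iseqv :=
    { refl := fun p => ⟨0, by simp⟩
      symm := by
        rintro p q ⟨n, rfl⟩
        refine ⟨-n, ?_⟩
        simp
      trans := by
        rintro p q r ⟨n, rfl⟩ ⟨m, rfl⟩
        refine ⟨m + n, ?_⟩
        have h : (φ ^ (m + n)) p.1 = (φ ^ m) ((φ ^ n) p.1) := by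
          rw [zpow_add, Homeomorph.mul_apply]
        simp only [h, Int.cast_add]
        ring_nf }

/-- The mapping torus of `φ`: the quotient of `X × ℝ` by `(x, t) ∼ (φ x, t + 1)`, that is,
`X × [0, 1]` with `(x, 0)` glued to `(φ x, 1)`. -/
def MappingTorus {X : Type} [TopologicalSpace X] (φ : X ≃ₜ X) : Type :=
  Quotient (mappingTorusSetoid φ)

instance {X : Type} [TopologicalSpace X] (φ : X ≃ₜ X) : TopologicalSpace (MappingTorus φ) :=
  inferInstanceAs (TopologicalSpace (Quotient (mappingTorusSetoid φ)))

/-- The class of `(x, t)` in the mapping torus. -/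
def MappingTorus.mk {X : Type} [TopologicalSpace X] (φ : X ≃ₜ X) (p : X × ℝ) : MappingTorus φ :=
  Quotient.mk (mappingTorusSetoid φ) p

/-- The torus `ℝ² / ℤ²`. -/
abbrev Torus : Type := UnitAddCircle × UnitAddCircle

/-- The torus homeomorphism with matrix `L = (1 1; 0 1)`. -/
def torusL : Torus ≃ₜ Torus where
  toFun p := (p.1 + p.2, p.2)
  invFun p := (p.1 - p.2, p.2)
  left_inv p := by simp
  right_inv p := by simp
  continuous_toFun := by fun_prop
  continuous_invFun := by fun_prop

/-- The torus homeomorphism with matrix `R = (1 0; 1 1)`. -/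
def torusR : Torus ≃ₜ Torus where
  toFun p := (p.1, p.1 + p.2)
  invFun p := (p.1, p.2 - p.1)
  left_inv p := by simp
  right_inv p := by simp
  continuous_toFun := by fun_prop
  continuous_invFun := by fun_prop

/-- The torus homeomorphism with matrix `LR = (2 1; 1 1)`: first `R`, then `L`. -/
def torusLR : Torus ≃ₜ Torus := torusR.trans torusL

theorem torusLR_zero : torusLR 0 = 0 := by
  simp [torusLR, torusL, torusR, Prod.ext_iff]

/-- The once-punctured torus: the torus minus the point `0`. -/
abbrev PuncturedTorus : Type := {p : Torus // p ≠ 0}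

/-- The diffeomorphism `LR` of the once-punctured torus. -/
def puncturedTorusLR : PuncturedTorus ≃ₜ PuncturedTorus where
  toFun p := ⟨torusLR p.1, fun h => p.2 (torusLR.injective (h.trans torusLR_zero.symm))⟩
  invFun p := ⟨torusLR.symm p.1, fun h => p.2 (by
    rw [← torusLR.apply_symm_apply p.1, h, torusLR_zero])⟩
  left_inv p := by simp
  right_inv p := by simp
  continuous_toFun := by fun_prop
  continuous_invFun := by fun_prop

/-- The once-punctured torus bundle `M_φ` with monodromy `φ = LR`. -/
abbrev BundleLR : Type := MappingTorus puncturedTorusLR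

/-- The closed torus bundle with monodromy `LR`, obtained from `BundleLR` by filling in the
puncture in each fibre; equivalently, the Dehn filling of `BundleLR` along the meridian, the
loop around the puncture of a fibre. -/
abbrev ClosedBundleLR : Type := MappingTorus torusLR

/-- The inclusion of the once-punctured torus bundle into the closed torus bundle. -/
def bundleInclusion : BundleLR → ClosedBundleLR :=
  Quotient.map (fun p => (p.1.1, p.2)) (by
    have key : ∀ (n : ℤ) (x : PuncturedTorus),
        ((puncturedTorusLR ^ n) x).1 = (torusLR ^ n) x.1 := by
      have hpos : ∀ (n : ℕ) (x : PuncturedTorus),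
          ((puncturedTorusLR ^ n) x).1 = (torusLR ^ n) x.1 := by
        intro n
        induction n with
        | zero => intro x; rfl
        | succ k ih =>
          intro x
          rw [pow_succ, pow_succ, Homeomorph.mul_apply, Homeomorph.mul_apply, ih]
          rfl
      intro n x
      cases n with
      | ofNat m => simpa using hpos m x
      | negSucc m =>
        have h := hpos (m + 1) ((puncturedTorusLR ^ (Int.negSucc m)) x)
        have e1 : (puncturedTorusLR ^ (m + 1)) ((puncturedTorusLR ^ (Int.negSucc m)) x) = x := by
          rw [← Homeomorph.mul_apply, zpow_negSucc, mul_inv_cancel]; rfl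
        rw [e1] at h
        have e2 : ∀ y, (torusLR ^ (Int.negSucc m)) ((torusLR ^ (m + 1)) y) = y := by
          intro y
          rw [← Homeomorph.mul_apply, zpow_negSucc, inv_mul_cancel]; rfl
        rw [h, e2]
    rintro p q ⟨n, rfl⟩
    exact ⟨n, by simp [key]⟩)

/-- The core of the filling: the closed curve in the closed torus bundle swept out by the
puncture `0`. -/
def bundleCore : Set ClosedBundleLR := range fun t : ℝ => MappingTorus.mk torusLR (0, t)

/-! ### Hyperbolic structures -/

/-- Hyperbolic three-space, in the upper half-space model: pairs `(w, s)` with `s > 0`. -/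
abbrev HyperbolicSpace3 : Type := {p : ℂ × ℝ // 0 < p.2}

/-- The hyperbolic distance `arcosh (1 + (|w - w'|² + (s - s')²) / (2 s s'))`. -/
def hdist (p q : HyperbolicSpace3) : ℝ :=
  Real.arcosh (1 + (‖p.1.1 - q.1.1‖ ^ 2 + (p.1.2 - q.1.2) ^ 2) / (2 * p.1.2 * q.1.2))

/-- The maps that are continuous and locally distance-preserving (for the hyperbolic distance). -/
def hyperbolicPregroupoid : Pregroupoid HyperbolicSpace3 where
  property f s := ContinuousOn f s ∧ ∀ x ∈ s, ∃ u, IsOpen u ∧ x ∈ u ∧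
    ∀ y ∈ s ∩ u, ∀ y' ∈ s ∩ u, hdist (f y) (f y') = hdist y y'
  comp := by
    rintro f g u v ⟨hf, hf'⟩ ⟨hg, hg'⟩ hu hv huv
    refine ⟨hg.comp (hf.mono inter_subset_left) fun x hx => hx.2, ?_⟩
    rintro x ⟨hxu, hxv⟩
    obtain ⟨a, ha, hxa, hfa⟩ := hf' x hxu
    obtain ⟨b, hb, hxb, hgb⟩ := hg' (f x) hxv
    refine ⟨a ∩ (u ∩ f ⁻¹' b), ha.inter (hf.isOpen_inter_preimage hu hb), ⟨hxa, hxu, hxb⟩, ?_⟩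
    rintro y ⟨⟨hyu, hyv⟩, hya, -, hyb⟩ y' ⟨⟨hyu', hyv'⟩, hya', -, hyb'⟩
    exact (hgb _ ⟨hyv, hyb⟩ _ ⟨hyv', hyb'⟩).trans (hfa _ ⟨hyu, hya⟩ _ ⟨hyu', hya'⟩)
  id_mem := ⟨continuousOn_id, fun _ _ => ⟨univ, isOpen_univ, mem_univ _, fun _ _ _ _ => rfl⟩⟩
  locality := by
    intro f u hu h
    refine ⟨fun x hx => ?_, fun x hx => ?_⟩
    · obtain ⟨v, hv, hxv, hc, -⟩ := h x hx
      exact ((hc x ⟨hx, hxv⟩).continuousAt ((hu.inter hv).mem_nhds ⟨hx, hxv⟩)).continuousWithinAt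
    · obtain ⟨v, hv, hxv, -, hd⟩ := h x hx
      obtain ⟨a, ha, hxa, hfa⟩ := hd x ⟨hx, hxv⟩
      exact ⟨v ∩ a, hv.inter ha, ⟨hxv, hxa⟩, fun y hy y' hy' =>
        hfa y ⟨⟨hy.1, hy.2.1⟩, hy.2.2⟩ y' ⟨⟨hy'.1, hy'.2.1⟩, hy'.2.2⟩⟩
  congr := by
    rintro f g u hu h ⟨hc, hd⟩
    refine ⟨hc.congr h, fun x hx => ?_⟩
    obtain ⟨a, ha, hxa, hfa⟩ := hd x hx
    refine ⟨a, ha, hxa, fun y hy y' hy' => ?_⟩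
    rw [h y hy.1, h y' hy'.1]
    exact hfa y hy y' hy'

/-- The groupoid of local isometries of hyperbolic three-space. A hyperbolic structure on a
three-manifold `M` is an atlas of charts into `HyperbolicSpace3` with transition maps in this
groupoid. -/
def hyperbolicGroupoid : StructureGroupoid HyperbolicSpace3 := hyperbolicPregroupoid.groupoid

/-- Geodesic completeness: every unit-speed geodesic `[0, a) → M` converges in `M` at `a`.
Unit-speed geodesics are the curves that in charts locally preserve distances. -/
def GeodesicallyComplete (M : Type) [TopologicalSpace M] [ChartedSpace HyperbolicSpace3 M] :
    Prop :=
  ∀ (a : ℝ) (γ : ℝ → M), 0 < a →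
    (∀ s ∈ Ico 0 a, ∃ ε > 0, ∀ u ∈ Ico 0 a, ∀ v ∈ Ico 0 a, |u - s| < ε → |v - s| < ε →
      γ u ∈ (chartAt HyperbolicSpace3 (γ s)).source ∧
      γ v ∈ (chartAt HyperbolicSpace3 (γ s)).source ∧
      hdist (chartAt HyperbolicSpace3 (γ s) (γ u)) (chartAt HyperbolicSpace3 (γ s) (γ v))
        = |u - v|) →
    ∃ x : M, Tendsto γ (𝓝[<] a) (𝓝 x)

/-- The distance of the hyperbolic cone `ℍ³_θ` (`0 < θ ≤ 2π`), the space `ℂ × ℝ` in which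
`(r e^{iψ}, t)` is the point at distance `r` from the singular axis `{0} × ℝ`, at height `t` along
the axis and at angle `θ ψ / (2π)` around it, so that the angles around the axis add up to `θ`.
The metric tensor is `dr² + (θ / 2π)² sinh² r dψ² + cosh² r dt²`; for `θ = 2π` this is hyperbolic
three-space in cylindrical coordinates. -/
def coneDist (θ : ℝ) (p q : ℂ × ℝ) : ℝ :=
  Real.arcosh (Real.cosh ‖p.1‖ * Real.cosh ‖q.1‖ * Real.cosh (p.2 - q.2) -
    Real.sinh ‖p.1‖ * Real.sinh ‖q.1‖ *
      Real.cos (θ / (2 * Real.pi) * (p.1 * (starRingEnd ℂ) q.1).arg))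

/-- The hyperbolic structure on `BundleLR` given by an atlas extends to the closed bundle with a
cone singularity of angle `θ` along the core: every point of the core has a neighbourhood in the
closed bundle with a homeomorphism `h` to an open subset of `ℍ³_θ` that takes the core to the
axis and is a local isometry off the core. -/
def HasConeSingularity (θ : ℝ) [ChartedSpace HyperbolicSpace3 BundleLR] : Prop :=
  ∀ x ∈ bundleCore, ∃ h : OpenPartialHomeomorph ClosedBundleLR (ℂ × ℝ),
    x ∈ h.source ∧ (∀ y ∈ h.source, y ∈ bundleCore ↔ (h y).1 = 0) ∧
    ∀ y : BundleLR, bundleInclusion y ∈ h.source →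
      ∃ V ∈ 𝓝 y, V ⊆ (chartAt HyperbolicSpace3 y).source ∧
        bundleInclusion '' V ⊆ h.source ∧
        ∀ y₁ ∈ V, ∀ y₂ ∈ V,
          hdist (chartAt HyperbolicSpace3 y y₁) (chartAt HyperbolicSpace3 y y₂) =
            coneDist θ (h (bundleInclusion y₁)) (h (bundleInclusion y₂))

/-- An atlas on the once-punctured torus bundle is a hyperbolic cone structure along the meridian
with cone angle `θ ∈ [0, 2π)` if it is a hyperbolic structure which, for `θ > 0`, has a cone
singularity of angle `θ` along the core of the filling along the meridian, and which is complete
for `θ = 0`. -/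
def IsHyperbolicConeStructure (θ : ℝ) [ChartedSpace HyperbolicSpace3 BundleLR] : Prop :=
  HasGroupoid BundleLR hyperbolicGroupoid ∧
  (0 < θ → HasConeSingularity θ) ∧
  (θ = 0 → GeodesicallyComplete BundleLR)

/-! ### Geometric ideal triangulations -/

/-- Homogeneous coordinates with respect to the ideal tetrahedron with vertices `0, 1, z, ∞`
(`Im z ≠ 0`): for `(w, s)` write `w = a • 0 + b • 1 + c • z` with `a + b + c = 1`; the first three
coordinates are `a, b, c`. The last one vanishes on the hemisphere through `0, 1, z` and is
positive above it. -/
def idealCoord (z : ℂ) (p : HyperbolicSpace3) : Fin 4 → ℝ :=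
  let c := p.1.1.im / z.im
  let b := p.1.1.re - c * z.re
  ![1 - b - c, b, c, ‖p.1.1‖ ^ 2 + p.1.2 ^ 2 - b - c * ‖z‖ ^ 2]

/-- The ideal hyperbolic tetrahedron with vertices `0, 1, z, ∞`, that is, with shape
parameter `z`. -/
def idealTetrahedron (z : ℂ) : Set HyperbolicSpace3 := {p | ∀ k, 0 ≤ idealCoord z p k}

/-- The interior of the ideal tetrahedron. -/
def idealInterior (z : ℂ) : Set HyperbolicSpace3 := {p | ∀ k, 0 < idealCoord z p k}

/-- The faces of the ideal tetrahedron. -/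
def idealFace (z : ℂ) (k : Fin 4) : Set HyperbolicSpace3 :=
  {p | p ∈ idealTetrahedron z ∧ idealCoord z p k = 0}

/-- The faces of the ideal tetrahedron, without their edges. -/
def idealOpenFace (z : ℂ) (k : Fin 4) : Set HyperbolicSpace3 :=
  {p | idealCoord z p k = 0 ∧ ∀ l, l ≠ k → 0 < idealCoord z p l}

/-- The hyperbolic manifold `M` has a geometric ideal triangulation by ideal tetrahedra with shape
parameters `z i`: the tetrahedra are mapped to `M` by local isometries, their images cover `M`,
they overlap only along their boundaries, and they meet face to face: an interior point of a face
is identified only with interior points of faces, and the images of two such faces coincide. -/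
def HasGeometricIdealTriangulation {ι : Type} (z : ι → ℂ) (M : Type) [TopologicalSpace M]
    [ChartedSpace HyperbolicSpace3 M] : Prop :=
  ∃ f : ι → HyperbolicSpace3 → M,
    (∀ i, ∀ p ∈ idealTetrahedron (z i), ∃ U ∈ 𝓝 p,
      (∀ q ∈ U ∩ idealTetrahedron (z i), f i q ∈ (chartAt HyperbolicSpace3 (f i p)).source) ∧
      ∀ q ∈ U ∩ idealTetrahedron (z i), ∀ q' ∈ U ∩ idealTetrahedron (z i),
        hdist (chartAt HyperbolicSpace3 (f i p) (f i q))
          (chartAt HyperbolicSpace3 (f i p) (f i q')) = hdist q q') ∧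
    (∀ x, ∃ i, ∃ p ∈ idealTetrahedron (z i), f i p = x) ∧
    (∀ i j, ∀ p ∈ idealInterior (z i), ∀ q ∈ idealTetrahedron (z j),
      f i p = f j q → i = j ∧ p = q) ∧
    (∀ i j k, ∀ p ∈ idealOpenFace (z i) k, ∀ q ∈ idealTetrahedron (z j), f i p = f j q →
      ∃ l, q ∈ idealOpenFace (z j) l ∧ f i '' idealFace (z i) k = f j '' idealFace (z j) l)

/-! ### Shape parameters -/

/-- `z' = 1 / (1 - z)`. -/
def shape' (z : ℂ) : ℂ := 1 / (1 - z)

/-- `z'' = 1 - 1 / z`. -/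
def shape'' (z : ℂ) : ℂ := 1 - 1 / z

/-- The logarithmic holonomy of the representative `μ₁` of the meridian. -/
def holonomyMu₁ (z₁ : ℂ) : ℂ := 2 * (Complex.log (shape'' z₁) - Complex.log (shape' z₁))

/-- The logarithmic holonomy of the representative `μ₂` of the meridian. -/
def holonomyMu₂ (z₂ : ℂ) : ℂ := 2 * (Complex.log (shape' z₂) - Complex.log (shape'' z₂))

/-- The logarithmic holonomy around the edge `e`. -/
def holonomyEdge (z₁ z₂ : ℂ) : ℂ :=
  Complex.log z₁ + 2 * Complex.log (shape' z₁) + Complex.log z₂ + 2 * Complex.log (shape' z₂)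

/-- The root `((2 - B) + √((2 - B)² - 4)) / 2` of `z² - (2 - B) z + 1`, where the square root is
written as `i √(4 - (2 - B)²)` with the principal root. With `B = e^{iη}` this is the branch that
is continuous on `-π < η < π` and equals `i √3` at `η = 0`. -/
def shapeRoot (B : ℂ) : ℂ := ((2 - B) + Complex.I * Complex.sqrt (4 - (2 - B) ^ 2)) / 2

/-- The shape parameter `z₁(η)`, with `B = e^{iη}`. -/
def shape₁ (η : ℝ) : ℂ := shapeRoot (Complex.exp (η * Complex.I))

/-- The shape parameter `z₂(η)`, with `B⁻¹ = e^{-iη}`. -/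
def shape₂ (η : ℝ) : ℂ := shapeRoot (Complex.exp (-(η * Complex.I)))

end

open Real
open scoped ComplexConjugate
noncomputable section
open Complex (I sub_im sub_re add_im add_re normSq_eq_norm_sq normSq_apply conj_ofReal conj_ofNat one_im slitPlane exp_mul_I arg_le_pi)
open Matrix (cons_val)
open Fin (sum_univ_four sum_univ_six)
open Finset (sum_congr sum_div sum_pos')
open Function (support)
open Int (units_eq_one_or)
open Equiv (sum_comp apply_symm_apply)
open Metric (ball ball_mem_nhds)
open Classical (choose_spec)

/-- Points of the universal abelian cover of the closed bundle. -/
abbrev Point : Type := (ℝ × ℝ) × ℝ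

/-- The lattice. -/
notation "ℤ²" => ℤ × ℤ

/-- Coordinates indexed by the vertices of a tetrahedron. -/
abbrev Bary : Type := Fin 4 → ℝ

/-- Coordinates indexed by the lattice. -/
abbrev Weights : Type := ℤ² → ℝ

/-- The upper half-space. -/
notation "ℍ³" => HyperbolicSpace3

variable {P T a k l l' s A B : ℝ} {x v : ℝ × ℝ} {y : Point} {z e : ℂ} {b w : Weights} {n n' : ℤ}
  {m m' r : ℤ²} {i j : Fin 4} {u u' : Bary} {c c' : OpenPartialHomeomorph Point ℍ³}

lemma abs_sub_lt_mem_nhds (s : ℝ) {δ : ℝ} (hδ : 0 < δ) : {t | |s - t| < δ} ∈ 𝓝 s := by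
  simpa [ball, Real.dist_eq, abs_sub_comm] using ball_mem_nhds s hδ

lemma nhdsGT_le_nhdsWithin_Ico (h : l ∈ Ico 0 a) : 𝓝[>] l ≤ 𝓝[Ico 0 a] l :=
  nhdsWithin_le_iff.2 (mem_of_superset (Ioo_mem_nhdsGT h.2) fun _ hw => ⟨h.1.trans hw.1.le, hw.2⟩)

/-! ### Hyperbolic three-space in the light-cone model -/

/-- The argument of `arcosh` in `hdist`. -/
lemma one_le_hdist_arg (p q : ℍ³) :
    1 ≤ 1 + (‖p.1.1 - q.1.1‖ ^ 2 + (p.1.2 - q.1.2) ^ 2) / (2 * p.1.2 * q.1.2) := by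
  have hp := p.2; have hq := q.2
  have : 0 ≤ (‖p.1.1 - q.1.1‖ ^ 2 + (p.1.2 - q.1.2) ^ 2) / (2 * p.1.2 * q.1.2) := by positivity
  linarith

lemma cosh_hdist (p q : ℍ³) : cosh (hdist p q) =
      1 + (‖p.1.1 - q.1.1‖ ^ 2 + (p.1.2 - q.1.2) ^ 2) / (2 * p.1.2 * q.1.2) :=
  cosh_arcosh (one_le_hdist_arg p q)

lemma hdist_nonneg (p q : ℍ³) : 0 ≤ hdist p q := arcosh_nonneg (one_le_hdist_arg p q)

lemma hdist_self (p : ℍ³) : hdist p p = 0 := by simp [hdist]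

lemma hdist_comm (p q : ℍ³) : hdist p q = hdist q p := by
  unfold hdist; rw [norm_sub_rev]
  ring_nf

lemma normSq_expand (z : ℂ) : ‖z‖ ^ 2 = z.re ^ 2 + z.im ^ 2 := by
  rw [← normSq_eq_norm_sq, normSq_apply]; ring

lemma cosh_hdist' (p q : ℍ³) :
    cosh (hdist p q) = ((p.1.1.re - q.1.1.re) ^ 2 + (p.1.1.im - q.1.1.im) ^ 2
      + p.1.2 ^ 2 + q.1.2 ^ 2) / (2 * p.1.2 * q.1.2) := by
  have hp := p.2; have hq := q.2
  rw [cosh_hdist, normSq_expand, sub_re, sub_im]; field_simp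
  ring

lemma eq_of_hdist_eq_zero {p q : ℍ³} (h : hdist p q = 0) : p = q := by
  have hp := p.2; have hq := q.2
  have h1 := cosh_hdist p q; rw [h, cosh_zero] at h1
  have h2 : (‖p.1.1 - q.1.1‖ ^ 2 + (p.1.2 - q.1.2) ^ 2) / (2 * p.1.2 * q.1.2) = 0 := by linarith
  rw [div_eq_zero_iff] at h2
  rcases h2 with h2 | h2
  · have h3 : ‖p.1.1 - q.1.1‖ ^ 2 = 0 := by nlinarith [sq_nonneg (p.1.2 - q.1.2), sq_nonneg ‖p.1.1 - q.1.1‖]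
    have h4 : (p.1.2 - q.1.2) ^ 2 = 0 := by nlinarith [sq_nonneg (p.1.2 - q.1.2), sq_nonneg ‖p.1.1 - q.1.1‖]
    have h5 := norm_eq_zero.1 (pow_eq_zero_iff (two_ne_zero) |>.1 h3)
    have h6 := pow_eq_zero_iff (two_ne_zero) |>.1 h4
    exact Subtype.ext (Prod.ext (sub_eq_zero.1 h5) (sub_eq_zero.1 h6))
  · exact absurd h2 (by positivity)

lemma hdist_triangle (p q r : ℍ³) : hdist p r ≤ hdist p q + hdist q r := by
  have hp := p.2; have hq := q.2
  have hr := r.2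
  have key : cosh (hdist p r) ≤ cosh (hdist p q + hdist q r) := by
    rw [cosh_add]; set sa := sinh (hdist p q) with hsa
    set sb := sinh (hdist q r) with hsb; have hsa0 : 0 ≤ sa := sinh_nonneg_iff.2 (hdist_nonneg _ _)
    have hsb0 : 0 ≤ sb := sinh_nonneg_iff.2 (hdist_nonneg _ _)
    have ha : sa ^ 2 = cosh (hdist p q) ^ 2 - 1 := by rw [hsa, sinh_sq]
    have hb : sb ^ 2 = cosh (hdist q r) ^ 2 - 1 := by rw [hsb, sinh_sq]
    rw [cosh_hdist'] at ha hb ⊢; rw [cosh_hdist' p q, cosh_hdist' q r]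
    obtain ⟨⟨w, s⟩, hs⟩ := p; obtain ⟨⟨w', s'⟩, hs'⟩ := q
    obtain ⟨⟨w'', s''⟩, hs''⟩ := r; simp only at *
    generalize w.re = a1 at *
    generalize w.im = a2 at *
    generalize w'.re = b1 at *
    generalize w'.im = b2 at *
    generalize w''.re = c1 at *
    generalize w''.im = c2 at *
    set x1 := (a1 - b1) / s with hx1; set x2 := (a2 - b2) / s with hx2
    set x3 := ((a1 - b1) ^ 2 + (a2 - b2) ^ 2 + s ^ 2 - s' ^ 2) / (2 * s * s') with hx3
    set y1 := (c1 - b1) / s'' with hy1; set y2 := (c2 - b2) / s'' with hy2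
    set y3 := ((c1 - b1) ^ 2 + (c2 - b2) ^ 2 + s'' ^ 2 - s' ^ 2) / (2 * s'' * s') with hy3
    have e1 : sa ^ 2 = x1 ^ 2 + x2 ^ 2 + x3 ^ 2 := by rw [ha, hx1, hx2, hx3]; field_simp; ring
    have e2 : sb ^ 2 = y1 ^ 2 + y2 ^ 2 + y3 ^ 2 := by rw [hb, hy1, hy2, hy3]; field_simp; ring
    have e3 : ((a1 - c1) ^ 2 + (a2 - c2) ^ 2 + s ^ 2 + s'' ^ 2) / (2 * s * s'')
        = ((a1 - b1) ^ 2 + (a2 - b2) ^ 2 + s ^ 2 + s' ^ 2) / (2 * s * s') *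
          (((b1 - c1) ^ 2 + (b2 - c2) ^ 2 + s' ^ 2 + s'' ^ 2) / (2 * s' * s''))
          - (x1 * y1 + x2 * y2 + x3 * y3) := by
      rw [hx1, hx2, hx3, hy1, hy2, hy3]; field_simp; ring
    rw [e3]
    have e4 : (x1 * y1 + x2 * y2 + x3 * y3) ^ 2 ≤ (sa * sb) ^ 2 := by
      rw [mul_pow, e1, e2]
      nlinarith [sq_nonneg (x1 * y2 - x2 * y1), sq_nonneg (x1 * y3 - x3 * y1),
        sq_nonneg (x2 * y3 - x3 * y2)]
    have e5 := abs_le_of_sq_le_sq' e4 (by positivity)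
    linarith [e5.1]
  rw [cosh_le_cosh, abs_of_nonneg (hdist_nonneg _ _),
    abs_of_nonneg (add_nonneg (hdist_nonneg _ _) (hdist_nonneg _ _))] at key
  exact key

lemma continuous_hdist : Continuous fun x : ℍ³ × ℍ³ => hdist x.1 x.2 := by
  unfold hdist
  refine continuousOn_arcosh.comp_continuous ?_ fun x => one_le_hdist_arg x.1 x.2
  refine continuous_const.add (Continuous.div (by fun_prop) (by fun_prop) fun x => ?_)
  have h1 := x.1.2; have h2 := x.2.2
  positivity

lemma hball_mem_nhds (p : ℍ³) {ε : ℝ} (hε : 0 < ε) : {q | hdist p q < ε} ∈ 𝓝 p := by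
  have h : Continuous fun q => hdist p q :=
    continuous_hdist.comp (f := fun q => (p, q)) (by fun_prop)
  exact h.continuousAt.eventually_lt continuousAt_const (by rw [hdist_self]; exact hε)

lemma exists_hball_subset {p : ℍ³} {N : Set ℍ³} (hN : N ∈ 𝓝 p) :
    ∃ ε > 0, {q | hdist p q < ε} ⊆ N := by
  rw [nhds_subtype_eq_comap, mem_comap] at hN; obtain ⟨U, hU, hUN⟩ := hN
  obtain ⟨ε, hε, hεU⟩ := Metric.mem_nhds_iff.1 hU; have hp := p.2
  -- the Euclidean ball of radius `ε` contains a hyperbolic ball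
  have h1 : Tendsto (fun δ : ℝ => 2 * p.1.2 * (p.1.2 * exp δ) * (cosh δ - 1)) (𝓝 0)
      (𝓝 (2 * p.1.2 * (p.1.2 * exp 0) * (cosh 0 - 1))) :=
    (Continuous.tendsto (by fun_prop) 0)
  simp only [exp_zero, cosh_zero, sub_self, mul_zero] at h1
  have h2 := (h1.eventually (gt_mem_nhds (show (0:ℝ) < ε ^ 2 by positivity))).filter_mono
    (nhdsWithin_le_nhds (s := Ioi 0))
  obtain ⟨δ, hδ, hδ0⟩ := (h2.and self_mem_nhdsWithin).exists
  replace hδ0 : 0 < δ := hδ0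
  refine ⟨δ, hδ0, fun q hq => hUN (hεU ?_)⟩
  have hq2 := q.2
  have hc : cosh (hdist p q) < cosh δ := by
    rw [cosh_lt_cosh, abs_of_nonneg (hdist_nonneg _ _), abs_of_pos hδ0]
    exact hq
  have hc' := cosh_hdist p q; set t := ‖p.1.1 - q.1.1‖ ^ 2 + (p.1.2 - q.1.2) ^ 2 with ht
  have h3 : t / (2 * p.1.2 * q.1.2) < cosh δ - 1 := by linarith
  rw [div_lt_iff₀ (by positivity)] at h3
  -- `q.1.2 ≤ p.1.2 * exp δ`
  have h4 : q.1.2 ≤ p.1.2 * exp δ := by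
    by_contra! hcon
    have h5 : (p.1.2 - q.1.2) ^ 2 ≤ t := by rw [ht]; nlinarith [sq_nonneg ‖p.1.1 - q.1.1‖]
    have h6 : (p.1.2 - q.1.2) ^ 2 < (exp δ + exp (-δ) - 2) * (p.1.2 * q.1.2) := by
      have : (exp δ + exp (-δ) - 2) * (p.1.2 * q.1.2) =
          (cosh δ - 1) * (2 * p.1.2 * q.1.2) := by rw [cosh_eq]; ring
      rw [this]
      exact h5.trans_lt h3
    have h7 : exp δ * exp (-δ) = 1 := by rw [← exp_add]; simp
    have h8 : (q.1.2 - p.1.2 * exp δ) * (q.1.2 - p.1.2 * exp (-δ)) < 0 := by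
      have : (q.1.2 - p.1.2 * exp δ) * (q.1.2 - p.1.2 * exp (-δ)) = (p.1.2 - q.1.2) ^ 2 -
          (exp δ + exp (-δ) - 2) * (p.1.2 * q.1.2) := by
        linear_combination p.1.2 ^ 2 * h7
      linarith
    have h9 : exp (-δ) < exp δ := exp_lt_exp.2 (by linarith)
    have : 0 < q.1.2 - p.1.2 * exp (-δ) := by nlinarith
    nlinarith
  have h10 : t < ε ^ 2 := by
    have hcd : 0 ≤ cosh δ - 1 := by linarith [one_le_cosh δ]
    have : (cosh δ - 1) * (2 * p.1.2 * q.1.2) ≤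
        2 * p.1.2 * (p.1.2 * exp δ) * (cosh δ - 1) := by
      nlinarith [mul_nonneg hcd hp.le]
    linarith
  rw [Metric.mem_ball, dist_comm, Prod.dist_eq, max_lt_iff]; constructor
  · rw [dist_eq_norm]
    refine lt_of_pow_lt_pow_left₀ 2 hε.le ?_
    nlinarith [sq_nonneg (p.1.2 - q.1.2)]
  · rw [dist_eq]
    refine abs_lt_of_sq_lt_sq ?_ hε.le
    nlinarith [sq_nonneg ‖p.1.1 - q.1.1‖]

/-- The vector space containing the light cone, with coordinates `(|w|² + s², w, 1)`. -/
abbrev Lor : Type := ℝ × ℂ × ℝ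

/-- The Lorentz form, normalised so that light-like `(|w|², w, 1)`, `(|w'|², w', 1)` pair to
`|w - w'|²`. -/
def lform (X Y : Lor) : ℝ :=
  X.1 * Y.2.2 + X.2.2 * Y.1 - 2 * (X.2.1.re * Y.2.1.re + X.2.1.im * Y.2.1.im)

/-- The homogeneous coordinates of a point. -/
def lvec (p : ℍ³) : Lor := (‖p.1.1‖ ^ 2 + p.1.2 ^ 2, p.1.1, 1)

open Classical in
/-- The point with given homogeneous coordinates. -/
def lproj (X : Lor) : ℍ³ :=
  if h : 0 < √(lform X X / 2) / X.2.2 then ⟨(X.2.1 / (X.2.2 : ℂ), √(lform X X / 2) / X.2.2), h⟩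
  else ⟨(0, 1), one_pos⟩

/-- The time-like vectors of the future cone. -/
def Future (X : Lor) : Prop := 0 < X.2.2 ∧ 0 < lform X X

lemma lproj_of_future {X : Lor} (h : Future X) :
    (lproj X).1 = (X.2.1 / (X.2.2 : ℂ), √(lform X X / 2) / X.2.2) := by
  have h1 := h.1; have h2 := h.2
  rw [lproj, dif_pos]
  positivity

lemma lform_comm (X Y : Lor) : lform X Y = lform Y X := by unfold lform; ring

lemma lform_add_left (X Y Z : Lor) : lform (X + Y) Z = lform X Z + lform Y Z := by
  simp [lform]; ring

lemma lform_smul_left (a : ℝ) (X Z : Lor) : lform (a • X) Z = a * lform X Z := by simp [lform]; ring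

lemma lform_add_right (X Y Z : Lor) : lform Z (X + Y) = lform Z X + lform Z Y := by
  simp [lform]; ring

lemma lform_smul_right (a : ℝ) (X Z : Lor) : lform Z (a • X) = a * lform Z X := by
  simp [lform]; ring

lemma lform_zero_left (Z : Lor) : lform 0 Z = 0 := by simp [lform]

lemma lform_sum_left {ι : Type*} (s : Finset ι) (X : ι → Lor) (Z : Lor) :
    lform (∑ i ∈ s, X i) Z = ∑ i ∈ s, lform (X i) Z := by
  classical
  induction s using Finset.induction_on with
  | empty => simp [lform_zero_left]
  | insert a s ha ih => rw [Finset.sum_insert ha, Finset.sum_insert ha, lform_add_left, ih]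

lemma lform_sum_right {ι : Type*} (s : Finset ι) (X : ι → Lor) (Z : Lor) :
    lform Z (∑ i ∈ s, X i) = ∑ i ∈ s, lform Z (X i) := by
  rw [lform_comm, lform_sum_left]; exact sum_congr rfl fun i _ => lform_comm _ _

lemma lform_lvec_self (p : ℍ³) : lform (lvec p) (lvec p) = 2 * p.1.2 ^ 2 := by
  simp only [lform, lvec, normSq_expand]; ring

lemma future_lvec (p : ℍ³) : Future (lvec p) := by
  have := p.2
  refine ⟨by simp [lvec], ?_⟩
  rw [lform_lvec_self]; positivity

lemma hdist_lproj {X Y : Lor} (hX : Future X) (hY : Future Y) :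
    hdist (lproj X) (lproj Y) = arcosh (lform X Y / √(lform X X * lform Y Y)) := by
  have hX1 := hX.1; have hX2 := hX.2
  have hY1 := hY.1; have hY2 := hY.2
  rw [hdist]
  congr 1
  rw [lproj_of_future hX, lproj_of_future hY]; simp only
  have e1 : √(lform X X * lform Y Y) = 2 * (√(lform X X / 2) * √(lform Y Y / 2)) := by
    rw [← sqrt_mul (by positivity), show lform X X * lform Y Y =
      2 ^ 2 * (lform X X / 2 * (lform Y Y / 2)) by ring, sqrt_mul (by positivity),
      sqrt_sq (by norm_num)]
  have s1 : √(lform X X / 2) ^ 2 = lform X X / 2 := sq_sqrt (by positivity)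
  have s2 : √(lform Y Y / 2) ^ 2 = lform Y Y / 2 := sq_sqrt (by positivity)
  have p1 : 0 < √(lform X X / 2) := by positivity
  have p2 : 0 < √(lform Y Y / 2) := by positivity
  rw [e1]; set a := √(lform X X / 2)
  set b := √(lform Y Y / 2)
  have n1 : ‖X.2.1 / (X.2.2 : ℂ) - Y.2.1 / (Y.2.2 : ℂ)‖ ^ 2 =
      (X.2.1.re / X.2.2 - Y.2.1.re / Y.2.2) ^ 2 + (X.2.1.im / X.2.2 - Y.2.1.im / Y.2.2) ^ 2 := by
    rw [normSq_expand]; simp [Complex.div_ofReal_re, Complex.div_ofReal_im]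
  rw [n1]
  have t1 : lform X X = 2 * X.1 * X.2.2 - 2 * (X.2.1.re ^ 2 + X.2.1.im ^ 2) := by unfold lform; ring
  have t2 : lform Y Y = 2 * Y.1 * Y.2.2 - 2 * (Y.2.1.re ^ 2 + Y.2.1.im ^ 2) := by unfold lform; ring
  rw [t1] at s1; rw [t2] at s2
  unfold lform; field_simp
  linear_combination Y.2.2 ^ 2 * s1 + X.2.2 ^ 2 * s2

lemma lproj_smul (ha : 0 < a) {X : Lor} (hX : Future X) : lproj (a • X) = lproj X := by
  have h1 := hX.1; have h2 := hX.2
  have hF : Future (a • X) := by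
    refine ⟨?_, ?_⟩
    · simp only [Prod.smul_snd, smul_eq_mul]; positivity
    · rw [lform_smul_left, lform_smul_right]; positivity
  refine Subtype.ext ?_
  rw [lproj_of_future hF, lproj_of_future hX]
  have h3 : √(lform (a • X) (a • X) / 2) = a * √(lform X X / 2) := by
    rw [lform_smul_left, lform_smul_right, show a * (a * lform X X) / 2 = a ^ 2 * (lform X X / 2) by
      ring, sqrt_mul (by positivity), sqrt_sq ha.le]
  rw [h3]
  refine Prod.ext ?_ ?_
  · simp only [Prod.smul_snd, Prod.smul_fst, smul_eq_mul, Complex.real_smul, Complex.ofReal_mul]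
    rw [mul_div_mul_left]
    exact_mod_cast ha.ne'
  · simp only [Prod.smul_snd, smul_eq_mul]
    rw [mul_div_mul_left _ _ ha.ne']

lemma lproj_lvec (p : ℍ³) : lproj (lvec p) = p := by
  refine Subtype.ext ?_
  rw [lproj_of_future (future_lvec p), lform_lvec_self]; have := p.2
  refine Prod.ext ?_ ?_
  · simp [lvec]
  · simp only [lvec, div_one]
    rw [mul_div_cancel_left₀ _ two_ne_zero, sqrt_sq this.le]

lemma lvec_lproj {X : Lor} (hX : Future X) : lvec (lproj X) = (X.2.2)⁻¹ • X := by
  have h1 := hX.1; have h2 := hX.2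
  have h3 := lproj_of_future hX; unfold lvec
  rw [h3]; simp only
  refine Prod.ext ?_ (Prod.ext ?_ ?_)
  · simp only [Prod.smul_fst, smul_eq_mul]
    rw [div_pow, sq_sqrt (by positivity), normSq_expand]
    simp only [Complex.div_ofReal_re, Complex.div_ofReal_im]; unfold lform
    field_simp; ring
  · simp only [Prod.smul_snd, Prod.smul_fst, Complex.real_smul, Complex.ofReal_inv]
    rw [div_eq_inv_mul]
  · simp [h1.ne']

lemma lform_lvec (p q : ℍ³) : lform (lvec p) (lvec q) = 2 * p.1.2 * q.1.2 * cosh (hdist p q) := by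
  have hp := p.2; have hq := q.2
  rw [cosh_hdist']; simp only [lform, lvec, normSq_expand]
  field_simp; ring

lemma continuousOn_lproj : ContinuousOn lproj {X | Future X} := by
  refine (Topology.IsInducing.subtypeVal (t := {p : ℂ × ℝ | 0 < p.2})).continuousOn_iff.2 ?_
  have hc : ContinuousOn (fun X : Lor => ((X.2.1 / (X.2.2 : ℂ), √(lform X X / 2) / X.2.2) : ℂ × ℝ))
      {X | Future X} := by
    refine ContinuousOn.prodMk ?_ ?_
    · refine ContinuousOn.div (by fun_prop) (by fun_prop) fun X hX => ?_
      exact_mod_cast hX.1.ne'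
    · refine ContinuousOn.div ?_ (by fun_prop) fun X hX => hX.1.ne'
      unfold lform
      fun_prop
  exact hc.congr fun X hX => lproj_of_future hX

/-- Any two points are joined by a geodesic. -/
lemma exists_geodesic (p q : ℍ³) : ∃ γ : ℝ → ℍ³,
    γ 0 = p ∧ γ (hdist p q) = q ∧ ∀ s ∈ Icc 0 (hdist p q), ∀ t ∈ Icc 0 (hdist p q),
      hdist (γ s) (γ t) = |s - t| := by
  rcases (hdist_nonneg p q).eq_or_lt with h0 | h0
  · refine ⟨fun _ => p, rfl, eq_of_hdist_eq_zero h0.symm, fun s hs t ht => ?_⟩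
    rw [← h0, Icc_self, mem_singleton_iff] at hs ht; rw [hs, ht, hdist_self]; simp
  set L := hdist p q with hL; have hp := p.2
  have hq := q.2; have hsL : 0 < sinh L := sinh_pos_iff.2 h0
  set G : ℝ → Lor := fun s => (sinh (L - s) / p.1.2) • lvec p + (sinh s / q.1.2) • lvec q with hG
  have hform : ∀ s t, lform (G s) (G t) = 2 * sinh L ^ 2 * cosh (s - t) := by
    intro s t
    have e : lform (G s) (G t) = 2 * (sinh (L - s) * sinh (L - t) + sinh s * sinh t + cosh L *
          (sinh (L - s) * sinh t + sinh s * sinh (L - t))) := by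
      simp only [hG, lform_add_left, lform_add_right, lform_smul_left, lform_smul_right]
      rw [lform_comm (lvec q) (lvec p), lform_lvec_self, lform_lvec_self, lform_lvec, ← hL]
      field_simp; ring
    rw [e, sinh_sub, sinh_sub, cosh_sub]; have h1 := cosh_sq L
    have h2 := cosh_sq s; have h3 := cosh_sq t
    ring_nf; rw [h1]
    ring
  have hF : ∀ s ∈ Icc 0 L, Future (G s) := by
    intro s hs
    refine ⟨?_, ?_⟩
    · have a1 : 0 ≤ sinh (L - s) := sinh_nonneg_iff.2 (by linarith [hs.2])
      have a2 : 0 ≤ sinh s := sinh_nonneg_iff.2 hs.1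
      have : (G s).2.2 = sinh (L - s) / p.1.2 + sinh s / q.1.2 := by simp [hG, lvec]
      rw [this]
      rcases hs.1.eq_or_lt with h | h
      · rw [← h, sub_zero]; simp only [sinh_zero, zero_div, add_zero]; positivity
      · have : 0 < sinh s := sinh_pos_iff.2 h
        positivity
    · rw [hform]; have := cosh_pos (s - s); positivity
  refine ⟨fun s => lproj (G s), ?_, ?_, ?_⟩
  · have : G 0 = (sinh L / p.1.2) • lvec p := by simp [hG]
    simp only [this]; rw [lproj_smul (by positivity) (future_lvec p), lproj_lvec]
  · have : G L = (sinh L / q.1.2) • lvec q := by simp [hG]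
    simp only [this]; rw [lproj_smul (by positivity) (future_lvec q), lproj_lvec]
  · intro s hs t ht
    simp only; rw [hdist_lproj (hF s hs) (hF t ht), hform, hform, hform]
    simp only [sub_self, cosh_zero, mul_one]
    rw [sqrt_mul_self (by positivity), mul_div_cancel_left₀ _ (by positivity),
      ← cosh_abs, arcosh_cosh (abs_nonneg _)]

/-- A pseudo-distance on a hyperbolic ball that is pointwise locally bounded by the hyperbolic
distance is bounded by it on a smaller ball. -/
lemma le_hdist_of_local {D : ℍ³ → ℍ³ → ℝ} {p₀ : ℍ³}
    {ε : ℝ} (hself : ∀ x, D x x = 0) (hcomm : ∀ x y, D x y = D y x)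
    (htri : ∀ x y z, hdist p₀ x < 4 * ε → hdist p₀ y < 4 * ε → hdist p₀ z < 4 * ε →
      D x z ≤ D x y + D y z)
    (hloc : ∀ y, hdist p₀ y < 4 * ε → ∀ᶠ y' in 𝓝 y, D y y' ≤ hdist y y')
    {p q : ℍ³} (hp : hdist p₀ p < ε) (hq : hdist p₀ q < ε) :
    D p q ≤ hdist p q := by
  obtain ⟨γ, h0, h1, hγ⟩ := exists_geodesic p q; set L := hdist p q with hL
  have hL0 : 0 ≤ L := hdist_nonneg _ _
  have hLε : L < 2 * ε := by
    have := hdist_triangle p p₀ q; rw [hdist_comm p p₀] at this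
    linarith
  have hin : ∀ s ∈ Icc 0 L, hdist p₀ (γ s) < 4 * ε := by
    intro s hs; have a := hdist_triangle p₀ p (γ s)
    have b := hγ 0 ⟨le_rfl, hL0⟩ s hs; rw [h0, zero_sub, abs_neg, abs_of_nonneg hs.1] at b
    linarith [hs.2]
  have hloc' : ∀ s ∈ Icc 0 L, ∀ᶠ t in 𝓝[Icc 0 L] s, D (γ s) (γ t) ≤ |s - t| := by
    intro s hs
    have hc : ContinuousWithinAt γ (Icc 0 L) s := by
      rw [ContinuousWithinAt, tendsto_def]; intro N hN
      obtain ⟨δ, hδ, hδN⟩ := exists_hball_subset hN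
      have := abs_sub_lt_mem_nhds s hδ
      filter_upwards [nhdsWithin_le_nhds this, self_mem_nhdsWithin] with t ht ht'
      exact hδN (by rw [mem_ofPred_eq, hγ s hs t ht']; exact ht)
    filter_upwards [hc.eventually (hloc _ (hin s hs)), self_mem_nhdsWithin] with t ht ht'
    rwa [hγ s hs t ht'] at ht
  have hfc : ContinuousOn (fun s => D p (γ s)) (Icc 0 L) := by
    intro s hs; rw [Metric.continuousWithinAt_iff']
    intro δ hδ
    have := abs_sub_lt_mem_nhds s hδ
    have hpin : hdist p₀ p < 4 * ε := by
      have := hin 0 ⟨le_rfl, hL0⟩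
      rwa [h0] at this
    filter_upwards [hloc' s hs, nhdsWithin_le_nhds this, self_mem_nhdsWithin] with t a b c
    have t1 := htri p (γ s) (γ t) hpin (hin s hs) (hin t c)
    have t2 := htri p (γ t) (γ s) hpin (hin t c) (hin s hs); rw [hcomm (γ t)] at t2
    have b' : |s - t| < δ := b; rw [dist_eq, abs_lt]
    constructor <;> linarith
  have hcl : IsClosed ({s | D p (γ s) ≤ s} ∩ Icc 0 L) := by
    have : {s | D p (γ s) ≤ s} ∩ Icc 0 L = {s ∈ Icc 0 L | D p (γ s) ≤ s} := by
      ext s; simp [and_comm]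
    rw [this]
    exact isClosed_Icc.isClosed_le hfc continuousOn_id
  have hsub := hcl.Icc_subset_of_forall_exists_gt (by
      rw [mem_ofPred_eq, h0, hself]) (fun s hs y hy => by
    have hsI : s ∈ Icc 0 L := ⟨hs.2.1, hs.2.2.le⟩
    have hev : ∀ᶠ t in 𝓝[>] s, t ∈ Icc 0 L ∧ D (γ s) (γ t) ≤ |s - t| := by
      have hle : 𝓝[>] s ≤ 𝓝[Icc 0 L] s := by
        rw [nhdsWithin, nhdsWithin]
        refine le_inf inf_le_left ?_
        rw [le_principal_iff]; have := Ioc_mem_nhdsGT hs.2.2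
        exact mem_of_superset this fun t ht => ⟨hs.2.1.trans ht.1.le, ht.2⟩
      filter_upwards [hle (hloc' s hsI), hle self_mem_nhdsWithin] with t a b using ⟨b, a⟩
    obtain ⟨t, ⟨ht, htD⟩, htm⟩ := (hev.and (Ioc_mem_nhdsGT (show s < y from hy))).exists
    refine ⟨t, ?_, htm⟩
    have hpin : hdist p₀ p < 4 * ε := by
      have := hin 0 ⟨le_rfl, hL0⟩
      rwa [h0] at this
    have := htri p (γ s) (γ t) hpin (hin s hsI) (hin t ht); have h3 : D p (γ s) ≤ s := hs.1
    rw [abs_of_nonpos (by linarith [htm.1])] at htD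
    rw [mem_ofPred_eq]; linarith)
  have := hsub (right_mem_Icc.2 hL0); rw [mem_ofPred_eq, h1] at this
  exact this

/-! ### The lattice, the matrix `(1 1; 1 0)` and the layered ideal triangulation -/

/-- The matrix `(1 1; 1 0)`, the square of which is `LR`, acting on the plane. -/
def fibR : (ℝ × ℝ) ≃L[ℝ] (ℝ × ℝ) where
  toFun x := (x.1 + x.2, x.1)
  invFun x := (x.2, x.1 - x.2)
  map_add' x y := by ext <;> simp; ring
  map_smul' a x := by ext <;> simp; ring
  left_inv x := by ext <;> simp
  right_inv x := by ext <;> simp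
  continuous_toFun := by fun_prop
  continuous_invFun := by fun_prop

/-- The matrix `(1 1; 1 0)` acting on the lattice. -/
def fibZ : (ℤ²) ≃ₗ[ℤ] (ℤ²) where
  toFun x := (x.1 + x.2, x.1)
  invFun x := (x.2, x.1 - x.2)
  map_add' x y := by ext <;> simp; ring
  map_smul' a x := by ext <;> simp; ring
  left_inv x := by ext <;> simp
  right_inv x := by ext <;> simp

/-- The inclusion of the lattice into the plane. -/
def latR (r : ℤ²) : ℝ × ℝ := (r.1, r.2)

lemma latR_add (r s : ℤ²) : latR (r + s) = latR r + latR s := by simp [latR]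

lemma latR_sub (r s : ℤ²) : latR (r - s) = latR r - latR s := by simp [latR]

lemma latR_injective : Function.Injective latR := by
  intro r s h; simp only [latR, Prod.mk.injEq, Int.cast_inj] at h
  exact Prod.ext h.1 h.2

lemma fibR_apply (x : ℝ × ℝ) : fibR x = (x.1 + x.2, x.1) := rfl

lemma fibR_inv_apply (x : ℝ × ℝ) : fibR⁻¹ x = (x.2, x.1 - x.2) := rfl

lemma fibZ_apply (x : ℤ²) : fibZ x = (x.1 + x.2, x.1) := rfl

lemma fibZ_inv_apply (x : ℤ²) : fibZ⁻¹ x = (x.2, x.1 - x.2) := rfl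

lemma one_apply_fibR (x : ℝ × ℝ) : (1 : (ℝ × ℝ) ≃L[ℝ] (ℝ × ℝ)) x = x := rfl

lemma fibR_zpow_add_apply (m n : ℤ) (x : ℝ × ℝ) :
    (fibR ^ (m + n)) x = (fibR ^ m) ((fibR ^ n) x) := by
  rw [zpow_add]; rfl

lemma fibZ_zpow_add_apply (m n : ℤ) (x : ℤ²) : (fibZ ^ (m + n)) x = (fibZ ^ m) ((fibZ ^ n) x) := by
  rw [zpow_add]; rfl

lemma fibR_zpow_neg_apply (n : ℤ) (x : ℝ × ℝ) : (fibR ^ (-n)) ((fibR ^ n) x) = x := by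
  rw [← fibR_zpow_add_apply]; simp; rfl

lemma fibR_zpow_apply_neg (n : ℤ) (x : ℝ × ℝ) : (fibR ^ n) ((fibR ^ (-n)) x) = x := by
  rw [← fibR_zpow_add_apply]; simp; rfl

lemma fibZ_zpow_neg_apply (n : ℤ) (x : ℤ²) : (fibZ ^ (-n)) ((fibZ ^ n) x) = x := by
  rw [← fibZ_zpow_add_apply]; simp

lemma fibZ_zpow_apply_neg (n : ℤ) (x : ℤ²) : (fibZ ^ n) ((fibZ ^ (-n)) x) = x := by
  rw [← fibZ_zpow_add_apply]; simp

lemma latR_fibZ_zpow (n : ℤ) (r : ℤ²) : latR ((fibZ ^ n) r) = (fibR ^ n) (latR r) := by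
  induction n using Int.induction_on generalizing r with
  | zero => simp [one_apply_fibR]
  | succ k ih =>
    rw [fibZ_zpow_add_apply, fibR_zpow_add_apply, ih]; simp [fibZ_apply, fibR_apply, latR]
  | pred k ih =>
    rw [sub_eq_add_neg, fibZ_zpow_add_apply, fibR_zpow_add_apply, ih]
    simp [fibZ_inv_apply, fibR_inv_apply, latR]

/-- The expanding eigenform of `(1 1; 1 0)`. -/
def eigenform (d : ℤ²) : ℝ := goldenRatio * d.1 + d.2

lemma eigenform_fibZ_zpow (n : ℤ) (d : ℤ²) :
    eigenform ((fibZ ^ n) d) = goldenRatio ^ n * eigenform d := by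
  have h0 := goldenRatio_pos; have h1 := goldenRatio_sq
  induction n using Int.induction_on generalizing d with
  | zero => simp
  | succ k ih =>
    rw [fibZ_zpow_add_apply, ih, zpow_add₀ h0.ne', zpow_one, zpow_one, fibZ_apply]
    simp only [eigenform]; push_cast
    linear_combination (-goldenRatio ^ (k : ℤ) * d.1) * h1
  | pred k ih =>
    rw [sub_eq_add_neg, fibZ_zpow_add_apply, ih, zpow_add₀ h0.ne', zpow_neg_one, zpow_neg_one,
      fibZ_inv_apply]
    simp only [eigenform]; push_cast
    field_simp
    linear_combination (4 * d.2 : ℝ) * h1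

lemma eigenform_neg (d : ℤ²) : eigenform (-d) = -eigenform d := by simp [eigenform]; ring

lemma eigenform_ne_zero {d : ℤ²} (h : d ≠ 0) : eigenform d ≠ 0 := by
  intro h0; unfold eigenform at h0
  by_cases h1 : d.1 = 0
  · rw [h1] at h0
    simp at h0
    exact h (Prod.ext h1 h0)
  · refine goldenRatio_irrational ⟨-d.2 / d.1, ?_⟩
    have : (d.1 : ℝ) ≠ 0 := by exact_mod_cast h1
    push_cast; rw [div_eq_iff this]
    linarith

/-- The layer of an edge direction: `n` for `± (1 1; 1 0)ⁿ (0, 1)`. -/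
def level (d : ℤ²) : ℝ := log |eigenform d| / log goldenRatio

lemma log_goldenRatio_pos : 0 < log goldenRatio := log_pos one_lt_goldenRatio

lemma level_fibZ_zpow (n : ℤ) {d : ℤ²} (hd : d ≠ 0) : level ((fibZ ^ n) d) = level d + n := by
  have h0 := goldenRatio_pos; have h2 := log_goldenRatio_pos
  rw [level, eigenform_fibZ_zpow, abs_mul, abs_of_pos (zpow_pos h0 n), log_mul
    (zpow_pos h0 n).ne' (abs_ne_zero.2 (eigenform_ne_zero hd)), log_zpow, level]
  field_simp; ring

lemma level_neg (d : ℤ²) : level (-d) = level d := by rw [level, eigenform_neg, abs_neg, level]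

lemma level_zero_one : level (0, 1) = 0 := by simp [level, eigenform]

/-- The weight `P ^ (-level d)` of an edge, where `0` is no edge. -/
def weight (P : ℝ) (d : ℤ²) : ℝ := if d = 0 then 0 else exp (-level d * log P)

lemma weight_zero (P : ℝ) : weight P 0 = 0 := if_pos rfl

lemma weight_neg (P : ℝ) (d : ℤ²) : weight P (-d) = weight P d := by simp [weight, level_neg]

lemma weight_fibZ_zpow (hP : 0 < P) (n : ℤ) (d : ℤ²) :
    weight P ((fibZ ^ n) d) = P ^ (-n) * weight P d := by
  by_cases hd : d = 0
  · simp [hd, weight]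
  · have : (fibZ ^ n) d ≠ 0 := by simpa using hd
    rw [weight, weight, if_neg hd, if_neg this, level_fibZ_zpow n hd, neg_add, add_mul,
      exp_add, mul_comm]
    congr 1
    rw [← rpow_intCast, rpow_def_of_pos hP]
    congr 1
    push_cast; ring

lemma weight_zero_one (P : ℝ) : weight P (0, 1) = 1 := by
  simp [weight, level_zero_one, Prod.ext_iff]

/-- The vertices of the basic tetrahedron. -/
def corner : Fin 4 → ℤ² := ![(0, 0), (0, 1), (1, 0), (1, 1)]

/-- The vertices of the tetrahedra of the triangulation. -/
def tileVertex (m : ℤ²) (n : ℤ) (i : Fin 4) : ℤ² := (fibZ ^ n) (corner i) + m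

lemma tileVertex_zero_zero (i : Fin 4) : tileVertex 0 0 i = corner i := by simp [tileVertex]

lemma corner_injective : Function.Injective corner := by
  intro i j h
  fin_cases i <;> fin_cases j <;> simp_all [corner]

lemma tileVertex_injective (m : ℤ²) (n : ℤ) : Function.Injective (tileVertex m n) := by
  intro i j h
  exact corner_injective ((fibZ ^ n).injective (add_right_cancel h))

lemma tileVertex_sub (m : ℤ²) (n : ℤ) (i j : Fin 4) :
    tileVertex m n i - tileVertex m n j = (fibZ ^ n) (corner i - corner j) := by
  rw [tileVertex, tileVertex, map_sub]; abel

/-- The simplex without its vertices. -/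
def idealSimplex : Set (Bary) := {u | (∀ i, 0 ≤ u i ∧ u i < 1) ∧ ∑ i, u i = 1}

/-- The barycentric coordinates, as functions on the lattice, of the point with coordinates `u`
in a tetrahedron. -/
def spread (m : ℤ²) (n : ℤ) (u : Bary) (r : ℤ²) : ℝ :=
  ∑ i, if tileVertex m n i = r then u i else 0

lemma spread_vertex (m : ℤ²) (n : ℤ) (u : Bary) (i : Fin 4) :
    spread m n u (tileVertex m n i) = u i := by
  simp [spread, (tileVertex_injective m n).eq_iff]

lemma spread_of_notMem (u : Bary) (h : r ∉ range (tileVertex m n)) : spread m n u r = 0 := by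
  refine Finset.sum_eq_zero fun i _ => if_neg fun hi => h ⟨i, hi⟩

lemma mem_range_of_spread_ne_zero (h : spread m n u r ≠ 0) : r ∈ range (tileVertex m n) :=
  not_imp_comm.1 (spread_of_notMem u) h

lemma eq_neg_of_tileVertex_eq_zero (h : tileVertex m n i = 0) : m = -(fibZ ^ n) (corner i) :=
  (neg_eq_of_add_eq_zero_right h).symm

lemma nonneg_of_mem_idealSimplex (hu : u ∈ idealSimplex) :
    (0 ≤ u 0 ∧ 0 ≤ u 1 ∧ 0 ≤ u 2 ∧ 0 ≤ u 3) ∧ u 0 + u 1 + u 2 + u 3 = 1 :=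
  ⟨⟨(hu.1 0).1, (hu.1 1).1, (hu.1 2).1, (hu.1 3).1⟩, by rw [← sum_univ_four]; exact hu.2⟩

lemma mul_nonneg_of_mem_idealSimplex (hu : u ∈ idealSimplex) : 0 ≤ u 0 * u 1 ∧ 0 ≤ u 0 * u 2 ∧
    0 ≤ u 0 * u 3 ∧ 0 ≤ u 1 * u 2 ∧ 0 ≤ u 1 * u 3 ∧ 0 ≤ u 2 * u 3 := by
  obtain ⟨⟨b0, b1, b2, b3⟩, -⟩ := nonneg_of_mem_idealSimplex hu
  exact ⟨mul_nonneg b0 b1, mul_nonneg b0 b2, mul_nonneg b0 b3, mul_nonneg b1 b2,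
    mul_nonneg b1 b3, mul_nonneg b2 b3⟩

lemma spread_nonneg (hu : u ∈ idealSimplex) (m : ℤ²) (n : ℤ) (r : ℤ²) :
    0 ≤ spread m n u r := by
  refine Finset.sum_nonneg fun i _ => ?_
  split_ifs
  · exact (hu.1 i).1
  · exact le_rfl

lemma spread_lt_one (hu : u ∈ idealSimplex) (m : ℤ²) (n : ℤ) (r : ℤ²) :
    spread m n u r < 1 := by
  by_cases h : r ∈ range (tileVertex m n)
  · obtain ⟨i, rfl⟩ := h
    rw [spread_vertex]; exact (hu.1 i).2
  · rw [spread_of_notMem u h]; exact one_pos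

/-- Sums over the lattice reduce to sums over the vertices of a tetrahedron. -/
lemma finsum_spread {M : Type*} [AddCommMonoid M] (F : ℤ² → ℝ → M) (hF : ∀ r, F r 0 = 0)
    (m : ℤ²) (n : ℤ) (u : Bary) :
    ∑ᶠ r, F r (spread m n u r) = ∑ i, F (tileVertex m n i) (u i) := by
  classical
  rw [finsum_eq_sum_of_support_subset (s := Finset.univ.image (tileVertex m n))]
  · rw [Finset.sum_image fun i _ j _ h => tileVertex_injective m n h]
    exact sum_congr rfl fun i _ => by rw [spread_vertex]
  · intro r hr
    by_contra hcon
    refine hr ?_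
    simp only; rw [spread_of_notMem u (fun h => hcon ?_), hF]
    obtain ⟨i, rfl⟩ := h; simp

/-- The points of the triangulation, as functions on the lattice. -/
def tileComplex : Set Weights := {b | ∃ m n, ∃ u ∈ idealSimplex, b = spread m n u}

lemma spread_mem (hu : u ∈ idealSimplex) (m : ℤ²) (n : ℤ) :
    spread m n u ∈ tileComplex := ⟨m, n, u, hu, rfl⟩

lemma eq_spread_of_support (h : ∀ r, b r ≠ 0 → r ∈ range (tileVertex m n)) :
    b = spread m n (fun i => b (tileVertex m n i)) := by
  ext r
  by_cases hr : r ∈ range (tileVertex m n)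
  · obtain ⟨i, rfl⟩ := hr
    rw [spread_vertex]
  · rw [spread_of_notMem _ hr]
    by_contra hcon
    exact hr (h r hcon)

lemma mem_idealSimplex_of_support (hb : b ∈ tileComplex)
    (h : ∀ r, b r ≠ 0 → r ∈ range (tileVertex m n)) :
    (fun i => b (tileVertex m n i)) ∈ idealSimplex := by
  have e := eq_spread_of_support h; obtain ⟨m', n', u, hu, rfl⟩ := hb
  refine ⟨fun i => ⟨spread_nonneg hu _ _ _, spread_lt_one hu _ _ _⟩, ?_⟩
  have h1 := finsum_spread (fun _ t => t) (fun _ => rfl) m' n' u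
  rw [e, finsum_spread (fun _ t => t) (fun _ => rfl), hu.2] at h1
  exact h1

/-- The action of the affine group on functions on the lattice. -/
def pushAct (m : ℤ²) (n : ℤ) (b : Weights) (r : ℤ²) : ℝ := b ((fibZ ^ (-n)) (r - m))

lemma tileVertex_act (m m' : ℤ²) (n n' : ℤ) (i : Fin 4) :
    tileVertex ((fibZ ^ n) m' + m) (n + n') i = (fibZ ^ n) (tileVertex m' n' i) + m := by
  rw [tileVertex, tileVertex, map_add, fibZ_zpow_add_apply, add_assoc]

lemma pushAct_spread (m m' : ℤ²) (n n' : ℤ) (u : Bary) :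
    pushAct m n (spread m' n' u) = spread ((fibZ ^ n) m' + m) (n + n') u := by
  ext r; simp only [pushAct, spread]
  refine sum_congr rfl fun i _ => if_congr ?_ rfl rfl
  rw [tileVertex_act]; constructor
  · intro h
    rw [h, fibZ_zpow_apply_neg, sub_add_cancel]
  · intro h
    rw [← h, add_sub_cancel_right, fibZ_zpow_neg_apply]

lemma pushAct_mem (hb : b ∈ tileComplex) (m : ℤ²) (n : ℤ) :
    pushAct m n b ∈ tileComplex := by
  obtain ⟨m', n', u, hu, rfl⟩ := hb; rw [pushAct_spread]
  exact spread_mem hu _ _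

/-- The point of the plane with given barycentric coordinates. -/
def baryCenter (b : Weights) : ℝ × ℝ := (∑ᶠ r, b r * r.1, ∑ᶠ r, b r * r.2)

lemma baryCenter_spread (m : ℤ²) (n : ℤ) (u : Bary) :
    baryCenter (spread m n u) = ∑ i, u i • latR (tileVertex m n i) := by
  rw [baryCenter, finsum_spread (fun r t => t * (r.1 : ℝ)) (by simp),
    finsum_spread (fun r t => t * (r.2 : ℝ)) (by simp)]
  ext <;> simp [latR, Prod.fst_sum, Prod.snd_sum]

lemma baryCenter_spread_zero (u : Bary) : baryCenter (spread 0 0 u) = (u 2 + u 3, u 1 + u 3) := by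
  rw [baryCenter_spread]; simp [sum_univ_four, tileVertex, corner, latR]

lemma baryCenter_spread_act (hu : u ∈ idealSimplex) (m m' : ℤ²) (n n' : ℤ) :
    baryCenter (spread ((fibZ ^ n) m' + m) (n + n') u) =
      (fibR ^ n) (baryCenter (spread m' n' u)) + latR m := by
  rw [baryCenter_spread, baryCenter_spread, map_sum]
  have : latR m = ∑ i, u i • latR m := by rw [← Finset.sum_smul, hu.2, one_smul]
  rw [this, ← Finset.sum_add_distrib]
  refine sum_congr rfl fun i _ => ?_
  rw [tileVertex_act, latR_add, latR_fibZ_zpow, map_smul, smul_add]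

lemma baryCenter_spread' (hu : u ∈ idealSimplex) (m : ℤ²) (n : ℤ) :
    baryCenter (spread m n u) = (fibR ^ n) (u 2 + u 3, u 1 + u 3) + latR m := by
  have := baryCenter_spread_act hu m 0 n 0
  rwa [map_zero, zero_add, add_zero, baryCenter_spread_zero] at this

lemma baryCenter_pushAct (hb : b ∈ tileComplex) (m : ℤ²) (n : ℤ) :
    baryCenter (pushAct m n b) = (fibR ^ n) (baryCenter b) + latR m := by
  obtain ⟨m', n', u, hu, rfl⟩ := hb; rw [pushAct_spread, baryCenter_spread_act hu]

/-- Points of the triangulation do not lie over the lattice. -/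
lemma baryCenter_notMem (hb : b ∈ tileComplex) : baryCenter b ∉ range latR := by
  obtain ⟨m, n, u, hu, rfl⟩ := hb; rintro ⟨r, hr⟩
  rw [baryCenter_spread' hu] at hr
  have h1 : (u 2 + u 3, u 1 + u 3) = latR ((fibZ ^ (-n)) (r - m)) := by
    rw [latR_fibZ_zpow, latR_sub, hr, add_sub_cancel_right, fibR_zpow_neg_apply]
  generalize (fibZ ^ (-n)) (r - m) = s at h1
  simp only [latR, Prod.mk.injEq] at h1; obtain ⟨h1, h2⟩ := h1
  have hs := hu.2; rw [sum_univ_four] at hs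
  have b0 := hu.1 0; have b1 := hu.1 1
  have b2 := hu.1 2; have b3 := hu.1 3
  have c1 : (-1 : ℝ) < s.1 := by linarith
  have c2 : (s.1 : ℝ) < 2 := by linarith
  have c3 : (-1 : ℝ) < s.2 := by linarith
  have c4 : (s.2 : ℝ) < 2 := by linarith
  norm_cast at c1 c2 c3 c4
  have d1 : s.1 = 0 ∨ s.1 = 1 := by omega
  have d2 : s.2 = 0 ∨ s.2 = 1 := by omega
  rcases d1 with d1 | d1 <;> rcases d2 with d2 | d2 <;> rw [d1] at h1 <;> rw [d2] at h2 <;>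
    push_cast at h1 h2 <;> linarith

/-- The sum over pairs of lattice points. -/
def pairSum (G : ℤ² → Weights) (b b' : Weights) : ℝ := ∑ᶠ r, ∑ᶠ r', G r r' * b r * b' r'

lemma pairSum_spread (G : ℤ² → Weights) (m : ℤ²) (n : ℤ) (u u' : Bary) :
    pairSum G (spread m n u) (spread m n u') =
      ∑ i, ∑ j, G (tileVertex m n i) (tileVertex m n j) * u i * u' j := by
  rw [pairSum, finsum_spread (fun r t => ∑ᶠ r', G r r' * t * spread m n u' r') (by simp)]
  refine sum_congr rfl fun i _ => ?_
  rw [finsum_spread (fun r' t => G (tileVertex m n i) r' * u i * t) (by simp)]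

/-- Local finiteness of a family of weights. -/
abbrev LocFin {X : Type} [TopologicalSpace X] (b : X → Weights) : Prop :=
  LocallyFinite fun r => support fun x => b x r

lemma continuous_pairSum {X : Type} [TopologicalSpace X] {b : X → Weights}
    (hc : ∀ r, Continuous fun x => b x r) (hf : LocFin b) (G : ℤ² → Weights) :
    Continuous fun x => pairSum G (b x) (b x) := by
  refine continuous_finsum (fun r => continuous_finsum (fun r' => ?_) ?_) ?_
  · exact (continuous_const.mul (hc r)).mul (hc r')
  · refine hf.subset fun r' x hx h => hx ?_
    simp [h]
  · refine hf.subset fun r x hx h => hx ?_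
    simp [h]

lemma continuous_baryCenter {X : Type} [TopologicalSpace X] {b : X → Weights}
    (hc : ∀ r, Continuous fun x => b x r) (hf : LocFin b) :
    Continuous fun x => baryCenter (b x) := by
  refine Continuous.prodMk (continuous_finsum (fun r => (hc r).mul continuous_const) ?_)
    (continuous_finsum (fun r => (hc r).mul continuous_const) ?_)
  · refine hf.subset fun r x hx h => hx ?_
    simp [h]
  · refine hf.subset fun r x hx h => hx ?_
    simp [h]

/-- The upward direction in the fibres of the basic tetrahedron over the plane. -/
def upward : Bary := ![1, -1, -1, 1]

/-- A function on the triangulation that defines the height over the plane. -/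
structure IsHeight (τ : Weights → ℝ) : Prop where
  continuous : ∀ (X : Type) [TopologicalSpace X] (b : X → Weights),
    (∀ r, Continuous fun x => b x r) →
    LocFin b → (∀ x, b x ∈ tileComplex) →
    Continuous fun x => τ (b x)
  shift : ∀ m n, ∀ u ∈ idealSimplex, τ (spread m n u) = τ (spread 0 0 u) + n / 2
  strictMono : ∀ u ∈ idealSimplex, ∀ e > (0 : ℝ), (u + e • upward) ∈ idealSimplex →
    τ (spread 0 0 u) < τ (spread 0 0 (u + e • upward))
  bound : ∃ C c : ℝ, 0 ≤ c ∧ c * log 2 < 1 / 4 ∧ ∀ u ∈ idealSimplex,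
    -C ≤ τ (spread 0 0 u) ∧ ∃ i, τ (spread 0 0 u) ≤ C - c * log (1 - u i)

/-! ### Barycentric coordinates of the layered triangulation -/

/-- The hat function of the triangulation of the plane with edges parallel to
`(1, 0)`, `(0, 1)`, `(1, -1)`. -/
def hat (x : ℝ × ℝ) : ℝ := max 0 (1 - max (max |x.1| |x.2|) |x.1 + x.2|)

/-- Interpolation between the hat functions of two successive triangulations. -/
def baseBary (x : ℝ × ℝ) (s : ℝ) : ℝ := (1 - s) * hat x + s * hat (fibR⁻¹ x)

/-- Interpolation between the hat functions of all the triangulations. -/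
def flowBary (x : ℝ × ℝ) (l : ℝ) : ℝ := baseBary ((fibR ^ (-⌊l⌋)) x) (Int.fract l)

/-- The point of the layered triangulation over `x` with parameter `l`. -/
def flowPoint (x : ℝ × ℝ) (l : ℝ) (r : ℤ²) : ℝ := flowBary (x - latR r) l

lemma hat_fibR (x : ℝ × ℝ) : hat (fibR⁻¹ (fibR x)) = hat x := by
  simp [hat, fibR_apply, fibR_inv_apply]

lemma continuous_hat : Continuous hat := by unfold hat; fun_prop

lemma continuous_baseBary : Continuous fun p : Point => baseBary p.1 p.2 := by
  unfold baseBary; have h := continuous_hat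
  have h' : Continuous fun p : Point => hat (fibR⁻¹ p.1) :=
    h.comp ((fibR⁻¹).continuous.comp continuous_fst)
  exact ((continuous_const.sub continuous_snd).mul (h.comp continuous_fst)).add
    (continuous_snd.mul h')

lemma flowBary_eq (h : l ∈ Icc (n : ℝ) (n + 1)) (x : ℝ × ℝ) :
    flowBary x l = baseBary ((fibR ^ (-n)) x) (l - n) := by
  rcases h.2.eq_or_lt with h1 | h1
  · have hf : ⌊l⌋ = n + 1 := by rw [h1]; exact_mod_cast Int.floor_intCast (n + 1)
    rw [flowBary, hf, Int.fract, hf]; have e1 : l - ((n + 1 : ℤ) : ℝ) = 0 := by push_cast; linarith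
    have e2 : l - n = 1 := by linarith
    rw [e1, e2, baseBary, baseBary]
    have : (fibR ^ (-n)) x = fibR ((fibR ^ (-(n + 1))) x) := by
      rw [show -n = 1 + -(n + 1) by ring, fibR_zpow_add_apply, zpow_one]
    rw [this, hat_fibR]; simp
  · have hf : ⌊l⌋ = n := Int.floor_eq_iff.2 ⟨h.1, h1⟩
    rw [flowBary, Int.fract, hf]

lemma continuous_flowBary : Continuous fun p : Point => flowBary p.1 p.2 := by
  have hlf : LocallyFinite fun n : ℤ => {p : Point | p.2 ∈ Icc (n : ℝ) (n + 1)} := by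
    intro p
    refine ⟨{q | q.2 ∈ Ioo (p.2 - 1) (p.2 + 1)}, ?_, ?_⟩
    · refine continuous_snd.continuousAt.eventually (Ioo_mem_nhds ?_ ?_) <;> linarith
    · refine (finite_Icc (⌊p.2⌋ - 3) (⌊p.2⌋ + 3)).subset ?_
      rintro n ⟨q, hq1, hq2⟩; have a := Int.floor_le p.2
      have b := Int.lt_floor_add_one p.2; have c : (n : ℝ) < ⌊p.2⌋ + 3 := by linarith [hq1.1, hq2.2]
      have d : (⌊p.2⌋ : ℝ) - 3 < n := by linarith [hq1.2, hq2.1]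
      exact ⟨by exact_mod_cast d.le, by exact_mod_cast c.le⟩
  refine hlf.continuous ?_ ?_ ?_
  · refine eq_univ_of_forall fun p => mem_iUnion.2 ⟨⌊p.2⌋, Int.floor_le _, ?_⟩
    exact (Int.lt_floor_add_one _).le
  · intro n
    exact isClosed_Icc.preimage continuous_snd
  · intro n
    have : Continuous fun p : Point => baseBary ((fibR ^ (-n)) p.1) (p.2 - n) :=
      continuous_baseBary.comp (((fibR ^ (-n)).continuous.comp continuous_fst).prodMk
        (continuous_snd.sub continuous_const))
    exact this.continuousOn.congr fun p hp => flowBary_eq hp p.1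

lemma flowBary_act (n : ℤ) (x : ℝ × ℝ) (l : ℝ) :
    flowBary ((fibR ^ n) x) (l + n) = flowBary x l := by
  rw [flowBary, flowBary, Int.floor_add_intCast, Int.fract_add_intCast, ← fibR_zpow_add_apply]
  congr 3
  ring

lemma flowPoint_act (m : ℤ²) (n : ℤ) (x : ℝ × ℝ) (l : ℝ) :
    flowPoint ((fibR ^ n) x + latR m) (l + n) = pushAct m n (flowPoint x l) := by
  ext r
  rw [pushAct, flowPoint, flowPoint, latR_fibZ_zpow, latR_sub,
    ← flowBary_act n (x - (fibR ^ (-n)) (latR r - latR m)) l, map_sub, fibR_zpow_apply_neg]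
  congr 1
  abel

/-- The barycentric coordinates in the basic tetrahedron of the point over `x` with parameter
`s`. -/
def squareBary (x : ℝ × ℝ) (v : ℝ) : Bary := ![1 - x.1 - x.2 + v, x.2 - v, x.1 - v, v]

/-- The last barycentric coordinate of the point over `x` with parameter `s`. -/
def fibreCoord (x : ℝ × ℝ) (s : ℝ) : ℝ := (1 - s) * max 0 (x.1 + x.2 - 1) + s * min x.1 x.2

lemma hat_values {x y : ℝ} (hx : x ∈ Icc (0 : ℝ) 1) (hy : y ∈ Icc (0 : ℝ) 1) :
    hat (x, y) = 1 - x - y + max 0 (x + y - 1) ∧ hat (x, y - 1) = y - max 0 (x + y - 1) ∧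
    hat (x - 1, y) = x - max 0 (x + y - 1) ∧ hat (x - 1, y - 1) = max 0 (x + y - 1) := by
  obtain ⟨hx0, hx1⟩ := hx; obtain ⟨hy0, hy1⟩ := hy
  simp only [hat]
  refine ⟨?_, ?_, ?_, ?_⟩ <;> grind

lemma hat_values' {x y : ℝ} (hx : x ∈ Icc (0 : ℝ) 1) (hy : y ∈ Icc (0 : ℝ) 1) :
    hat (y, x - y) = 1 - x - y + min x y ∧ hat (y - 1, x - (y - 1)) = y - min x y ∧
    hat (y, x - 1 - y) = x - min x y ∧ hat (y - 1, x - 1 - (y - 1)) = min x y := by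
  obtain ⟨hx0, hx1⟩ := hx; obtain ⟨hy0, hy1⟩ := hy
  simp only [hat]
  refine ⟨?_, ?_, ?_, ?_⟩ <;> grind

lemma hat_ne_zero (h : hat x ≠ 0) : ‖x‖ < 1 := by
  by_contra! hcon
  refine h (max_eq_left ?_)
  have : ‖x‖ = max |x.1| |x.2| := rfl; have h2 := le_max_left (max |x.1| |x.2|) |x.1 + x.2|
  linarith

lemma hat_inv_ne_zero (h : hat (fibR⁻¹ x) ≠ 0) : ‖x‖ < 1 := by
  by_contra! hcon
  refine h (max_eq_left ?_)
  have h1 : ‖x‖ = max |x.1| |x.2| := rfl; rw [h1] at hcon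
  simp only [fibR_inv_apply, add_sub_cancel]
  rcases le_max_iff.1 hcon with h2 | h2
  · have := le_max_right (max |x.2| |x.1 - x.2|) |x.1|
    linarith
  · have := le_max_left (max |x.2| |x.1 - x.2|) |x.1|
    have := le_max_left |x.2| |x.1 - x.2|; linarith

lemma baseBary_ne_zero (h : baseBary x s ≠ 0) : ‖x‖ < 1 := by
  by_contra hcon
  have h1 : hat x = 0 := by_contra fun h1 => hcon (hat_ne_zero h1)
  have h2 : hat (fibR⁻¹ x) = 0 := by_contra fun h1 => hcon (hat_inv_ne_zero h1)
  exact h (by simp [baseBary, h1, h2])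

lemma norm_fibR_zpow_le (n : ℤ) (x : ℝ × ℝ) : ‖(fibR ^ n) x‖ ≤ 2 ^ |(n : ℝ)| * ‖x‖ := by
  have h1 : ∀ x : ℝ × ℝ, ‖fibR x‖ ≤ 2 * ‖x‖ := by
    intro x; rw [fibR_apply, Prod.norm_mk, max_le_iff]
    have a := norm_fst_le x; have b := norm_snd_le x
    have c := norm_add_le x.1 x.2; have d := norm_nonneg x
    constructor <;> linarith
  have h2 : ∀ x : ℝ × ℝ, ‖fibR⁻¹ x‖ ≤ 2 * ‖x‖ := by
    intro x; rw [fibR_inv_apply, Prod.norm_mk, max_le_iff]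
    have a := norm_fst_le x; have b := norm_snd_le x
    have c := norm_sub_le x.1 x.2; have d := norm_nonneg x
    constructor <;> linarith
  have e1 : ∀ (k : ℕ) (x : ℝ × ℝ), ‖(fibR ^ (k : ℤ)) x‖ ≤ 2 ^ k * ‖x‖ := by
    intro k
    induction k with
    | zero => intro x; simp; rfl
    | succ k ih =>
      intro x; push_cast
      rw [fibR_zpow_add_apply]
      refine (ih _).trans ?_
      rw [pow_succ, mul_assoc]
      gcongr
      exact h1 x
  have e2 : ∀ (k : ℕ) (x : ℝ × ℝ), ‖(fibR ^ (-(k : ℤ))) x‖ ≤ 2 ^ k * ‖x‖ := by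
    intro k
    induction k with
    | zero => intro x; simp; rfl
    | succ k ih =>
      intro x; push_cast
      rw [neg_add, fibR_zpow_add_apply]
      refine (ih _).trans ?_
      rw [pow_succ, mul_assoc]
      gcongr
      exact h2 x
  obtain ⟨k, rfl | rfl⟩ := n.eq_nat_or_neg
  · have := e1 k x
    simpa using this
  · have := e2 k x
    simpa using this

lemma flowBary_ne_zero (h : flowBary x l ≠ 0) : ‖x‖ ≤ 2 ^ |(⌊l⌋ : ℝ)| := by
  have h1 := baseBary_ne_zero h; have h2 := norm_fibR_zpow_le ⌊l⌋ ((fibR ^ (-⌊l⌋)) x)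
  rw [fibR_zpow_apply_neg] at h2; have : (0 : ℝ) < 2 ^ |(⌊l⌋ : ℝ)| := by positivity
  nlinarith

lemma finite_latR_norm_le (x : ℝ × ℝ) (R : ℝ) : {r : ℤ² | ‖x - latR r‖ ≤ R}.Finite := by
  refine ((finite_Icc ⌊x.1 - R⌋ ⌈x.1 + R⌉).prod (finite_Icc ⌊x.2 - R⌋ ⌈x.2 + R⌉)).subset ?_
  intro r hr
  replace hr : ‖x - latR r‖ ≤ R := hr
  have h1 := (norm_fst_le (x - latR r)).trans hr; have h2 := (norm_snd_le (x - latR r)).trans hr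
  rw [norm_eq_abs, abs_le] at h1 h2; simp only [latR, Prod.fst_sub, Prod.snd_sub] at h1 h2
  refine ⟨⟨?_, ?_⟩, ⟨?_, ?_⟩⟩
  · have := Int.floor_le (x.1 - R)
    exact_mod_cast (show (⌊x.1 - R⌋ : ℝ) ≤ r.1 by linarith)
  · have := Int.le_ceil (x.1 + R)
    exact_mod_cast (show (r.1 : ℝ) ≤ ⌈x.1 + R⌉ by linarith)
  · have := Int.floor_le (x.2 - R)
    exact_mod_cast (show (⌊x.2 - R⌋ : ℝ) ≤ r.2 by linarith)
  · have := Int.le_ceil (x.2 + R)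
    exact_mod_cast (show (r.2 : ℝ) ≤ ⌈x.2 + R⌉ by linarith)

lemma locallyFinite_flowPoint :
    LocallyFinite fun r => support fun p : Point => flowPoint p.1 p.2 r := by
  intro p
  refine ⟨{q | q.1 ∈ ball p.1 1 ∧ q.2 ∈ Ioo (p.2 - 1) (p.2 + 1)}, ?_, ?_⟩
  · refine (continuous_fst.continuousAt.eventually (ball_mem_nhds _ one_pos)).and
      (continuous_snd.continuousAt.eventually (Ioo_mem_nhds ?_ ?_)) <;> linarith
  · refine (finite_latR_norm_le p.1 (1 + 2 ^ (|p.2| + 2))).subset ?_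
    rintro r ⟨q, hq1, hq2, hq3⟩; have h1 := flowBary_ne_zero hq1
    have h2 : |(⌊q.2⌋ : ℝ)| ≤ |p.2| + 2 := by
      have a := Int.floor_le q.2; have b := Int.lt_floor_add_one q.2
      rw [abs_le]; have c := neg_abs_le p.2
      have d := le_abs_self p.2
      constructor <;> linarith [hq3.1, hq3.2]
    have h3 : (2 : ℝ) ^ |(⌊q.2⌋ : ℝ)| ≤ 2 ^ (|p.2| + 2) :=
      rpow_le_rpow_of_exponent_le (by norm_num) h2
    have h4 : ‖q.1 - p.1‖ < 1 := by rw [← dist_eq_norm]; exact hq2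
    have h5 := norm_sub_le (q.1 - latR r) (q.1 - p.1); rw [sub_sub_sub_cancel_left] at h5
    rw [mem_ofPred_eq]; linarith

lemma baseBary_square (h1 : x.1 ∈ Icc (0 : ℝ) 1) (h2 : x.2 ∈ Icc (0 : ℝ) 1)
    (s : ℝ) : (fun r => baseBary (x - latR r) s) = spread 0 0 (squareBary x (fibreCoord x s)) := by
  obtain ⟨a0, a1, a2, a3⟩ := hat_values h1 h2; obtain ⟨b0, b1, b2, b3⟩ := hat_values' h1 h2
  ext r
  by_cases hr : r ∈ range (tileVertex 0 0)
  · obtain ⟨i, rfl⟩ := hr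
    rw [spread_vertex, tileVertex_zero_zero]; obtain ⟨x, y⟩ := x
    fin_cases i
    · simp [baseBary, corner, latR, squareBary, fibreCoord, fibR_inv_apply, a0, b0]
      ring
    · simp [baseBary, corner, latR, squareBary, fibreCoord, fibR_inv_apply]
      simp only at *
      rw [a1, b1]; ring
    · simp [baseBary, corner, latR, squareBary, fibreCoord, fibR_inv_apply]
      simp only at *
      rw [a2, b2]; ring
    · simp [baseBary, corner, latR, squareBary, fibreCoord, fibR_inv_apply]
      simp only [sub_sub_sub_cancel_right] at *
      rw [a3, b3]
  · rw [spread_of_notMem _ hr]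
    by_contra hcon
    have h3 := baseBary_ne_zero hcon; have h4 := (norm_fst_le _).trans_lt h3
    have h5 := (norm_snd_le _).trans_lt h3; rw [norm_eq_abs, abs_lt] at h4 h5
    simp only [latR, Prod.fst_sub, Prod.snd_sub] at h4 h5
    have c1 : (-1 : ℝ) < r.1 := by linarith [h1.1]
    have c2 : (r.1 : ℝ) < 2 := by linarith [h1.2]
    have c3 : (-1 : ℝ) < r.2 := by linarith [h2.1]
    have c4 : (r.2 : ℝ) < 2 := by linarith [h2.2]
    norm_cast at c1 c2 c3 c4
    have d1 : r.1 = 0 ∨ r.1 = 1 := by omega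
    have d2 : r.2 = 0 ∨ r.2 = 1 := by omega
    refine hr ?_
    rcases d1 with d1 | d1 <;> rcases d2 with d2 | d2
    · exact ⟨0, by rw [tileVertex_zero_zero]; exact Prod.ext d1.symm d2.symm⟩
    · exact ⟨1, by rw [tileVertex_zero_zero]; exact Prod.ext d1.symm d2.symm⟩
    · exact ⟨2, by rw [tileVertex_zero_zero]; exact Prod.ext d1.symm d2.symm⟩
    · exact ⟨3, by rw [tileVertex_zero_zero]; exact Prod.ext d1.symm d2.symm⟩

lemma squareBary_mem (h1 : x.1 ∈ Icc (0 : ℝ) 1) (h2 : x.2 ∈ Icc (0 : ℝ) 1)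
    (hx : x ∉ range latR) {v : ℝ} (hv0 : max 0 (x.1 + x.2 - 1) ≤ v) (hv1 : v ≤ min x.1 x.2) :
    squareBary x v ∈ idealSimplex := by
  rw [max_le_iff] at hv0; rw [le_min_iff] at hv1
  have hs : ∑ i, squareBary x v i = 1 := by rw [sum_univ_four]; simp [squareBary]
  have hn : ∀ i, 0 ≤ squareBary x v i := by
    intro i
    fin_cases i <;> simp [squareBary] <;> linarith
  refine ⟨fun i => ⟨hn i, ?_⟩, hs⟩
  by_contra! hcon
  refine hx ⟨corner i, ?_⟩
  have n0 := hn 0; have n1 := hn 1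
  have n2 := hn 2; have n3 := hn 3
  simp only [squareBary, cons_val] at n0 n1 n2 n3
  fin_cases i <;> simp [squareBary] at hcon <;> refine Prod.ext ?_ ?_ <;>
    simp [latR, corner] <;> linarith

lemma fibreCoord_mem (h1 : x.1 ∈ Icc (0 : ℝ) 1) (h2 : x.2 ∈ Icc (0 : ℝ) 1)
    (hs : s ∈ Icc (0 : ℝ) 1) :
    max 0 (x.1 + x.2 - 1) ≤ fibreCoord x s ∧ fibreCoord x s ≤ min x.1 x.2 := by
  have h : max 0 (x.1 + x.2 - 1) ≤ min x.1 x.2 := by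
    rw [max_le_iff, le_min_iff, le_min_iff]
    refine ⟨⟨h1.1, h2.1⟩, ?_, ?_⟩ <;> linarith [h1.2, h2.2]
  unfold fibreCoord
  constructor <;> nlinarith [hs.1, hs.2]

lemma exists_fibreCoord (hu : u ∈ idealSimplex) :
    ∃ s ∈ Icc (0 : ℝ) 1, u = squareBary (u 2 + u 3, u 1 + u 3)
      (fibreCoord (u 2 + u 3, u 1 + u 3) s) := by
  obtain ⟨⟨b0, b1, b2, b3⟩, hs⟩ := nonneg_of_mem_idealSimplex hu
  have key : ∀ s, fibreCoord (u 2 + u 3, u 1 + u 3) s = u 3 →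
      u = squareBary (u 2 + u 3, u 1 + u 3) (fibreCoord (u 2 + u 3, u 1 + u 3) s) := by
    intro s h; rw [h]
    ext i
    fin_cases i <;> simp [squareBary]
    linarith
  set v0 := max 0 (u 2 + u 3 + (u 1 + u 3) - 1) with hv0
  set v1 := min (u 2 + u 3) (u 1 + u 3) with hv1
  have e0 : v0 ≤ u 3 := by rw [hv0, max_le_iff]; constructor <;> linarith
  have e1 : u 3 ≤ v1 := by rw [hv1, le_min_iff]; constructor <;> linarith
  rcases (e0.trans e1).eq_or_lt with h | h
  · refine ⟨0, by simp, key 0 ?_⟩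
    rw [fibreCoord]; simp only [← hv0, ← hv1]
    linarith
  · refine ⟨(u 3 - v0) / (v1 - v0), ⟨div_nonneg (by linarith) (by linarith), ?_⟩, key _ ?_⟩
    · rw [div_le_one (by linarith)]; linarith
    · rw [fibreCoord]
      simp only [← hv0, ← hv1]; have : v1 - v0 ≠ 0 := by linarith
      field_simp; ring

lemma squareBary_sub_corner_le (hu : u ∈ idealSimplex) (i : Fin 4) :
    ‖((u 2 + u 3, u 1 + u 3) : ℝ × ℝ) - latR (corner i)‖ ≤ 1 - u i := by
  obtain ⟨⟨b0, b1, b2, b3⟩, hs⟩ := nonneg_of_mem_idealSimplex hu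
  rw [Prod.norm_def, max_le_iff, norm_eq_abs, norm_eq_abs, abs_le, abs_le]
  fin_cases i <;> simp [latR, corner] <;> (refine ⟨⟨?_, ?_⟩, ?_, ?_⟩) <;> linarith

/-- The decomposition of a point of the plane with respect to the triangulations of layer `n`. -/
lemma exists_square (n : ℤ) (x : ℝ × ℝ) : ∃ (m : ℤ²) (x' : ℝ × ℝ),
    x'.1 ∈ Icc (0 : ℝ) 1 ∧ x'.2 ∈ Icc (0 : ℝ) 1 ∧ x = (fibR ^ n) x' + latR m := by
  set z := (fibR ^ (-n)) x with hz
  refine ⟨(fibZ ^ n) (⌊z.1⌋, ⌊z.2⌋), (Int.fract z.1, Int.fract z.2),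
    ⟨Int.fract_nonneg _, (Int.fract_lt_one _).le⟩, ⟨Int.fract_nonneg _, (Int.fract_lt_one _).le⟩,
    ?_⟩
  rw [latR_fibZ_zpow, ← map_add]
  have : ((Int.fract z.1, Int.fract z.2) : ℝ × ℝ) + latR (⌊z.1⌋, ⌊z.2⌋) = z := by
    ext <;> simp [latR]
  rw [this, hz, fibR_zpow_apply_neg]

lemma notMem_latR_act (h : (fibR ^ n) x + latR m ∉ range latR) :
    x ∉ range latR := by
  rintro ⟨r, rfl⟩
  exact h ⟨(fibZ ^ n) r + m, by rw [latR_add, latR_fibZ_zpow]⟩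

lemma flowPoint_square {x' : ℝ × ℝ} (h1 : x'.1 ∈ Icc (0 : ℝ) 1) (h2 : x'.2 ∈ Icc (0 : ℝ) 1)
    (m : ℤ²) (n : ℤ) (hs : s ∈ Icc (0 : ℝ) 1) :
    flowPoint ((fibR ^ n) x' + latR m) (s + n) =
      spread m n (squareBary x' (fibreCoord x' s)) := by
  have h3 : flowPoint x' s = spread 0 0 (squareBary x' (fibreCoord x' s)) := by
    rw [← baseBary_square h1 h2]; ext r
    rw [flowPoint, flowBary_eq (n := 0) (by simpa using hs)]
    simp
    rfl
  rw [flowPoint_act, h3, pushAct_spread]; simp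

lemma exists_flowPoint_eq (hx : x ∉ range latR) (l : ℝ) :
    ∃ m, ∃ u ∈ idealSimplex, flowPoint x l = spread m ⌊l⌋ u ∧
      x = (fibR ^ ⌊l⌋) (u 2 + u 3, u 1 + u 3) + latR m := by
  obtain ⟨m, x', h1, h2, rfl⟩ := exists_square ⌊l⌋ x
  have hs : Int.fract l ∈ Icc (0 : ℝ) 1 := ⟨Int.fract_nonneg _, (Int.fract_lt_one _).le⟩
  have hv := fibreCoord_mem h1 h2 hs
  refine ⟨m, _, squareBary_mem h1 h2 (notMem_latR_act hx) hv.1 hv.2, ?_, ?_⟩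
  · rw [← flowPoint_square h1 h2 m ⌊l⌋ hs, Int.fract_add_floor]
  · congr 2
    ext <;> simp [squareBary]

lemma flowPoint_mem (hx : x ∉ range latR) (l : ℝ) :
    flowPoint x l ∈ tileComplex := by
  obtain ⟨m, u, hu, h, -⟩ := exists_flowPoint_eq hx l; rw [h]; exact spread_mem hu _ _

lemma baryCenter_flowPoint (hx : x ∉ range latR) (l : ℝ) : baryCenter (flowPoint x l) = x := by
  obtain ⟨m, u, hu, h, h'⟩ := exists_flowPoint_eq hx l; rw [h, baryCenter_spread' hu, ← h']

lemma exists_flowPoint_eq_spread (hu : u ∈ idealSimplex) (m : ℤ²) (n : ℤ) :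
    ∃ s ∈ Icc (0 : ℝ) 1, flowPoint (baryCenter (spread m n u)) (s + n) = spread m n u := by
  obtain ⟨s, hs, h⟩ := exists_fibreCoord hu
  refine ⟨s, hs, ?_⟩
  have hsum := hu.2; rw [sum_univ_four] at hsum
  have b0 := (hu.1 0).1; have b1 := (hu.1 1).1
  have b2 := (hu.1 2).1; have b3 := (hu.1 3).1
  rw [baryCenter_spread' hu, flowPoint_square ⟨?_, ?_⟩ ⟨?_, ?_⟩ m n hs, ← h] <;> simp only <;>
    linarith

/-! ### Barycentric coordinates as functions of the point and the height -/

lemma exists_forall_le_norm_sub (hx : x ∉ range latR) :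
    ∃ δ > 0, ∀ x', ‖x' - x‖ < δ → ∀ r, δ ≤ ‖x' - latR r‖ := by
  have h1 : ∀ᶠ δ in 𝓝[>] (0 : ℝ), ∀ r ∈ {r : ℤ² | ‖x - latR r‖ ≤ 1}, δ ≤ ‖x - latR r‖ := by
    refine (eventually_all_finite (finite_latR_norm_le x 1)).2 fun r _ => ?_
    have : 0 < ‖x - latR r‖ := norm_pos_iff.2 (sub_ne_zero.2 fun h => hx ⟨r, h.symm⟩)
    exact nhdsWithin_le_nhds (Iic_mem_nhds this)
  have h2 : ∀ᶠ δ in 𝓝[>] (0 : ℝ), δ < 1 := nhdsWithin_le_nhds (Iio_mem_nhds one_pos)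
  obtain ⟨δ, ⟨h1, h2⟩, hδ⟩ := ((h1.and h2).and self_mem_nhdsWithin).exists
  replace hδ : 0 < δ := hδ
  refine ⟨δ / 2, half_pos hδ, fun x' hx' r => ?_⟩
  have h3 : δ ≤ ‖x - latR r‖ := by
    by_cases h : ‖x - latR r‖ ≤ 1
    · exact h1 r h
    · linarith
  have h4 := norm_sub_le (x' - latR r) (x' - x); rw [sub_sub_sub_cancel_left] at h4
  linarith

/-- The points of the plane times the line that do not lie over the lattice. -/
def offLattice : Set Point := {y | y.1 ∉ range latR}

lemma isOpen_offLattice : IsOpen offLattice := by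
  rw [isOpen_iff_mem_nhds]; intro y hy
  obtain ⟨δ, hδ, h⟩ := exists_forall_le_norm_sub hy
  filter_upwards [continuous_fst.continuousAt.eventually (ball_mem_nhds y.1 hδ)] with z hz
  rintro ⟨r, hr⟩; have := h z.1 (by rwa [← dist_eq_norm]) r
  rw [hr, sub_self, norm_zero] at this; linarith

lemma continuous_flowPoint (r : ℤ²) : Continuous fun p : Point => flowPoint p.1 p.2 r :=
  continuous_flowBary.comp ((continuous_fst.sub continuous_const).prodMk continuous_snd)

section
variable {τ : Weights → ℝ}

lemma IsHeight.continuousOn_flowPoint (hτ : IsHeight τ) :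
    ContinuousOn (fun p : Point => τ (flowPoint p.1 p.2)) offLattice := by
  rw [continuousOn_iff_continuous_domRestrict]
  refine hτ.continuous offLattice (fun p => flowPoint p.1.1 p.1.2) (fun r => ?_) ?_ ?_
  · exact (continuous_flowPoint r).comp continuous_subtype_val
  · exact locallyFinite_flowPoint.preimage_continuous continuous_subtype_val
  · exact fun p => flowPoint_mem p.2 _

lemma IsHeight.mono_of_mem_Icc (hτ : IsHeight τ) (hx : x ∉ range latR) (n : ℤ) (h : l ∈ Icc (n : ℝ) (n + 1)) (h' : l' ∈ Icc (n : ℝ) (n + 1)) (hl : l ≤ l') :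
    τ (flowPoint x l) ≤ τ (flowPoint x l') ∧
      (τ (flowPoint x l) = τ (flowPoint x l') → flowPoint x l = flowPoint x l') := by
  obtain ⟨m, x', h1, h2, rfl⟩ := exists_square n x
  have hs : l - n ∈ Icc (0 : ℝ) 1 := ⟨by linarith [h.1], by linarith [h.2]⟩
  have hs' : l' - n ∈ Icc (0 : ℝ) 1 := ⟨by linarith [h'.1], by linarith [h'.2]⟩
  have e := flowPoint_square h1 h2 m n hs; have e' := flowPoint_square h1 h2 m n hs'
  rw [sub_add_cancel] at e e'; have hx' := notMem_latR_act hx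
  have hv := fibreCoord_mem h1 h2 hs; have hv' := fibreCoord_mem h1 h2 hs'
  have hm := squareBary_mem h1 h2 hx' hv.1 hv.2; have hm' := squareBary_mem h1 h2 hx' hv'.1 hv'.2
  have hle : fibreCoord x' (l - n) ≤ fibreCoord x' (l' - n) := by
    have := hv.1.trans hv.2; unfold fibreCoord
    nlinarith
  rw [e, e', hτ.shift _ _ _ hm, hτ.shift _ _ _ hm']
  rcases hle.eq_or_lt with h3 | h3
  · rw [h3]; simp
  · have h4 := hτ.strictMono _ hm _ (sub_pos.2 h3)
    have h5 : squareBary x' (fibreCoord x' (l - n)) +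
        (fibreCoord x' (l' - n) - fibreCoord x' (l - n)) • upward =
        squareBary x' (fibreCoord x' (l' - n)) := by
      ext i
      fin_cases i <;> simp [squareBary, upward]
    rw [h5] at h4; have h6 := h4 hm'
    exact ⟨by linarith, fun h => by linarith⟩

lemma IsHeight.mono (hτ : IsHeight τ) (hx : x ∉ range latR)
    (hl : l ≤ l') : τ (flowPoint x l) ≤ τ (flowPoint x l') ∧
      (τ (flowPoint x l) = τ (flowPoint x l') → flowPoint x l = flowPoint x l') := by
  have key : ∀ (k : ℕ) (l l' : ℝ), l ≤ l' → l' ≤ ⌊l⌋ + 1 + k →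
      τ (flowPoint x l) ≤ τ (flowPoint x l') ∧
      (τ (flowPoint x l) = τ (flowPoint x l') → flowPoint x l = flowPoint x l') := by
    intro k
    induction k with
    | zero =>
      intro l l' h1 h2
      refine hτ.mono_of_mem_Icc hx ⌊l⌋ ⟨Int.floor_le l, (Int.lt_floor_add_one l).le⟩
        ⟨(Int.floor_le l).trans h1, by simpa using h2⟩ h1
    | succ k ih =>
      intro l l' h1 h2; have h3 := Int.lt_floor_add_one l
      rcases le_total l' (⌊l⌋ + 1) with h | h
      · exact hτ.mono_of_mem_Icc hx ⌊l⌋ ⟨Int.floor_le l, h3.le⟩ ⟨(Int.floor_le l).trans h1, h⟩ h1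
      · have a := hτ.mono_of_mem_Icc hx ⌊l⌋ ⟨Int.floor_le l, h3.le⟩ (l' := ⌊l⌋ + 1)
          ⟨by linarith, le_rfl⟩ h3.le
        have hf : ⌊(⌊l⌋ : ℝ) + 1⌋ = ⌊l⌋ + 1 := by simp
        have b := ih (⌊l⌋ + 1) l' h (by rw [hf]; push_cast at h2 ⊢; linarith)
        refine ⟨a.1.trans b.1, fun he => ?_⟩
        rw [a.2 (le_antisymm a.1 (by rw [he]; exact b.1)),
          b.2 (le_antisymm b.1 (by rw [← he]; exact a.1))]
  refine key ⌈l' - ⌊l⌋⌉₊ l l' hl ?_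
  have := Nat.le_ceil (l' - ⌊l⌋); linarith

lemma IsHeight.eq_of_eq (hτ : IsHeight τ) (hx : x ∉ range latR)
    (h : τ (flowPoint x l) = τ (flowPoint x l')) : flowPoint x l = flowPoint x l' := by
  rcases le_total l l' with hl | hl
  · exact (hτ.mono hx hl).2 h
  · exact ((hτ.mono hx hl).2 h.symm).symm

lemma IsHeight.flow_bound (hτ : IsHeight τ) : ∃ C c : ℝ, 0 ≤ c ∧ c * log 2 < 1 / 4 ∧
    ∀ x ∉ range latR, ∀ δ > 0, (∀ r, δ ≤ ‖x - latR r‖) → ∀ l, ⌊l⌋ / 2 - C ≤ τ (flowPoint x l) ∧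
      τ (flowPoint x l) ≤ ⌊l⌋ / 2 + C - c * log δ + c * log 2 * |(⌊l⌋ : ℝ)| := by
  obtain ⟨C, c, hc0, hc1, hb⟩ := hτ.bound
  refine ⟨C, c, hc0, hc1, fun x hx δ hδ hr l => ?_⟩
  obtain ⟨m, u, hu, h1, h2⟩ := exists_flowPoint_eq hx l; obtain ⟨b1, i, b2⟩ := hb u hu
  rw [h1, hτ.shift _ _ _ hu]
  refine ⟨by linarith, ?_⟩
  have h3 := hr (tileVertex m ⌊l⌋ i)
  rw [tileVertex, latR_add, latR_fibZ_zpow, h2, add_sub_add_right_eq_sub, ← map_sub] at h3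
  have h4 := h3.trans (norm_fibR_zpow_le _ _); have h5 := squareBary_sub_corner_le hu i
  have h6 : (0 : ℝ) < 2 ^ |(⌊l⌋ : ℝ)| := by positivity
  have h7 : δ ≤ 2 ^ |(⌊l⌋ : ℝ)| * (1 - u i) := h4.trans (by gcongr)
  have h8 := log_le_log hδ h7
  rw [log_mul h6.ne' (sub_pos.2 (hu.1 i).2).ne', log_rpow two_pos] at h8
  have h9 := mul_le_mul_of_nonneg_left h8 hc0
  nlinarith

/-- A parameter of the point at height `y.2` over `y.1`. -/
def flowParam (τ : Weights → ℝ) (y : Point) : ℝ :=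
  Classical.epsilon fun l => τ (flowPoint y.1 l) = y.2

/-- The barycentric coordinates of a point. -/
def bary (τ : Weights → ℝ) (y : Point) : Weights := flowPoint y.1 (flowParam τ y)

lemma IsHeight.exists_param (hτ : IsHeight τ) (hx : x ∉ range latR) (t : ℝ) :
    ∃ l, τ (flowPoint x l) = t := by
  obtain ⟨C, c, hc0, hc1, hb⟩ := hτ.flow_bound; obtain ⟨δ, hδ, hr⟩ := exists_forall_le_norm_sub hx
  replace hr := hr x (by simpa using hδ)
  have hcont : Continuous fun l => τ (flowPoint x l) := by
    refine hτ.continuousOn_flowPoint.comp_continuous (f := fun l => (x, l)) (by fun_prop) ?_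
    exact fun l => hx
  refine mem_range_of_exists_le_of_exists_ge hcont ?_ ?_
  · obtain ⟨N, hN⟩ := exists_nat_ge ((C - c * log δ - t) / (1 / 2 - c * log 2))
    refine ⟨-N, ?_⟩
    have := (hb x hx δ hδ hr (-N)).2
    have hf : ⌊(-N : ℝ)⌋ = -N := by exact_mod_cast Int.floor_intCast (R := ℝ) (-N)
    rw [hf] at this; push_cast at this
    rw [abs_neg, Nat.abs_cast] at this; rw [div_le_iff₀ (by linarith)] at hN
    linarith
  · obtain ⟨N, hN⟩ := exists_nat_ge (2 * (C + t))
    refine ⟨N, ?_⟩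
    have := (hb x hx δ hδ hr N).1; simp at this
    linarith

lemma IsHeight.flowParam_spec (hτ : IsHeight τ) (hy : y ∈ offLattice) : τ (bary τ y) = y.2 :=
  Classical.epsilon_spec (hτ.exists_param hy y.2)

lemma bary_mem (hy : y ∈ offLattice) : bary τ y ∈ tileComplex := flowPoint_mem hy _

lemma baryCenter_bary (hy : y ∈ offLattice) :
    baryCenter (bary τ y) = y.1 := baryCenter_flowPoint hy _

lemma IsHeight.bary_eq (hτ : IsHeight τ) (hb : b ∈ tileComplex) :
    bary τ (baryCenter b, τ b) = b := by
  have hy : (baryCenter b, τ b) ∈ offLattice := baryCenter_notMem hb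
  have h1 := hτ.flowParam_spec hy; obtain ⟨m, n, u, hu, rfl⟩ := id hb
  obtain ⟨s, -, hs⟩ := exists_flowPoint_eq_spread hu m n; rw [← hs] at h1 ⊢
  simp only [hs] at h1 ⊢; rw [bary] at h1 ⊢
  have h2 := hτ.eq_of_eq (x := baryCenter (spread m n u)) hy
    (l := flowParam τ (baryCenter (spread m n u), τ (spread m n u))) (l' := s + n)
    (by rw [hs]; exact h1)
  rw [h2, hs]

lemma IsHeight.bary_eq' (hτ : IsHeight τ) (hb : b ∈ tileComplex) (h1 : baryCenter b = y.1) (h2 : τ b = y.2) : bary τ y = b := by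
  have := hτ.bary_eq hb
  rwa [h1, h2] at this

/-- The affine group acting on the plane times the line. -/
def pointAct (m : ℤ²) (n : ℤ) (y : Point) : Point := ((fibR ^ n) y.1 + latR m, y.2 + n / 2)

lemma pointAct_mem (hy : y ∈ offLattice) (m : ℤ²) (n : ℤ) :
    pointAct m n y ∈ offLattice := by
  rintro ⟨r, hr⟩
  refine hy ⟨(fibZ ^ (-n)) (r - m), ?_⟩
  rw [latR_fibZ_zpow, latR_sub, hr, pointAct, add_sub_cancel_right, fibR_zpow_neg_apply]

lemma IsHeight.shift_pushAct (hτ : IsHeight τ) (hb : b ∈ tileComplex)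
    (m : ℤ²) (n : ℤ) : τ (pushAct m n b) = τ b + n / 2 := by
  obtain ⟨m', n', u, hu, rfl⟩ := hb; rw [pushAct_spread, hτ.shift _ _ _ hu, hτ.shift m' n' _ hu]
  push_cast; ring

lemma IsHeight.bary_pointAct (hτ : IsHeight τ) (hy : y ∈ offLattice)
    (m : ℤ²) (n : ℤ) : bary τ (pointAct m n y) = pushAct m n (bary τ y) := by
  have hb := bary_mem (τ := τ) hy
  refine hτ.bary_eq' (pushAct_mem hb _ _) ?_ ?_
  · rw [baryCenter_pushAct hb, baryCenter_bary hy, pointAct]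
  · rw [hτ.shift_pushAct hb, hτ.flowParam_spec hy, pointAct]

lemma IsHeight.eventually_abs_flowParam_le (hτ : IsHeight τ)
    (hy : y ∈ offLattice) : ∃ N : ℝ, ∀ᶠ z in 𝓝 y, |flowParam τ z| ≤ N := by
  obtain ⟨C, c, hc0, hc1, hb⟩ := hτ.flow_bound; obtain ⟨δ, hδ, hr⟩ := exists_forall_le_norm_sub hy
  set K := (C - c * log δ + 1 - y.2) / (1 / 2 - c * log 2) with hK
  refine ⟨max (2 * (y.2 + 1 + C) + 1) (max K 0 + 1), ?_⟩
  filter_upwards [isOpen_offLattice.mem_nhds hy,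
    continuous_fst.continuousAt.eventually (ball_mem_nhds y.1 hδ),
    continuous_snd.continuousAt.eventually (Ioo_mem_nhds (a := y.2 - 1) (b := y.2 + 1)
      (by linarith) (by linarith))] with z hz hz1 hz2
  replace hr := hr z.1 (by rwa [← dist_eq_norm])
  obtain ⟨b1, b2⟩ := hb z.1 hz δ hδ hr (flowParam τ z)
  have e : τ (flowPoint z.1 (flowParam τ z)) = z.2 := hτ.flowParam_spec hz; rw [e] at b1 b2
  have f1 := Int.floor_le (flowParam τ z); have f2 := Int.lt_floor_add_one (flowParam τ z)
  have m1 := le_max_left (2 * (y.2 + 1 + C) + 1) (max K 0 + 1)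
  have m2 := le_max_right (2 * (y.2 + 1 + C) + 1) (max K 0 + 1); have m3 := le_max_left K 0
  have m4 := le_max_right K 0; rw [abs_le]
  refine ⟨?_, by linarith [hz2.1, hz2.2]⟩
  rcases le_total 0 ⌊flowParam τ z⌋ with h | h
  · have : (0 : ℝ) ≤ ⌊flowParam τ z⌋ := by exact_mod_cast h
    linarith
  · have h0 : (⌊flowParam τ z⌋ : ℝ) ≤ 0 := by exact_mod_cast h
    rw [abs_of_nonpos h0] at b2
    have : -(⌊flowParam τ z⌋ : ℝ) ≤ K := by
      rw [hK, le_div_iff₀ (by linarith)]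
      linarith [hz2.1, hz2.2]
    linarith

lemma IsHeight.exists_finite_support (hτ : IsHeight τ) (hy : y ∈ offLattice) :
    ∃ F : Set (ℤ²), F.Finite ∧ ∀ᶠ z in 𝓝 y, ∀ r, bary τ z r ≠ 0 → r ∈ F := by
  obtain ⟨N, hN⟩ := hτ.eventually_abs_flowParam_le hy
  refine ⟨_, finite_latR_norm_le y.1 (1 + 2 ^ (N + 1)), ?_⟩
  filter_upwards [hN, continuous_fst.continuousAt.eventually
    (ball_mem_nhds y.1 one_pos)] with z hz hz1 r hr
  have h1 := flowBary_ne_zero hr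
  have h2 : |(⌊flowParam τ z⌋ : ℝ)| ≤ N + 1 := by
    have a := Int.floor_le (flowParam τ z); have b := Int.lt_floor_add_one (flowParam τ z)
    rw [abs_le] at hz ⊢
    constructor <;> linarith
  have h3 : (2 : ℝ) ^ |(⌊flowParam τ z⌋ : ℝ)| ≤ 2 ^ (N + 1) :=
    rpow_le_rpow_of_exponent_le (by norm_num) h2
  have h4 : ‖z.1 - y.1‖ < 1 := by rw [← dist_eq_norm]; exact hz1
  have h5 := norm_sub_le (z.1 - latR r) (z.1 - y.1); rw [sub_sub_sub_cancel_left] at h5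
  linarith

lemma IsHeight.continuousAt_bary (hτ : IsHeight τ) (hy : y ∈ offLattice)
    (r : ℤ²) : ContinuousAt (fun z => bary τ z r) y := by
  obtain ⟨N, hN⟩ := hτ.eventually_abs_flowParam_le hy; rw [ContinuousAt, tendsto_iff_ultrafilter]
  intro g hg
  have h1 : ∀ᶠ z in (g : Filter _), flowParam τ z ∈ Icc (-N) N :=
    hg (hN.mono fun z hz => abs_le.1 hz)
  obtain ⟨l, -, hl⟩ := (isCompact_Icc (a := -N) (b := N)).ultrafilter_le_nhds
    (g.map (flowParam τ)) (by rw [le_principal_iff]; exact h1)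
  replace hl : Tendsto (flowParam τ) g (𝓝 l) := hl
  have hp : Tendsto (fun z : Point => (z.1, flowParam τ z)) g (𝓝 (y.1, l)) :=
    ((continuous_fst.tendsto y).mono_left hg).prodMk_nhds hl
  have h2 := (hτ.continuousOn_flowPoint.continuousAt (x := (y.1, l))
    (isOpen_offLattice.mem_nhds hy)).tendsto.comp hp
  have h3 : Tendsto (fun z : Point => z.2) g (𝓝 y.2) := (continuous_snd.tendsto y).mono_left hg
  have h4 : τ (flowPoint y.1 l) = y.2 := by
    refine tendsto_nhds_unique h2 (h3.congr' ?_)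
    filter_upwards [hg (isOpen_offLattice.mem_nhds hy)] with z hz
    exact (hτ.flowParam_spec hz).symm
  have h5 : flowPoint y.1 l = bary τ y := hτ.eq_of_eq hy (h4.trans (hτ.flowParam_spec hy).symm)
  have h6 := ((continuous_flowPoint r).tendsto (y.1, l)).comp hp; simp only [h5] at h6
  exact h6

lemma IsHeight.continuousOn_bary (hτ : IsHeight τ) (r : ℤ²) :
    ContinuousOn (fun z => bary τ z r) offLattice :=
  fun _ hy => (hτ.continuousAt_bary hy r).continuousWithinAt

/-- Points near a given one are vertices-wise comparable. -/
lemma IsHeight.eventually_support (hτ : IsHeight τ) (hy : y ∈ offLattice) :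
    ∀ᶠ z in 𝓝 y, z ∈ offLattice ∧ ∀ r, bary τ y r ≠ 0 → bary τ z r ≠ 0 := by
  obtain ⟨F, hF, h⟩ := hτ.exists_finite_support hy
  have h1 : ∀ᶠ z in 𝓝 y, ∀ r ∈ F, bary τ y r ≠ 0 → bary τ z r ≠ 0 := by
    refine (eventually_all_finite hF).2 fun r _ => ?_
    by_cases h0 : bary τ y r = 0
    · exact Eventually.of_forall fun z hz => absurd h0 hz
    · exact ((hτ.continuousAt_bary hy r).eventually_ne h0).mono fun z hz _ => hz
  filter_upwards [h1, isOpen_offLattice.mem_nhds hy] with z hz hz'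
  exact ⟨hz', fun r hr => hz r (h.self_of_nhds r hr) hr⟩

/-- A function on the triangulation supported by the vertices of the tetrahedron of another one. -/
lemma exists_spread_of_support {b' : Weights} (hb : b ∈ tileComplex) (hb' : b' ∈ tileComplex)
    (h : ∀ r, b r ≠ 0 → b' r ≠ 0) : ∃ m n, ∃ u ∈ idealSimplex, ∃ u' ∈ idealSimplex,
      b = spread m n u ∧ b' = spread m n u' := by
  obtain ⟨m, n, u', hu', rfl⟩ := hb'
  have h1 : ∀ r, b r ≠ 0 → r ∈ range (tileVertex m n) := fun r hr =>
    mem_range_of_spread_ne_zero (h r hr)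
  exact ⟨m, n, _, mem_idealSimplex_of_support hb h1, u', hu', eq_spread_of_support h1, rfl⟩

lemma IsHeight.eq_of_range_subset (hτ : IsHeight τ)
    (h : range (tileVertex m n) ⊆ range (tileVertex m' n')) : m = m' ∧ n = n' := by
  have hu : (fun _ => 1 / 4 : Bary) ∈ idealSimplex :=
    ⟨fun i => by norm_num, by rw [sum_univ_four]; norm_num⟩
  have h1 : ∀ r, spread m n (fun _ => 1 / 4) r ≠ 0 → r ∈ range (tileVertex m' n') := by
    intro r hr
    refine h ?_
    exact mem_range_of_spread_ne_zero hr
  have hinj : Function.Injective fun i => Classical.choose (h ⟨i, rfl⟩) := by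
    intro i j hij; have a := choose_spec (h ⟨i, rfl⟩)
    have b := choose_spec (h ⟨j, rfl⟩); simp only at hij
    rw [hij, b] at a
    exact (tileVertex_injective m n a).symm
  have hsurj := Finite.surjective_of_injective hinj
  have h2 : spread m n (fun _ => 1 / 4) = spread m' n' (fun _ => 1 / 4) := by
    rw [eq_spread_of_support h1]
    congr 1
    ext j; obtain ⟨i, rfl⟩ := hsurj j
    rw [choose_spec (h ⟨i, rfl⟩), spread_vertex]
  have h3 : n = n' := by
    have := congrArg τ h2; rw [hτ.shift m n _ hu, hτ.shift m' n' _ hu] at this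
    have : (n : ℝ) = n' := by linarith
    exact_mod_cast this
  subst h3; have := congrArg baryCenter h2
  rw [baryCenter_spread' hu, baryCenter_spread' hu] at this
  exact ⟨latR_injective (add_left_cancel this), rfl⟩

end

open MappingTorus

/-! ### The torus bundle as a quotient -/

section
variable {X : Type} [TopologicalSpace X] (φ : X ≃ₜ X)

lemma MappingTorus.mk_eq_mk {p q : X × ℝ} : mk φ p = mk φ q ↔ ∃ n : ℤ, q = ((φ ^ n) p.1, p.2 + n) :=
  Quotient.eq

lemma MappingTorus.continuous_mk : Continuous (mk φ) := continuous_quotient_mk'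

lemma MappingTorus.mk_surjective : Function.Surjective (mk φ) := Quotient.mk_surjective

lemma MappingTorus.isOpenMap_mk : IsOpenMap (mk φ) := by
  intro U hU; have h : IsQuotientMap (mk φ) := isQuotientMap_quotient_mk'
  rw [← h.isOpen_preimage]
  have : mk φ ⁻¹' (mk φ '' U) = ⋃ n : ℤ, (fun p : X × ℝ => ((φ ^ n) p.1, p.2 + (n : ℝ))) ⁻¹' U := by
    ext p; simp only [mem_preimage, mem_image, mem_iUnion]
    constructor
    · rintro ⟨q, hq, he⟩
      obtain ⟨n, rfl⟩ := (mk_eq_mk φ).1 he.symm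
      exact ⟨n, hq⟩
    · rintro ⟨n, hn⟩
      exact ⟨_, hn, ((mk_eq_mk φ).2 ⟨n, rfl⟩).symm⟩
  rw [this]
  exact isOpen_iUnion fun n => hU.preimage (by fun_prop)

instance [T2Space X] : T2Space (MappingTorus φ) := by
  have hq : IsOpenQuotientMap (mk φ) :=
    ⟨mk_surjective φ, continuous_mk φ, isOpenMap_mk φ⟩
  rw [t2Space_iff_of_isOpenQuotientMap hq]
  have : {q : (X × ℝ) × X × ℝ | mk φ q.1 = mk φ q.2} =
      ⋃ n : ℤ, {q | q.2 = ((φ ^ n) q.1.1, q.1.2 + (n : ℝ))} := by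
    ext q; rw [mem_iUnion]
    exact mk_eq_mk φ
  rw [this]
  refine LocallyFinite.isClosed_iUnion ?_ fun n => isClosed_eq (by fun_prop) (by fun_prop)
  intro q; have hc : Continuous fun q : (X × ℝ) × X × ℝ => q.2.2 - q.1.2 := by fun_prop
  refine ⟨_, hc.continuousAt.eventually (Ioo_mem_nhds (a := q.2.2 - q.1.2 - 1)
    (b := q.2.2 - q.1.2 + 1) (by linarith) (by linarith)), ?_⟩
  refine (finite_Icc ⌊q.2.2 - q.1.2 - 1⌋ ⌈q.2.2 - q.1.2 + 1⌉).subset ?_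
  rintro n ⟨z, hz1, hz2⟩
  replace hz1 : z.2 = ((φ ^ n) z.1.1, z.1.2 + (n : ℝ)) := hz1
  replace hz2 : z.2.2 - z.1.2 ∈ Ioo (q.2.2 - q.1.2 - 1) (q.2.2 - q.1.2 + 1) := hz2
  rw [hz1] at hz2; simp only [add_sub_cancel_left] at hz2
  have a := Int.floor_le (q.2.2 - q.1.2 - 1); have b := Int.le_ceil (q.2.2 - q.1.2 + 1)
  exact ⟨by exact_mod_cast a.trans hz2.1.le, by exact_mod_cast hz2.2.le.trans b⟩

end

/-- The covering of the torus. -/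
def toTorus (x : ℝ × ℝ) : Torus := ((x.1 : UnitAddCircle), (x.2 : UnitAddCircle))

lemma toTorus_eq_iff {x' : ℝ × ℝ} : toTorus x = toTorus x' ↔ ∃ m, x' = x + latR m := by
  have h : ∀ a b : ℝ, (a : UnitAddCircle) = b ↔ ∃ n : ℤ, b = a + n := by
    intro a b; rw [eq_comm, ← sub_eq_zero, ← AddCircle.coe_sub, AddCircle.coe_eq_zero_iff]
    refine exists_congr fun n => ?_
    rw [zsmul_eq_mul, mul_one, eq_sub_iff_add_eq, eq_comm, add_comm]
  rw [toTorus, toTorus, Prod.mk.injEq, h, h]; constructor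
  · rintro ⟨⟨n, hn⟩, k, hk⟩
    exact ⟨(n, k), Prod.ext hn hk⟩
  · rintro ⟨m, rfl⟩
    exact ⟨⟨m.1, rfl⟩, m.2, rfl⟩

lemma torusLR_zpow_toTorus (n : ℤ) (x : ℝ × ℝ) :
    (torusLR ^ n) (toTorus x) = toTorus ((fibR ^ (2 * n)) x) := by
  have h1 : ∀ x : ℝ × ℝ, torusLR (toTorus x) = toTorus ((fibR ^ (2 : ℤ)) x) := by
    intro x
    rw [show (2 : ℤ) = 1 + 1 from rfl, fibR_zpow_add_apply, zpow_one, fibR_apply, fibR_apply]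
    simp [torusLR, torusL, torusR, toTorus, add_comm]
  induction n using Int.induction_on generalizing x with
  | zero => simp [one_apply_fibR]
  | succ k ih =>
    rw [zpow_add, zpow_one, Homeomorph.mul_apply, h1, ih, ← fibR_zpow_add_apply]; ring_nf
  | pred k ih =>
    have h2 := h1 ((fibR ^ (-2 : ℤ)) x); rw [fibR_zpow_apply_neg] at h2
    rw [sub_eq_add_neg, zpow_add, Homeomorph.mul_apply, zpow_neg_one, ← h2]
    have h3 : (torusLR⁻¹) (torusLR (toTorus ((fibR ^ (-2 : ℤ)) x))) =
      toTorus ((fibR ^ (-2 : ℤ)) x) := torusLR.symm_apply_apply _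
    rw [h3, ih, ← fibR_zpow_add_apply]; ring_nf

/-- The covering of the closed torus bundle. -/
def toClosed (y : Point) : ClosedBundleLR := mk torusLR (toTorus y.1, y.2)

lemma continuous_toClosed : Continuous toClosed := by
  refine (continuous_mk torusLR).comp (Continuous.prodMk (Continuous.prodMk ?_ ?_) ?_)
  · exact (AddCircle.continuous_mk' 1).comp (by fun_prop)
  · exact (AddCircle.continuous_mk' 1).comp (by fun_prop)
  · fun_prop

lemma isOpenMap_toClosed : IsOpenMap toClosed := by
  have h : IsOpenMap ((↑) : ℝ → UnitAddCircle) := QuotientAddGroup.isOpenMap_coe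
  exact (isOpenMap_mk torusLR).comp ((h.prodMap h).prodMap IsOpenMap.id)

lemma toTorus_surjective : Function.Surjective toTorus := by
  rintro ⟨p, q⟩; obtain ⟨a, rfl⟩ := QuotientAddGroup.mk_surjective p
  obtain ⟨b, rfl⟩ := QuotientAddGroup.mk_surjective q
  exact ⟨(a, b), rfl⟩

lemma toClosed_surjective : Function.Surjective toClosed := by
  intro x; obtain ⟨⟨p, t⟩, rfl⟩ := mk_surjective torusLR x
  obtain ⟨a, rfl⟩ := toTorus_surjective p
  exact ⟨(a, t), rfl⟩

lemma toClosed_eq_iff {y' : Point} :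
    toClosed y = toClosed y' ↔ ∃ m n, y' = pointAct m (2 * n) y := by
  rw [toClosed, toClosed, mk_eq_mk, exists_comm]
  refine exists_congr fun n => ?_
  rw [Prod.mk.injEq, torusLR_zpow_toTorus, eq_comm, toTorus_eq_iff, ← exists_and_right]
  refine exists_congr fun m => ?_
  rw [pointAct]; push_cast
  rw [mul_div_cancel_left₀ _ two_ne_zero]
  exact ⟨fun h => Prod.ext h.1 h.2, fun h => by rw [h]; exact ⟨rfl, rfl⟩⟩

lemma toTorus_eq_zero_iff : toTorus x = 0 ↔ x ∈ range latR := by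
  rw [eq_comm, show (0 : Torus) = toTorus 0 from rfl, toTorus_eq_iff]
  simp only [zero_add, mem_range, eq_comm]

lemma puncturedTorusLR_zpow_coe (n : ℤ) (x : PuncturedTorus) :
    ((puncturedTorusLR ^ n) x).1 = (torusLR ^ n) x.1 := by
  induction n using Int.induction_on generalizing x with
  | zero => rfl
  | succ k ih =>
    rw [zpow_add, zpow_add, Homeomorph.mul_apply, Homeomorph.mul_apply, ih]
    rfl
  | pred k ih =>
    rw [sub_eq_add_neg, zpow_add, zpow_add, Homeomorph.mul_apply, Homeomorph.mul_apply, ih]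
    rfl

lemma bundleInclusion_mk (p : PuncturedTorus × ℝ) : bundleInclusion (mk puncturedTorusLR p) =
      mk torusLR (p.1.1, p.2) := rfl

lemma isOpenEmbedding_bundleInclusion : IsOpenEmbedding bundleInclusion := by
  refine IsOpenEmbedding.of_continuous_injective_isOpenMap ?_ ?_ ?_
  · refine continuous_quot_lift _ ?_
    exact (continuous_mk torusLR).comp (by fun_prop)
  · intro x y h
    obtain ⟨p, rfl⟩ := mk_surjective _ x; obtain ⟨q, rfl⟩ := mk_surjective _ y
    rw [bundleInclusion_mk, bundleInclusion_mk, mk_eq_mk] at h; rw [mk_eq_mk]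
    obtain ⟨n, hn⟩ := h; rw [Prod.mk.injEq] at hn
    refine ⟨n, Prod.ext (Subtype.ext ?_) hn.2⟩
    rw [puncturedTorusLR_zpow_coe, hn.1]
  · intro U hU
    have h : bundleInclusion '' U = mk torusLR ''
        ((fun p : PuncturedTorus × ℝ => (p.1.1, p.2)) '' (mk puncturedTorusLR ⁻¹' U)) := by
      rw [image_image]; simp only [← bundleInclusion_mk]
      rw [← image_image (f := mk puncturedTorusLR), image_preimage_eq _ (mk_surjective _)]
    rw [h]
    refine isOpenMap_mk _ _ ?_
    have h1 : IsOpenMap (Subtype.val : PuncturedTorus → Torus) :=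
      (isOpen_compl_singleton (x := (0 : Torus))).isOpenMap_subtype_val
    exact (h1.prodMap IsOpenMap.id) _ (hU.preimage (continuous_mk _))

lemma toClosed_mem_range :
    toClosed y ∈ range bundleInclusion ↔ y ∈ offLattice := by
  constructor
  · rintro ⟨x, hx⟩ hy
    obtain ⟨p, rfl⟩ := mk_surjective _ x
    rw [bundleInclusion_mk, toClosed, toTorus_eq_zero_iff.2 hy, eq_comm, mk_eq_mk] at hx
    obtain ⟨n, hn⟩ := hx
    refine p.1.2 ((congrArg Prod.fst hn).trans ?_)
    have := torusLR_zpow_toTorus n 0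
    rwa [map_zero] at this
  · intro h
    exact ⟨mk _ (⟨toTorus y.1, fun h0 => h (toTorus_eq_zero_iff.1 h0)⟩, y.2), rfl⟩

lemma toClosed_mem_bundleCore : toClosed y ∈ bundleCore ↔ y ∉ offLattice := by
  constructor
  · rintro ⟨t, ht⟩
    have : toClosed (0, t) = toClosed y := ht; obtain ⟨m, n, rfl⟩ := toClosed_eq_iff.1 this
    exact fun h => h ⟨m, by simp [pointAct]⟩
  · intro h
    refine ⟨y.2, ?_⟩
    rw [toClosed, toTorus_eq_zero_iff.2 (not_not.1 h)]

lemma exists_lift (x : BundleLR) : ∃ y ∈ offLattice, toClosed y = bundleInclusion x := by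
  obtain ⟨y, hy⟩ := toClosed_surjective (bundleInclusion x)
  exact ⟨y, toClosed_mem_range.1 ⟨x, hy.symm⟩, hy⟩

instance : Nonempty BundleLR := by
  have : ((1 / 2 : ℝ), (0 : ℝ)) ∉ range latR := by
    rintro ⟨m, hm⟩; have h1 : (m.1 : ℝ) = 1 / 2 := congrArg Prod.fst hm
    have h2 : (2 * m.1 : ℝ) = 1 := by linarith
    have h3 : 2 * m.1 = 1 := by exact_mod_cast h2
    omega
  obtain ⟨x, -⟩ := toClosed_mem_range.2 (show (((1 / 2 : ℝ), (0 : ℝ)), (0 : ℝ)) ∈ offLattice from this)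
  exact ⟨x⟩

lemma injOn_toClosed (y : Point) : InjOn toClosed (ball y (1 / 2)) := by
  intro z hz z' hz' h; obtain ⟨m, n, rfl⟩ := toClosed_eq_iff.1 h
  have hd := (dist_triangle_right z (pointAct m (2 * n) z) y).trans_lt (add_lt_add hz hz')
  rw [Prod.dist_eq, max_lt_iff, dist_eq_norm, dist_eq, pointAct] at hd; simp only at hd
  push_cast at hd; rw [mul_div_cancel_left₀ _ (two_ne_zero' ℝ), sub_add_cancel_left, abs_neg] at hd
  have h2 : |n| < 1 := by
    have : |(n : ℝ)| < 1 := by linarith [hd.2]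
    exact_mod_cast this
  obtain rfl := Int.abs_lt_one_iff.1 h2; have h1 := hd.1
  simp only [mul_zero, zpow_zero, one_apply_fibR, sub_add_cancel_left, norm_neg] at h1
  have : m = 0 := by
    have a := (norm_fst_le _).trans_lt h1; have b := (norm_snd_le _).trans_lt h1
    simp only [latR, norm_eq_abs] at a b; norm_num at a b
    refine Prod.ext (Int.abs_lt_one_iff.1 ?_) (Int.abs_lt_one_iff.1 ?_)
    · exact_mod_cast a
    · exact_mod_cast b
  subst this
  ext <;> simp [pointAct, one_apply_fibR, latR]

/-- The covering of the closed bundle restricted to a small ball. -/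
def sheet (y : Point) : OpenPartialHomeomorph Point ClosedBundleLR :=
  OpenPartialHomeomorph.ofContinuousOpen ((injOn_toClosed y).toPartialEquiv)
    continuous_toClosed.continuousOn isOpenMap_toClosed Metric.isOpen_ball

lemma continuous_pointAct (m : ℤ²) (n : ℤ) : Continuous (pointAct m n) :=
  (((fibR ^ n).continuous.comp continuous_fst).add continuous_const).prodMk (by fun_prop)

lemma toClosed_pointAct (m : ℤ²) (n : ℤ) (y : Point) :
    toClosed (pointAct m (2 * n) y) = toClosed y := (toClosed_eq_iff.2 ⟨m, n, rfl⟩).symm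

/-! ### Developments and the induced hyperbolic structure -/

/-- The affine group acting by homeomorphisms. -/
def pointHomeo (m : ℤ²) (n : ℤ) : Point ≃ₜ Point where
  toFun := pointAct m n
  invFun y := ((fibR ^ (-n)) (y.1 - latR m), y.2 - n / 2)
  left_inv y := by ext <;> simp only [pointAct, add_sub_cancel_right, fibR_zpow_neg_apply]
  right_inv y := by ext <;> simp only [pointAct, fibR_zpow_apply_neg, sub_add_cancel]
  continuous_toFun := continuous_pointAct m n
  continuous_invFun := ((fibR ^ (-n)).continuous.comp (continuous_fst.sub continuous_const)).prodMk
    (by fun_prop)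

/-- A distance between points of the same tetrahedron which is invariant under the affine group. -/
def IsTileInvariant (D : Weights → Weights → ℝ) : Prop :=
  ∀ m n m' n', ∀ u ∈ idealSimplex, ∀ u' ∈ idealSimplex,
    D (pushAct m n (spread m' n' u)) (pushAct m n (spread m' n' u')) =
      D (spread m' n' u) (spread m' n' u')

/-- A development: a chart which is distance-preserving on tetrahedra. -/
structure IsDevelopment (τ : Weights → ℝ) (D : Weights → Weights → ℝ)
    (c : OpenPartialHomeomorph Point ℍ³) : Prop where
  subset : c.source ⊆ offLattice
  dist : ∀ m n, ∀ u ∈ idealSimplex, ∀ u' ∈ idealSimplex, ∀ z ∈ c.source, ∀ z' ∈ c.source,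
    bary τ z = spread m n u → bary τ z' = spread m n u' →
      hdist (c z) (c z') = D (spread m n u) (spread m n u')

section
variable {τ : Weights → ℝ} {D : Weights → Weights → ℝ}

lemma IsDevelopment.comp_pointHomeo (hτ : IsHeight τ) (hD : IsTileInvariant D) (hc : IsDevelopment τ D c)
    (m : ℤ²) (n : ℤ) :
    IsDevelopment τ D ((pointHomeo m n).transOpenPartialHomeomorph c) := by
  have hs : ∀ z ∈ ((pointHomeo m n).transOpenPartialHomeomorph c).source, z ∈ offLattice := by
    intro z hz hcon; obtain ⟨r, hr⟩ := hcon
    refine hc.subset (show pointAct m n z ∈ c.source from hz) ⟨(fibZ ^ n) r + m, ?_⟩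
    rw [latR_add, latR_fibZ_zpow, hr, pointAct]
  refine ⟨hs, fun m' n' u hu u' hu' z hz z' hz' h h' => ?_⟩
  have e := hτ.bary_pointAct (hs z hz) m n; have e' := hτ.bary_pointAct (hs z' hz') m n
  rw [h, pushAct_spread] at e; rw [h', pushAct_spread] at e'
  rw [← hD m n m' n' u hu u' hu', pushAct_spread, pushAct_spread]
  exact hc.dist _ _ u hu u' hu' _ hz _ hz' e e'

lemma IsDevelopment.eventually_hdist_le (hτ : IsHeight τ) (hc : IsDevelopment τ D c)
    (hc' : IsDevelopment τ D c') (hy : y ∈ c.source) (hy' : y ∈ c'.source) :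
    ∃ N ∈ 𝓝 y, ∀ z ∈ N, ∀ z' ∈ N, hdist (c' z) (c' z') ≤ hdist (c z) (c z') := by
  have hW : {p | p ∈ c.target ∧ c.symm p ∈ c'.source} ∈ 𝓝 (c y) := by
    refine inter_mem (c.open_target.mem_nhds (c.map_source hy)) ?_
    refine (c.continuousAt_symm (c.map_source hy)).eventually (c'.open_source.mem_nhds ?_)
    rwa [c.left_inv hy]
  obtain ⟨ε, hε, hsub⟩ := exists_hball_subset hW
  have hball : {z | hdist (c y) (c z) < ε / 4} ∈ 𝓝 y :=
    (c.continuousAt hy).eventually (hball_mem_nhds (c y) (by positivity))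
  refine ⟨_, inter_mem hball (c.open_source.mem_nhds hy), ?_⟩
  rintro z ⟨hz, hzs⟩ z' ⟨hz', hzs'⟩
  have key := le_hdist_of_local (D := fun p q => hdist (c' (c.symm p)) (c' (c.symm q)))
    (p₀ := c y) (ε := ε / 4) (fun _ => hdist_self _) (fun _ _ => hdist_comm _ _)
    (fun _ _ _ _ _ _ => hdist_triangle _ _ _) ?_ hz hz'
  · rwa [c.left_inv hzs, c.left_inv hzs'] at key
  · intro p hp
    obtain ⟨hp1, hp2⟩ := hsub (show hdist (c y) p < ε by linarith)
    have hps := c.map_target hp1; have h1 := hτ.eventually_support (hc.subset hps)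
    filter_upwards [(c.continuousAt_symm hp1).eventually h1,
      (c.continuousAt_symm hp1).eventually (c'.open_source.mem_nhds hp2),
      c.open_target.mem_nhds hp1] with q hq1 hq2 hq3
    obtain ⟨m, n, u, hu, u', hu', e, e'⟩ := exists_spread_of_support
      (bary_mem (τ := τ) (hc.subset hps)) (bary_mem hq1.1) hq1.2
    have a := hc.dist m n u hu u' hu' _ hps _ (c.map_target hq3) e e'
    have b := hc'.dist m n u hu u' hu' _ hp2 _ hq2 e e'; rw [c.right_inv hp1, c.right_inv hq3] at a
    rw [a, b]

lemma IsDevelopment.eventually_hdist_eq (hτ : IsHeight τ) (hc : IsDevelopment τ D c)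
    (hc' : IsDevelopment τ D c') (hy : y ∈ c.source) (hy' : y ∈ c'.source) :
    ∃ N ∈ 𝓝 y, ∀ z ∈ N, ∀ z' ∈ N, hdist (c z) (c z') = hdist (c' z) (c' z') := by
  obtain ⟨N, hN, h⟩ := hc.eventually_hdist_le hτ hc' hy hy'
  obtain ⟨N', hN', h'⟩ := hc'.eventually_hdist_le hτ hc hy' hy
  exact ⟨N ∩ N', inter_mem hN hN', fun z hz z' hz' =>
    le_antisymm (h' z hz.2 z' hz'.2) (h z hz.1 z' hz'.1)⟩

/-- The chart of the punctured torus bundle given by a development near `y`. -/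
def devChart (c : OpenPartialHomeomorph Point ℍ³) (y : Point) : OpenPartialHomeomorph BundleLR ℍ³ :=
  (isOpenEmbedding_bundleInclusion.toOpenPartialHomeomorph bundleInclusion).trans
    ((sheet y).symm.trans c)

lemma devChart_of_lift {z : Point} (hz : z ∈ ball y (1 / 2)) (hzc : z ∈ c.source) {x : BundleLR}
    (hx : bundleInclusion x = toClosed z) : x ∈ (devChart c y).source ∧ devChart c y x = c z := by
  have h1 : (sheet y).symm (bundleInclusion x) = z := by rw [hx]; exact (sheet y).left_inv hz
  constructor
  · simp only [devChart, OpenPartialHomeomorph.trans_source, mem_inter_iff, mem_preimage,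
      IsOpenEmbedding.toOpenPartialHomeomorph_apply,
      IsOpenEmbedding.toOpenPartialHomeomorph_source, mem_univ, true_and]
    refine ⟨?_, by rwa [h1]⟩
    rw [hx]
    exact (sheet y).map_source hz
  · simp only [devChart, OpenPartialHomeomorph.trans_apply,
      IsOpenEmbedding.toOpenPartialHomeomorph_apply, h1]

lemma exists_lift_of_mem_devChart {x : BundleLR} (hx : x ∈ (devChart c y).source) :
    ∃ z ∈ ball y (1 / 2), z ∈ c.source ∧ bundleInclusion x = toClosed z := by
  simp only [devChart, OpenPartialHomeomorph.trans_source, mem_inter_iff, mem_preimage,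
      IsOpenEmbedding.toOpenPartialHomeomorph_apply,
      IsOpenEmbedding.toOpenPartialHomeomorph_source, mem_univ, true_and] at hx
  exact ⟨_, (sheet y).map_target hx.1, hx.2, ((sheet y).right_inv hx.1).symm⟩

/-- There are enough developments. -/
def HasDevelopments (τ : Weights → ℝ) (D : Weights → Weights → ℝ) : Prop :=
  ∀ y ∈ offLattice, ∃ c, IsDevelopment τ D c ∧ y ∈ c.source

/-- A lift of a point of the punctured torus bundle. -/
def lift (x : BundleLR) : Point := Classical.choose (exists_lift x)

lemma lift_mem (x : BundleLR) : lift x ∈ offLattice := (choose_spec (exists_lift x)).1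

lemma toClosed_lift (x : BundleLR) : toClosed (lift x) = bundleInclusion x :=
  (choose_spec (exists_lift x)).2

/-- The hyperbolic structure given by developments. -/
@[reducible] def developedSpace (h : HasDevelopments τ D) : ChartedSpace ℍ³ BundleLR where
  atlas := {e | ∃ c y, IsDevelopment τ D c ∧ e = devChart c y}
  chartAt x := devChart (Classical.choose (h _ (lift_mem x))) (lift x)
  mem_chart_source x := (devChart_of_lift (Metric.mem_ball_self (by norm_num))
    (choose_spec (h _ (lift_mem x))).2 (toClosed_lift x).symm).1
  chart_mem_atlas x := ⟨_, _, (choose_spec (h _ (lift_mem x))).1, rfl⟩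

lemma developedSpace_chartAt (h : HasDevelopments τ D) (x : BundleLR) :
    ∃ c, IsDevelopment τ D c ∧ lift x ∈ c.source ∧
      (developedSpace h).chartAt x = devChart c (lift x) :=
  ⟨_, (choose_spec (h _ (lift_mem x))).1, (choose_spec (h _ (lift_mem x))).2, rfl⟩

/-- The charts of the developed structure are compatible with all developments. -/
lemma developedSpace_hdist (hτ : IsHeight τ) (hD : IsTileInvariant D) (h : HasDevelopments τ D) (hc : IsDevelopment τ D c) (hy : y ∈ c.source) {x₀ : BundleLR} (hx₀ : bundleInclusion x₀ = toClosed y) :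
    ∃ N ∈ 𝓝 y, N ⊆ c.source ∧ ∀ z ∈ N, ∀ x, bundleInclusion x = toClosed z →
      x ∈ ((developedSpace h).chartAt x₀).source ∧ ∀ z' ∈ N, ∀ x', bundleInclusion x' = toClosed z' →
        hdist ((developedSpace h).chartAt x₀ x) ((developedSpace h).chartAt x₀ x') =
          hdist (c z) (c z') := by
  obtain ⟨c₀, hc₀, hl, e⟩ := developedSpace_chartAt h x₀; rw [e]
  obtain ⟨m, n, hmn⟩ := toClosed_eq_iff.1 (hx₀.symm.trans (toClosed_lift x₀).symm)
  have hl' : pointAct m (2 * n) y ∈ c₀.source := by rwa [← hmn]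
  obtain ⟨N, hN, hd⟩ := hc.eventually_hdist_eq hτ (hc₀.comp_pointHomeo hτ hD m (2 * n)) hy hl'
  have hb : pointAct m (2 * n) ⁻¹' (ball (lift x₀) (1 / 2) ∩ c₀.source) ∈ 𝓝 y := by
    refine (continuous_pointAct m (2 * n)).continuousAt.preimage_mem_nhds ?_
    rw [← hmn]
    exact inter_mem (ball_mem_nhds _ (by norm_num)) (c₀.open_source.mem_nhds hl)
  refine ⟨N ∩ (c.source ∩ pointAct m (2 * n) ⁻¹' (ball (lift x₀) (1 / 2) ∩ c₀.source)),
    inter_mem hN (inter_mem (c.open_source.mem_nhds hy) hb), fun z hz => hz.2.1, ?_⟩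
  have key : ∀ z ∈ N ∩ (c.source ∩ pointAct m (2 * n) ⁻¹' (ball (lift x₀) (1 / 2) ∩
      c₀.source)), ∀ x, bundleInclusion x = toClosed z →
      x ∈ (devChart c₀ (lift x₀)).source ∧ devChart c₀ (lift x₀) x = c₀ (pointAct m (2 * n) z) := by
    rintro z ⟨-, -, hz1, hz2⟩ x hx
    exact devChart_of_lift hz1 hz2 (hx.trans (toClosed_pointAct m n z).symm)
  refine fun z hz x hx => ⟨(key z hz x hx).1, fun z' hz' x' hx' => ?_⟩
  rw [(key z hz x hx).2, (key z' hz' x' hx').2, hd z hz.1 z' hz'.1]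
  rfl

lemma devChart_property (hτ : IsHeight τ) (hD : IsTileInvariant D) (hc : IsDevelopment τ D c)
    (hc' : IsDevelopment τ D c') (y y' : Point) :
    hyperbolicPregroupoid.property ((devChart c y).symm.trans (devChart c' y'))
      ((devChart c y).symm.trans (devChart c' y')).source := by
  refine ⟨((devChart c y).symm.trans (devChart c' y')).continuousOn, fun p hp => ?_⟩
  rw [OpenPartialHomeomorph.trans_source] at hp; obtain ⟨hp1, hp2⟩ := hp
  replace hp1 : p ∈ (devChart c y).target := hp1
  replace hp2 : (devChart c y).symm p ∈ (devChart c' y').source := hp2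
  have hx := (devChart c y).map_target hp1
  obtain ⟨z, hz, hzc, hxz⟩ := exists_lift_of_mem_devChart hx
  obtain ⟨z', hz', hzc', hxz'⟩ := exists_lift_of_mem_devChart hp2
  obtain ⟨m, n, rfl⟩ := toClosed_eq_iff.1 (hxz.symm.trans hxz')
  obtain ⟨N, hN, hd⟩ := hc.eventually_hdist_eq hτ (hc'.comp_pointHomeo hτ hD m (2 * n)) hzc hzc'
  have hb : N ∩ (ball y (1 / 2) ∩ (c.source ∩
      pointAct m (2 * n) ⁻¹' (ball y' (1 / 2) ∩ c'.source))) ∈ 𝓝 z := by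
    refine inter_mem hN (inter_mem (Metric.isOpen_ball.mem_nhds hz)
      (inter_mem (c.open_source.mem_nhds hzc) ?_))
    exact (continuous_pointAct m (2 * n)).continuousAt.preimage_mem_nhds
      (inter_mem (Metric.isOpen_ball.mem_nhds hz') (c'.open_source.mem_nhds hzc'))
  obtain ⟨V, hV, hVo, hzV⟩ := mem_nhds_iff.1 hb
  refine ⟨c '' V, c.isOpen_image_of_subset_source hVo fun v hv => (hV hv).2.2.1, ⟨z, hzV, ?_⟩, ?_⟩
  · rw [← (devChart_of_lift hz hzc hxz).2, (devChart c y).right_inv hp1]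
  · have key : ∀ v ∈ V, ((devChart c y).symm.trans (devChart c' y')) (c v) =
        c' (pointAct m (2 * n) v) := by
      intro v hv; obtain ⟨hv0, hv1, hv2, hv3, hv4⟩ := hV hv
      obtain ⟨x, hx⟩ := toClosed_mem_range.2 (hc.subset hv2); have h1 := devChart_of_lift hv1 hv2 hx
      have h2 := devChart_of_lift hv3 hv4 (hx.trans (toClosed_pointAct m n v).symm)
      rw [OpenPartialHomeomorph.trans_apply, ← h1.2, (devChart c y).left_inv h1.1, h2.2]
    rintro q ⟨-, v, hv, rfl⟩ q' ⟨-, v', hv', rfl⟩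
    rw [key v hv, key v' hv', hd v (hV hv).1 v' (hV hv').1]
    rfl

lemma developedSpace_hasGroupoid (hτ : IsHeight τ) (hD : IsTileInvariant D)
    (h : HasDevelopments τ D) :
    @HasGroupoid _ _ BundleLR _ (developedSpace h) hyperbolicGroupoid := by
  let := developedSpace h
  refine ⟨?_⟩
  rintro e e' ⟨c, y, hc, rfl⟩ ⟨c', y', hc', rfl⟩
  refine mem_groupoid_of_pregroupoid.2 ⟨devChart_property hτ hD hc hc' y y', ?_⟩
  have := devChart_property hτ hD hc' hc y' y
  rwa [← OpenPartialHomeomorph.symm_source, OpenPartialHomeomorph.trans_symm_eq_symm_trans_symm,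
    OpenPartialHomeomorph.symm_symm]

end

/-! ### Heights -/

lemma level_corner_sub (i j : Fin 4) : level (corner i - corner j) =
    !![level 0, 0, 1, 2; 0, level 0, -1, 1; 1, -1, level 0, 0; 2, 1, 0, level 0] i j := by
  have h0 := level_zero_one; have hne : ((0, 1) : ℤ²) ≠ 0 := by simp [Prod.ext_iff]
  have h1 := level_fibZ_zpow 1 hne; have h2 := level_fibZ_zpow 2 hne
  have h3 := level_fibZ_zpow (-1) hne
  have e2 : (fibZ ^ (2 : ℤ)) ((0, 1) : ℤ²) = (1, 1) := by
    rw [show (2 : ℤ) = 1 + 1 from rfl, fibZ_zpow_add_apply, zpow_one]; rfl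
  rw [zpow_one, show fibZ (0, 1) = ((1, 0) : ℤ²) from rfl] at h1; rw [e2] at h2
  rw [zpow_neg_one, show fibZ⁻¹ (0, 1) = ((1, -1) : ℤ²) from rfl] at h3; rw [h0] at h1 h2 h3
  have hn : ∀ d, level (-d) = level d := level_neg; have n0 := hn (0, 1)
  have n1 := hn (1, 0); have n2 := hn (1, 1)
  have n3 := hn (1, -1); simp only [Prod.neg_mk, neg_zero, neg_neg] at n0 n1 n2 n3
  fin_cases i <;> fin_cases j <;> simp [corner, *]

lemma corner_sub_eq_zero : corner i - corner j = 0 ↔ i = j := by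
  rw [sub_eq_zero, corner_injective.eq_iff]

lemma weight_corner_sub (hP : 0 < P) (i j : Fin 4) : weight P (corner i - corner j) =
    !![0, 1, P⁻¹, (P ^ 2)⁻¹; 1, 0, P, P⁻¹; P⁻¹, P, 0, 1; (P ^ 2)⁻¹, P⁻¹, 1, 0] i j := by
  have h2 : exp (-(2 * log P)) = (P ^ 2)⁻¹ := by
    rw [exp_neg, mul_comm, exp_mul, exp_log hP]; norm_cast
  rw [weight, level_corner_sub]; simp only [corner_sub_eq_zero]
  fin_cases i <;> fin_cases j <;> simp [h2, exp_neg, exp_log hP]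

lemma weight_tileVertex_sub (hP : 0 < P) (m : ℤ²) (n : ℤ) (i j : Fin 4) :
    weight P (tileVertex m n i - tileVertex m n j) =
      P ^ (-n) * weight P (corner i - corner j) := by
  rw [tileVertex_sub, weight_fibZ_zpow hP]

/-- The quadratic form with the weights of the edges. -/
def edgeSum (P : ℝ) (b : Weights) : ℝ := pairSum (fun r r' => weight P (r - r')) b b

lemma edgeSum_spread (hP : 0 < P) (m : ℤ²) (n : ℤ) (u : Bary) :
    edgeSum P (spread m n u) = P ^ (-n) * (2 * (u 0 * u 1 + u 2 * u 3 +
      P⁻¹ * (u 0 * u 2 + u 1 * u 3) + (P ^ 2)⁻¹ * (u 0 * u 3) + P * (u 1 * u 2))) := by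
  rw [edgeSum, pairSum_spread]; simp only [weight_tileVertex_sub hP, weight_corner_sub hP]
  simp [sum_univ_four]
  ring

lemma pairs_pos (hu : u ∈ idealSimplex) : ∃ i,
    (1 - u i) / 2 ≤ 2 * (u 0 * u 1 + u 2 * u 3 + (u 0 * u 2 + u 1 * u 3) + u 0 * u 3 + u 1 * u 2) := by
  obtain ⟨⟨b0, b1, b2, b3⟩, hs⟩ := nonneg_of_mem_idealSimplex hu
  obtain ⟨p01, p02, p03, p12, p13, p23⟩ := mul_nonneg_of_mem_idealSimplex hu
  have h : ∃ i, 1 / 4 ≤ u i := by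
    by_contra! hcon
    have := hcon 0; have := hcon 1
    have := hcon 2; have := hcon 3
    linarith
  obtain ⟨i, hi⟩ := h; have hi1 := (hu.1 i).2
  refine ⟨i, ?_⟩
  have : (1 - u i) / 2 ≤ 2 * (u i * (1 - u i)) := by nlinarith
  refine this.trans ?_
  have key : u i * (1 - u i) ≤
      u 0 * u 1 + u 2 * u 3 + (u 0 * u 2 + u 1 * u 3) + u 0 * u 3 + u 1 * u 2 := by
    rw [← hs]
    fin_cases i <;> simp <;> nlinarith
  linarith

/-- The quadratic form `edgeSum 1`, positive on the triangulation. -/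
lemma edgeSum_pos (hP : 0 < P) (hb : b ∈ tileComplex) :
    0 < edgeSum P b := by
  obtain ⟨m, n, u, hu, rfl⟩ := hb; rw [edgeSum_spread hP]
  obtain ⟨⟨b0, b1, b2, b3⟩, hs⟩ := nonneg_of_mem_idealSimplex hu
  obtain ⟨p01, p02, p03, p12, p13, p23⟩ := mul_nonneg_of_mem_idealSimplex hu
  obtain ⟨i, hi⟩ := pairs_pos hu; have h1 : 0 < 1 - u i := sub_pos.2 (hu.1 i).2
  refine mul_pos (zpow_pos hP _) (mul_pos two_pos ?_)
  by_contra! hcon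
  have q1 : 0 < P⁻¹ := by positivity
  have q2 : 0 < (P ^ 2)⁻¹ := by positivity
  have r1 := mul_nonneg q1.le (add_nonneg p02 p13); have r2 := mul_nonneg q2.le p03
  have r3 := mul_nonneg hP.le p12
  have s1 : u 0 * u 2 + u 1 * u 3 = 0 := by
    have : P⁻¹ * (u 0 * u 2 + u 1 * u 3) = 0 := by linarith
    simpa [q1.ne'] using this
  have s2 : u 0 * u 3 = 0 := by
    have : (P ^ 2)⁻¹ * (u 0 * u 3) = 0 := by linarith
    rcases mul_eq_zero.1 this with h | h
    · exact absurd h q2.ne'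
    · exact h
  have s3 : u 1 * u 2 = 0 := by
    have : P * (u 1 * u 2) = 0 := by linarith
    rcases mul_eq_zero.1 this with h | h
    · exact absurd h hP.ne'
    · exact h
  linarith

lemma continuous_edgeSum {X : Type} [TopologicalSpace X] (P : ℝ) {b : X → Weights}
    (hc : ∀ r, Continuous fun x => b x r) (hf : LocFin b) :
    Continuous fun x => edgeSum P (b x) := continuous_pairSum hc hf _

/-- The height for the complete structure. -/
def cuspHeight (b : Weights) : ℝ :=
  pairSum (fun r r' => if r = r' then 0 else level (r - r')) b b / (2 * edgeSum 1 b)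

lemma cuspHeight_spread (m : ℤ²) (n : ℤ) (hu : u ∈ idealSimplex) : cuspHeight (spread m n u) =
      (u 0 * u 2 + u 1 * u 3 + 2 * (u 0 * u 3) - u 1 * u 2) / (2 * (u 0 * u 1 + u 2 * u 3 +
        (u 0 * u 2 + u 1 * u 3) + u 0 * u 3 + u 1 * u 2)) + n / 2 := by
  have hpos := edgeSum_pos one_pos (spread_mem hu m n); rw [edgeSum_spread one_pos] at hpos
  have hG : ∀ i j, (if tileVertex m n i = tileVertex m n j then 0 else
      level (tileVertex m n i - tileVertex m n j)) =
      if i = j then 0 else level (corner i - corner j) + n := by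
    intro i j
    by_cases h : i = j
    · rw [if_pos h, if_pos (congrArg _ h)]
    · rw [if_neg h, if_neg fun h' => h (tileVertex_injective m n h'), tileVertex_sub, level_fibZ_zpow n (fun h0 => h (corner_sub_eq_zero.1 h0))]
  rw [cuspHeight, pairSum_spread, edgeSum_spread one_pos]; simp only [hG, level_corner_sub]
  simp [sum_univ_four]
  simp at hpos
  field_simp; ring

lemma isHeight_cuspHeight : IsHeight cuspHeight where
  continuous X _ b hc hf hb := by
    refine (continuous_pairSum hc hf _).div (continuous_const.mul (continuous_edgeSum 1 hc hf)) ?_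
    intro x; have := edgeSum_pos one_pos (hb x)
    positivity
  shift m n u hu := by rw [cuspHeight_spread m n hu, cuspHeight_spread 0 0 hu]; simp
  strictMono u hu e he hue := by
    have h1 := edgeSum_pos one_pos (spread_mem hu 0 0)
    have h2 := edgeSum_pos one_pos (spread_mem hue 0 0); rw [edgeSum_spread one_pos] at h1 h2
    rw [cuspHeight_spread 0 0 hu, cuspHeight_spread 0 0 hue]; have b0 := (hu.1 0).1
    have b1 := (hu.1 1).1; have b2 := (hu.1 2).1
    have b3 := (hu.1 3).1; obtain ⟨y, hy⟩ : ∃ y, u 1 = y + e := ⟨u 1 - e, by ring⟩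
    obtain ⟨z, hz⟩ : ∃ z, u 2 = z + e := ⟨u 2 - e, by ring⟩
    have c1 := (hue.1 1).1; have c2 := (hue.1 2).1
    simp only [Pi.add_apply, Pi.smul_apply, upward, smul_eq_mul, cons_val] at *
    simp only [neg_zero, zpow_zero, inv_one, one_pow, one_mul, hy, hz] at *
    replace c1 : 0 ≤ y := by linarith
    replace c2 : 0 ≤ z := by linarith
    refine add_lt_add_left ?_ _
    rw [div_lt_div_iff₀ (by linarith) (by linarith), ← sub_pos]
    ring_nf
    positivity
  bound := by
    refine ⟨1, 0, le_rfl, by norm_num, fun u hu => ?_⟩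
    have h1 := edgeSum_pos one_pos (spread_mem hu 0 0); rw [edgeSum_spread one_pos] at h1
    rw [cuspHeight_spread 0 0 hu]
    obtain ⟨⟨b0, b1, b2, b3⟩, hs⟩ := nonneg_of_mem_idealSimplex hu
    obtain ⟨p01, p02, p03, p12, p13, p23⟩ := mul_nonneg_of_mem_idealSimplex hu
    simp only [neg_zero, zpow_zero, inv_one, one_pow, one_mul] at h1
    simp only [Int.cast_zero, zero_div, add_zero, zero_mul, sub_zero]
    refine ⟨?_, 0, ?_⟩
    · rw [le_div_iff₀ (by linarith)]; linarith
    · rw [div_le_iff₀ (by linarith)]; linarith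

/-- The height for the cone structures. -/
def coneHeight (P k : ℝ) (b : Weights) : ℝ :=
  -(log (edgeSum P b) - (1 - k) * log (edgeSum 1 b)) / (2 * log P)

lemma coneHeight_deriv_neg {x y z w : ℝ} (hP : 1 < P) (hk0 : 0 < k) (hk1 : k ≤ 1)
    (hk : k ≤ P ^ 2 - P) (hx : 0 < x) (hy : 0 < y) (hz : 0 < z) (hw : 0 < w) :
    ((x + w) * (1 - P ^ 2 - P) + (y + z) * (-P ^ 3 + P ^ 2 + P)) *
      (x * y + z * w + (x * z + y * w) + x * w + y * z) -
      (1 - k) * (y + z - x - w) *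
        (x * w + P ^ 3 * (y * z) + P ^ 2 * (x * y + z * w) + P * (x * z + y * w)) < 0 := by
  obtain ⟨κ, rfl⟩ : ∃ κ, k = 1 - κ := ⟨1 - k, by ring⟩
  have hκ0 : 0 ≤ κ := by linarith
  have hκ1 : κ < 1 := by linarith
  have hP2 : 1 < P ^ 2 := by nlinarith
  have hP3 : 1 < P ^ 3 := by nlinarith
  have c1 : 0 < P ^ 2 + P - 1 - κ := by linarith
  have c2 : 0 ≤ P ^ 2 + P - 1 - κ * P ^ 2 := by nlinarith
  have c3 : 0 ≤ P ^ 2 + P - 1 - κ * P := by nlinarith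
  have d : 0 ≤ P ^ 2 - P - 1 + κ := by linarith
  have dP := mul_nonneg (by linarith : (0 : ℝ) ≤ P) d
  have c6 : 0 ≤ P ^ 3 - P ^ 2 - P + κ * P := by linarith
  have hPP : P ≤ P ^ 2 := by nlinarith
  have hPPP : P ≤ P ^ 3 := by nlinarith
  have c5 : 0 ≤ P ^ 3 - P ^ 2 - P + κ * P ^ 2 := by nlinarith
  have c4 : 0 ≤ P ^ 3 - P ^ 2 - P + κ * P ^ 3 := by nlinarith
  have t1 : 0 ≤ 2 * P ^ 3 - P ^ 2 - P - 1 - κ * (P ^ 3 - P ^ 2 - P) := by nlinarith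
  have t2 : 0 ≤ P ^ 3 + P ^ 2 + P - 2 - κ * (P ^ 2 + P - 1) := by nlinarith
  have main : 0 < (x + w) * (x * w) * (P ^ 2 + P - 1 - κ) +
      ((x ^ 2 * y + z * w ^ 2) * (P ^ 2 + P - 1 - κ * P ^ 2) +
      (x ^ 2 * z + y * w ^ 2) * (P ^ 2 + P - 1 - κ * P) +
      (y + z) * (y * z) * (P ^ 3 - P ^ 2 - P + κ * P ^ 3) +
      (x * y ^ 2 + z ^ 2 * w) * (P ^ 3 - P ^ 2 - P + κ * P ^ 2) +
      (x * z ^ 2 + y ^ 2 * w) * (P ^ 3 - P ^ 2 - P + κ * P) +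
      (x + w) * (y * z) * (2 * P ^ 3 - P ^ 2 - P - 1 - κ * (P ^ 3 - P ^ 2 - P)) +
      (y + z) * (x * w) * (P ^ 3 + P ^ 2 + P - 2 - κ * (P ^ 2 + P - 1))) :=
    add_pos_of_pos_of_nonneg (by positivity) (by positivity)
  rw [← neg_pos]
  refine main.trans_eq ?_
  ring

lemma coneHeight_spread (hP : 1 < P) (m : ℤ²) (n : ℤ)
    (hu : u ∈ idealSimplex) : coneHeight P k (spread m n u) =
      coneHeight P k (spread 0 0 u) + n / 2 := by
  have hP0 : 0 < P := by linarith
  have hl := log_pos hP; have h1 := edgeSum_pos hP0 (spread_mem hu 0 0)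
  have e1 : edgeSum 1 (spread m n u) = edgeSum 1 (spread 0 0 u) := by
    rw [edgeSum_spread one_pos, edgeSum_spread one_pos]; simp
  have e2 : edgeSum P (spread m n u) = P ^ (-n) * edgeSum P (spread 0 0 u) := by
    rw [edgeSum_spread hP0, edgeSum_spread hP0]; simp
  rw [coneHeight, coneHeight, e1, e2, log_mul (zpow_pos hP0 _).ne' h1.ne', log_zpow]; push_cast
  field_simp; ring

lemma add_smul_upward (u : Bary) (s : ℝ) :
    u + s • upward = ![u 0 + s, u 1 - s, u 2 - s, u 3 + s] := by
  ext i
  fin_cases i <;> simp [upward] <;> ring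

lemma coneHeight_bound (hP : 1 < P) (hk0 : 0 < k)
    (hu : u ∈ idealSimplex) : -(1 / 2) ≤ coneHeight P k (spread 0 0 u) ∧ ∃ i,
      coneHeight P k (spread 0 0 u) ≤ 1 / 2 * (2 + k / log P * log 2) -
        k / (2 * log P) * log (1 - u i) := by
  have hP0 : 0 < P := by linarith
  have hl := log_pos hP; have h1 := edgeSum_pos hP0 (spread_mem hu 0 0)
  have h2 := edgeSum_pos one_pos (spread_mem hu 0 0); obtain ⟨i, hi⟩ := pairs_pos hu
  have hi1 : 0 < 1 - u i := sub_pos.2 (hu.1 i).2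
  obtain ⟨⟨b0, b1, b2, b3⟩, hs⟩ := nonneg_of_mem_idealSimplex hu
  obtain ⟨p01, p02, p03, p12, p13, p23⟩ := mul_nonneg_of_mem_idealSimplex hu
  have e1 := edgeSum_spread one_pos 0 0 u
  have e2 := edgeSum_spread hP0 0 0 u
  simp only [neg_zero, zpow_zero, inv_one, one_pow, one_mul] at e1 e2
  have hPi : P⁻¹ ≤ 1 := inv_le_one_of_one_le₀ hP.le; have hPi0 : 0 < P⁻¹ := by positivity
  have hPi2 : (P ^ 2)⁻¹ ≤ P⁻¹ := by rw [inv_le_inv₀ (by positivity) hP0]; nlinarith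
  have hPi20 : 0 < (P ^ 2)⁻¹ := by positivity
  have u1 : edgeSum P (spread 0 0 u) ≤ P * edgeSum 1 (spread 0 0 u) := by
    rw [e1, e2]
    nlinarith [add_nonneg p01 p23, add_nonneg p02 p13]
  have u2 : (P ^ 2)⁻¹ * edgeSum 1 (spread 0 0 u) ≤ edgeSum P (spread 0 0 u) := by
    rw [e1, e2]
    nlinarith [add_nonneg p01 p23, add_nonneg p02 p13]
  have u3 : edgeSum 1 (spread 0 0 u) ≤ 1 := by
    rw [e1]
    nlinarith [sq_nonneg (u 0), sq_nonneg (u 1), sq_nonneg (u 2), sq_nonneg (u 3)]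
  have u4 : (1 - u i) / 2 ≤ edgeSum 1 (spread 0 0 u) := by rw [e1]; linarith
  have l1 := log_le_log h1 u1; have l2 := log_le_log (by positivity) u2
  rw [log_mul hP0.ne' h2.ne'] at l1; rw [log_mul hPi20.ne' h2.ne', log_inv, log_pow] at l2
  have l3 := log_nonpos h2.le u3; have l4 := log_le_log (by positivity) u4
  rw [log_div hi1.ne' two_ne_zero] at l4; push_cast at l2
  refine ⟨?_, i, ?_⟩
  · rw [coneHeight, le_div_iff₀ (by positivity)]
    nlinarith
  · rw [coneHeight, div_le_iff₀ (by positivity)]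
    field_simp
    nlinarith

lemma isHeight_coneHeight (hP : 1 < P) (hk0 : 0 < k) (hk1 : k ≤ 1)
    (hk : k ≤ P ^ 2 - P) (hk2 : 2 * k * log 2 < log P) : IsHeight (coneHeight P k) where
  continuous X _ b hc hf hb := by
    have hP0 : 0 < P := by linarith
    refine (((continuous_edgeSum P hc hf).log ?_).sub (continuous_const.mul
      ((continuous_edgeSum 1 hc hf).log ?_))).neg.div_const _
    · exact fun x => (edgeSum_pos hP0 (hb x)).ne'
    · exact fun x => (edgeSum_pos one_pos (hb x)).ne'
  shift m n u hu := coneHeight_spread hP m n hu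
  strictMono u hu e he hue := by
    have hP0 : 0 < P := by linarith
    have hl := log_pos hP
    have hmem : ∀ s ∈ Icc 0 e, u + s • upward ∈ idealSimplex := by
      intro s hs
      have e0 : u + s • upward = (1 - s / e) • u + (s / e) • (u + e • upward) := by
        ext i; simp
        field_simp; ring
      have s0 : 0 ≤ s / e := div_nonneg hs.1 he.le
      have s1 : 0 ≤ 1 - s / e := by rw [sub_nonneg, div_le_one he]; exact hs.2
      rw [e0]
      refine ⟨fun i => ⟨?_, ?_⟩, ?_⟩
      · exact add_nonneg (mul_nonneg s1 (hu.1 i).1) (mul_nonneg s0 (hue.1 i).1)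
      · have a := (hu.1 i).2
        have b := (hue.1 i).2
        exact convex_Iio (1 : ℝ) a b s1 s0 (by ring)
      · have := hue.2
        simp only [Pi.add_apply, Pi.smul_apply, smul_eq_mul, Finset.sum_add_distrib,
          ← Finset.mul_sum, hu.2] at this ⊢
        rw [this]; ring
    have hval : ∀ p : ℝ, 0 < p → ∀ s, edgeSum p (spread 0 0 (u + s • upward)) =
        2 * ((u 0 + s) * (u 1 - s) + (u 2 - s) * (u 3 + s) +
        p⁻¹ * ((u 0 + s) * (u 2 - s) + (u 1 - s) * (u 3 + s)) +
        (p ^ 2)⁻¹ * ((u 0 + s) * (u 3 + s)) + p * ((u 1 - s) * (u 2 - s))) := by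
      intro p hp s; rw [edgeSum_spread hp, add_smul_upward]
      simp
    have hder : ∀ p : ℝ, 0 < p → ∀ s, HasDerivAt (fun s => edgeSum p (spread 0 0 (u + s • upward)))
        (2 * ((1 + p⁻¹) * ((u 1 - s) + (u 2 - s) - (u 0 + s) - (u 3 + s)) +
          (p ^ 2)⁻¹ * ((u 0 + s) + (u 3 + s)) - p * ((u 1 - s) + (u 2 - s)))) s := by
      intro p hp s; simp only [hval p hp]
      have a0 := (hasDerivAt_id s).const_add (u 0); have a1 := (hasDerivAt_id s).const_sub (u 1)
      have a2 := (hasDerivAt_id s).const_sub (u 2); have a3 := (hasDerivAt_id s).const_add (u 3)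
      have := (((((a0.mul a1).add (a2.mul a3)).add (((a0.mul a2).add (a1.mul a3)).const_mul
        p⁻¹)).add ((a0.mul a3).const_mul (p ^ 2)⁻¹)).add ((a1.mul a2).const_mul p)).const_mul 2
      refine HasDerivAt.congr_deriv (f := fun s => _) this ?_
      simp only [id]; ring
    have hpos : ∀ p : ℝ, 0 < p → ∀ s ∈ Icc 0 e, 0 < edgeSum p (spread 0 0 (u + s • upward)) :=
      fun p hp s hs => edgeSum_pos hp (spread_mem (hmem s hs) 0 0)
    have hd : ∀ s ∈ Icc 0 e, HasDerivAt (fun s => log (edgeSum P (spread 0 0 (u + s • upward)))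
        - (1 - k) * log (edgeSum 1 (spread 0 0 (u + s • upward)))) _ s := fun s hs =>
      ((hder P hP0 s).log (hpos P hP0 s hs).ne').sub
        (((hder 1 one_pos s).log (hpos 1 one_pos s hs).ne').const_mul (1 - k))
    have hanti := strictAntiOn_of_deriv_neg (convex_Icc 0 e)
      (fun s hs => (hd s hs).continuousAt.continuousWithinAt) (fun s hs => by
        rw [interior_Icc] at hs; have hs' := Ioo_subset_Icc_self hs
        rw [(hd s hs').deriv]; have q1 := hpos P hP0 s hs'
        have q2 := hpos 1 one_pos s hs'; have b0 := (hu.1 0).1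
        have b3 := (hu.1 3).1; have c1 := (hue.1 1).1
        have c2 := (hue.1 2).1; simp only [add_smul_upward, cons_val] at c1 c2
        have key := coneHeight_deriv_neg hP hk0 hk1 hk (x := u 0 + s) (y := u 1 - s)
          (z := u 2 - s) (w := u 3 + s) (by linarith [hs.1]) (by linarith [hs.2])
          (by linarith [hs.2]) (by linarith [hs.1])
        rw [sub_neg, mul_div_assoc', div_lt_div_iff₀ q1 q2, hval P hP0, hval 1 one_pos, ← sub_neg]
        have h4 : 0 < 4 * (P ^ 2)⁻¹ := by positivity
        refine lt_of_eq_of_lt ?_ (mul_neg_of_pos_of_neg h4 key)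
        field_simp; ring)
    have := hanti (left_mem_Icc.2 he.le) (right_mem_Icc.2 he.le) he
    simp only [zero_smul, add_zero] at this; rw [coneHeight, coneHeight]
    gcongr
  bound := by
    have hl := log_pos hP
    refine ⟨1 / 2 * (2 + k / log P * log 2), k / (2 * log P), by positivity, ?_,
      fun u hu => ⟨?_, (coneHeight_bound hP hk0 hu).2⟩⟩
    · rw [div_mul_eq_mul_div, div_lt_iff₀ (by positivity)]; linarith
    · refine le_trans ?_ (coneHeight_bound hP hk0 hu).1
      have : 0 ≤ k / log P * log 2 := by positivity
      linarith

/-! ### Geometric coordinates on the triangulation -/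

/-- A reparametrization of the barycentric coordinates near the vertices. -/
def stretch (k v : ℝ) : ℝ := min 1 (2 * (1 - v)) ^ (1 - k) - (1 - v)

lemma stretch_of_le (k : ℝ) {v : ℝ} (h : v ≤ 1 / 2) : stretch k v = v := by
  rw [stretch, min_eq_left (by linarith), one_rpow]; ring

lemma stretch_of_ge (k : ℝ) {v : ℝ} (h : 1 / 2 ≤ v) :
    stretch k v = (2 * (1 - v)) ^ (1 - k) - (1 - v) := by
  rw [stretch, min_eq_right (by linarith)]

lemma stretch_zero (k : ℝ) : stretch k 0 = 0 := stretch_of_le k (by norm_num)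

lemma continuousOn_stretch (k : ℝ) : ContinuousOn (stretch k) (Iio 1) := by
  unfold stretch
  refine ContinuousOn.sub (ContinuousOn.rpow_const (by fun_prop) ?_) (by fun_prop)
  intro v hv
  replace hv : v < 1 := hv
  exact Or.inl (lt_min one_pos (by linarith)).ne'

/-- The reparametrization on a simplex, normalized to have sum `1`. -/
def simplexWarp (k : ℝ) (u : Bary) (i : Fin 4) : ℝ := stretch k (u i) / ∑ j, stretch k (u j)

lemma simplexWarp_of_le (k : ℝ) (hu : u ∈ idealSimplex)
    (h : ∀ i, u i ≤ 1 / 2) : ∑ j, stretch k (u j) = 1 ∧ simplexWarp k u = u := by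
  have h1 : ∑ j, stretch k (u j) = 1 := by
    rw [← hu.2]; exact sum_congr rfl fun i _ => stretch_of_le k (h i)
  refine ⟨h1, ?_⟩
  ext i; rw [simplexWarp, h1, div_one, stretch_of_le k (h i)]

lemma simplexWarp_of_gt (k : ℝ) (hu : u ∈ idealSimplex)
    (h : 1 / 2 < u i) : ∑ j, stretch k (u j) = (2 * (1 - u i)) ^ (1 - k) ∧
      simplexWarp k u i = 1 - (1 - u i) / (2 * (1 - u i)) ^ (1 - k) ∧
      ∀ j, j ≠ i → simplexWarp k u j = u j / (2 * (1 - u i)) ^ (1 - k) := by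
  have h1 := (hu.1 i).2; have hs := hu.2
  rw [← Finset.add_sum_erase _ _ (Finset.mem_univ i)] at hs
  have h2 : ∀ j, j ≠ i → stretch k (u j) = u j := by
    intro j hj
    refine stretch_of_le k ?_
    have := Finset.single_le_sum (f := u) (fun x _ => (hu.1 x).1)
      (Finset.mem_erase.2 ⟨hj, Finset.mem_univ j⟩)
    linarith
  have h3 : ∑ j, stretch k (u j) = (2 * (1 - u i)) ^ (1 - k) := by
    rw [← Finset.add_sum_erase _ _ (Finset.mem_univ i), stretch_of_ge k h.le,
      sum_congr rfl fun j hj => h2 j (Finset.ne_of_mem_erase hj)]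
    linarith
  have h4 : (0 : ℝ) < (2 * (1 - u i)) ^ (1 - k) := rpow_pos_of_pos (by linarith) _
  refine ⟨h3, ?_, fun j hj => ?_⟩
  · rw [simplexWarp, h3, stretch_of_ge k h.le]; field_simp
  · rw [simplexWarp, h3, h2 j hj]

lemma simplexWarp_mem (hk : 0 < k) (hu : u ∈ idealSimplex) :
    0 < ∑ j, stretch k (u j) ∧ simplexWarp k u ∈ idealSimplex ∧
      (∀ i, simplexWarp k u i = 0 ↔ u i = 0) ∧ simplexWarp k⁻¹ (simplexWarp k u) = u := by
  by_cases h : ∀ i, u i ≤ 1 / 2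
  · obtain ⟨h1, h2⟩ := simplexWarp_of_le k hu h
    obtain ⟨h3, h4⟩ := simplexWarp_of_le k⁻¹ hu h; rw [h1, h2, h4]
    exact ⟨one_pos, hu, fun _ => Iff.rfl, rfl⟩
  · push Not at h
    obtain ⟨i, hi⟩ := h; obtain ⟨h1, h2, h3⟩ := simplexWarp_of_gt k hu hi
    have hlt := (hu.1 i).2; have hρ : 0 < 2 * (1 - u i) := by linarith
    set T := (2 * (1 - u i)) ^ (1 - k) with hT; have hT0 : 0 < T := rpow_pos_of_pos hρ _
    have hTρ : T * (2 * (1 - u i)) ^ k = 2 * (1 - u i) := by rw [hT, ← rpow_add hρ]; simp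
    have hk1 : (2 * (1 - u i)) ^ k < 1 := rpow_lt_one hρ.le (by linarith) hk
    have hk0 : 0 < (2 * (1 - u i)) ^ k := rpow_pos_of_pos hρ _
    have hd : (1 - u i) / T = (2 * (1 - u i)) ^ k / 2 := by rw [div_eq_iff hT0.ne']; linarith
    have hsum : ∑ j, simplexWarp k u j = 1 := by
      simp only [simplexWarp, ← sum_div, h1]
      exact div_self hT0.ne'
    have hnn : ∀ j, 0 ≤ simplexWarp k u j := by
      intro j
      rcases eq_or_ne j i with rfl | hj
      · rw [h2, hd]; linarith
      · rw [h3 j hj]; exact div_nonneg (hu.1 j).1 hT0.le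
    have hi' : 1 / 2 < simplexWarp k u i := by rw [h2, hd]; linarith
    have hmem : simplexWarp k u ∈ idealSimplex := by
      refine ⟨fun j => ⟨hnn j, ?_⟩, hsum⟩
      rcases eq_or_ne j i with rfl | hj
      · rw [h2, hd]; linarith
      · have := Finset.add_le_sum (f := simplexWarp k u) (fun x _ => hnn x) (Finset.mem_univ i)
          (Finset.mem_univ j) hj.symm
        rw [hsum] at this; linarith
    refine ⟨by rw [h1]; exact hT0, hmem, fun j => ?_, ?_⟩
    · rcases eq_or_ne j i with rfl | hj
      · constructor <;> intro h0 <;> linarith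
      · rw [h3 j hj, div_eq_zero_iff]
        exact or_iff_left hT0.ne'
    · obtain ⟨g1, g2, g3⟩ := simplexWarp_of_gt k⁻¹ hmem hi'
      have e : 2 * (1 - simplexWarp k u i) = (2 * (1 - u i)) ^ k := by rw [h2, hd]; ring
      have e' : (2 * (1 - simplexWarp k u i)) ^ (1 - k⁻¹) = T⁻¹ := by
        rw [e, ← rpow_mul hρ.le, hT, ← rpow_neg hρ.le]
        congr 1
        field_simp; ring
      rw [e'] at g2 g3; ext j
      rcases eq_or_ne j i with rfl | hj
      · rw [g2, h2]; field_simp; ring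
      · rw [g3 j hj, h3 j hj]; field_simp

/-- The geometric coordinates of a point of the triangulation. -/
def warp (k : ℝ) (b : Weights) (r : ℤ²) : ℝ := stretch k (b r) / ∑ᶠ r', stretch k (b r')

lemma warp_spread (k : ℝ) (m : ℤ²) (n : ℤ) (u : Bary) :
    warp k (spread m n u) = spread m n (simplexWarp k u) := by
  ext r; rw [warp, finsum_spread (fun _ t => stretch k t) (fun _ => stretch_zero k)]
  by_cases hr : r ∈ range (tileVertex m n)
  · obtain ⟨i, rfl⟩ := hr
    rw [spread_vertex, spread_vertex, simplexWarp]
  · rw [spread_of_notMem _ hr, spread_of_notMem _ hr, stretch_zero, zero_div]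

lemma warp_mem (hk : 0 < k) (hb : b ∈ tileComplex) :
    warp k b ∈ tileComplex := by
  obtain ⟨m, n, u, hu, rfl⟩ := hb; rw [warp_spread]
  exact spread_mem (simplexWarp_mem hk hu).2.1 m n

lemma warp_inv_warp (hk : 0 < k) (hb : b ∈ tileComplex) : warp k⁻¹ (warp k b) = b := by
  obtain ⟨m, n, u, hu, rfl⟩ := hb; rw [warp_spread, warp_spread, (simplexWarp_mem hk hu).2.2.2]

lemma warp_warp_inv (hk : 0 < k) (hb : b ∈ tileComplex) : warp k (warp k⁻¹ b) = b := by
  have := warp_inv_warp (inv_pos.2 hk) hb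
  rwa [inv_inv] at this

lemma warp_eq_zero (hk : 0 < k) (hb : b ∈ tileComplex) (r : ℤ²) : warp k b r = 0 ↔ b r = 0 := by
  obtain ⟨m, n, u, hu, rfl⟩ := hb; rw [warp_spread]
  by_cases hr : r ∈ range (tileVertex m n)
  · obtain ⟨i, rfl⟩ := hr
    rw [spread_vertex, spread_vertex, (simplexWarp_mem hk hu).2.2.1]
  · rw [spread_of_notMem _ hr, spread_of_notMem _ hr]

lemma warp_pushAct (hb : b ∈ tileComplex) (m : ℤ²) (n : ℤ) :
    warp k (pushAct m n b) = pushAct m n (warp k b) := by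
  obtain ⟨m', n', u, hu, rfl⟩ := hb; rw [pushAct_spread, warp_spread, warp_spread, pushAct_spread]

lemma finsum_stretch_pos (hk : 0 < k) (hb : b ∈ tileComplex) :
    0 < ∑ᶠ r, stretch k (b r) := by
  obtain ⟨m, n, u, hu, rfl⟩ := hb
  rw [finsum_spread (fun _ t => stretch k t) (fun _ => stretch_zero k)]
  exact (simplexWarp_mem hk hu).1

lemma lt_one_of_mem_tileComplex (hb : b ∈ tileComplex) (r : ℤ²) :
    b r < 1 := by
  obtain ⟨m, n, u, hu, rfl⟩ := hb
  exact spread_lt_one hu m n r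

lemma nonneg_of_mem_tileComplex (hb : b ∈ tileComplex) (r : ℤ²) :
    0 ≤ b r := by
  obtain ⟨m, n, u, hu, rfl⟩ := hb
  exact spread_nonneg hu m n r

lemma continuous_warp {X : Type} [TopologicalSpace X] (hk : 0 < k) {b : X → Weights}
    (hc : ∀ r, Continuous fun x => b x r) (hf : LocFin b) (hb : ∀ x, b x ∈ tileComplex)
    (r : ℤ²) : Continuous fun x => warp k (b x) r := by
  have h1 : ∀ r, Continuous fun x => stretch k (b x r) := fun r =>
    (continuousOn_stretch k).comp_continuous (hc r) fun x => lt_one_of_mem_tileComplex (hb x) r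
  refine (h1 r).div (continuous_finsum h1 ?_) fun x => (finsum_stretch_pos hk (hb x)).ne'
  refine hf.subset fun r x hx h => hx ?_
  simp [h, stretch_zero]

lemma locallyFinite_warp {X : Type} [TopologicalSpace X] (hk : 0 < k)
    {b : X → Weights} (hf : LocFin b)
    (hb : ∀ x, b x ∈ tileComplex) :
    LocFin fun x => warp k (b x) :=
  hf.subset fun r x hx h => hx ((warp_eq_zero hk (hb x) r).2 h)

section
variable {τ : Weights → ℝ} {k : ℝ}

/-- The geometric coordinates of a point. -/
def wbary (τ : Weights → ℝ) (k : ℝ) (y : Point) : Weights := warp k (bary τ y)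

/-- The point with given geometric coordinates. -/
def place (τ : Weights → ℝ) (k : ℝ) (w : Weights) : Point :=
  (baryCenter (warp k⁻¹ w), τ (warp k⁻¹ w))

lemma wbary_mem (hk : 0 < k) (hy : y ∈ offLattice) :
    wbary τ k y ∈ tileComplex := warp_mem hk (bary_mem hy)

lemma place_mem (hk : 0 < k) (hw : w ∈ tileComplex) :
    place τ k w ∈ offLattice := baryCenter_notMem (warp_mem (inv_pos.2 hk) hw)

lemma IsHeight.bary_place (hτ : IsHeight τ) (hk : 0 < k)
    (hw : w ∈ tileComplex) : bary τ (place τ k w) = warp k⁻¹ w :=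
  hτ.bary_eq (warp_mem (inv_pos.2 hk) hw)

lemma IsHeight.wbary_place (hτ : IsHeight τ) (hk : 0 < k)
    (hw : w ∈ tileComplex) : wbary τ k (place τ k w) = w := by
  rw [wbary, hτ.bary_place hk hw, warp_warp_inv hk hw]

lemma IsHeight.place_wbary (hτ : IsHeight τ) (hk : 0 < k)
    (hy : y ∈ offLattice) : place τ k (wbary τ k y) = y := by
  rw [place, wbary, warp_inv_warp hk (bary_mem hy), baryCenter_bary hy, hτ.flowParam_spec hy]

lemma IsHeight.wbary_pointAct (hτ : IsHeight τ) (hy : y ∈ offLattice)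
    (m : ℤ²) (n : ℤ) : wbary τ k (pointAct m n y) = pushAct m n (wbary τ k y) := by
  rw [wbary, hτ.bary_pointAct hy, warp_pushAct (bary_mem hy)]; rfl

lemma IsHeight.place_pushAct (hτ : IsHeight τ) (hk : 0 < k)
    (hw : w ∈ tileComplex) (m : ℤ²) (n : ℤ) :
    place τ k (pushAct m n w) = pointAct m n (place τ k w) := by
  rw [← hτ.place_wbary hk (pointAct_mem (place_mem hk hw) m n),
    hτ.wbary_pointAct (place_mem hk hw), hτ.wbary_place hk hw]

lemma IsHeight.locallyFinite_wbary (hτ : IsHeight τ) (hk : 0 < k) :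
    LocFin fun y : offLattice => wbary τ k y := by
  refine locallyFinite_warp hk ?_ fun y => bary_mem y.2
  intro y; obtain ⟨F, hF, h⟩ := hτ.exists_finite_support y.2
  refine ⟨_, continuous_subtype_val.continuousAt.eventually h, hF.subset ?_⟩
  rintro r ⟨z, hz1, hz2⟩
  exact hz2 r hz1

lemma IsHeight.continuous_wbary (hτ : IsHeight τ) (hk : 0 < k) (r : ℤ²) :
    Continuous fun y : offLattice => wbary τ k y r := by
  refine continuous_warp hk (fun r => ?_) ?_ (fun y => bary_mem y.2) r
  · exact continuousOn_iff_continuous_domRestrict.1 (hτ.continuousOn_bary r)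
  · refine (hτ.locallyFinite_wbary hk).subset fun r y hy h => hy ?_
    exact (warp_eq_zero hk (bary_mem y.2) r).1 h

lemma IsHeight.continuous_place (hτ : IsHeight τ) (hk : 0 < k) {X : Type} [TopologicalSpace X]
    {w : X → Weights} (hc : ∀ r, Continuous fun x => w x r)
    (hf : LocFin w) (hw : ∀ x, w x ∈ tileComplex) :
    Continuous fun x => place τ k (w x) := by
  have h1 := continuous_warp (inv_pos.2 hk) hc hf hw
  have h2 := locallyFinite_warp (inv_pos.2 hk) hf hw
  exact (continuous_baryCenter h1 h2).prodMk
    (hτ.continuous X _ h1 h2 fun x => warp_mem (inv_pos.2 hk) (hw x))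

end

/-! ### The metric of the tetrahedra -/

/-- The bilinear form with the weights of the edges. -/
def edgeForm (P : ℝ) (w w' : Weights) : ℝ := pairSum (fun r r' => weight P (r - r')) w w'

/-- The distance in a tetrahedron, in geometric coordinates. -/
def tileDist (P : ℝ) (w w' : Weights) : ℝ :=
  arcosh (edgeForm P w w' / √(edgeForm P w w * edgeForm P w' w'))

lemma edgeForm_spread (hP : 0 < P) (m : ℤ²) (n : ℤ) (u u' : Bary) :
    edgeForm P (spread m n u) (spread m n u') =
      P ^ (-n) * ∑ i, ∑ j, weight P (corner i - corner j) * u i * u' j := by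
  rw [edgeForm, pairSum_spread, Finset.mul_sum]
  refine sum_congr rfl fun i _ => ?_
  rw [Finset.mul_sum]
  refine sum_congr rfl fun j _ => ?_
  rw [weight_tileVertex_sub hP]; ring

lemma arcosh_scale {c b d : ℝ} (hc : 0 < c) :
    arcosh (c * a / √(c * b * (c * d))) = arcosh (a / √(b * d)) := by
  rw [show c * b * (c * d) = c ^ 2 * (b * d) by ring, sqrt_mul (sq_nonneg c),
    sqrt_sq hc.le, mul_div_mul_left _ _ hc.ne']

lemma tileDist_spread (hP : 0 < P) (m m' : ℤ²) (n n' : ℤ) (u u' : Bary) :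
    tileDist P (spread m n u) (spread m n u') = tileDist P (spread m' n' u) (spread m' n' u') := by
  simp only [tileDist, edgeForm_spread hP]
  rw [arcosh_scale (zpow_pos hP _), arcosh_scale (zpow_pos hP _)]

/-- The distance of points of the same tetrahedron. -/
def pointDist (P k : ℝ) (b b' : Weights) : ℝ := tileDist P (warp k b) (warp k b')

lemma isTileInvariant_pointDist (hP : 0 < P) (k : ℝ) :
    IsTileInvariant (pointDist P k) := by
  intro m n m' n' u hu u' hu'; simp only [pointDist, pushAct_spread, warp_spread]
  exact tileDist_spread hP _ _ _ _ _ _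

/-- Points given by null vectors with the Gram matrix of a tetrahedron. -/
lemma hdist_lproj_sum {c : ℝ} (hP : 0 < P) (hc : 0 < c) {V : Fin 4 → Lor}
    (hV : ∀ i j, lform (V i) (V j) = c * weight P (corner i - corner j))
    (hu : Future (∑ i, u i • V i)) (hu' : Future (∑ i, u' i • V i)) (m : ℤ²) (n : ℤ) :
    hdist (lproj (∑ i, u i • V i)) (lproj (∑ i, u' i • V i)) =
      tileDist P (spread m n u) (spread m n u') := by
  have h : ∀ u u' : Bary, lform (∑ i, u i • V i) (∑ i, u' i • V i) =
      c * ∑ i, ∑ j, weight P (corner i - corner j) * u i * u' j := by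
    intro u u'; rw [lform_sum_left, Finset.mul_sum]
    refine sum_congr rfl fun i _ => ?_
    rw [lform_sum_right, Finset.mul_sum]
    refine sum_congr rfl fun j _ => ?_
    rw [lform_smul_left, lform_smul_right, hV]; ring
  rw [hdist_lproj hu hu', h, h, h, arcosh_scale hc, tileDist]; simp only [edgeForm_spread hP]
  rw [arcosh_scale (zpow_pos hP _)]

lemma lform_sum_pos {c : ℝ} (hP : 0 < P) (hc : 0 < c) {V : Fin 4 → Lor}
    (hV : ∀ i j, lform (V i) (V j) = c * weight P (corner i - corner j))
    (hu : u ∈ idealSimplex) : 0 < lform (∑ i, u i • V i) (∑ i, u i • V i) := by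
  have h := edgeSum_pos hP (spread_mem hu 0 0); rw [edgeSum, pairSum_spread] at h
  rw [lform_sum_left]; simp only [lform_sum_right, lform_smul_left, lform_smul_right, hV]
  simp only [tileVertex_zero_zero] at h
  refine (mul_pos hc h).trans_eq ?_
  simp only [Finset.mul_sum]
  exact sum_congr rfl fun i _ => sum_congr rfl fun j _ => by ring

/-! ### Ideal tetrahedra -/

/-- Null vectors for the vertices `0, 1, z, ∞` of an ideal tetrahedron. -/
def idealVec (z : ℂ) : Fin 4 → Lor := ![(0, 0, 1), (1, 1, 1), (‖z‖ ^ 2, z, 1), (1, 0, 0)]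

lemma lvec_eq_sum (hz : z.im ≠ 0) (p : ℍ³) : lvec p = ∑ i, idealCoord z p i • idealVec z i := by
  rw [sum_univ_four]; simp only [idealCoord, idealVec, lvec, cons_val]
  refine Prod.ext ?_ (Prod.ext (Complex.ext ?_ ?_) ?_)
  · simp
  · simp
  · simp [hz]
  · simp
    ring

lemma idealCoord_lproj (hz : z.im ≠ 0) {c : Bary}
    (hX : Future (∑ i, c i • idealVec z i)) (i : Fin 4) :
    idealCoord z (lproj (∑ i, c i • idealVec z i)) i = c i / (c 0 + c 1 + c 2) := by
  have h1 := lvec_lproj hX; have h2 := hX.1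
  set p := lproj (∑ i, c i • idealVec z i) with hp; rw [sum_univ_four] at h1 h2
  simp only [idealVec, cons_val, Prod.smul_mk, smul_zero, Prod.mk_add_mk, lvec,
    smul_eq_mul, mul_one, mul_zero, zero_add, add_zero, Prod.mk.injEq] at h1 h2
  obtain ⟨e1, e2, -⟩ := h1; have hS : c 0 + c 1 + c 2 ≠ 0 := h2.ne'
  have e3 := congrArg Complex.re e2; have e4 := congrArg Complex.im e2
  simp only [Complex.smul_re, add_re, Complex.one_re, smul_eq_mul, mul_one,
    Complex.smul_im, add_im, one_im, mul_zero, zero_add] at e3 e4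
  simp only [idealCoord, e1, e3, e4]
  fin_cases i <;> simp <;> field_simp <;> ring

/-- Coordinates that identify an ideal tetrahedron with the tetrahedra of the triangulation. -/
structure IsTileModel (P : ℝ) (z : ℂ) (coord : ℍ³ → Bary) (σ : Equiv.Perm (Fin 4)) : Prop where
  continuousOn : ContinuousOn coord (idealTetrahedron z)
  bijOn : BijOn coord (idealTetrahedron z) idealSimplex
  eq_zero : ∀ p ∈ idealTetrahedron z, ∀ i, coord p i = 0 ↔ idealCoord z p (σ i) = 0
  dist : ∀ p ∈ idealTetrahedron z, ∀ q ∈ idealTetrahedron z, ∀ m n,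
    hdist p q = tileDist P (spread m n (coord p)) (spread m n (coord q))

lemma isTileModel_of_gram {c : ℝ} (hP : 0 < P) (hc : 0 < c) (hz : z.im ≠ 0)
    (σ : Equiv.Perm (Fin 4)) {β : Bary} (hβ : ∀ i, 0 < β i)
    (hG : ∀ i j, lform (β i • idealVec z (σ i)) (β j • idealVec z (σ j)) =
      c * weight P (corner i - corner j)) :
    ∃ coord, IsTileModel P z coord σ := by
  set V : Fin 4 → Lor := fun i => β i • idealVec z (σ i) with hV
  set a : ℍ³ → Bary := fun p i => idealCoord z p (σ i) / β i with ha
  have hsum : ∀ p, lvec p = ∑ i, a p i • V i := by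
    intro p; rw [lvec_eq_sum hz, ← sum_comp σ]
    refine sum_congr rfl fun i _ => ?_
    rw [ha, hV]; simp only
    rw [smul_smul, div_mul_cancel₀ _ (hβ i).ne']
  have ha0 : ∀ p ∈ idealTetrahedron z, ∀ i, 0 ≤ a p i := fun p hp i => div_nonneg (hp _) (hβ i).le
  have hself : ∀ i, lform (V i) (V i) = 0 := by
    intro i; rw [hV]; simp only
    rw [hG, sub_self, weight_zero, mul_zero]
  have hS : ∀ p ∈ idealTetrahedron z, 0 < ∑ j, a p j := by
    intro p hp
    refine lt_of_le_of_ne (Finset.sum_nonneg fun i _ => ha0 p hp i) fun h => ?_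
    have h0 := (Finset.sum_eq_zero_iff_of_nonneg fun i _ => ha0 p hp i).1 h.symm
    have := (future_lvec p).2
    rw [hsum p, Finset.sum_eq_zero fun i hi => by rw [h0 i hi, zero_smul], lform_zero_left] at this
    exact lt_irrefl _ this
  set coord : ℍ³ → Bary := fun p i => a p i / ∑ j, a p j with hcoord
  have hmem : ∀ p ∈ idealTetrahedron z, coord p ∈ idealSimplex := by
    intro p hp
    have h1 : ∑ i, coord p i = 1 := by
      simp only [hcoord, ← sum_div]; exact div_self (hS p hp).ne'
    have h2 : ∀ i, 0 ≤ coord p i := fun i => div_nonneg (ha0 p hp i) (hS p hp).le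
    refine ⟨fun i => ⟨h2 i, ?_⟩, h1⟩
    by_contra! hcon
    rw [← Finset.add_sum_erase _ _ (Finset.mem_univ i)] at h1
    have h3 : ∑ j ∈ Finset.univ.erase i, coord p j = 0 :=
      le_antisymm (by linarith) (Finset.sum_nonneg fun j _ => h2 j)
    have h4 := (Finset.sum_eq_zero_iff_of_nonneg fun j _ => h2 j).1 h3
    have h5 : ∀ j, j ≠ i → a p j = 0 := by
      intro j hj; have := h4 j (Finset.mem_erase.2 ⟨hj, Finset.mem_univ j⟩)
      rw [hcoord] at this
      simpa [(hS p hp).ne'] using this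
    have h6 := (future_lvec p).2
    rw [hsum p, Finset.sum_eq_single i (fun j _ hj => by rw [h5 j hj, zero_smul])
      (fun h => absurd (Finset.mem_univ i) h), lform_smul_left, lform_smul_right, hself] at h6
    simp at h6
  have hlv : ∀ p ∈ idealTetrahedron z, ∑ i, coord p i • V i = (∑ j, a p j)⁻¹ • lvec p := by
    intro p hp; rw [hsum p, Finset.smul_sum]
    refine sum_congr rfl fun i _ => ?_
    change (a p i / ∑ j, a p j) • V i = _
    rw [div_eq_inv_mul, mul_smul]
  have hfut : ∀ p ∈ idealTetrahedron z, Future (∑ i, coord p i • V i) := by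
    intro p hp; have h1 := inv_pos.2 (hS p hp)
    have h2 := future_lvec p; rw [hlv p hp]
    refine ⟨mul_pos h1 h2.1, ?_⟩
    rw [lform_smul_left, lform_smul_right]
    exact mul_pos h1 (mul_pos h1 h2.2)
  have hproj : ∀ p ∈ idealTetrahedron z, lproj (∑ i, coord p i • V i) = p := by
    intro p hp; rw [hlv p hp, lproj_smul (inv_pos.2 (hS p hp)) (future_lvec p), lproj_lvec]
  refine ⟨coord, ⟨?_, ⟨fun p hp => hmem p hp, ?_, ?_⟩, ?_, ?_⟩⟩
  · have hac : ∀ i, Continuous fun p => a p i := by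
      intro i
      refine Continuous.div_const ?_ _
      generalize σ i = j
      fin_cases j <;> simp [idealCoord] <;> fun_prop
    refine continuousOn_pi.2 fun i => ContinuousOn.div (hac i).continuousOn
      (continuous_finsetSum _ fun j _ => hac j).continuousOn fun p hp => (hS p hp).ne'
  · intro p hp q hq h
    rw [← hproj p hp, ← hproj q hq, h]
  · intro u hu
    have hVe : ∑ i, u i • V i = ∑ i, (u (σ.symm i) * β (σ.symm i)) • idealVec z i := by
      rw [← sum_comp σ (fun i => (u (σ.symm i) * β (σ.symm i)) • idealVec z i)]
      refine sum_congr rfl fun i _ => ?_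
      rw [hV, Equiv.symm_apply_apply, mul_smul]
    have hpos := lform_sum_pos hP hc hG hu
    have hnn : ∀ i, 0 ≤ u (σ.symm i) * β (σ.symm i) := fun i => mul_nonneg (hu.1 _).1 (hβ _).le
    have hF : Future (∑ i, u i • V i) := by
      refine ⟨lt_of_le_of_ne ?_ ?_, hpos⟩
      · rw [hVe, sum_univ_four]
        simp only [idealVec, cons_val, Prod.smul_mk, smul_zero, Prod.mk_add_mk,
          smul_eq_mul, mul_one, mul_zero, add_zero]
        linarith [hnn 0, hnn 1, hnn 2]
      · intro h0
        replace hpos : 0 < lform (∑ i, u i • V i) (∑ i, u i • V i) := hpos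
        rw [lform, ← h0] at hpos
        nlinarith [sq_nonneg (∑ i, u i • V i).2.1.re, sq_nonneg (∑ i, u i • V i).2.1.im]
    have hic : ∀ i, idealCoord z (lproj (∑ i, u i • V i)) i = u (σ.symm i) * β (σ.symm i) /
        (u (σ.symm 0) * β (σ.symm 0) + u (σ.symm 1) * β (σ.symm 1) +
          u (σ.symm 2) * β (σ.symm 2)) := fun i => by
      rw [hVe] at hF ⊢; exact idealCoord_lproj hz hF i
    set S := u (σ.symm 0) * β (σ.symm 0) + u (σ.symm 1) * β (σ.symm 1) +
      u (σ.symm 2) * β (σ.symm 2) with hSdef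
    have hS0 : 0 < S := by
      have := hF.1; rw [hVe, sum_univ_four] at this
      simpa only [idealVec, cons_val, Prod.smul_mk, smul_zero, Prod.mk_add_mk,
          smul_eq_mul, mul_one, mul_zero, add_zero] using this
    refine ⟨lproj (∑ i, u i • V i), fun i => ?_, ?_⟩
    · rw [hic]; exact div_nonneg (hnn i) hS0.le
    · have h1 : ∀ i, a (lproj (∑ i, u i • V i)) i = u i / S := by
        intro i; rw [ha]
        simp only; rw [hic, Equiv.symm_apply_apply]
        have := (hβ i).ne'; field_simp
      ext i; rw [hcoord]
      simp only [h1, ← sum_div, hu.2]; field_simp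
  · intro p hp i
    rw [hcoord, ha]; simp only
    rw [div_eq_zero_iff, or_iff_left (hS p hp).ne', div_eq_zero_iff, or_iff_left (hβ i).ne']
  · intro p hp q hq m n
    rw [← hdist_lproj_sum hP hc hG (hfut p hp) (hfut q hq) m n]
    exact congrArg₂ hdist (hproj p hp).symm (hproj q hq).symm

lemma lform_idealVec (z : ℂ) (i j : Fin 4) : lform (idealVec z i) (idealVec z j) =
    !![0, 1, ‖z‖ ^ 2, 1; 1, 0, ‖1 - z‖ ^ 2, 1; ‖z‖ ^ 2, ‖1 - z‖ ^ 2, 0, 1; 1, 1, 1, 0] i j := by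
  have h : ‖1 - z‖ ^ 2 = (1 - z.re) ^ 2 + z.im ^ 2 := by rw [normSq_expand]; simp
  have h' := normSq_expand z
  fin_cases i <;> fin_cases j <;> simp [lform, idealVec, h, h'] <;> ring

/-- The ideal tetrahedron of shape `z` with `|1 - z|² = |z|` is a model of the tetrahedra. -/
lemma exists_isTileModel (hP : 0 < P) (hz : z.im ≠ 0)
    (h1 : ‖1 - z‖ ^ 2 = ‖z‖) (h2 : ‖z‖ = P ∨ ‖z‖ = P⁻¹) : ∃ coord σ, IsTileModel P z coord σ := by
  rcases h2 with h2 | h2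
  · obtain ⟨c, h⟩ := isTileModel_of_gram hP hP hz
      (σ := ⟨![3, 1, 2, 0], ![3, 1, 2, 0], by decide, by decide⟩)
      (β := ![1, P, 1, P⁻¹]) (by intro i; fin_cases i <;> simp [hP]) (by
        intro i j
        rw [lform_smul_left, lform_smul_right, lform_idealVec, weight_corner_sub hP, h1, h2]
        fin_cases i <;> fin_cases j <;> simp <;> field_simp)
    exact ⟨c, _, h⟩
  · have hP3 : 0 < P ^ 3 := by positivity
    obtain ⟨c, h⟩ := isTileModel_of_gram hP hP3 hz
      (σ := ⟨![3, 2, 1, 0], ![3, 2, 1, 0], by decide, by decide⟩)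
      (β := ![1, P ^ 3, P ^ 2, P]) (by intro i; fin_cases i <;> simp [hP]) (by
        intro i j
        rw [lform_smul_left, lform_smul_right, lform_idealVec, weight_corner_sub hP, h1, h2]
        fin_cases i <;> fin_cases j <;> simp <;> field_simp <;> simp)
    exact ⟨c, _, h⟩

/-! ### The geometric ideal triangulation -/

open Classical in
/-- The point of the punctured torus bundle below a point off the lattice. -/
def toBundle (y : Point) : BundleLR :=
  if h : y ∈ offLattice then Classical.choose (toClosed_mem_range.2 h)
  else Classical.choice inferInstance

lemma bundleInclusion_toBundle (hy : y ∈ offLattice) :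
    bundleInclusion (toBundle y) = toClosed y := by
  rw [toBundle, dif_pos hy]
  exact choose_spec (toClosed_mem_range.2 hy)

lemma toBundle_eq_iff {y' : Point} (hy : y ∈ offLattice) (hy' : y' ∈ offLattice) :
    toBundle y = toBundle y' ↔ ∃ m n, y' = pointAct m (2 * n) y := by
  rw [← isOpenEmbedding_bundleInclusion.injective.eq_iff, bundleInclusion_toBundle hy,
    bundleInclusion_toBundle hy', toClosed_eq_iff]

lemma exists_face_of_spread_eq (h : spread m n u = spread m' n' u')
    (hpos : ∀ j, j ≠ i → u j ≠ 0) {l : Fin 4} (hl : u' l = 0) {v : Bary}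
    (hv : v ∈ idealSimplex) (hvi : v i = 0) :
    ∃ v' ∈ idealSimplex, v' l = 0 ∧ spread m n v = spread m' n' v' := by
  have h1 : ∀ r, spread m n v r ≠ 0 → r ∈ range (tileVertex m' n') := by
    intro r hr
    by_contra hcon
    refine hr ?_
    by_cases hrm : r ∈ range (tileVertex m n)
    · obtain ⟨j, rfl⟩ := hrm
      rw [spread_vertex]
      by_cases hj : j = i
      · rw [hj, hvi]
      · have := congrFun h (tileVertex m n j)
        rw [spread_vertex, spread_of_notMem u' hcon] at this
        exact absurd this (hpos j hj)
    · exact spread_of_notMem v hrm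
  refine ⟨_, mem_idealSimplex_of_support (spread_mem hv m n) h1, ?_, eq_spread_of_support h1⟩
  by_cases hrm : tileVertex m' n' l ∈ range (tileVertex m n)
  · obtain ⟨j, hj⟩ := hrm
    rw [← hj, spread_vertex]
    by_cases hji : j = i
    · rw [hji, hvi]
    · refine absurd ?_ (hpos j hji)
      rw [← spread_vertex m n u j, hj, h, spread_vertex, hl]
  · exact spread_of_notMem v hrm

lemma exists_eq_zero_of_spread_eq (h : spread m n u = spread m' n' u') (hi : u i = 0)
    (hpos : ∀ j, j ≠ i → u j ≠ 0) : ∃ l, u' l = 0 ∧ ∀ j, j ≠ l → u' j ≠ 0 := by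
  classical
  have hsub : (Finset.univ.filter fun j => u' j ≠ 0).image (tileVertex m' n') =
      (Finset.univ.filter fun j => u j ≠ 0).image (tileVertex m n) := by
    have key : ∀ (m : ℤ²) (n : ℤ) (u : Bary) r,
        r ∈ (Finset.univ.filter fun j => u j ≠ 0).image (tileVertex m n) ↔ spread m n u r ≠ 0 := by
      intro m n u r; rw [Finset.mem_image]
      constructor
      · rintro ⟨j, hj, rfl⟩
        rw [spread_vertex]
        exact (Finset.mem_filter.1 hj).2
      · intro hr
        obtain ⟨j, rfl⟩ := mem_range_of_spread_ne_zero hr; rw [spread_vertex] at hr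
        exact ⟨j, Finset.mem_filter.2 ⟨Finset.mem_univ _, hr⟩, rfl⟩
    ext r; rw [key, key, h]
  have hcard := congrArg Finset.card hsub
  rw [Finset.card_image_of_injective _ (tileVertex_injective _ _),
    Finset.card_image_of_injective _ (tileVertex_injective _ _)] at hcard
  have h3 : (Finset.univ.filter fun j => u j ≠ 0) = Finset.univ.erase i := by
    ext j; simp only [Finset.mem_filter, Finset.mem_univ, true_and, Finset.mem_erase, and_true]
    exact ⟨fun hj hji => hj (hji ▸ hi), hpos j⟩
  rw [h3, Finset.card_erase_of_mem (Finset.mem_univ i), Finset.card_univ, Fintype.card_fin] at hcard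
  have h4 : (Finset.univ.filter fun j => u' j = 0).card = 1 := by
    have := Finset.card_filter_add_card_filter_not (s := (Finset.univ : Finset (Fin 4)))
      (fun j => u' j = 0)
    rw [Finset.card_univ, Fintype.card_fin] at this; simp only [ne_eq] at hcard
    omega
  obtain ⟨l, hl⟩ := Finset.card_eq_one.1 h4
  refine ⟨l, ?_, fun j hj h0 => hj ?_⟩
  · have : l ∈ Finset.univ.filter fun j => u' j = 0 := by rw [hl]; exact Finset.mem_singleton_self l
    exact (Finset.mem_filter.1 this).2
  · have : j ∈ Finset.univ.filter fun j => u' j = 0 := Finset.mem_filter.2 ⟨Finset.mem_univ _, h0⟩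
    rw [hl] at this
    exact Finset.mem_singleton.1 this

lemma hasGeometricIdealTriangulation {τ : Weights → ℝ} (hτ : IsHeight τ)
    (hP : 0 < P) (hk : 0 < k) (hdev : HasDevelopments τ (pointDist P k)) {z : Fin 2 → ℂ}
    {coord : Fin 2 → ℍ³ → Bary} {σ : Fin 2 → Equiv.Perm (Fin 4)}
    (hz : ∀ i, IsTileModel P (z i) (coord i) (σ i)) :
    @HasGeometricIdealTriangulation (Fin 2) z BundleLR _ (developedSpace hdev) := by
  set pt : Fin 2 → (Bary) → Point := fun i u => place τ k (spread 0 (i : ℕ) u) with hpt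
  have hmem : ∀ i, ∀ u ∈ idealSimplex, pt i u ∈ offLattice := fun i u hu =>
    place_mem hk (spread_mem hu _ _)
  have heq : ∀ i j, ∀ u ∈ idealSimplex, ∀ v ∈ idealSimplex, toBundle (pt i u) = toBundle (pt j v) ↔
        ∃ m n, spread m (2 * n + (i : ℕ)) u = spread 0 (j : ℕ) v := by
    intro i j u hu v hv; rw [toBundle_eq_iff (hmem i u hu) (hmem j v hv)]
    refine exists_congr fun m => exists_congr fun n => ?_
    have e : pointAct m (2 * n) (pt i u) = place τ k (spread m (2 * n + (i : ℕ)) u) := by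
      rw [hpt]; simp only
      rw [← hτ.place_pushAct hk (spread_mem hu _ _), pushAct_spread, map_zero, zero_add]
    rw [e]; constructor
    · intro h
      have := congrArg (wbary τ k) h; rw [hτ.wbary_place hk (spread_mem hu _ _)] at this
      rw [← this, hpt]; simp only
      rw [hτ.wbary_place hk (spread_mem hv _ _)]
    · intro h
      rw [h]
  refine ⟨fun i p => toBundle (pt i (coord i p)), ?_, ?_, ?_, ?_⟩
  · intro i p hp
    have hu := (hz i).bijOn.mapsTo hp; obtain ⟨c, hc, hyc⟩ := hdev _ (hmem i _ hu)
    obtain ⟨N, hN, hNs, hd⟩ := developedSpace_hdist hτ (isTileInvariant_pointDist hP k) hdev hc hyc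
      (bundleInclusion_toBundle (hmem i _ hu))
    have hcont : ContinuousOn (fun q => pt i (coord i q)) (idealTetrahedron (z i)) := by
      rw [continuousOn_iff_continuous_domRestrict]
      have hcc := continuousOn_iff_continuous_domRestrict.1 (hz i).continuousOn
      refine hτ.continuous_place hk (X := idealTetrahedron (z i))
        (w := fun q => spread 0 (i : ℕ) (coord i q)) (fun r => ?_) ?_
        fun q => spread_mem ((hz i).bijOn.mapsTo q.2) _ _
      · refine continuous_finsetSum _ fun j _ => ?_
        split_ifs
        · exact (continuous_apply j).comp hcc
        · exact continuous_const
      · refine fun q => ⟨univ, univ_mem, (finite_range (tileVertex 0 (i : ℕ))).subset ?_⟩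
        exact fun r ⟨q, hq, _⟩ => mem_range_of_spread_ne_zero hq
    have := hcont p hp hN; rw [mem_map, mem_nhdsWithin_iff_exists_mem_nhds_inter] at this
    obtain ⟨U, hU, hUN⟩ := this
    refine ⟨U, hU, fun q hq => ?_, fun q hq q' hq' => ?_⟩
    · exact (hd _ (hUN hq) _ (bundleInclusion_toBundle (hmem i _ ((hz i).bijOn.mapsTo hq.2)))).1
    · have hq1 := (hz i).bijOn.mapsTo hq.2
      have hq2 := (hz i).bijOn.mapsTo hq'.2
      refine ((hd _ (hUN hq) _ (bundleInclusion_toBundle (hmem i _ hq1))).2 _ (hUN hq') _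
        (bundleInclusion_toBundle (hmem i _ hq2))).trans ?_
      have b1 : ∀ u ∈ idealSimplex, bary τ (pt i u) = spread 0 (i : ℕ) (simplexWarp k⁻¹ u) := by
        intro u hu; rw [hpt]
        simp only; rw [hτ.bary_place hk (spread_mem hu _ _), warp_spread]
      have hk' := inv_pos.2 hk
      rw [hc.dist 0 _ _ (simplexWarp_mem hk' hq1).2.1 _ (simplexWarp_mem hk' hq2).2.1 _
        (hNs (hUN hq)) _ (hNs (hUN hq')) (b1 _ hq1) (b1 _ hq2), pointDist, ← warp_spread,
        ← warp_spread, warp_warp_inv hk (spread_mem hq1 _ _), warp_warp_inv hk (spread_mem hq2 _ _),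
        (hz i).dist q hq.2 q' hq'.2 0 (i : ℕ)]
  · intro x
    obtain ⟨y, hy, hyx⟩ := exists_lift x; obtain ⟨m, n, u, hu, hw⟩ := wbary_mem (τ := τ) hk hy
    have hi : ∃ (i : Fin 2) (l : ℤ), n = 2 * l + (i : ℕ) := by
      rcases Int.even_or_odd' n with ⟨l, rfl | rfl⟩
      · exact ⟨0, l, by simp⟩
      · exact ⟨1, l, by simp⟩
    obtain ⟨i, l, rfl⟩ := hi; obtain ⟨p, hp, hpu⟩ := (hz i).bijOn.surjOn hu
    refine ⟨i, p, hp, ?_⟩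
    simp only [hpu]
    refine isOpenEmbedding_bundleInclusion.injective ?_
    rw [bundleInclusion_toBundle (hmem i u hu), ← hyx, toClosed_eq_iff]
    refine ⟨m, l, ?_⟩
    rw [hpt]; simp only
    rw [← hτ.place_pushAct hk (spread_mem hu _ _), pushAct_spread, map_zero, zero_add, ← hw,
      hτ.place_wbary hk hy]
  · intro i j p hp q hq h
    have hpT : p ∈ idealTetrahedron (z i) := fun l => (hp l).le
    have hu := (hz i).bijOn.mapsTo hpT; have hv := (hz j).bijOn.mapsTo hq
    obtain ⟨m, n, hmn⟩ := (heq i j _ hu _ hv).1 h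
    have hsub : range (tileVertex m (2 * n + (i : ℕ))) ⊆ range (tileVertex 0 (j : ℕ)) := by
      rintro r ⟨l, rfl⟩
      have := congrFun hmn (tileVertex m (2 * n + (i : ℕ)) l)
      rw [spread_vertex] at this
      exact mem_range_of_spread_ne_zero fun h0 =>
        (hp _).ne' (((hz i).eq_zero p hpT _).1 (this.trans h0))
    obtain ⟨rfl, h2⟩ := hτ.eq_of_range_subset hsub
    have hij : i = j := by
      refine Fin.ext ?_
      have := i.2; have := j.2
      omega
    subst hij
    refine ⟨rfl, (hz i).bijOn.injOn hpT hq ?_⟩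
    rw [h2] at hmn; ext l
    rw [← spread_vertex 0 (i : ℕ) (coord i p) l, hmn, spread_vertex]
  · intro i j l p hp q hq h
    have hpT : p ∈ idealTetrahedron (z i) := fun l' => by
      by_cases hl : l' = l
      · rw [hl, hp.1]
      · exact (hp.2 l' hl).le
    have hu := (hz i).bijOn.mapsTo hpT; have hv := (hz j).bijOn.mapsTo hq
    obtain ⟨m, n, hmn⟩ := (heq i j _ hu _ hv).1 h
    have hi0 : coord i p ((σ i).symm l) = 0 := by
      rw [(hz i).eq_zero p hpT, apply_symm_apply, hp.1]
    have hipos : ∀ l', l' ≠ (σ i).symm l → coord i p l' ≠ 0 := by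
      intro l' hl' h0; rw [(hz i).eq_zero p hpT] at h0
      exact (hp.2 _ fun h' => hl' (by rw [← h', Equiv.symm_apply_apply])).ne' h0
    obtain ⟨o, ho, hopos⟩ := exists_eq_zero_of_spread_eq hmn hi0 hipos
    refine ⟨σ j o, ⟨?_, fun l' hl' => ?_⟩, ?_⟩
    · rw [← (hz j).eq_zero q hq, ho]
    · refine lt_of_le_of_ne (hq l') fun h0 => ?_
      refine hopos ((σ j).symm l') (fun h' => hl' ?_) ?_
      · rw [← h', apply_symm_apply]
      · rw [(hz j).eq_zero q hq, apply_symm_apply, ← h0]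
    · refine Subset.antisymm ?_ ?_
      · rintro _ ⟨p', ⟨hp', hp0⟩, rfl⟩
        have hu' := (hz i).bijOn.mapsTo hp'
        obtain ⟨v, hv, hv0, hve⟩ := exists_face_of_spread_eq hmn hipos ho hu'
          (by rw [(hz i).eq_zero p' hp', apply_symm_apply, hp0])
        obtain ⟨q', hq', rfl⟩ := (hz j).bijOn.surjOn hv
        refine ⟨q', ⟨hq', ?_⟩, ((heq i j _ hu' _ hv).2 ⟨m, n, hve⟩).symm⟩
        rwa [← (hz j).eq_zero q' hq']
      · rintro _ ⟨q', ⟨hq', hq0⟩, rfl⟩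
        have hu' := (hz j).bijOn.mapsTo hq'
        obtain ⟨v, hv, hv0, hve⟩ := exists_face_of_spread_eq hmn.symm hopos hi0 hu'
          (by rw [(hz j).eq_zero q' hq', hq0])
        obtain ⟨p', hp', rfl⟩ := (hz i).bijOn.surjOn hv
        refine ⟨p', ⟨hp', ?_⟩, (heq i j _ hv _ hu').2 ⟨m, n, hve.symm⟩⟩
        rwa [(hz i).eq_zero p' hp', apply_symm_apply] at hv0

/-! ### The star of an edge in the complete structure -/

/-- The vertices of the star of the edge from `0` to `(0, 1)`. -/
def hexVertex : Fin 8 → ℤ² :=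
  ![(0, 0), (0, 1), (1, 1), (1, 0), (1, -1), (-1, 2), (-1, 1), (-1, 0)]

/-- The six tetrahedra of the star. -/
def hexIndex : Fin 6 → Fin 4 → Fin 8 :=
  ![![0, 1, 3, 2], ![7, 6, 0, 1], ![0, 4, 1, 3], ![6, 0, 5, 1], ![0, 5, 4, 1], ![7, 0, 1, 2]]

/-- Null vectors of the vertices of the star. -/
def hexVec : Fin 8 → Lor :=
  ![(1, 0, 0), (0, 0, 1), (1, ⟨1, 0⟩, 1), (1, ⟨1 / 2, √3 / 2⟩, 1), (1, ⟨-1 / 2, √3 / 2⟩, 1),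
    (1, ⟨-1, 0⟩, 1), (1, ⟨-1 / 2, -(√3 / 2)⟩, 1), (1, ⟨1 / 2, -(√3 / 2)⟩, 1)]

lemma hexVertex_injective : Function.Injective hexVertex := by decide

lemma hexIndex_injective (j : Fin 6) : Function.Injective (hexIndex j) := by revert j; decide

lemma exists_tileVertex_eq_hex (j : Fin 6) : ∃ m n, tileVertex m n = hexVertex ∘ hexIndex j := by
  have e2 : fibZ ^ (-2 : ℤ) = fibZ⁻¹ * fibZ⁻¹ := by
    rw [show (-2 : ℤ) = -1 + -1 from rfl, zpow_add, zpow_neg_one]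
  fin_cases j
  · refine ⟨0, 0, ?_⟩
    ext i : 1; fin_cases i <;> rfl
  · refine ⟨(-1, 0), 0, ?_⟩
    ext i : 1; fin_cases i <;> rfl
  · refine ⟨0, -1, ?_⟩
    ext i : 1; unfold tileVertex; rw [zpow_neg_one]; fin_cases i <;> rfl
  · refine ⟨(-1, 1), -1, ?_⟩
    ext i : 1; unfold tileVertex; rw [zpow_neg_one]; fin_cases i <;> rfl
  · refine ⟨0, -2, ?_⟩
    ext i : 1; unfold tileVertex; rw [e2]; fin_cases i <;> rfl
  · refine ⟨(-1, 0), 1, ?_⟩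
    ext i : 1; unfold tileVertex; rw [zpow_one]; fin_cases i <;> rfl

lemma exists_hex_of_mem_range (h0 : (0, 0) ∈ range (tileVertex m n))
    (h1 : (0, 1) ∈ range (tileVertex m n)) : ∃ j, tileVertex m n = hexVertex ∘ hexIndex j := by
  have e2 : fibZ ^ (-2 : ℤ) = fibZ⁻¹ * fibZ⁻¹ := by
    rw [show (-2 : ℤ) = -1 + -1 from rfl, zpow_add, zpow_neg_one]
  obtain ⟨i, hi⟩ := h0; obtain ⟨i', hi'⟩ := h1
  have hd : (fibZ ^ n) (corner i' - corner i) = (0, 1) := by rw [← tileVertex_sub m, hi, hi']; rfl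
  have hne : corner i' - corner i ≠ 0 := by
    intro h; rw [h, map_zero] at hd
    exact absurd hd (by decide)
  have hl := level_fibZ_zpow n hne; rw [hd, level_zero_one, level_corner_sub] at hl
  obtain rfl := eq_neg_of_tileVertex_eq_zero hi
  have hn : n = 0 ∨ n = -1 ∨ n = -2 ∨ n = 1 := by
    fin_cases i <;> fin_cases i' <;> simp [sub_self] at hl hne <;>
    first
      | (have : (n : ℝ) = 0 := by linarith)
        exact Or.inl (by exact_mod_cast this)
      | (have : (n : ℝ) = -1 := by linarith)
        exact Or.inr (Or.inl (by exact_mod_cast this))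
      | (have : (n : ℝ) = -2 := by linarith)
        exact Or.inr (Or.inr (Or.inl (by exact_mod_cast this)))
      | (have : (n : ℝ) = 1 := by linarith)
        exact Or.inr (Or.inr (Or.inr (by exact_mod_cast this)))
  have key : ∀ f : (ℤ²) ≃ₗ[ℤ] (ℤ²), fibZ ^ n = f →
      (∀ i i' : Fin 4, f (corner i' - corner i) = (0, 1) → ∃ j : Fin 6, ∀ l,
        f (corner l) + -f (corner i) = hexVertex (hexIndex j l)) →
      ∃ j, tileVertex (-(fibZ ^ n) (corner i)) n = hexVertex ∘ hexIndex j := by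
    rintro f rfl hf; obtain ⟨j, hj⟩ := hf i i' hd
    exact ⟨j, funext hj⟩
  rcases hn with rfl | rfl | rfl | rfl
  · exact key 1 (zpow_zero _) (by decide)
  · exact key fibZ⁻¹ (zpow_neg_one _) (by decide)
  · exact key _ e2 (by decide)
  · exact key fibZ (zpow_one _) (by decide)

lemma lform_hexVec (j : Fin 6) (i l : Fin 4) :
    lform (hexVec (hexIndex j i)) (hexVec (hexIndex j l)) = 1 * weight 1 (corner i - corner l) := by
  have h3 : √3 * √3 = (3 : ℝ) := mul_self_sqrt (by norm_num)
  rw [weight_corner_sub one_pos]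
  fin_cases j <;> fin_cases i <;> fin_cases l <;> simp [hexIndex, hexVec, lform] <;> nlinarith

/-- Coordinates of a point of the plane with respect to a hexagonal fan. -/
def hexFan (a b : ℝ) : Fin 6 → ℝ :=
  ![max 0 (min a (a + b)), max 0 (min b (a + b)), max 0 (min (-a) b), max 0 (min (-a) (-a - b)),
    max 0 (min (-b) (-a - b)), max 0 (min a (-b))]

/-- The coefficients of a vector with respect to the null vectors of the star. -/
def hexCoef (X : Lor) : Fin 8 → ℝ :=
  let h := hexFan (X.2.1.re - X.2.1.im / √3) (2 * X.2.1.im / √3)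
  ![X.1 - ∑ k, h k, X.2.2 - ∑ k, h k, h 0, h 1, h 2, h 3, h 4, h 5]

lemma continuous_hexCoef (i : Fin 8) : Continuous fun X => hexCoef X i := by
  have hf : ∀ k : Fin 6, Continuous fun X : Lor =>
      hexFan (X.2.1.re - X.2.1.im / √3) (2 * X.2.1.im / √3) k := by
    intro k
    fin_cases k <;> simp only [hexFan] <;> simp <;> fun_prop
  have hs : Continuous fun X : Lor => ∑ k,
      hexFan (X.2.1.re - X.2.1.im / √3) (2 * X.2.1.im / √3) k :=
    continuous_finsetSum _ fun k _ => hf k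
  fin_cases i
  · exact continuous_fst.sub hs
  · exact (continuous_snd.comp continuous_snd).sub hs
  · exact hf 0
  · exact hf 1
  · exact hf 2
  · exact hf 3
  · exact hf 4
  · exact hf 5

lemma hexFan_sector {x y : ℝ} (hx : 0 ≤ x) (hy : 0 ≤ y) :
    hexFan x y = ![x, y, 0, 0, 0, 0] ∧ hexFan (-y) (x + y) = ![0, x, y, 0, 0, 0] ∧
    hexFan (-x - y) x = ![0, 0, x, y, 0, 0] ∧ hexFan (-x) (-y) = ![0, 0, 0, x, y, 0] ∧
    hexFan y (-x - y) = ![0, 0, 0, 0, x, y] ∧ hexFan (x + y) (-x) = ![y, 0, 0, 0, 0, x] := by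
  have hxy : 0 ≤ x + y := add_nonneg hx hy
  have key : ∀ {a b : ℝ} {v : Fin 6 → ℝ}, max 0 (min a (a + b)) = v 0 →
      max 0 (min b (a + b)) = v 1 → max 0 (min (-a) b) = v 2 → max 0 (min (-a) (-a - b)) = v 3 →
      max 0 (min (-b) (-a - b)) = v 4 → max 0 (min a (-b)) = v 5 → hexFan a b = v := by
    intro a b v h0 h1 h2 h3 h4 h5
    ext k; fin_cases k <;> assumption
  refine ⟨key ?_ ?_ ?_ ?_ ?_ ?_, key ?_ ?_ ?_ ?_ ?_ ?_, key ?_ ?_ ?_ ?_ ?_ ?_,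
    key ?_ ?_ ?_ ?_ ?_ ?_, key ?_ ?_ ?_ ?_ ?_ ?_, key ?_ ?_ ?_ ?_ ?_ ?_⟩ <;>
  simp only [cons_val] <;> grind

lemma exists_sector (a b : ℝ) : ∃ x y : ℝ, 0 ≤ x ∧ 0 ≤ y ∧ ((a = x ∧ b = y) ∨
    (a = -y ∧ b = x + y) ∨ (a = -x - y ∧ b = x) ∨ (a = -x ∧ b = -y) ∨ (a = y ∧ b = -x - y) ∨
    (a = x + y ∧ b = -x)) := by
  rcases le_total 0 a with ha | ha <;> rcases le_total 0 b with hb | hb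
  · exact ⟨a, b, ha, hb, by grind⟩
  · rcases le_total 0 (a + b) with hc | hc
    · exact ⟨-b, a + b, by grind⟩
    · exact ⟨-a - b, a, by grind⟩
  · rcases le_total 0 (a + b) with hc | hc
    · exact ⟨a + b, -a, by grind⟩
    · exact ⟨b, -a - b, by grind⟩
  · exact ⟨-a, -b, by grind⟩

lemma lor_ext {X Y : Lor} (h1 : X.1 = Y.1) (h2 : X.2.1.re = Y.2.1.re)
    (h3 : X.2.1.im = Y.2.1.im) (h4 : X.2.2 = Y.2.2) : X = Y :=
  Prod.ext h1 (Prod.ext (Complex.ext h2 h3) h4)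

lemma exists_eq_sum_hexVec (X : Lor) : ∃ j, ∃ u : Bary,
    X = ∑ l, u l • hexVec (hexIndex j l) ∧ ∀ l, 2 ≤ hexIndex j l → 0 ≤ u l := by
  have h3 : √3 * √3 = (3 : ℝ) := mul_self_sqrt (by norm_num)
  have h30 : √3 ≠ 0 := by positivity
  obtain ⟨x, y, hx, hy, h⟩ := exists_sector (X.2.1.re - X.2.1.im / √3) (2 * X.2.1.im / √3)
  obtain ⟨X1, ⟨c, d⟩, X3⟩ := X; simp only at h
  obtain ⟨b, rfl⟩ : ∃ b, d = √3 / 2 * b := ⟨2 * d / √3, by field_simp⟩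
  have e1 : √3 / 2 * b / √3 = b / 2 := by field_simp
  have e2 : 2 * (√3 / 2 * b) / √3 = b := by field_simp
  rw [e1, e2] at h
  rcases h with ⟨h1, h2⟩ | ⟨h1, h2⟩ | ⟨h1, h2⟩ | ⟨h1, h2⟩ | ⟨h1, h2⟩ | ⟨h1, h2⟩
  on_goal 6 => obtain rfl : c = x / 2 + y := by linarith
  on_goal 6 => refine ⟨5, ![x, X1 - x - y, X3 - x - y, y], ?_, ?_⟩
  on_goal 5 => obtain rfl : c = (y - x) / 2 := by linarith
  on_goal 5 => refine ⟨1, ![y, x, X1 - x - y, X3 - x - y], ?_, ?_⟩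
  on_goal 4 => obtain rfl : c = -x - y / 2 := by linarith
  on_goal 4 => refine ⟨3, ![y, X1 - x - y, x, X3 - x - y], ?_, ?_⟩
  on_goal 3 => obtain rfl : c = -x / 2 - y := by linarith
  on_goal 3 => refine ⟨4, ![X1 - x - y, y, x, X3 - x - y], ?_, ?_⟩
  on_goal 2 => obtain rfl : c = (x - y) / 2 := by linarith
  on_goal 2 => refine ⟨2, ![X1 - x - y, y, X3 - x - y, x], ?_, ?_⟩
  on_goal 1 => obtain rfl : c = x + y / 2 := by linarith
  on_goal 1 => refine ⟨0, ![X1 - x - y, X3 - x - y, y, x], ?_, ?_⟩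
  all_goals first
    | intro l; fin_cases l <;> simp [hexIndex, hx, hy]
    | apply lor_ext <;> simp [sum_univ_four, hexVec, hexIndex, h2] <;> ring

lemma hexCoef_sum (j : Fin 6) (u : Bary) (hu : ∀ l, 2 ≤ hexIndex j l → 0 ≤ u l)
    (i : Fin 8) : hexCoef (∑ l, u l • hexVec (hexIndex j l)) i =
      ∑ l, if hexIndex j l = i then u l else 0 := by
  have h30 : √3 ≠ 0 := by positivity
  have h6 : ∀ (e : Fin 8 → ℝ) {v : Fin 6 → ℝ} {x y : ℝ} {X : Lor}, hexFan x y = v →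
      X.2.1.re - X.2.1.im / √3 = x → 2 * X.2.1.im / √3 = y →
      X.1 - ∑ k, v k = e 0 → X.2.2 - ∑ k, v k = e 1 → v 0 = e 2 → v 1 = e 3 → v 2 = e 4 →
      v 3 = e 5 → v 4 = e 6 → v 5 = e 7 → hexCoef X i = e i := by
    rintro e v x y X rfl rfl rfl h0 h1 h2 h3 h4 h5 h6 h7
    fin_cases i <;> assumption
  fin_cases j
  · refine h6 (fun i => ∑ l, if hexIndex 0 l = i then u l else 0)
      (hexFan_sector (hu 3 (by decide)) (hu 2 (by decide))).1 ?_ ?_ ?_ ?_ ?_ ?_ ?_ ?_ ?_ ?_ <;>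
    simp [sum_univ_four, sum_univ_six, hexVec, hexIndex] <;> (try field_simp) <;> ring
  · refine h6 (fun i => ∑ l, if hexIndex 1 l = i then u l else 0)
      (hexFan_sector (hu 1 (by decide)) (hu 0 (by decide))).2.2.2.2.1 ?_ ?_ ?_ ?_ ?_ ?_ ?_ ?_ ?_ ?_ <;>
    simp [sum_univ_four, sum_univ_six, hexVec, hexIndex] <;> (try field_simp) <;> ring
  · refine h6 (fun i => ∑ l, if hexIndex 2 l = i then u l else 0)
      (hexFan_sector (hu 3 (by decide)) (hu 1 (by decide))).2.1 ?_ ?_ ?_ ?_ ?_ ?_ ?_ ?_ ?_ ?_ <;>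
    simp [sum_univ_four, sum_univ_six, hexVec, hexIndex] <;> (try field_simp) <;> ring
  · refine h6 (fun i => ∑ l, if hexIndex 3 l = i then u l else 0)
      (hexFan_sector (hu 2 (by decide)) (hu 0 (by decide))).2.2.2.1 ?_ ?_ ?_ ?_ ?_ ?_ ?_ ?_ ?_ ?_ <;>
    simp [sum_univ_four, sum_univ_six, hexVec, hexIndex] <;> (try field_simp) <;> ring
  · refine h6 (fun i => ∑ l, if hexIndex 4 l = i then u l else 0)
      (hexFan_sector (hu 2 (by decide)) (hu 1 (by decide))).2.2.1 ?_ ?_ ?_ ?_ ?_ ?_ ?_ ?_ ?_ ?_ <;>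
    simp [sum_univ_four, sum_univ_six, hexVec, hexIndex] <;> (try field_simp) <;> ring
  · refine h6 (fun i => ∑ l, if hexIndex 5 l = i then u l else 0)
      (hexFan_sector (hu 0 (by decide)) (hu 3 (by decide))).2.2.2.2.2 ?_ ?_ ?_ ?_ ?_ ?_ ?_ ?_ ?_ ?_ <;>
    simp [sum_univ_four, sum_univ_six, hexVec, hexIndex] <;> (try field_simp) <;> ring

lemma sum_hexVec_eq (j : Fin 6) (f : Fin 8 → ℝ) (hf : ∀ i, i ∉ range (hexIndex j) → f i = 0) :
    ∑ i, f i • hexVec i = ∑ l, f (hexIndex j l) • hexVec (hexIndex j l) := by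
  classical
  rw [← Finset.sum_image (f := fun i => f i • hexVec i) (s := Finset.univ) (g := hexIndex j)
    fun a _ b _ h => hexIndex_injective j h]
  symm
  refine Finset.sum_subset (Finset.subset_univ _) fun i _ hi => ?_
  rw [hf i, zero_smul]; rintro ⟨l, rfl⟩
  exact hi (Finset.mem_image_of_mem _ (Finset.mem_univ l))

/-- The barycentric coordinates with given coefficients at the vertices of the star. -/
def hexFun (X : Lor) (r : ℤ²) : ℝ :=
  ∑ i, if hexVertex i = r then hexCoef X i / ∑ i', hexCoef X i' else 0

lemma hexFun_eq {j : Fin 6} (hu : ∀ l, 2 ≤ hexIndex j l → 0 ≤ u l) (hmn : tileVertex m n = hexVertex ∘ hexIndex j) :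
    hexFun (∑ l, u l • hexVec (hexIndex j l)) = spread m n (fun l => u l / ∑ l', u l') := by
  have hs : ∑ i, hexCoef (∑ l, u l • hexVec (hexIndex j l)) i = ∑ l, u l := by
    simp only [hexCoef_sum j u hu]; rw [Finset.sum_comm]
    exact sum_congr rfl fun l _ => by simp
  ext r; rw [hexFun, hs]
  by_cases hr : r ∈ range hexVertex
  · obtain ⟨i, rfl⟩ := hr
    simp only [hexVertex_injective.eq_iff, Finset.sum_ite_eq', Finset.mem_univ, if_true,
      hexCoef_sum j u hu, spread, hmn, Function.comp_apply]
    rw [sum_div]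
    exact sum_congr rfl fun l _ => by split_ifs <;> simp
  · rw [spread_of_notMem]
    · exact Finset.sum_eq_zero fun i _ => if_neg fun h => hr ⟨i, h⟩
    · rintro ⟨l, rfl⟩
      exact hr ⟨hexIndex j l, by rw [hmn]; rfl⟩

/-- The vector of a point of the star. -/
def hexSum (w : Weights) : Lor := ∑ i, w (hexVertex i) • hexVec i

lemma hexSum_spread {j : Fin 6} (hmn : tileVertex m n = hexVertex ∘ hexIndex j) (u : Bary) :
    hexSum (spread m n u) = ∑ l, u l • hexVec (hexIndex j l) := by
  rw [hexSum, sum_hexVec_eq j fun i => spread m n u (hexVertex i)]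
  · refine sum_congr rfl fun l _ => ?_
    rw [show hexVertex (hexIndex j l) = tileVertex m n l by rw [hmn]; rfl, spread_vertex]
  · intro i hi
    refine spread_of_notMem u ?_
    rintro ⟨l, hl⟩; rw [hmn] at hl
    exact hi ⟨l, hexVertex_injective hl⟩

lemma future_hexSum (hw : w ∈ tileComplex) (h0 : w (0, 0) ≠ 0)
    (h1 : w (0, 1) ≠ 0) : Future (hexSum w) ∧ ∃ j m n, ∃ u ∈ idealSimplex,
      tileVertex m n = hexVertex ∘ hexIndex j ∧ w = spread m n u := by
  have hn := nonneg_of_mem_tileComplex hw; have h1' := (hn (0, 1)).lt_of_ne' h1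
  obtain ⟨m, n, u, hu, rfl⟩ := hw
  have hr : ∀ r, spread m n u r ≠ 0 → r ∈ range (tileVertex m n) := by
    exact fun r h => mem_range_of_spread_ne_zero h
  obtain ⟨j, hj⟩ := exists_hex_of_mem_range (hr _ h0) (hr _ h1)
  refine ⟨⟨?_, ?_⟩, j, m, n, u, hu, hj, rfl⟩
  · have e : (hexSum (spread m n u)).2.2 = ∑ i, spread m n u (hexVertex i) * (hexVec i).2.2 := by
      simp only [hexSum, Prod.snd_sum, Prod.smul_snd, smul_eq_mul]
    rw [e]
    refine sum_pos' (fun i _ => mul_nonneg (hn _) ?_) ⟨1, Finset.mem_univ _, ?_⟩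
    · fin_cases i <;> simp [hexVec]
    · simpa [hexVec, hexVertex] using h1'
  · rw [hexSum_spread hj]
    exact lform_sum_pos one_pos one_pos (fun i l => lform_hexVec j i l) hu

lemma mem_idealSimplex_div (hu : ∀ i, 0 ≤ u i) (hij : i ≠ j)
    (hi : 0 < u i) (hj : 0 < u j) : (fun l => u l / ∑ l', u l') ∈ idealSimplex := by
  have hs : 0 < ∑ l', u l' := sum_pos' (fun l _ => hu l) ⟨i, Finset.mem_univ _, hi⟩
  refine ⟨fun l => ⟨div_nonneg (hu l) hs.le, ?_⟩, ?_⟩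
  · rw [div_lt_one hs]
    obtain ⟨l', hl', hpos⟩ : ∃ l', l' ≠ l ∧ 0 < u l' := by
      rcases eq_or_ne i l with rfl | h
      · exact ⟨j, hij.symm, hj⟩
      · exact ⟨i, h, hi⟩
    have := Finset.add_le_sum (f := u) (fun x _ => hu x) (Finset.mem_univ l) (Finset.mem_univ l')
      hl'.symm
    linarith
  · rw [← sum_div, div_self hs.ne']

lemma exists_hex_of_pos {p : ℍ³} (h0 : 0 < hexCoef (lvec p) 0)
    (h1 : 0 < hexCoef (lvec p) 1) : ∃ j m n, ∃ u : Bary,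
      tileVertex m n = hexVertex ∘ hexIndex j ∧ lvec p = ∑ l, u l • hexVec (hexIndex j l) ∧
      0 < ∑ l, u l ∧ (fun l => u l / ∑ l', u l') ∈ idealSimplex ∧
      hexFun (lvec p) = spread m n (fun l => u l / ∑ l', u l') := by
  obtain ⟨j, u, hX, hu⟩ := exists_eq_sum_hexVec (lvec p)
  obtain ⟨m, n, hmn⟩ := exists_tileVertex_eq_hex j; rw [hX, hexCoef_sum j u hu] at h0 h1
  have h01 : ∀ i : Fin 8, (0 < ∑ l, if hexIndex j l = i then u l else 0) →
      ∃ l, hexIndex j l = i ∧ 0 < u l := by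
    intro i hi
    obtain ⟨l, -, hl⟩ := Finset.exists_lt_of_sum_lt (f := fun _ => (0 : ℝ)) (by simpa using hi)
    by_cases h : hexIndex j l = i
    · exact ⟨l, h, by simpa [h] using hl⟩
    · simp [h] at hl
  obtain ⟨l0, e0, p0⟩ := h01 0 h0; obtain ⟨l1, e1, p1⟩ := h01 1 h1
  have hu' : ∀ l, 0 ≤ u l := by
    intro l
    by_cases h : 2 ≤ hexIndex j l
    · exact hu l h
    · have : hexIndex j l = 0 ∨ hexIndex j l = 1 := by
        generalize hexIndex j l = x at h
        revert x; decide
      rcases this with h | h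
      · rw [hexIndex_injective j (h.trans e0.symm)]; exact p0.le
      · rw [hexIndex_injective j (h.trans e1.symm)]; exact p1.le
  have hne : l0 ≠ l1 := by
    rintro rfl; rw [e0] at e1
    exact absurd e1 (by decide)
  refine ⟨j, m, n, u, hmn, hX, sum_pos' (fun l _ => hu' l) ⟨l0, Finset.mem_univ _, p0⟩,
    mem_idealSimplex_div hu' hne p0 p1, ?_⟩
  rw [hX, hexFun_eq hu hmn]

section
variable {τ : Weights → ℝ}

/-- The points of the star of the edge from `0` to `(0, 1)`. -/
def edgeStar (τ : Weights → ℝ) (k : ℝ) : Set Point :=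
  {y | y ∈ offLattice ∧ wbary τ k y (0, 0) ≠ 0 ∧ wbary τ k y (0, 1) ≠ 0}

lemma IsHeight.isOpen_edgeStar (hτ : IsHeight τ) (hk : 0 < k) :
    IsOpen (edgeStar τ k) := by
  have h : ∀ r, IsOpen {y : offLattice | wbary τ k y r ≠ 0} := fun r =>
    isOpen_ne_fun (hτ.continuous_wbary hk r) continuous_const
  have := isOpen_offLattice.isOpenMap_subtype_val _ ((h (0, 0)).inter (h (0, 1)))
  convert this using 1
  ext y; constructor
  · rintro ⟨h1, h2, h3⟩
    exact ⟨⟨y, h1⟩, ⟨h2, h3⟩, rfl⟩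
  · rintro ⟨z, ⟨h2, h3⟩, rfl⟩
    exact ⟨z.2, h2, h3⟩

lemma edgeStar_future (hk : 0 < k) (hy : y ∈ edgeStar τ k) :
    Future (hexSum (wbary τ k y)) ∧ ∃ j m n, ∃ u ∈ idealSimplex,
      tileVertex m n = hexVertex ∘ hexIndex j ∧ wbary τ k y = spread m n u :=
  future_hexSum (wbary_mem hk hy.1) hy.2.1 hy.2.2

lemma hexFun_lproj (hw : w ∈ tileComplex) (h0 : w (0, 0) ≠ 0)
    (h1 : w (0, 1) ≠ 0) : hexFun (lvec (lproj (hexSum w))) = w ∧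
      0 < hexCoef (lvec (lproj (hexSum w))) 0 ∧ 0 < hexCoef (lvec (lproj (hexSum w))) 1 := by
  obtain ⟨hX, j, m, n, u, hu, hmn, rfl⟩ := future_hexSum hw h0 h1
  have hc : 0 < ((hexSum (spread m n u)).2.2)⁻¹ := inv_pos.2 hX.1; have hl := lvec_lproj hX
  generalize ((hexSum (spread m n u)).2.2)⁻¹ = c at hc hl
  rw [hexSum_spread hmn] at hl; rw [hexSum_spread hmn, hl]
  have e : c • ∑ l, u l • hexVec (hexIndex j l) = ∑ l, (c * u l) • hexVec (hexIndex j l) := by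
    rw [Finset.smul_sum]
    exact sum_congr rfl fun l _ => smul_smul _ _ _
  have hn : ∀ l, 0 ≤ c * u l := fun l => mul_nonneg hc.le (hu.1 l).1
  have hpos : ∀ i, spread m n u (hexVertex i) ≠ 0 →
      0 < hexCoef (∑ l, (c * u l) • hexVec (hexIndex j l)) i := by
    intro i hi; rw [hexCoef_sum j _ fun l _ => hn l]
    obtain ⟨l, hl⟩ := mem_range_of_spread_ne_zero hi; rw [← hl, spread_vertex] at hi
    rw [hmn] at hl
    refine sum_pos' (fun l _ => ?_) ⟨l, Finset.mem_univ _, ?_⟩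
    · split_ifs
      · exact hn l
      · exact le_rfl
    · rw [if_pos (hexVertex_injective hl)]
      exact mul_pos hc ((hu.1 l).1.lt_of_ne' hi)
  rw [e]
  refine ⟨?_, hpos 0 h0, hpos 1 h1⟩
  rw [hexFun_eq (fun l _ => hn l) hmn, ← Finset.mul_sum, hu.2]
  congr 1
  ext l; field_simp

lemma continuous_lvec : Continuous lvec := by
  unfold lvec
  fun_prop

lemma IsHeight.continuousOn_place_hexFun (hτ : IsHeight τ) (hk : 0 < k) :
    ContinuousOn (fun p => place τ k (hexFun (lvec p)))
      {p | 0 < hexCoef (lvec p) 0 ∧ 0 < hexCoef (lvec p) 1} := by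
  rw [continuousOn_iff_continuous_domRestrict]
  have h : ∀ i, Continuous fun p : ℍ³ => hexCoef (lvec p) i := fun i =>
    (continuous_hexCoef i).comp continuous_lvec
  have hpos : ∀ p : ℍ³, 0 < hexCoef (lvec p) 0 ∧ 0 < hexCoef (lvec p) 1 →
      ∑ i, hexCoef (lvec p) i ≠ 0 := by
    intro p hp h0; obtain ⟨j, m, n, u, hmn, hX, hs, hu, he⟩ := exists_hex_of_pos hp.1 hp.2
    have h1 := finsum_spread (fun _ t => t) (fun _ => rfl) m n (fun l => u l / ∑ l', u l')
    rw [hu.2, ← he] at h1; simp [hexFun, h0] at h1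
  refine hτ.continuous_place hk (w := fun p : {p : ℍ³ |
      0 < hexCoef (lvec p) 0 ∧ 0 < hexCoef (lvec p) 1} => hexFun (lvec p.1))
    (fun r => ?_) ?_ fun p => ?_
  · refine continuous_finsetSum _ fun i _ => ?_
    split_ifs
    · exact ((h i).comp continuous_subtype_val).div ((continuous_finsetSum _ fun i _ =>
        h i).comp continuous_subtype_val) fun p => hpos p.1 p.2
    · exact continuous_const
  · intro p
    refine ⟨univ, univ_mem, (finite_range hexVertex).subset ?_⟩
    rintro r ⟨z, hz, -⟩
    by_contra hr
    refine hz (Finset.sum_eq_zero fun i _ => if_neg fun h => hr ⟨i, h⟩)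
  · obtain ⟨j, m, n, u, hmn, hX, hs, hu, he⟩ := exists_hex_of_pos p.2.1 p.2.2
    simp only [he]
    exact spread_mem hu m n

/-- The developing map of the star of an edge. -/
def IsHeight.edgeChart (hτ : IsHeight τ) (hk : 0 < k) : OpenPartialHomeomorph Point ℍ³ where
  toFun y := lproj (hexSum (wbary τ k y))
  invFun p := place τ k (hexFun (lvec p))
  source := edgeStar τ k
  target := {p | 0 < hexCoef (lvec p) 0 ∧ 0 < hexCoef (lvec p) 1}
  map_source' y hy := (hexFun_lproj (wbary_mem hk hy.1) hy.2.1 hy.2.2).2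
  map_target' p hp := by
    obtain ⟨j, m, n, u, hmn, hX, hs, hu, he⟩ := exists_hex_of_pos hp.1 hp.2
    have hw : hexFun (lvec p) ∈ tileComplex := by rw [he]; exact spread_mem hu m n
    have hne : ∀ i, 0 < hexCoef (lvec p) i → hexFun (lvec p) (hexVertex i) ≠ 0 := by
      intro i hi
      have hall : ∀ i, 0 ≤ hexCoef (lvec p) i := by
        intro i; rw [hX, hexCoef_sum j u]
        · refine Finset.sum_nonneg fun l _ => ?_
          split_ifs
          · have := (hu.1 l).1
            rwa [le_div_iff₀ hs, zero_mul] at this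
          · exact le_rfl
        · intro l _
          have := (hu.1 l).1
          rwa [le_div_iff₀ hs, zero_mul] at this
      simp only [hexFun, hexVertex_injective.eq_iff, Finset.sum_ite_eq', Finset.mem_univ, if_true]
      exact (div_pos hi (sum_pos' (fun i _ => hall i) ⟨i, Finset.mem_univ _, hi⟩)).ne'
    refine ⟨place_mem hk hw, ?_, ?_⟩
    · rw [hτ.wbary_place hk hw]; exact hne 0 hp.1
    · rw [hτ.wbary_place hk hw]; exact hne 1 hp.2
  left_inv' y hy := by
    rw [(hexFun_lproj (wbary_mem hk hy.1) hy.2.1 hy.2.2).1, hτ.place_wbary hk hy.1]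
  right_inv' p hp := by
    obtain ⟨j, m, n, u, hmn, hX, hs, hu, he⟩ := exists_hex_of_pos hp.1 hp.2
    have hw : hexFun (lvec p) ∈ tileComplex := by rw [he]; exact spread_mem hu m n
    have e : hexSum (hexFun (lvec p)) = (∑ l, u l)⁻¹ • lvec p := by
      rw [he, hexSum_spread hmn, hX, Finset.smul_sum]
      refine sum_congr rfl fun l _ => ?_
      rw [smul_smul, div_eq_inv_mul]
    rw [hτ.wbary_place hk hw, e, lproj_smul (inv_pos.2 hs) (future_lvec p), lproj_lvec]
  open_source := hτ.isOpen_edgeStar hk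
  open_target := by
    have h : ∀ i, Continuous fun p : ℍ³ => hexCoef (lvec p) i := fun i =>
      (continuous_hexCoef i).comp continuous_lvec
    exact (isOpen_lt continuous_const (h 0)).inter (isOpen_lt continuous_const (h 1))
  continuousOn_toFun := by
    refine continuousOn_lproj.comp ?_ fun y hy => (edgeStar_future hk hy).1
    refine ContinuousOn.mono ?_ (fun y hy => hy.1 : edgeStar τ k ⊆ offLattice)
    rw [continuousOn_iff_continuous_domRestrict]
    have h : Continuous fun y : offLattice => ∑ i, wbary τ k y (hexVertex i) • hexVec i :=
      continuous_finsetSum _ fun i _ => (hτ.continuous_wbary hk _).smul continuous_const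
    exact h
  continuousOn_invFun := hτ.continuousOn_place_hexFun hk

end

lemma exists_corner_sub (h : i ≠ j) : ∃ q : ℤ,
    corner j - corner i = (fibZ ^ q) (0, 1) ∨ corner i - corner j = (fibZ ^ q) (0, 1) := by
  have e0 : (fibZ ^ (0 : ℤ)) (0, 1) = (0, 1) := by simp
  have e1 : (fibZ ^ (1 : ℤ)) (0, 1) = (1, 0) := by rw [zpow_one]; rfl
  have e2 : (fibZ ^ (2 : ℤ)) (0, 1) = (1, 1) := by
    rw [show (2 : ℤ) = 1 + 1 from rfl, zpow_add, zpow_one]; rfl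
  have e3 : (fibZ ^ (-1 : ℤ)) (0, 1) = (1, -1) := by rw [zpow_neg_one]; rfl
  have key : ∀ i j : Fin 4, i ≠ j → ∃ v ∈ [((0 : ℤ), (1 : ℤ)), (1, 0), (1, 1), (1, -1)],
      corner j - corner i = v ∨ corner i - corner j = v := by decide
  obtain ⟨v, hv, hh⟩ := key i j h
  fin_cases hv
  · exact ⟨0, by rwa [e0]⟩
  · exact ⟨1, by rwa [e1]⟩
  · exact ⟨2, by rwa [e2]⟩
  · exact ⟨-1, by rwa [e3]⟩

lemma exists_edge_of_mem (hb : b ∈ tileComplex) :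
    ∃ m n, pushAct m n b (0, 0) ≠ 0 ∧ pushAct m n b (0, 1) ≠ 0 := by
  obtain ⟨m, n, u, hu, rfl⟩ := hb
  have key : ∀ (i j : Fin 4) (q : ℤ), corner j - corner i = (fibZ ^ q) (0, 1) → u i ≠ 0 → u j ≠ 0 →
      ∃ m' n', pushAct m' n' (spread m n u) (0, 0) ≠ 0 ∧
        pushAct m' n' (spread m n u) (0, 1) ≠ 0 := by
    intro i j q hq hi hj
    refine ⟨-((fibZ ^ (-(n + q))) (tileVertex m n i)), -(n + q), ?_, ?_⟩
    · have : (fibZ ^ (- -(n + q))) ((0, 0) - -((fibZ ^ (-(n + q))) (tileVertex m n i))) =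
          tileVertex m n i := by
        rw [neg_neg, show ((0 : ℤ), (0 : ℤ)) = 0 from rfl, zero_sub, neg_neg, fibZ_zpow_apply_neg]
      rwa [pushAct, this, spread_vertex]
    · have : (fibZ ^ (- -(n + q))) ((0, 1) - -((fibZ ^ (-(n + q))) (tileVertex m n i))) =
          tileVertex m n j := by
        rw [neg_neg, sub_neg_eq_add, map_add, fibZ_zpow_apply_neg, fibZ_zpow_add_apply, ← hq,
          ← tileVertex_sub m, sub_add_cancel]
      rwa [pushAct, this, spread_vertex]
  obtain ⟨i, -, hi⟩ : ∃ i ∈ Finset.univ, 0 < u i := by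
    refine Finset.exists_lt_of_sum_lt (f := fun _ => (0 : ℝ)) ?_
    rw [hu.2]; simp
  obtain ⟨j, hj1, hj⟩ : ∃ j ∈ Finset.univ.erase i, 0 < u j := by
    refine Finset.exists_lt_of_sum_lt (f := fun _ => (0 : ℝ)) ?_
    have h := hu.2; rw [← Finset.add_sum_erase _ _ (Finset.mem_univ i)] at h
    have := (hu.1 i).2; simp only [Finset.sum_const_zero]
    linarith
  obtain ⟨q, hq | hq⟩ := exists_corner_sub (Finset.ne_of_mem_erase hj1).symm
  · exact key i j q hq hi.ne' hj.ne'
  · exact key j i q hq hj.ne' hi.ne'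

lemma isDevelopment_edgeChart {τ : Weights → ℝ} (hτ : IsHeight τ) (hk : 0 < k) :
    IsDevelopment τ (pointDist 1 k) (hτ.edgeChart hk) where
  subset _ hy := hy.1
  dist m n u hu u' hu' z hz z' hz' h h' := by
    have e : wbary τ k z = spread m n (simplexWarp k u) := by rw [wbary, h, warp_spread]
    have e' : wbary τ k z' = spread m n (simplexWarp k u') := by rw [wbary, h', warp_spread]
    have hr : ∀ r, wbary τ k z r ≠ 0 → r ∈ range (tileVertex m n) := by
      intro r hr; rw [e] at hr
      exact mem_range_of_spread_ne_zero hr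
    obtain ⟨j, hj⟩ := exists_hex_of_mem_range (hr _ hz.2.1) (hr _ hz.2.2)
    have f := (edgeStar_future hk hz).1; have f' := (edgeStar_future hk hz').1
    change hdist (lproj (hexSum (wbary τ k z))) (lproj (hexSum (wbary τ k z'))) = _
    rw [e, hexSum_spread hj] at f ⊢; rw [e', hexSum_spread hj] at f' ⊢
    rw [pointDist, warp_spread, warp_spread]
    exact hdist_lproj_sum one_pos one_pos (fun i l => lform_hexVec j i l) f f' m n

lemma hasDevelopments_one {τ : Weights → ℝ} (hτ : IsHeight τ) (hk : 0 < k) :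
    HasDevelopments τ (pointDist 1 k) := by
  intro y hy; obtain ⟨m, n, h0, h1⟩ := exists_edge_of_mem (wbary_mem (τ := τ) hk hy)
  refine ⟨_, (isDevelopment_edgeChart hτ hk).comp_pointHomeo hτ
    (isTileInvariant_pointDist one_pos k) m n, ?_⟩
  change pointAct m n y ∈ edgeStar τ k
  refine ⟨pointAct_mem hy m n, ?_, ?_⟩ <;> rwa [hτ.wbary_pointAct hy]

/-! ### Completeness -/

lemma continuous_hdist_right (p : ℍ³) : Continuous (hdist p) :=
  continuous_hdist.comp (f := fun q => (p, q)) (by fun_prop)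

section
variable {M : Type} [TopologicalSpace M] [ChartedSpace ℍ³ M]

/-- Unit-speed geodesics `[0, a) → M`. -/
def IsUnitSpeed (a : ℝ) (γ : ℝ → M) : Prop :=
  ∀ s ∈ Ico 0 a, ∃ ε > 0, ∀ u ∈ Ico 0 a, ∀ v ∈ Ico 0 a, |u - s| < ε → |v - s| < ε →
    γ u ∈ (chartAt ℍ³ (γ s)).source ∧
    γ v ∈ (chartAt ℍ³ (γ s)).source ∧
    hdist (chartAt ℍ³ (γ s) (γ u)) (chartAt ℍ³ (γ s) (γ v)) = |u - v|

lemma eventually_hdist_chartAt [HasGroupoid M hyperbolicGroupoid] {x x₀ : M}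
    (hx : x ∈ (chartAt ℍ³ x₀).source) : ∃ V ∈ 𝓝 x, V ⊆ (chartAt ℍ³ x₀).source ∧ ∀ z ∈ V, ∀ z' ∈ V,
        hdist (chartAt ℍ³ x₀ z) (chartAt ℍ³ x₀ z') =
          hdist (chartAt ℍ³ x z) (chartAt ℍ³ x z') := by
  have h := HasGroupoid.compatible (G := hyperbolicGroupoid)
    (chart_mem_atlas ℍ³ x) (chart_mem_atlas ℍ³ x₀)
  have hxs := mem_chart_source ℍ³ x
  generalize chartAt ℍ³ x = e at h hxs ⊢
  generalize chartAt ℍ³ x₀ = e₀ at h hx ⊢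
  obtain ⟨⟨-, hd⟩, -⟩ := mem_groupoid_of_pregroupoid.1 h
  have hmem : ∀ z ∈ e.source, z ∈ e₀.source → e z ∈ (e.symm.trans e₀).source := by
    intro z hz hz'; rw [OpenPartialHomeomorph.trans_source]
    exact ⟨e.map_source hz, by rwa [mem_preimage, e.left_inv hz]⟩
  obtain ⟨u, hu, hxu, hd⟩ := hd (e x) (hmem x hxs hx)
  refine ⟨e.source ∩ e ⁻¹' u ∩ e₀.source, ?_, fun z hz => hz.2, fun z hz z' hz' => ?_⟩
  · exact inter_mem ((e.isOpen_inter_preimage hu).mem_nhds ⟨hxs, hxu⟩) (e₀.open_source.mem_nhds hx)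
  · have := hd (e z) ⟨hmem z hz.1.1 hz.2, hz.1.2⟩ (e z') ⟨hmem z' hz'.1.1 hz'.2, hz'.1.2⟩
    rwa [OpenPartialHomeomorph.trans_apply, OpenPartialHomeomorph.trans_apply, e.left_inv hz.1.1,
      e.left_inv hz'.1.1] at this

lemma IsUnitSpeed.continuousOn {γ : ℝ → M} (hγ : IsUnitSpeed a γ) :
    ContinuousOn γ (Ico 0 a) := by
  intro s hs N hN; obtain ⟨ε, hε, h⟩ := hγ s hs
  have hxs := mem_chart_source ℍ³ (γ s)
  generalize chartAt ℍ³ (γ s) = e at h hxs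
  have h1 : e.symm ⁻¹' N ∈ 𝓝 (e (γ s)) := e.tendsto_symm hxs hN
  obtain ⟨δ, hδ, h2⟩ := exists_hball_subset h1
  rw [mem_map, mem_nhdsWithin_iff_exists_mem_nhds_inter]
  refine ⟨ball s (min ε δ), ball_mem_nhds _ (lt_min hε hδ), fun u hu => ?_⟩
  have hu1 := lt_min_iff.1 (Metric.mem_ball.1 hu.1); rw [dist_eq] at hu1
  obtain ⟨k1, k2, k3⟩ := h s hs u hu.2 (by simpa using hε) hu1.1
  have : e (γ u) ∈ e.symm ⁻¹' N := h2 (by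
    change hdist _ _ < δ
    rw [k3, abs_sub_comm]; exact hu1.2)
  rwa [mem_preimage, e.left_inv k2] at this

lemma IsUnitSpeed.mem_of_ball [HasGroupoid M hyperbolicGroupoid] {γ : ℝ → M}
    (hγ : IsUnitSpeed a γ) {e : OpenPartialHomeomorph M ℍ³}
    (hcomp : ∀ y ∈ e.source, ∃ V ∈ 𝓝 y, V ⊆ e.source ∧ ∀ z ∈ V, ∀ z' ∈ V, hdist (e z) (e z') =
        hdist (chartAt ℍ³ y z) (chartAt ℍ³ y z'))
    {C : Set ℍ³} (hK : IsClosed (e.symm '' C)) (hKs : ∀ z ∈ e.symm '' C, z ∈ e.source)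
    {p : ℍ³} {ε : ℝ} (hεC : {q | hdist p q < ε} ⊆ C) {u : ℝ} (hu0 : 0 ≤ u)
    (hu1 : γ u ∈ e.source) (hu2 : hdist p (e (γ u)) < ε / 2) (hu5 : a - ε / 2 < u)
    (hT : T ∈ Ico u a) : γ T ∈ e.symm '' C := by
  have hε : 0 < ε := by linarith [hdist_nonneg p (e (γ u))]
  have hI : Icc u T ⊆ Ico 0 a := fun v hv => ⟨hu0.trans hv.1, hv.2.trans_lt hT.2⟩
  have hγc := hγ.continuousOn.mono hI
  have hF : IsClosed (Icc u T ∩ γ ⁻¹' (e.symm '' C)) :=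
    hγc.preimage_isClosed_of_isClosed isClosed_Icc hK
  have hcl : IsClosed
      ({v | γ v ∈ e.symm '' C ∧ hdist (e (γ u)) (e (γ v)) - (v - u) ≤ 0} ∩ Icc u T) := by
    have h3 : ContinuousOn (fun v => hdist (e (γ u)) (e (γ v)) - (v - u))
        (Icc u T ∩ γ ⁻¹' (e.symm '' C)) := by
      have h6 : ContinuousOn (fun v => (e (γ u), e (γ v))) (Icc u T ∩ γ ⁻¹' (e.symm '' C)) :=
        continuousOn_const.prodMk
          (e.continuousOn.comp (hγc.mono inter_subset_left) fun v hv => hKs _ hv.2)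
      exact (continuous_hdist.comp_continuousOn h6).sub (by fun_prop)
    have h4 := h3.preimage_isClosed_of_isClosed hF (isClosed_Iic (a := (0 : ℝ)))
    have h5 : {v | γ v ∈ e.symm '' C ∧ hdist (e (γ u)) (e (γ v)) - (v - u) ≤ 0} ∩ Icc u T =
        Icc u T ∩ γ ⁻¹' (e.symm '' C) ∩ (fun v => hdist (e (γ u)) (e (γ v)) - (v - u)) ⁻¹' Iic 0 :=
      Set.ext fun v => ⟨fun h => ⟨⟨h.2, h.1.1⟩, h.1.2⟩, fun h => ⟨⟨h.1.2, h.2⟩, h.1.1⟩⟩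
    rw [h5]
    exact h4
  have hsub : Icc u T ⊆ {v | γ v ∈ e.symm '' C ∧ hdist (e (γ u)) (e (γ v)) - (v - u) ≤ 0} := by
    refine IsClosed.Icc_subset_of_forall_exists_gt ?_ ?_ ?_
    · exact hcl
    · refine ⟨⟨e (γ u), hεC (hu2.trans (by linarith)), e.left_inv hu1⟩, ?_⟩
      simp [hdist_self]
    · rintro v ⟨⟨hv1, hv2⟩, hv3⟩ y hy
      have hv0 : v ∈ Ico 0 a := hI (Ico_subset_Icc_self hv3); have hvs := hKs _ hv1
      obtain ⟨V, hV, hVs, hVd⟩ := hcomp _ hvs; obtain ⟨δ, hδ, hd⟩ := hγ v hv0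
      have hlt : hdist p (e (γ v)) < ε := by
        have := hdist_triangle p (e (γ u)) (e (γ v)); have := hT.2; have := hv3.2
        linarith
      have hW : V ∩ {z | z ∈ e.source ∧ hdist p (e z) < ε} ∈ 𝓝 (γ v) := by
        refine inter_mem hV (inter_mem (e.open_source.mem_nhds hvs) ?_)
        exact (e.continuousAt hvs).preimage_mem_nhds 
          ((isOpen_lt (continuous_hdist_right p) continuous_const).mem_nhds hlt)
      have h4 : ∀ᶠ w in 𝓝[>] v, γ w ∈ V ∩ {z | z ∈ e.source ∧ hdist p (e z) < ε} := by
        have := (hγ.continuousOn v hv0) hW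
        have h5 := nhdsGT_le_nhdsWithin_Ico hv0
        exact h5 this
      have h6 : ∀ᶠ w in 𝓝[>] v, w ∈ Ioo v (min (min y T) (v + δ)) :=
        Ioo_mem_nhdsGT (lt_min (lt_min hy hv3.2) (by linarith))
      obtain ⟨w, hw1, hw2⟩ := (h4.and h6).exists; have hw3 := lt_min_iff.1 hw2.2
      have hw4 := lt_min_iff.1 hw3.1
      have hw5 : w ∈ Ico 0 a := ⟨hv0.1.trans hw2.1.le, hw4.2.trans hT.2⟩
      have h7 := hVd _ (mem_of_mem_nhds hV) _ hw1.1
      have h8 := (hd v hv0 w hw5 (by simpa using hδ)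
        (by rw [abs_of_pos (by linarith [hw2.1])]; linarith)).2.2
      rw [h8, abs_sub_comm, abs_of_pos (by linarith [hw2.1])] at h7
      refine ⟨w, ⟨⟨e (γ w), hεC hw1.2.2, e.left_inv hw1.2.1⟩, ?_⟩, hw2.1, hw4.1.le⟩
      have := hdist_triangle (e (γ u)) (e (γ v)) (e (γ w)); linarith
  exact (hsub (right_mem_Icc.2 hT.1)).1

lemma IsUnitSpeed.tendsto [T2Space M] [HasGroupoid M hyperbolicGroupoid] {γ : ℝ → M}
    (ha : 0 < a) (hγ : IsUnitSpeed a γ) {x : M} (hx : ∀ N ∈ 𝓝 x, ∃ᶠ u in 𝓝[<] a, γ u ∈ N) :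
    Tendsto γ (𝓝[<] a) (𝓝 x) := by
  have hxs := mem_chart_source ℍ³ x
  have hcomp : ∀ y ∈ (chartAt ℍ³ x).source, ∃ V ∈ 𝓝 y,
      V ⊆ (chartAt ℍ³ x).source ∧ ∀ z ∈ V, ∀ z' ∈ V, hdist (chartAt ℍ³ x z) (chartAt ℍ³ x z') =
          hdist (chartAt ℍ³ y z) (chartAt ℍ³ y z') :=
    fun y hy => eventually_hdist_chartAt hy
  generalize chartAt ℍ³ x = e at hxs hcomp
  have hloc : LocallyCompactSpace ℍ³ :=
    (isOpen_lt continuous_const continuous_snd : IsOpen {p : ℂ × ℝ | 0 < p.2}).locallyCompactSpace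
  intro N hN
  have h1 : e.symm ⁻¹' N ∩ e.target ∈ 𝓝 (e x) :=
    inter_mem (e.tendsto_symm hxs hN) (e.open_target.mem_nhds (e.map_source hxs))
  obtain ⟨C, hC, hCN, hCc⟩ := local_compact_nhds h1; obtain ⟨ε, hε, hεC⟩ := exists_hball_subset hC
  have hK : IsClosed (e.symm '' C) :=
    (hCc.image_of_continuousOn (e.continuousOn_symm.mono fun p hp => (hCN hp).2)).isClosed
  have hKs : ∀ z ∈ e.symm '' C, z ∈ e.source := by
    rintro _ ⟨p, hp, rfl⟩
    exact e.map_target (hCN hp).2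
  have hball : {z | z ∈ e.source ∧ hdist (e x) (e z) < ε / 2} ∈ 𝓝 x := by
    refine inter_mem (e.open_source.mem_nhds hxs) ?_
    exact (e.continuousAt hxs).preimage_mem_nhds (hball_mem_nhds _ (half_pos hε))
  have hlt : ∀ᶠ u in 𝓝[<] a, max 0 (a - ε / 2) < u ∧ u < a :=
    Ioo_mem_nhdsLT (max_lt ha (by linarith))
  obtain ⟨u, ⟨hu1, hu2⟩, hu3, hu4⟩ := ((hx _ hball).and_eventually hlt).exists
  have hu0 : 0 ≤ u := (le_max_left _ _).trans hu3.le
  have hu5 : a - ε / 2 < u := (le_max_right _ _).trans_lt hu3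
  have key : ∀ T ∈ Ico u a, γ T ∈ e.symm '' C := fun T hT =>
    hγ.mem_of_ball hcomp hK hKs hεC hu0 hu1 hu2 hu5 hT
  rw [mem_map]
  refine mem_of_superset (Ioo_mem_nhdsLT hu4) fun v hv => ?_
  obtain ⟨p, hp, he⟩ := key v ⟨hv.1.le, hv.2⟩; rw [mem_preimage, ← he]
  exact (hCN hp).1

lemma geodesicallyComplete_of_isCompact [T2Space M] [HasGroupoid M hyperbolicGroupoid]
    (h : ∀ (a : ℝ) (γ : ℝ → M), 0 < a → IsUnitSpeed a γ →
      ∃ K, IsCompact K ∧ ∀ u ∈ Ico 0 a, γ u ∈ K) : GeodesicallyComplete M := by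
  intro a γ ha hγ; obtain ⟨K, hK, hγK⟩ := h a γ ha hγ
  have hle : map γ (𝓝[<] a) ≤ 𝓟 K := by
    rw [le_principal_iff, mem_map]
    exact mem_of_superset (Ioo_mem_nhdsLT ha) fun v hv => hγK v ⟨hv.1.le, hv.2⟩
  obtain ⟨x, -, hx⟩ := hK hle
  refine ⟨x, IsUnitSpeed.tendsto ha hγ fun N hN => ?_⟩
  intro hcon; have := clusterPt_iff_frequently.1 hx N hN
  rw [frequently_map] at this
  exact this hcon

end

lemma edgeForm_one_spread (hu : u ∈ idealSimplex) (hu' : u' ∈ idealSimplex)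
    (m : ℤ²) (n : ℤ) : edgeForm 1 (spread m n u) (spread m n u') = 1 - ∑ i, u i * u' i := by
  rw [edgeForm_spread one_pos]; simp only [weight_corner_sub one_pos]
  have h := hu.2; have h' := hu'.2
  simp only [sum_univ_four] at h h' ⊢; simp
  have e : u 3 = 1 - u 0 - u 1 - u 2 := by linarith
  have e' : u' 3 = 1 - u' 0 - u' 1 - u' 2 := by linarith
  rw [e, e']; ring

lemma abs_log_edgeSum_le (hu : u ∈ idealSimplex) (hu' : u' ∈ idealSimplex)
    (m : ℤ²) (n : ℤ) : |log (edgeSum 1 (spread m n u)) - log (edgeSum 1 (spread m n u'))|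
      ≤ 2 * tileDist 1 (spread m n u) (spread m n u') := by
  have h1 := edgeSum_pos one_pos (spread_mem hu m n)
  have h2 := edgeSum_pos one_pos (spread_mem hu' m n)
  have e : ∀ w, edgeForm 1 w w = edgeSum 1 w := fun _ => rfl
  have hB : edgeSum 1 (spread m n u) + edgeSum 1 (spread m n u') ≤
      2 * edgeForm 1 (spread m n u) (spread m n u') := by
    rw [← e, ← e, edgeForm_one_spread hu hu, edgeForm_one_spread hu' hu',
      edgeForm_one_spread hu hu']
    simp only [sum_univ_four]
    nlinarith [sq_nonneg (u 0 - u' 0), sq_nonneg (u 1 - u' 1), sq_nonneg (u 2 - u' 2),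
      sq_nonneg (u 3 - u' 3)]
  rw [tileDist, e, e]
  generalize edgeSum 1 (spread m n u) = a at *
  generalize edgeSum 1 (spread m n u') = b at *
  generalize edgeForm 1 (spread m n u) (spread m n u') = c at *
  have hs : 0 < √(a * b) := sqrt_pos.2 (mul_pos h1 h2); set x := |log a - log b| / 2 with hx
  have hx0 : 0 ≤ x := by positivity
  have hc : cosh x = (a + b) / (2 * √(a * b)) := by
    have hx2 : cosh x = cosh ((log a - log b) / 2) := by
      rw [hx, ← cosh_abs ((log a - log b) / 2), abs_div, abs_two]
    have ea : exp (log a / 2) = √a := by rw [← log_sqrt h1.le, exp_log (sqrt_pos.2 h1)]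
    have eb : exp (log b / 2) = √b := by rw [← log_sqrt h2.le, exp_log (sqrt_pos.2 h2)]
    have ha := sqrt_pos.2 h1; have hb := sqrt_pos.2 h2
    rw [hx2, cosh_eq, neg_div', neg_sub, sub_div, sub_div, exp_sub, exp_sub, ea, eb, sqrt_mul h1.le]
    field_simp; rw [sq_sqrt h1.le, sq_sqrt h2.le]
  have hle : x ≤ arcosh (c / √(a * b)) := by
    rw [← arcosh_cosh hx0, arcosh_le_arcosh (cosh_pos x) (div_pos (by linarith) hs), hc, ← div_div]
    exact div_le_div_of_nonneg_right (by linarith) hs.le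
  linarith

lemma edgeSum_pushAct (hP : 0 < P) (hb : b ∈ tileComplex) (m : ℤ²)
    (n : ℤ) : edgeSum P (pushAct m n b) = P ^ (-n) * edgeSum P b := by
  obtain ⟨m', n', u, hu, rfl⟩ := hb
  rw [pushAct_spread, edgeSum_spread hP, edgeSum_spread hP, neg_add, zpow_add₀ hP.ne', mul_assoc]

lemma exists_nhds_lift {x₀ : BundleLR} (hx₀ : bundleInclusion x₀ = toClosed y)
    {N : Set Point} (hN : N ∈ 𝓝 y) :
    ∀ᶠ x in 𝓝 x₀, ∃ z ∈ N, bundleInclusion x = toClosed z := by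
  have h : toClosed '' N ∈ 𝓝 (bundleInclusion x₀) := by
    rw [hx₀]
    exact isOpenMap_toClosed.image_mem_nhds hN
  filter_upwards [isOpenEmbedding_bundleInclusion.continuous.continuousAt.preimage_mem_nhds h]
    with x hx
  obtain ⟨z, hz, hx⟩ := hx
  exact ⟨z, hz, hx.symm⟩

section
variable {τ : Weights → ℝ} {k : ℝ}

/-- The size of a point of the bundle, which tends to zero in the cusp. -/
def cuspSize (τ : Weights → ℝ) (k : ℝ) (x : BundleLR) : ℝ := edgeSum 1 (wbary τ k (lift x))

lemma cuspSize_eq (hτ : IsHeight τ) (hk : 0 < k) {z : Point} (hz : z ∈ offLattice)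
    {x : BundleLR} (hx : bundleInclusion x = toClosed z) :
    cuspSize τ k x = edgeSum 1 (wbary τ k z) := by
  rw [← toClosed_lift x] at hx; obtain ⟨m, n, rfl⟩ := toClosed_eq_iff.1 hx
  rw [cuspSize, hτ.wbary_pointAct (lift_mem x), edgeSum_pushAct one_pos (wbary_mem hk (lift_mem x))]
  simp

lemma cuspSize_pos (hk : 0 < k) (x : BundleLR) : 0 < cuspSize τ k x :=
  edgeSum_pos one_pos (wbary_mem hk (lift_mem x))

lemma eventually_log_cuspSize_le (hτ : IsHeight τ) (hk : 0 < k)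
    (h : HasDevelopments τ (pointDist 1 k)) (x₀ : BundleLR) : ∀ᶠ x in 𝓝 x₀,
      |log (cuspSize τ k x₀) - log (cuspSize τ k x)| ≤
        2 * hdist ((developedSpace h).chartAt x₀ x₀) ((developedSpace h).chartAt x₀ x) := by
  have hy := lift_mem x₀; have hx₀ := (toClosed_lift x₀).symm
  obtain ⟨c, hc, hyc⟩ := h _ hy
  obtain ⟨N, hN, hNs, hd⟩ := developedSpace_hdist hτ (isTileInvariant_pointDist one_pos k) h hc hyc hx₀
  filter_upwards [exists_nhds_lift hx₀ (inter_mem hN (hτ.eventually_support hy))] with x hx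
  obtain ⟨z, ⟨hzN, hzo, hzs⟩, hxz⟩ := hx
  rw [(hd _ (mem_of_mem_nhds hN) x₀ hx₀).2 z hzN x hxz, cuspSize_eq hτ hk hy hx₀,
    cuspSize_eq hτ hk hzo hxz]
  obtain ⟨m, n, u, hu, u', hu', e, e'⟩ := exists_spread_of_support (bary_mem hy) (bary_mem hzo) hzs
  rw [hc.dist m n u hu u' hu' _ hyc _ (hNs hzN) e e', wbary, wbary, e, e', pointDist, warp_spread,
    warp_spread]
  exact abs_log_edgeSum_le (simplexWarp_mem hk hu).2.1 (simplexWarp_mem hk hu').2.1 m n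

lemma isCompact_le_cuspSize (hτ : IsHeight τ) (hk : 0 < k) {ε : ℝ} (hε : 0 < ε) :
    IsCompact {x : BundleLR | ε ≤ cuspSize τ k x} := by
  set S : Set (Bary) := {u | (∀ i, u i ∈ Icc (0 : ℝ) 1) ∧ ∑ i, u i = 1 ∧ ε ≤ 1 - ∑ i, u i * u i}
    with hS
  have hSi : ∀ u ∈ S, u ∈ idealSimplex := by
    rintro u ⟨h1, h2, h3⟩
    refine ⟨fun i => ⟨(h1 i).1, (h1 i).2.lt_of_ne fun h => ?_⟩, h2⟩
    have := Finset.single_le_sum (f := fun i => u i * u i) (fun j _ => mul_self_nonneg (u j))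
      (Finset.mem_univ i)
    simp only [h] at this; linarith
  have hSc : IsCompact S := by
    have h1 : IsCompact (Set.pi univ fun _ : Fin 4 => Icc (0 : ℝ) 1) :=
      isCompact_univ_pi fun _ => isCompact_Icc
    have h2 : IsClosed {u : Bary | ∑ i, u i = 1 ∧ ε ≤ 1 - ∑ i, u i * u i} :=
      (isClosed_eq (f := fun u : Bary => ∑ i, u i) (by fun_prop) continuous_const).inter
        (isClosed_le (g := fun u : Bary => 1 - ∑ i, u i * u i) continuous_const (by fun_prop))
    convert h1.inter_right h2 using 1
    ext u; simp only [hS, mem_ofPred_eq, mem_inter_iff, mem_univ_pi]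
  have hcont : ∀ n : ℤ, Continuous fun u : S => place τ k (spread 0 n u) := by
    intro n
    refine hτ.continuous_place hk (w := fun u : S => spread 0 n u) (fun r => ?_) ?_
      fun u => spread_mem (hSi u u.2) _ _
    · refine continuous_finsetSum _ fun j _ => ?_
      split_ifs
      · exact (continuous_apply j).comp continuous_subtype_val
      · exact continuous_const
    · refine fun q => ⟨univ, univ_mem, (finite_range (tileVertex 0 n)).subset ?_⟩
      exact fun r ⟨q, hq, _⟩ => mem_range_of_spread_ne_zero hq
  have hcont' : ∀ n : ℤ, Continuous fun u : S => toBundle (place τ k (spread 0 n u)) := by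
    intro n; rw [isOpenEmbedding_bundleInclusion.isInducing.continuous_iff]
    refine (continuous_toClosed.comp (hcont n)).congr fun u => ?_
    exact (bundleInclusion_toBundle (place_mem hk (spread_mem (hSi u u.2) _ _))).symm
  have hcomp : ∀ n : ℤ, IsCompact (range fun u : S => toBundle (place τ k (spread 0 n u))) := by
    intro n; have := isCompact_iff_compactSpace.1 hSc
    exact isCompact_range (hcont' n)
  have hval : ∀ u ∈ idealSimplex, ∀ m n, edgeSum 1 (spread m n u) = 1 - ∑ i, u i * u i :=
    fun u hu m n => edgeForm_one_spread hu hu m n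
  convert (hcomp 0).union (hcomp 1) using 1
  ext x; constructor
  · intro hx
    replace hx : ε ≤ cuspSize τ k x := hx
    obtain ⟨m, n, u, hu, e⟩ := wbary_mem (τ := τ) hk (lift_mem x)
    have huS : u ∈ S := by
      refine ⟨fun i => ⟨(hu.1 i).1, (hu.1 i).2.le⟩, hu.2, ?_⟩
      rwa [cuspSize, e, hval u hu] at hx
    have key : ∀ q j : ℤ, n = 2 * q + j → toBundle (place τ k (spread 0 j u)) = x := by
      intro q j hq
      apply isOpenEmbedding_bundleInclusion.injective
      rw [bundleInclusion_toBundle (place_mem hk (spread_mem hu _ _)), ← toClosed_lift x,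
        toClosed_eq_iff]
      refine ⟨m, q, ?_⟩
      rw [← hτ.place_pushAct hk (spread_mem hu _ _), pushAct_spread, map_zero, zero_add, ← hq, ← e,
        hτ.place_wbary hk (lift_mem x)]
    rcases Int.even_or_odd' n with ⟨q, hq | hq⟩
    · exact Or.inl ⟨⟨u, huS⟩, key q 0 (by omega)⟩
    · exact Or.inr ⟨⟨u, huS⟩, key q 1 (by omega)⟩
  · have key : ∀ (n : ℤ) (u : S), ε ≤ cuspSize τ k (toBundle (place τ k (spread 0 n u))) := by
      intro n u; have hu := hSi u u.2
      have hw := spread_mem hu 0 n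
      rw [cuspSize_eq hτ hk (place_mem hk hw) (bundleInclusion_toBundle (place_mem hk hw)),
        hτ.wbary_place hk hw, hval _ hu]
      exact u.2.2.2
    rintro (⟨u, rfl⟩ | ⟨u, rfl⟩)
    · exact key 0 u
    · exact key 1 u

lemma geodesicallyComplete_developedSpace (hτ : IsHeight τ) (hk : 0 < k)
    (h : HasDevelopments τ (pointDist 1 k)) :
    @GeodesicallyComplete BundleLR _ (developedSpace h) := by
  let _ := developedSpace h
  have : HasGroupoid BundleLR hyperbolicGroupoid :=
    developedSpace_hasGroupoid hτ (isTileInvariant_pointDist one_pos k) h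
  refine geodesicallyComplete_of_isCompact fun a γ ha hγ => ?_
  set f : ℝ → ℝ := fun s => log (cuspSize τ k (γ s)) with hf
  have hloc : ∀ s ∈ Ico 0 a, ∀ᶠ u in 𝓝[Ico 0 a] s, |f s - f u| ≤ 2 * |s - u| := by
    intro s hs; obtain ⟨ε, hε, hd⟩ := hγ s hs
    have h1 := (hγ.continuousOn s hs).eventually (eventually_log_cuspSize_le hτ hk h (γ s))
    have h2 : ∀ᶠ u in 𝓝[Ico 0 a] s, |u - s| < ε :=
      mem_nhdsWithin_of_mem_nhds (ball_mem_nhds s hε)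
    filter_upwards [h1, h2, self_mem_nhdsWithin] with u hu1 hu2 hu3
    rwa [← (hd s hs u hu3 (by simpa using hε) hu2).2.2]
  have hfc : ContinuousOn f (Ico 0 a) := by
    intro s hs
    refine tendsto_iff_dist_tendsto_zero.2 ?_
    have h3 : Tendsto (fun u => 2 * |s - u|) (𝓝[Ico 0 a] s) (𝓝 0) := by
      have : ContinuousAt (fun u => 2 * |s - u|) s := by fun_prop
      simpa using this.tendsto.mono_left nhdsWithin_le_nhds
    refine squeeze_zero' (Eventually.of_forall fun u => dist_nonneg) ?_ h3
    filter_upwards [hloc s hs] with u hu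
    rwa [dist_comm, dist_eq]
  have hbound : ∀ T ∈ Ico 0 a, f 0 - 2 * T ≤ f T := by
    intro T hT; have hI : Icc 0 T ⊆ Ico 0 a := fun v hv => ⟨hv.1, hv.2.trans_lt hT.2⟩
    have hsub : Icc 0 T ⊆ {v | f 0 - 2 * v ≤ f v} := by
      refine IsClosed.Icc_subset_of_forall_exists_gt ?_ ?_ ?_
      · rw [inter_comm]
        exact isClosed_Icc.isClosed_le (by fun_prop) (hfc.mono hI)
      · simp
      · rintro v ⟨hv1, hv2⟩ y hy
        have hv0 : v ∈ Ico 0 a := hI (Ico_subset_Icc_self hv2)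
        have h5 := nhdsGT_le_nhdsWithin_Ico hv0
        have h6 : ∀ᶠ w in 𝓝[>] v, w ∈ Ioc v y := Ioc_mem_nhdsGT hy
        obtain ⟨w, hw1, hw2⟩ := ((hloc v hv0).filter_mono h5 |>.and h6).exists
        refine ⟨w, ?_, hw2⟩
        replace hv1 : f 0 - 2 * v ≤ f v := hv1
        have := (abs_le.1 hw1).2; rw [abs_sub_comm, abs_of_pos (by linarith [hw2.1])] at this
        change f 0 - 2 * w ≤ f w
        linarith
    exact hsub (right_mem_Icc.2 hT.1)
  refine ⟨_, isCompact_le_cuspSize hτ hk (exp_pos (f 0 - 2 * a)), fun u hu => ?_⟩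
  have := hbound u hu; rw [mem_ofPred_eq, ← le_log_iff_exp_le (cuspSize_pos hk _)]
  linarith [hu.2]

end

/-! ### The star of a vertex -/

/-- The neighbours of `0` are `±starRay n`. -/
def starRay (n : ℤ) : ℤ² := (fibZ ^ n) (0, 1)

lemma fibZ_starRay (m n : ℤ) : (fibZ ^ m) (starRay n) = starRay (m + n) :=
  (fibZ_zpow_add_apply m n _).symm

lemma starRay_zero : starRay 0 = (0, 1) := by simp [starRay]

lemma starRay_one : starRay 1 = (1, 0) := by rw [starRay, zpow_one]; rfl

lemma starRay_neg_one : starRay (-1) = (1, -1) := by rw [starRay, zpow_neg_one]; rfl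

lemma starRay_add_two (n : ℤ) : starRay (n + 2) = starRay n + starRay (n + 1) := by
  have : starRay 2 = starRay 0 + starRay 1 := by
    rw [starRay_zero, starRay_one, ← one_add_one_eq_two, ← fibZ_starRay, starRay_one, zpow_one]; rfl
  rw [← fibZ_starRay, this, map_add, fibZ_starRay, fibZ_starRay, add_zero]

lemma eigenform_starRay (n : ℤ) : eigenform (starRay n) = goldenRatio ^ n := by
  rw [starRay, eigenform_fibZ_zpow]; simp [eigenform]

lemma weight_starRay (hP : 0 < P) (n : ℤ) : weight P (starRay n) = P ^ (-n) := by
  rw [starRay, weight_fibZ_zpow hP, weight_zero_one, mul_one]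

lemma eigenform_unit_smul (ε : ℤˣ) (d : ℤ²) :
    eigenform ((ε : ℤ) • d) = ((ε : ℤ) : ℝ) * eigenform d := by
  simp [eigenform]; ring

lemma unit_smul_starRay_ne_zero (ε : ℤˣ) (n : ℤ) : (ε : ℤ) • starRay n ≠ 0 := by
  intro h; have h1 := eigenform_starRay n
  have : starRay n = 0 := by rcases units_eq_one_or ε with rfl | rfl <;> simpa using h
  rw [this] at h1; have := zpow_pos goldenRatio_pos n
  simp [eigenform] at h1
  linarith

lemma unit_smul_starRay_eq_iff {ε ε' : ℤˣ} :
    (ε : ℤ) • starRay n = (ε' : ℤ) • starRay n' ↔ ε = ε' ∧ n = n' := by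
  refine ⟨fun h => ?_, fun ⟨h1, h2⟩ => by rw [h1, h2]⟩
  have h1 := congrArg eigenform h
  rw [eigenform_unit_smul, eigenform_unit_smul, eigenform_starRay, eigenform_starRay] at h1
  have hp := zpow_pos goldenRatio_pos n; have hp' := zpow_pos goldenRatio_pos n'
  have key : goldenRatio ^ n = goldenRatio ^ n' → n = n' := fun h =>
    zpow_right_injective₀ goldenRatio_pos one_lt_goldenRatio.ne' h
  rcases units_eq_one_or ε with rfl | rfl <;> rcases units_eq_one_or ε' with rfl | rfl <;>
    simp at h1
  · exact ⟨rfl, key h1⟩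
  · linarith
  · linarith
  · exact ⟨rfl, key h1⟩

/-- The vertices of the tetrahedra with vertex `0`. -/
def starTile (k : ℤ) (ε δ : ℤˣ) : Fin 4 → ℤ² :=
  ![0, (ε : ℤ) • starRay k, (δ : ℤ) • starRay (k + 1), (ε : ℤ) • starRay (k + 2)]

/-- The vertex of a tetrahedron that lies at `0`, for given signs, and the position of the other
vertices. -/
def starPerm (i : Fin 4) : ℤ × ℤˣ × ℤˣ × Equiv.Perm (Fin 4) :=
  ![(0, 1, 1, 1), (-1, 1, -1, ⟨![1, 2, 0, 3], ![2, 0, 1, 3], by decide, by decide⟩),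
    (-1, -1, 1, ⟨![2, 1, 3, 0], ![3, 1, 0, 2], by decide, by decide⟩),
    (0, -1, -1, ⟨![3, 2, 1, 0], ![3, 2, 1, 0], by decide, by decide⟩)] i

lemma corner_starPerm (i j : Fin 4) : corner ((starPerm i).2.2.2 j) - corner i =
    starTile (starPerm i).1 (starPerm i).2.1 (starPerm i).2.2.1 j := by
  have h2 : starRay 2 = (1, 1) := by
    rw [show (2 : ℤ) = 0 + 2 from rfl, starRay_add_two, zero_add, starRay_zero, starRay_one]; rfl
  fin_cases i <;> fin_cases j <;>
    simp [starPerm, starTile, corner, starRay_zero, starRay_one, starRay_neg_one, h2]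

lemma fibZ_starTile (n k : ℤ) (ε δ : ℤˣ) (j : Fin 4) :
    (fibZ ^ n) (starTile k ε δ j) = starTile (n + k) ε δ j := by
  fin_cases j
  · exact map_zero _
  · change (fibZ ^ n) ((ε : ℤ) • starRay k) = (ε : ℤ) • starRay (n + k)
    rw [map_zsmul, fibZ_starRay]
  · change (fibZ ^ n) ((δ : ℤ) • starRay (k + 1)) = (δ : ℤ) • starRay (n + k + 1)
    rw [map_zsmul, fibZ_starRay, add_assoc]
  · change (fibZ ^ n) ((ε : ℤ) • starRay (k + 2)) = (ε : ℤ) • starRay (n + k + 2)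
    rw [map_zsmul, fibZ_starRay, add_assoc]

lemma tileVertex_starPerm (n : ℤ) (i j : Fin 4) :
    tileVertex (-(fibZ ^ n) (corner i)) n ((starPerm i).2.2.2 j) =
      starTile (n + (starPerm i).1) (starPerm i).2.1 (starPerm i).2.2.1 j := by
  rw [tileVertex, ← fibZ_starTile, ← corner_starPerm, map_sub, sub_eq_add_neg]

lemma exists_starPerm (ε δ : ℤˣ) : ∃ i, (starPerm i).2.1 = ε ∧ (starPerm i).2.2.1 = δ := by
  revert ε δ; decide

/-- `b` has coordinates `u` in a tetrahedron with vertex `0`. -/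
structure IsStarForm (b : Weights) (k : ℤ) (ε δ : ℤˣ) (u : Bary) : Prop where
  mem : u ∈ idealSimplex
  eq : ∃ m n, ∃ e : Equiv.Perm (Fin 4), (∀ i, tileVertex m n (e i) = starTile k ε δ i) ∧
    b = spread m n (fun i => u (e.symm i))

lemma comp_perm_mem (hu : u ∈ idealSimplex) (e : Equiv.Perm (Fin 4)) :
    (fun i => u (e i)) ∈ idealSimplex :=
  ⟨fun i => hu.1 (e i), by rw [← hu.2]; exact sum_comp e u⟩

/-- Two points of a common tetrahedron with vertex `0`. -/
lemma exists_isStarForm_pair (hu : u ∈ idealSimplex) (hu' : u' ∈ idealSimplex)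
    (h0 : spread m n u 0 ≠ 0) : ∃ k ε δ v v', IsStarForm (spread m n u) k ε δ v ∧
      IsStarForm (spread m n u') k ε δ v' := by
  obtain ⟨i, hi⟩ := mem_range_of_spread_ne_zero h0
  obtain rfl := eq_neg_of_tileVertex_eq_zero hi
  exact ⟨_, _, _, _, _, ⟨comp_perm_mem hu (starPerm i).2.2.2, _, _, (starPerm i).2.2.2,
    tileVertex_starPerm n i, by simp⟩, ⟨comp_perm_mem hu' (starPerm i).2.2.2, _, _,
    (starPerm i).2.2.2, tileVertex_starPerm n i, by simp⟩⟩

lemma exists_isStarForm (hb : b ∈ tileComplex) (h0 : b 0 ≠ 0) :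
    ∃ k ε δ u, IsStarForm b k ε δ u := by
  obtain ⟨m, n, u, hu, rfl⟩ := hb
  obtain ⟨k, ε, δ, v, -, h, -⟩ := exists_isStarForm_pair hu hu h0
  exact ⟨k, ε, δ, v, h⟩

lemma exists_isStarForm' (hu : u ∈ idealSimplex) (k : ℤ) (ε δ : ℤˣ) :
    ∃ b, IsStarForm b k ε δ u := by
  obtain ⟨i, rfl, rfl⟩ := exists_starPerm ε δ
  refine ⟨_, hu, -(fibZ ^ (k - (starPerm i).1)) (corner i), k - (starPerm i).1,
    (starPerm i).2.2.2, fun j => ?_, rfl⟩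
  rw [tileVertex_starPerm, sub_add_cancel]

namespace IsStarForm
variable {b b' : Weights} {k : ℤ} {ε δ : ℤˣ} {u u' : Bary}

lemma mem_tileComplex (h : IsStarForm b k ε δ u) : b ∈ tileComplex := by
  obtain ⟨m, n, e, he, rfl⟩ := h.eq
  exact spread_mem (comp_perm_mem h.mem e.symm) m n

lemma finsum {M : Type*} [AddCommMonoid M] (h : IsStarForm b k ε δ u) (F : ℤ² → ℝ → M)
    (hF : ∀ r, F r 0 = 0) : ∑ᶠ r, F r (b r) = ∑ i, F (starTile k ε δ i) (u i) := by
  obtain ⟨m, n, e, he, rfl⟩ := h.eq; rw [finsum_spread F hF, ← sum_comp e]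
  simp [he]

lemma apply (h : IsStarForm b k ε δ u) (i : Fin 4) : b (starTile k ε δ i) = u i := by
  obtain ⟨m, n, e, he, rfl⟩ := h.eq; rw [← he, spread_vertex, Equiv.symm_apply_apply]

lemma eq_zero (h : IsStarForm b k ε δ u) (hr : r ∉ range (starTile k ε δ)) : b r = 0 := by
  obtain ⟨m, n, e, he, rfl⟩ := h.eq
  refine spread_of_notMem _ ?_
  rintro ⟨i, rfl⟩
  exact hr ⟨e.symm i, by rw [← he, apply_symm_apply]⟩

lemma eq_sum (h : IsStarForm b k ε δ u) (r : ℤ²) :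
    b r = ∑ i, if starTile k ε δ i = r then u i else 0 := by
  obtain ⟨m, n, e, he, rfl⟩ := h.eq; rw [spread, ← sum_comp e]
  simp [he]

lemma warp (h : IsStarForm b k ε δ u) (κ : ℝ) (hκ : 0 < κ) :
    IsStarForm (warp κ b) k ε δ (simplexWarp κ u) := by
  obtain ⟨m, n, e, he, rfl⟩ := h.eq
  refine ⟨(simplexWarp_mem hκ h.mem).2.1, m, n, e, he, ?_⟩
  rw [warp_spread]
  congr 1
  ext i; rw [simplexWarp, simplexWarp, sum_comp e.symm fun i => stretch κ (u i)]

lemma pairSum_eq (h : IsStarForm b k ε δ u) (h' : IsStarForm b' k ε δ u')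
    (G : ℤ² → Weights) : pairSum G b b' =
      ∑ i, ∑ j, G (starTile k ε δ i) (starTile k ε δ j) * u i * u' j := by
  rw [pairSum, h.finsum (fun r t => ∑ᶠ r', G r r' * t * b' r') (by simp)]
  refine sum_congr rfl fun i _ => ?_
  rw [h'.finsum (fun r' t => G (starTile k ε δ i) r' * u i * t) (by simp)]

end IsStarForm

lemma weight_starTile (hP : 0 < P) (k : ℤ) (ε δ : ℤˣ) (i j : Fin 4) :
    weight P (starTile k ε δ i - starTile k ε δ j) = P ^ (-k) *
      (let d := if ε = δ then P else (P ^ 2)⁻¹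
       let d' := if ε = δ then 1 else (P ^ 3)⁻¹
       !![0, 1, P⁻¹, (P ^ 2)⁻¹; 1, 0, d, P⁻¹; P⁻¹, d, 0, d'; (P ^ 2)⁻¹, P⁻¹, d', 0] i j) := by
  have key : ∀ i' : Fin 4, starTile k (starPerm i').2.1 (starPerm i').2.2.1 i -
      starTile k (starPerm i').2.1 (starPerm i').2.2.1 j = (fibZ ^ (k - (starPerm i').1))
        (corner ((starPerm i').2.2.2 i) - corner ((starPerm i').2.2.2 j)) := by
    intro i'
    have h := fibZ_starTile (k - (starPerm i').1) (starPerm i').1 (starPerm i').2.1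
      (starPerm i').2.2.1
    rw [sub_add_cancel] at h
    rw [← h, ← h, ← map_sub, ← corner_starPerm, ← corner_starPerm, sub_sub_sub_cancel_right]
  obtain ⟨i', rfl, rfl⟩ := exists_starPerm ε δ
  rw [key, weight_fibZ_zpow hP, weight_corner_sub hP, neg_sub', sub_neg_eq_add, zpow_add₀ hP.ne',
    mul_assoc]
  congr 1
  have h11 : (1 : ℤˣ) ≠ -1 := by decide
  fin_cases i' <;> fin_cases i <;> fin_cases j <;>
    simp [starPerm, h11, h11.symm] <;> field_simp

/-- The norm form, `(-1) ^ n` on `±starRay n`. -/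
def normForm (d : ℤ²) : ℤ := d.2 ^ 2 + d.1 * d.2 - d.1 ^ 2

lemma normForm_starRay (n : ℤ) : normForm (starRay n) = if Even n then 1 else -1 := by
  have h1 : ∀ d, normForm (fibZ d) = -normForm d := by intro d; simp [normForm, fibZ_apply]; ring
  have h2 : ∀ n, normForm (starRay (n + 1)) = -normForm (starRay n) := by
    intro n; rw [add_comm, ← fibZ_starRay, zpow_one, h1]
  induction n using Int.induction_on with
  | zero => simp [starRay_zero, normForm]
  | succ k ih =>
    rw [h2, ih]
    by_cases h : Even (k : ℤ)
    · rw [if_pos h, if_neg (by rw [Int.even_add_one]; exact not_not.2 h)]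
    · rw [if_neg h, if_pos (by rwa [Int.even_add_one])]; rfl
  | pred k ih =>
    have := h2 (-k - 1); rw [sub_add_cancel, ih] at this
    have e : Even (-(k : ℤ)) ↔ ¬Even (-(k : ℤ) - 1) := by rw [← Int.even_add_one, sub_add_cancel]
    by_cases h : Even (-(k : ℤ) - 1)
    · rw [if_neg (by rw [e]; exact not_not.2 h)] at this
      rw [if_pos h]; omega
    · rw [if_pos (e.2 h)] at this
      rw [if_neg h]; omega

lemma normForm_unit_smul (ε : ℤˣ) (d : ℤ²) : normForm ((ε : ℤ) • d) = normForm d := by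
  rcases units_eq_one_or ε with rfl | rfl <;> simp [normForm]

/-- The coordinate along the axis of `±starRay n`. -/
def axisCoord (n : ℤ) (v : ℝ × ℝ) : ℝ := if Even n then v.1 else v.2

lemma axisCoord_add_one (n : ℤ) (v : ℝ × ℝ) :
    axisCoord (n + 1) v = if Even n then v.2 else v.1 := by
  rw [axisCoord]
  by_cases hn : Even n
  · rw [if_pos hn, if_neg (by rw [Int.even_add_one]; exact not_not.2 hn)]
  · rw [if_neg hn, if_pos (by rwa [Int.even_add_one])]

lemma axisCoord_add_two (n : ℤ) : axisCoord (n + 2) = axisCoord n := by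
  ext v; simp [axisCoord]

lemma axisCoord_ext {v' : ℝ × ℝ} (h : axisCoord n v = axisCoord n v')
    (h' : axisCoord (n + 1) v = axisCoord (n + 1) v') : v = v' := by
  by_cases hn : Even n <;> simp only [axisCoord_add_one] at h' <;> simp [axisCoord, hn] at h h'
  · exact Prod.ext h h'
  · exact Prod.ext h' h

lemma axisCoord_smul (n : ℤ) (a : ℝ) (v : ℝ × ℝ) : axisCoord n (a • v) = a * axisCoord n v := by
  unfold axisCoord; split_ifs <;> simp

lemma axisCoord_add (n : ℤ) (v v' : ℝ × ℝ) :
    axisCoord n (v + v') = axisCoord n v + axisCoord n v' := by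
  unfold axisCoord; split_ifs <;> simp

lemma abs_axisCoord_le (n : ℤ) (v : ℝ × ℝ) : |axisCoord n v| ≤ ‖v‖ := by
  unfold axisCoord
  split_ifs
  · exact norm_fst_le v
  · exact norm_snd_le v

lemma norm_le_axisCoord (n : ℤ) (v : ℝ × ℝ) : ‖v‖ ≤ max |axisCoord n v| |axisCoord (n + 1) v| := by
  rw [Prod.norm_def, axisCoord_add_one, axisCoord]
  split_ifs
  · exact le_rfl
  · exact (max_comm _ _).le

/-- The sign of a unit as a real number. -/
def unitR (ε : ℤˣ) : ℝ := ((ε : ℤ) : ℝ)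

lemma unitR_mul_self (ε : ℤˣ) : unitR ε * unitR ε = 1 := by
  rcases units_eq_one_or ε with rfl | rfl <;> simp [unitR]

lemma abs_unitR (ε : ℤˣ) : |unitR ε| = 1 := by
  rcases units_eq_one_or ε with rfl | rfl <;> simp [unitR]

/-- The vector of a lattice point in the link of `0`, scaled by the weight. -/
def linkVec (P : ℝ) (r : ℤ²) : ℝ × ℝ :=
  (√(weight P r) * (SignType.sign (eigenform r) : ℝ)) • if 0 < normForm r then (1, 0) else (0, 1)

lemma sign_eigenform (ε : ℤˣ) (n : ℤ) :
    (SignType.sign (eigenform ((ε : ℤ) • starRay n)) : ℝ) = unitR ε := by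
  have := zpow_pos goldenRatio_pos n; rw [eigenform_unit_smul, eigenform_starRay]
  rcases units_eq_one_or ε with rfl | rfl <;> simp [unitR, this, sign_pos, sign_neg]

lemma weight_unit_smul_starRay (hP : 0 < P) (ε : ℤˣ) (n : ℤ) :
    weight P ((ε : ℤ) • starRay n) = P ^ (-n) := by
  rcases units_eq_one_or ε with rfl | rfl <;> simp [weight_starRay hP, weight_neg]

lemma sqrt_weight {p : ℝ} (hp : 0 < p) (ε : ℤˣ) (n : ℤ) :
    √(weight (p ^ 2) ((ε : ℤ) • starRay n)) = p ^ (-n) := by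
  have h : (p ^ 2) ^ (-n) = (p ^ (-n)) ^ 2 := by
    rw [← zpow_natCast, ← zpow_natCast, ← zpow_mul, ← zpow_mul, mul_comm]
  rw [weight_unit_smul_starRay (by positivity), h, sqrt_sq (by positivity)]

lemma linkVec_zero (P : ℝ) : linkVec P 0 = 0 := by simp [linkVec, weight_zero]

lemma axisCoord_linkVec {p : ℝ} (hp : 0 < p) (ε : ℤˣ) (n : ℤ) :
    axisCoord n (linkVec (p ^ 2) ((ε : ℤ) • starRay n)) = p ^ (-n) * unitR ε ∧
      axisCoord (n + 1) (linkVec (p ^ 2) ((ε : ℤ) • starRay n)) = 0 := by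
  rw [linkVec, axisCoord_smul, axisCoord_smul, sqrt_weight hp, sign_eigenform, normForm_unit_smul,
    normForm_starRay]
  simp only [axisCoord_add_one]
  by_cases hn : Even n <;> simp [axisCoord, hn]

/-- The barycentric coordinate at `1` in the strip triangulation of a quadrant. -/
def clip (P A B : ℝ) : ℝ :=
  max 0 (min A (min ((P - P * B - A) / (P - 1)) ((P * A + P * B - 1) / (P - 1))))

/-- The barycentric coordinates of a point of the link. -/
def linkHat (p : ℝ) (v : ℝ × ℝ) (r : ℤ²) : ℝ :=
  open Classical in
  if ∃ (ε : ℤˣ) (n : ℤ), r = (ε : ℤ) • starRay n then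
    clip (p ^ 2) ((SignType.sign (eigenform r) : ℝ) * (if 0 < normForm r then v.1 else v.2) *
      √(weight (p ^ 2) r)) (|if 0 < normForm r then v.2 else v.1| * (√(weight (p ^ 2) r) / p))
  else 0

lemma linkHat_starRay {p : ℝ} (hp : 0 < p) (v : ℝ × ℝ) (ε : ℤˣ) (n : ℤ) :
    linkHat p v ((ε : ℤ) • starRay n) = clip (p ^ 2) (unitR ε * axisCoord n v * p ^ (-n))
      (|axisCoord (n + 1) v| * p ^ (-n - 1)) := by
  rw [linkHat, if_pos ⟨ε, n, rfl⟩, sqrt_weight hp, sign_eigenform, normForm_unit_smul,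
    normForm_starRay, zpow_sub_one₀ hp.ne', ← div_eq_mul_inv]
  simp only [axisCoord_add_one]
  by_cases hn : Even n <;> simp [axisCoord, hn]

lemma linkHat_of_not (p : ℝ) (v : ℝ × ℝ)
    (h : ¬∃ (ε : ℤˣ) (n : ℤ), r = (ε : ℤ) • starRay n) : linkHat p v r = 0 := if_neg h

lemma continuous_clip (P : ℝ) : Continuous fun x : ℝ × ℝ => clip P x.1 x.2 := by
  unfold clip
  fun_prop

lemma continuous_linkHat (p : ℝ) (r : ℤ²) : Continuous fun v => linkHat p v r := by
  unfold linkHat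
  split_ifs
  · exact (continuous_clip _).comp (f := fun v : ℝ × ℝ => ((SignType.sign (eigenform r) : ℝ) *
      v.1 * √(weight (p ^ 2) r), |v.2| * (√(weight (p ^ 2) r) / p))) (by fun_prop)
  · exact (continuous_clip _).comp (f := fun v : ℝ × ℝ => ((SignType.sign (eigenform r) : ℝ) *
      v.2 * √(weight (p ^ 2) r), |v.1| * (√(weight (p ^ 2) r) / p))) (by fun_prop)
  · exact continuous_const

lemma clip_of_nonpos (B : ℝ) (h : A ≤ 0) : clip P A B = 0 :=
  max_eq_left ((min_le_left _ _).trans h)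

lemma clip_of_ge (hP : 1 < P) (h : P ≤ P * B + A) : clip P A B = 0 :=
  max_eq_left ((min_le_right _ _).trans ((min_le_left _ _).trans
    (div_nonpos_of_nonpos_of_nonneg (by linarith) (by linarith))))

lemma clip_of_le (hP : 1 < P) (h : P * A + P * B ≤ 1) : clip P A B = 0 :=
  max_eq_left ((min_le_right _ _).trans ((min_le_right _ _).trans
    (div_nonpos_of_nonpos_of_nonneg (by linarith) (by linarith))))

lemma clip_eq {x : ℝ} (hP : 1 < P) (hx : 0 ≤ x) (h1 : x ≤ A) (h2 : x * (P - 1) ≤ P - P * B - A)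
    (h3 : x * (P - 1) ≤ P * A + P * B - 1) (h : x = A ∨ x * (P - 1) = P - P * B - A ∨
      x * (P - 1) = P * A + P * B - 1) : clip P A B = x := by
  have hP' : 0 < P - 1 := by linarith
  have e2 := (le_div_iff₀ hP').2 h2; have e3 := (le_div_iff₀ hP').2 h3
  refine le_antisymm (max_le hx ?_) (le_max_of_le_right (le_min h1 (le_min e2 e3)))
  rcases h with h | h | h
  · rw [h]; exact min_le_left _ _
  · rw [(eq_div_iff hP'.ne').2 h]; exact (min_le_right _ _).trans (min_le_left _ _)
  · rw [(eq_div_iff hP'.ne').2 h]; exact (min_le_right _ _).trans (min_le_right _ _)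

/-- The three values in a triangle, for the exponents `0, 1, 2` and all others. -/
lemma clip_even {x y z : ℝ} (hP : 1 < P) (hx : 0 ≤ x) (hy : 0 ≤ y) (hz : 0 ≤ z)
    (hs : x + y + z = 1) (i : ℤ) : clip P ((x + P * z) * P ^ (-i)) (y * P ^ (-i)) =
      if i = 0 then x else if i = 1 then z else 0 := by
  have hP0 : 0 < P := by linarith
  rcases lt_trichotomy i 0 with hi | rfl | hi
  · rw [if_neg hi.ne, if_neg (by omega)]
    refine clip_of_ge hP ?_
    have h1 : P ^ (1 : ℤ) ≤ P ^ (-i) := zpow_le_zpow_right₀ hP.le (by omega)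
    rw [zpow_one] at h1; have h2 : 1 ≤ P * y + x + P * z := by nlinarith
    nlinarith
  · rw [if_pos rfl, neg_zero, zpow_zero, mul_one, mul_one]
    obtain rfl : y = 1 - x - z := by linarith
    have h1 : 0 ≤ P * (P - 1) * z := mul_nonneg (mul_nonneg hP0.le (by linarith)) hz
    refine clip_eq hP hx (by nlinarith) ?_ ?_ (Or.inr (Or.inl ?_)) <;> nlinarith
  · rw [if_neg hi.ne']
    rcases (show 1 ≤ i by omega).eq_or_lt with rfl | hi
    · rw [if_pos rfl, zpow_neg_one]
      have e1 : (x + P * z) * P⁻¹ = x * P⁻¹ + z := by field_simp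
      have hq : 0 < P⁻¹ := inv_pos.2 hP0; have hq1 : P * P⁻¹ = 1 := mul_inv_cancel₀ hP0.ne'
      have hq2 : P⁻¹ < 1 := inv_lt_one_of_one_lt₀ hP; rw [e1]
      have e2 : P * (y * P⁻¹) = y := by rw [mul_comm y, ← mul_assoc, hq1, one_mul]
      have e3 : P * (x * P⁻¹ + z) = x + P * z := by
        rw [mul_add, mul_comm x, ← mul_assoc, hq1, one_mul]
      refine clip_eq hP hz (by nlinarith) ?_ ?_ (Or.inr (Or.inr ?_))
      · rw [e2]; nlinarith
      · rw [e2, e3]; nlinarith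
      · rw [e2, e3]; nlinarith
    · rw [if_neg (by omega)]
      refine clip_of_le hP ?_
      have h1 : P ^ (-i) ≤ P ^ (-2 : ℤ) := zpow_le_zpow_right₀ hP.le (by omega)
      have h2 : P * P * P ^ (-2 : ℤ) = 1 := by rw [zpow_neg]; field_simp
      have h3 : x + P * z + y ≤ P := by nlinarith
      have h4 : 0 ≤ x + P * z + y := by positivity
      calc P * ((x + P * z) * P ^ (-i)) + P * (y * P ^ (-i)) = P * (x + P * z + y) * P ^ (-i) := by
            ring
        _ ≤ P * P * P ^ (-2 : ℤ) := by gcongr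
        _ = 1 := h2

lemma clip_odd {x y z : ℝ} (hP : 1 < P) (hx : 0 ≤ x) (hy : 0 ≤ y) (hz : 0 ≤ z)
    (hs : x + y + z = 1) (i : ℤ) : clip P (y * P ^ (-i)) ((x + P * z) * P ^ (-i - 1)) =
      if i = 0 then y else 0 := by
  have hP0 : 0 < P := by linarith
  have e : P * ((x + P * z) * P ^ (-i - 1)) = (x + P * z) * P ^ (-i) := by
    rw [zpow_sub_one₀ hP0.ne']; field_simp
  rcases lt_trichotomy i 0 with hi | rfl | hi
  · rw [if_neg hi.ne]
    refine clip_of_ge hP ?_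
    rw [e]; have h1 : P ^ (1 : ℤ) ≤ P ^ (-i) := zpow_le_zpow_right₀ hP.le (by omega)
    rw [zpow_one] at h1; have h2 : 1 ≤ x + P * z + y := by nlinarith
    nlinarith
  · rw [if_pos rfl]
    refine clip_eq hP hy (by simp) ?_ ?_ (Or.inl (by simp))
    · rw [e]; simp; nlinarith
    · rw [e]; simp; nlinarith
  · rw [if_neg hi.ne']
    refine clip_of_le hP ?_
    rw [e]; have h1 : P ^ (-i) ≤ P ^ (-1 : ℤ) := zpow_le_zpow_right₀ hP.le (by omega)
    have h2 : P * P ^ (-1 : ℤ) = 1 := by rw [zpow_neg_one]; exact mul_inv_cancel₀ hP0.ne'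
    have h3 : P * y + x + P * z ≤ P := by nlinarith
    have h4 : 0 ≤ P * y + x + P * z := by positivity
    calc P * (y * P ^ (-i)) + (x + P * z) * P ^ (-i) = (P * y + x + P * z) * P ^ (-i) := by ring
      _ ≤ P * P ^ (-1 : ℤ) := by gcongr
      _ = 1 := h2

/-- `v` has barycentric coordinates `x, y, z` in a triangle of the link of `0`. -/
structure IsLinkForm (p : ℝ) (v : ℝ × ℝ) (k : ℤ) (ε δ : ℤˣ) (a : Bary) : Prop where
  zero : a 0 = 0
  nonneg : ∀ i, 0 ≤ a i
  sum : a 1 + a 2 + a 3 = 1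
  fst : axisCoord k v = unitR ε * p ^ k * (a 1 + p ^ 2 * a 3)
  snd : axisCoord (k + 1) v = unitR δ * p ^ (k + 1) * a 2

lemma starTile_injective (k : ℤ) (ε δ : ℤˣ) : Function.Injective (starTile k ε δ) := by
  intro i j h; have h0 := unit_smul_starRay_ne_zero
  fin_cases i <;> fin_cases j <;>
    simp only [starTile, Fin.zero_eta, Fin.mk_one, Fin.reduceFinMk, cons_val,
      unit_smul_starRay_eq_iff] at h <;>
    first
      | rfl
      | exact absurd h (h0 _ _)
      | exact absurd h.symm (h0 _ _)
      | (exfalso; omega)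

lemma finsum_ite_injective {f : Fin 4 → ℤ²} (hf : Function.Injective f) {g : Weights}
    {a : Bary} (hg : ∀ r, g r = ∑ i, if f i = r then a i else 0) (F : ℤ² → ℝ → ℝ)
    (hF : ∀ r, F r 0 = 0) : ∑ᶠ r, F r (g r) = ∑ i, F (f i) (a i) := by
  classical
  rw [finsum_eq_sum_of_support_subset (s := Finset.univ.image f)]
  · rw [Finset.sum_image fun i _ j _ h => hf h]
    exact sum_congr rfl fun i _ => by rw [hg]; simp [hf.eq_iff]
  · intro r hr
    by_contra hcon
    refine hr ?_
    have : g r = 0 := by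
      rw [hg]
      refine Finset.sum_eq_zero fun i _ => if_neg ?_
      rintro rfl
      exact hcon (by simp)
    simp only [this, hF]

section
variable {p : ℝ}

lemma zpow_two_mul_eq (i : ℤ) : p ^ (2 * i) = (p ^ 2) ^ i := by rw [zpow_mul]; norm_cast

lemma exists_isLinkForm (hp : 1 < p) (hv : v ≠ 0) : ∃ k ε δ a, IsLinkForm p v k ε δ a := by
  have hp0 : 0 < p := by linarith
  set l : ℤ → ℝ := fun n => |axisCoord n v| * p ^ (-n) + |axisCoord (n + 1) v| * p ^ (-n - 1) with hl
  have hv0 : 0 < ‖v‖ := norm_pos_iff.2 hv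
  have hb : ∀ n : ℤ, l n ≤ 2 * ‖v‖ * p ^ (-n) ∧ ‖v‖ * p ^ (-n - 1) ≤ l n := by
    intro n; have h1 := abs_axisCoord_le n v
    have h2 := abs_axisCoord_le (n + 1) v; have h3 := norm_le_axisCoord n v
    have q1 : 0 < p ^ (-n - 1) := by positivity
    have q2 : p ^ (-n - 1) ≤ p ^ (-n) := zpow_le_zpow_right₀ hp.le (by omega)
    have h4 := abs_nonneg (axisCoord n v); have h5 := abs_nonneg (axisCoord (n + 1) v)
    constructor
    · simp only [hl]; nlinarith [mul_le_mul h2 q2 q1.le hv0.le]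
    · simp only [hl]
      rcases le_max_iff.1 h3 with h | h <;> nlinarith
  obtain ⟨N, hN⟩ := pow_unbounded_of_one_lt (2 * ‖v‖) hp
  obtain ⟨N', hN'⟩ := pow_unbounded_of_one_lt (p * ‖v‖⁻¹) hp
  obtain ⟨k, hk1, hk2⟩ := Int.exists_greatest_of_bdd (P := fun n => 1 ≤ l n) ⟨N, fun n hn => by
      by_contra hcon
      push Not at hcon
      have h1 : p ^ (-n) ≤ p ^ (-(N : ℤ)) := zpow_le_zpow_right₀ hp.le (by omega)
      have h2 : p ^ (N : ℤ) * p ^ (-(N : ℤ)) = 1 := by rw [← zpow_add₀ hp0.ne']; simp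
      rw [← zpow_natCast] at hN; have h3 : 0 < p ^ (-(N : ℤ)) := by positivity
      nlinarith [(hb n).1]⟩ ⟨-(N' : ℤ), by
      refine le_trans ?_ (hb _).2
      rw [neg_neg, zpow_sub_one₀ hp0.ne', zpow_natCast]
      rw [← div_eq_mul_inv, div_lt_iff₀ hv0] at hN'
      rw [← mul_assoc, ← div_eq_mul_inv, le_div_iff₀ hp0]; linarith⟩
  have hk3 : l (k + 1) < 1 := by
    by_contra h
    push Not at h
    have := hk2 _ h
    omega
  obtain ⟨ε, hε⟩ : ∃ ε : ℤˣ, axisCoord k v = unitR ε * |axisCoord k v| := by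
    rcases abs_choice (axisCoord k v) with h | h
    · exact ⟨1, by simp [unitR, h]⟩
    · exact ⟨-1, by simp [unitR, h]⟩
  obtain ⟨δ, hδ⟩ : ∃ ε : ℤˣ, axisCoord (k + 1) v = unitR ε * |axisCoord (k + 1) v| := by
    rcases abs_choice (axisCoord (k + 1) v) with h | h
    · exact ⟨1, by simp [unitR, h]⟩
    · exact ⟨-1, by simp [unitR, h]⟩
  set X := |axisCoord k v| * p ^ (-k) with hX; set Y := |axisCoord (k + 1) v| * p ^ (-k - 1) with hY
  have h1 : 1 ≤ X + Y := hk1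
  have h2 : X + p ^ 2 * Y < p ^ 2 := by
    have e : l (k + 1) = Y + X / p ^ 2 := by
      simp only [hl, hX, hY]
      rw [add_assoc, one_add_one_eq_two, axisCoord_add_two, neg_add, ← sub_eq_add_neg,
        show -k - 1 - 1 = -k - 2 by ring, zpow_sub₀ hp0.ne' (-k) 2]
      norm_cast
      ring
    rw [e, ← sub_pos] at hk3
    have : 0 < (1 - (Y + X / p ^ 2)) * p ^ 2 := mul_pos hk3 (by positivity)
    field_simp at this; linarith
  have hP : 0 < p ^ 2 - 1 := by nlinarith
  refine ⟨k, ε, δ, ![0, (p ^ 2 - p ^ 2 * Y - X) / (p ^ 2 - 1), Y, (X + Y - 1) / (p ^ 2 - 1)], rfl, ?_,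
    ?_, ?_, ?_⟩
  · intro i
    fin_cases i
    · exact le_rfl
    · exact div_nonneg (by linarith) hP.le
    · exact mul_nonneg (abs_nonneg _) (zpow_pos hp0 _).le
    · exact div_nonneg (by linarith) hP.le
  · simp; field_simp; ring
  · have e : (p ^ 2 - p ^ 2 * Y - X) / (p ^ 2 - 1) + p ^ 2 * ((X + Y - 1) / (p ^ 2 - 1)) = X := by
      field_simp; ring
    simp only [cons_val]; rw [e, hX]
    nth_rewrite 1 [hε]
    have : p ^ k * p ^ (-k) = 1 := by rw [← zpow_add₀ hp0.ne']; simp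
    linear_combination (-unitR ε * |axisCoord k v|) * this
  · simp only [cons_val]
    rw [hY]
    nth_rewrite 1 [hδ]
    have : p ^ (k + 1) * p ^ (-k - 1) = 1 := by rw [← zpow_add₀ hp0.ne']; simp
    linear_combination (-unitR δ * |axisCoord (k + 1) v|) * this

namespace IsLinkForm
variable {v : ℝ × ℝ} {k : ℤ} {ε δ : ℤˣ} {a : Bary}

lemma linkHat_eq (hp : 1 < p) (h : IsLinkForm p v k ε δ a) (r : ℤ²) :
    linkHat p v r = ∑ i, if starTile k ε δ i = r then a i else 0 := by
  have hp0 : 0 < p := by linarith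
  have hP : 1 < p ^ 2 := by nlinarith
  have hneg : ∀ {ε ε' : ℤˣ}, ε' ≠ ε → unitR ε' * unitR ε = -1 := by
    intro ε ε' hne
    rcases units_eq_one_or ε with rfl | rfl <;> rcases units_eq_one_or ε' with rfl | rfl <;>
      first | exact absurd rfl hne | simp [unitR]
  have hX : 0 ≤ a 1 + p ^ 2 * a 3 := by have := h.nonneg 1; have := h.nonneg 3; positivity
  have hY := h.nonneg 2
  by_cases hr : ∃ (ε : ℤˣ) (n : ℤ), r = (ε : ℤ) • starRay n
  · obtain ⟨ε', n, rfl⟩ := hr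
    have h0 : ¬(0 : ℤ²) = (ε' : ℤ) • starRay n := fun h => unit_smul_starRay_ne_zero _ _ h.symm
    rw [linkHat_starRay hp0, sum_univ_four]
    simp only [starTile, cons_val, h0, if_false, unit_smul_starRay_eq_iff, zero_add]
    rcases Int.even_or_odd' (n - k) with ⟨i, hi | hi⟩
    · obtain rfl : n = k + 2 * i := by omega
      have c1 : ∀ i : ℤ, axisCoord (k + 2 * i) = axisCoord k ∧
          axisCoord (k + 2 * i + 1) = axisCoord (k + 1) := by
        intro i
        constructor <;> ext v <;> simp [axisCoord, Int.even_add, Int.odd_add]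
      rw [(c1 i).1, (c1 i).2, h.fst, h.snd, abs_mul, abs_mul, abs_unitR,
        abs_of_pos (zpow_pos hp0 _), abs_of_nonneg hY]
      have e1 : p ^ k * p ^ (-(k + 2 * i)) = (p ^ 2) ^ (-i) := by
        rw [← zpow_add₀ hp0.ne', ← zpow_two_mul_eq]; ring_nf
      have e2 : p ^ (k + 1) * p ^ (-(k + 2 * i) - 1) = (p ^ 2) ^ (-i) := by
        rw [← zpow_add₀ hp0.ne', ← zpow_two_mul_eq]; ring_nf
      have e3 : 1 * p ^ (k + 1) * a 2 * p ^ (-(k + 2 * i) - 1) = a 2 * (p ^ 2) ^ (-i) := by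
        rw [← e2]; ring
      rw [e3]
      by_cases hε : ε' = ε
      · subst hε
        have e4 : unitR ε' * (unitR ε' * p ^ k * (a 1 + p ^ 2 * a 3)) * p ^ (-(k + 2 * i)) =
            (a 1 + p ^ 2 * a 3) * (p ^ 2) ^ (-i) := by
          rw [← e1]
          linear_combination (p ^ k * (a 1 + p ^ 2 * a 3) * p ^ (-(k + 2 * i))) * unitR_mul_self ε'
        rw [e4, clip_even hP (h.nonneg 1) hY (h.nonneg 3) h.sum]
        have q2 : ¬(k + 1 = k + 2 * i) := by omega
        simp only [q2, and_false, if_false, add_zero, true_and]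
        by_cases i0 : i = 0
        · simp [i0]
        · by_cases i1 : i = 1
          · simp [i1]
          · have q3 : ¬(k = k + 2 * i) := by omega
            have q4 : ¬(k + 2 = k + 2 * i) := by omega
            simp [i0, i1, q4]
      · have q1 : ¬ε = ε' := fun h => hε h.symm
        have q2 : ¬(k + 1 = k + 2 * i) := by omega
        simp only [q1, q2, false_and, and_false, if_false, add_zero]
        refine clip_of_nonpos _ ?_
        have : unitR ε' * (unitR ε * p ^ k * (a 1 + p ^ 2 * a 3)) * p ^ (-(k + 2 * i)) =
            -(p ^ k * (a 1 + p ^ 2 * a 3) * p ^ (-(k + 2 * i))) := by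
          linear_combination (p ^ k * (a 1 + p ^ 2 * a 3) * p ^ (-(k + 2 * i))) * hneg hε
        rw [this, neg_nonpos]
        positivity
    · obtain rfl : n = k + 1 + 2 * i := by omega
      have c1 : ∀ i : ℤ, axisCoord (k + 1 + 2 * i) = axisCoord (k + 1) ∧
          axisCoord (k + 1 + 2 * i + 1) = axisCoord k := by
        intro i
        constructor <;> ext v <;> simp [axisCoord, Int.even_add, add_assoc]
      rw [(c1 i).1, (c1 i).2, h.fst, h.snd, abs_mul, abs_mul, abs_unitR,
        abs_of_pos (zpow_pos hp0 _), abs_of_nonneg hX]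
      have e1 : p ^ k * p ^ (-(k + 1 + 2 * i) - 1) = (p ^ 2) ^ (-i - 1) := by
        rw [← zpow_add₀ hp0.ne', ← zpow_two_mul_eq]; ring_nf
      have e2 : p ^ (k + 1) * p ^ (-(k + 1 + 2 * i)) = (p ^ 2) ^ (-i) := by
        rw [← zpow_add₀ hp0.ne', ← zpow_two_mul_eq]; ring_nf
      have e3 : 1 * p ^ k * (a 1 + p ^ 2 * a 3) * p ^ (-(k + 1 + 2 * i) - 1) =
          (a 1 + p ^ 2 * a 3) * (p ^ 2) ^ (-i - 1) := by
        rw [← e1]; ring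
      rw [e3]; have q1 : ¬(k = k + 1 + 2 * i) := by omega
      have q2 : ¬(k + 2 = k + 1 + 2 * i) := by omega
      simp only [q1, q2, and_false, if_false, add_zero, zero_add]
      by_cases hδ : ε' = δ
      · subst hδ
        have e4 : unitR ε' * (unitR ε' * p ^ (k + 1) * a 2) * p ^ (-(k + 1 + 2 * i)) =
            a 2 * (p ^ 2) ^ (-i) := by
          rw [← e2]
          linear_combination (p ^ (k + 1) * a 2 * p ^ (-(k + 1 + 2 * i))) * unitR_mul_self ε'
        rw [e4, clip_odd hP (h.nonneg 1) hY (h.nonneg 3) h.sum]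
        by_cases i0 : i = 0
        · simp [i0]
        · have q3 : ¬(k + 1 = k + 1 + 2 * i) := by omega
          simp [i0]
      · have q3 : ¬δ = ε' := fun h => hδ h.symm
        simp only [q3, false_and, if_false]
        refine clip_of_nonpos _ ?_
        have : unitR ε' * (unitR δ * p ^ (k + 1) * a 2) * p ^ (-(k + 1 + 2 * i)) =
            -(p ^ (k + 1) * a 2 * p ^ (-(k + 1 + 2 * i))) := by
          linear_combination (p ^ (k + 1) * a 2 * p ^ (-(k + 1 + 2 * i))) * hneg hδ
        rw [this, neg_nonpos]
        positivity
  · rw [linkHat_of_not p v hr]; symm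
    refine Finset.sum_eq_zero fun i _ => ?_
    split_ifs with hi
    · fin_cases i
      · exact h.zero
      · exact absurd ⟨ε, k, hi.symm⟩ hr
      · exact absurd ⟨δ, k + 1, hi.symm⟩ hr
      · exact absurd ⟨ε, k + 2, hi.symm⟩ hr
    · rfl

end IsLinkForm
end

/-- The scale of the horosphere at `0`. -/
def coneConst (p : ℝ) : ℝ := (p ^ 2 - 1) ^ 2 / p ^ 2

/-- The last coordinate of the vector of a point. -/
def starLen (p : ℝ) (b : Weights) : ℝ := ∑ᶠ r, b r * weight (p ^ 2) r

/-- The position of a point seen from `0`, in the coordinates of the link. -/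
def starDir (p : ℝ) (b : Weights) : ℝ × ℝ := (starLen p b)⁻¹ • ∑ᶠ r, b r • linkVec (p ^ 2) r

/-- The square of the distance of a point from the foot of the axis. -/
def starTop (p : ℝ) (b : Weights) : ℝ :=
  (starLen p b)⁻¹ * ∑ᶠ r, b r * if r = 0 then coneConst p else 1

/-- The height of the link over a direction. -/
def linkHeight (p : ℝ) (v : ℝ × ℝ) : ℝ := ∑ᶠ r, linkHat p v r / weight (p ^ 2) r

/-- The sum of the unnormalized coordinates of a point of the star. -/
def starSum (p : ℝ) (v : ℝ × ℝ) (T : ℝ) : ℝ := (T - linkHeight p v) / coneConst p + linkHeight p v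

/-- The coordinates of a point of the star. -/
def starFun (p : ℝ) (v : ℝ × ℝ) (T : ℝ) (r : ℤ²) : ℝ :=
  (if r = 0 then (T - linkHeight p v) / coneConst p else linkHat p v r / weight (p ^ 2) r) /
    starSum p v T

section
variable {p : ℝ} {b : Weights} {v : ℝ × ℝ} {k : ℤ} {ε δ : ℤˣ} {u a : Bary}

lemma coneConst_pos (hp : 1 < p) : 0 < coneConst p := by
  have : 0 < p ^ 2 - 1 := by nlinarith
  unfold coneConst
  positivity

/-- The sum of the weighted coordinates in a tetrahedron. -/
def formLen (p : ℝ) (u : Bary) : ℝ := u 1 + u 2 * (p ^ 2)⁻¹ + u 3 * (p ^ 4)⁻¹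

lemma formLen_pos (hp : 0 < p) (hu : u ∈ idealSimplex) : 0 < formLen p u := by
  have h0 := (hu.1 0).2; have h1 := (hu.1 1).1
  have h2 := (hu.1 2).1; have h3 := (hu.1 3).1
  have hs := hu.2; rw [sum_univ_four] at hs
  unfold formLen
  rcases h1.eq_or_lt with e1 | h1'
  · rcases h2.eq_or_lt with e2 | h2'
    · have : 0 < u 3 := by linarith
      positivity
    · positivity
  · positivity

namespace IsStarForm

lemma apply_zero (h : IsStarForm b k ε δ u) : b 0 = u 0 := h.apply 0

lemma starLen_eq (hp : 0 < p) (h : IsStarForm b k ε δ u) :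
    starLen p b = p ^ (-2 * k) * formLen p u := by
  rw [starLen, h.finsum (fun r t => t * weight (p ^ 2) r) (by simp), sum_univ_four]
  have hP : 0 < p ^ 2 := by positivity
  simp only [starTile, cons_val, weight_unit_smul_starRay hP, weight_zero, ← zpow_two_mul_eq]
  rw [show 2 * -(k + 1) = -2 * k + -2 by ring, show 2 * -(k + 2) = -2 * k + -4 by ring,
    show 2 * -k = -2 * k by ring, zpow_add₀ hp.ne', zpow_add₀ hp.ne', formLen, zpow_neg p 2,
    zpow_neg p 4]
  norm_cast
  ring

lemma starLen_pos (hp : 0 < p) (h : IsStarForm b k ε δ u) : 0 < starLen p b := by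
  rw [h.starLen_eq hp]
  exact mul_pos (zpow_pos hp _) (formLen_pos hp h.mem)

lemma starTop_eq (hp : 0 < p) (h : IsStarForm b k ε δ u) :
    starTop p b = p ^ (2 * k) * (coneConst p * u 0 + u 1 + u 2 + u 3) / formLen p u := by
  rw [starTop, h.starLen_eq hp, h.finsum (fun r t => t * if r = 0 then coneConst p else 1) (by simp),
    sum_univ_four]
  simp only [starTile, cons_val, unit_smul_starRay_ne_zero, if_true, if_false]
  have := (formLen_pos hp h.mem).ne'; rw [neg_mul, zpow_neg]
  field_simp

lemma isLinkForm (hp : 0 < p) (h : IsStarForm b k ε δ u) : IsLinkForm p (starDir p b) k ε δ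
    ![0, u 1 / formLen p u, u 2 * (p ^ 2)⁻¹ / formLen p u, u 3 * (p ^ 4)⁻¹ / formLen p u] := by
  have hL := formLen_pos hp h.mem; have hk : ∀ i : ℤ, p ^ i ≠ 0 := fun i => (zpow_pos hp i).ne'
  have hdir : ∀ n, axisCoord n (starDir p b) =
      (starLen p b)⁻¹ * ∑ i, u i * axisCoord n (linkVec (p ^ 2) (starTile k ε δ i)) := by
    intro n
    rw [starDir, axisCoord_smul, h.finsum (fun r t => t • linkVec (p ^ 2) r) (by simp),
      sum_univ_four, sum_univ_four]
    simp only [axisCoord_add, axisCoord_smul]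
  have e0 : ∀ n, axisCoord n (0 : ℝ × ℝ) = 0 := by intro n; simp [axisCoord]
  have h2 : axisCoord k (linkVec (p ^ 2) ((δ : ℤ) • starRay (k + 1))) = 0 := by
    have := (axisCoord_linkVec hp δ (k + 1)).2
    rwa [add_assoc, one_add_one_eq_two, axisCoord_add_two] at this
  have h3 := axisCoord_linkVec hp ε (k + 2)
  rw [axisCoord_add_two, show k + 2 + 1 = k + 1 + 2 by ring, axisCoord_add_two] at h3
  refine ⟨rfl, fun i => ?_, ?_, ?_, ?_⟩
  · have := fun i => (h.mem.1 i).1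
    fin_cases i
    · exact le_rfl
    · exact div_nonneg (this 1) hL.le
    · exact div_nonneg (mul_nonneg (this 2) (by positivity)) hL.le
    · exact div_nonneg (mul_nonneg (this 3) (by positivity)) hL.le
  · simp only [cons_val]
    rw [← add_div, ← add_div]
    exact div_self hL.ne'
  · rw [hdir, h.starLen_eq hp, sum_univ_four]
    simp only [starTile, cons_val, linkVec_zero, e0, (axisCoord_linkVec hp ε k).1, h2, h3.1]
    rw [show -2 * k = -k + -k by ring, zpow_add₀ hp.ne', neg_add, zpow_add₀ hp.ne', zpow_neg p k,
      zpow_neg p 2]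
    have := hk k
    norm_cast
    field_simp; ring
  · rw [hdir, h.starLen_eq hp, sum_univ_four]
    simp only [starTile, cons_val, linkVec_zero, e0, (axisCoord_linkVec hp ε k).2,
      (axisCoord_linkVec hp δ (k + 1)).1, h3.2]
    rw [show -2 * k = -k + -k by ring, zpow_add₀ hp.ne', neg_add, zpow_add₀ hp.ne', zpow_neg p k,
      zpow_add₀ hp.ne' k 1, zpow_neg_one, zpow_one]
    have := hk k; field_simp
    ring

end IsStarForm

namespace IsLinkForm

lemma linkHeight_eq (hp : 1 < p) (h : IsLinkForm p v k ε δ a) :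
    linkHeight p v = p ^ (2 * k) * (a 1 + p ^ 2 * a 2 + p ^ 4 * a 3) := by
  have hp0 : 0 < p := by linarith
  have hP : 0 < p ^ 2 := by positivity
  rw [linkHeight, finsum_ite_injective (starTile_injective k ε δ) (h.linkHat_eq hp)
    (fun r t => t / weight (p ^ 2) r) (by simp), sum_univ_four]
  simp only [starTile, cons_val, weight_unit_smul_starRay hP, weight_zero, ← zpow_two_mul_eq]
  rw [show 2 * -(k + 1) = -(2 * k + 2) by ring, show 2 * -(k + 2) = -(2 * k + 4) by ring,
    show 2 * -k = -(2 * k) by ring, zpow_neg, zpow_neg, zpow_neg, div_inv_eq_mul, div_inv_eq_mul,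
    div_inv_eq_mul, zpow_add₀ hp0.ne', zpow_add₀ hp0.ne']
  norm_cast
  simp
  ring

lemma linkHeight_pos (hp : 1 < p) (h : IsLinkForm p v k ε δ a) : 0 < linkHeight p v := by
  have hp0 : 0 < p := by linarith
  rw [h.linkHeight_eq hp]
  refine mul_pos (zpow_pos hp0 _) ?_
  have h1 := h.nonneg 1; have h2 := h.nonneg 2
  have h3 := h.nonneg 3; have hs := h.sum
  have hp2 : 1 ≤ p ^ 2 := by nlinarith
  have hp4 : 1 ≤ p ^ 4 := by nlinarith
  nlinarith

lemma ne_zero (hp : 0 < p) (h : IsLinkForm p v k ε δ a) : v ≠ 0 := by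
  rintro rfl; have h1 := h.fst
  have h2 := h.snd; have e0 : ∀ n, axisCoord n (0 : ℝ × ℝ) = 0 := by intro n; simp [axisCoord]
  have n1 := h.nonneg 1; have n2 := h.nonneg 2
  have n3 := h.nonneg 3; have hk : ∀ i : ℤ, p ^ i ≠ 0 := fun i => (zpow_pos hp i).ne'
  have hu : ∀ ε, unitR ε ≠ 0 := fun ε h => by simpa [h] using abs_unitR ε
  rw [e0] at h1 h2; have h1' : a 1 + p ^ 2 * a 3 = 0 := by simpa [hk, hu] using h1.symm
  have h2' : a 2 = 0 := by simpa [hk, hu] using h2.symm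
  have h3 : 0 ≤ p ^ 2 * a 3 := by positivity
  have h4 : a 3 = 0 := by
    have : p ^ 2 * a 3 = 0 := by linarith
    simpa [hp.ne'] using this
  have := h.sum; linarith

/-- The coordinates in the tetrahedron of a point over the link. -/
def coords (p : ℝ) (v : ℝ × ℝ) (T : ℝ) (k : ℤ) (a : Bary) : Bary :=
  ![(T - linkHeight p v) / coneConst p, p ^ (2 * k) * a 1, p ^ (2 * k + 2) * a 2,
    p ^ (2 * k + 4) * a 3]

lemma sum_coords (hp : 1 < p) (h : IsLinkForm p v k ε δ a) (T : ℝ) :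
    ∑ i, coords p v T k a i = starSum p v T := by
  have hp0 : 0 < p := by linarith
  rw [sum_univ_four, starSum, h.linkHeight_eq hp]; simp only [coords, cons_val]
  rw [h.linkHeight_eq hp, zpow_add₀ hp0.ne', zpow_add₀ hp0.ne']
  norm_cast
  ring

lemma isStarForm (hp : 1 < p) (h : IsLinkForm p v k ε δ a) (hT : linkHeight p v < T) :
    IsStarForm (starFun p v T) k ε δ (fun i => coords p v T k a i / starSum p v T) := by
  have hp0 : 0 < p := by linarith
  have hP : 0 < p ^ 2 := by positivity
  have hn : ∀ i, 0 ≤ coords p v T k a i := by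
    intro i; have := h.nonneg
    fin_cases i
    · exact div_nonneg (by linarith) (coneConst_pos hp).le
    · exact mul_nonneg (zpow_pos hp0 _).le (this 1)
    · exact mul_nonneg (zpow_pos hp0 _).le (this 2)
    · exact mul_nonneg (zpow_pos hp0 _).le (this 3)
  have h0 : 0 < coords p v T k a 0 := div_pos (by linarith) (coneConst_pos hp)
  have hu : (fun i => coords p v T k a i / starSum p v T) ∈ idealSimplex := by
    rw [← h.sum_coords hp]
    obtain ⟨j, hj0, hj⟩ : ∃ j, (0 : Fin 4) ≠ j ∧ 0 < coords p v T k a j := by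
      by_contra hcon
      push Not at hcon
      have e : ∀ j, (0 : Fin 4) ≠ j → coords p v T k a j = 0 := fun j hj =>
        le_antisymm (hcon j hj) (hn j)
      have e1 := e 1 (by decide)
      have e2 := e 2 (by decide)
      have e3 := e 3 (by decide)
      have hk : ∀ i : ℤ, p ^ i ≠ 0 := fun i => (zpow_pos hp0 i).ne'
      simp only [coords, cons_val, mul_eq_zero, hk, false_or] at e1 e2 e3; have := h.sum
      linarith
    exact mem_idealSimplex_div hn hj0 h0 hj
  obtain ⟨b, hb⟩ := exists_isStarForm' hu k ε δ
  have : starFun p v T = b := by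
    ext r; rw [hb.eq_sum, starFun]
    by_cases hr : r ∈ range (starTile k ε δ)
    · obtain ⟨i, rfl⟩ := hr
      simp only [(starTile_injective k ε δ).eq_iff, Finset.sum_ite_eq', Finset.mem_univ, if_true]
      congr 1
      have hl : ∀ i, linkHat p v (starTile k ε δ i) = a i := by
        intro i; rw [h.linkHat_eq hp]
        simp [(starTile_injective k ε δ).eq_iff]
      rw [hl]
      fin_cases i
      · simp [starTile, coords]
      · simp only [starTile, coords, Fin.mk_one, cons_val, unit_smul_starRay_ne_zero, if_false,
          weight_unit_smul_starRay hP, ← zpow_two_mul_eq]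
        rw [mul_neg, zpow_neg, div_inv_eq_mul, mul_comm]
      · simp only [starTile, coords, Fin.reduceFinMk, cons_val, unit_smul_starRay_ne_zero,
          if_false, weight_unit_smul_starRay hP, ← zpow_two_mul_eq]
        rw [mul_neg, zpow_neg, div_inv_eq_mul, mul_comm, mul_add, mul_one]
      · simp only [starTile, coords, Fin.reduceFinMk, cons_val, unit_smul_starRay_ne_zero,
          if_false, weight_unit_smul_starRay hP, ← zpow_two_mul_eq]
        rw [mul_neg, zpow_neg, div_inv_eq_mul, mul_comm, mul_add]; norm_num
    · have hr0 : r ≠ 0 := by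
        rintro rfl
        exact hr ⟨0, rfl⟩
      have hi : ∀ i, starTile k ε δ i ≠ r := fun i hi => hr ⟨i, hi⟩
      rw [if_neg hr0, h.linkHat_eq hp]; simp [hi]
  rw [this]
  exact hb

lemma eq_of (h : IsLinkForm p v k ε δ a) {v' : ℝ × ℝ} (h' : IsLinkForm p v' k ε δ a) : v = v' :=
  axisCoord_ext (h.fst.trans h'.fst.symm) (h.snd.trans h'.snd.symm)

lemma starDir_starFun (hp : 1 < p) (h : IsLinkForm p v k ε δ a)
    (hT : linkHeight p v < T) : starDir p (starFun p v T) = v ∧ starTop p (starFun p v T) = T := by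
  have hp0 : 0 < p := by linarith
  have hs := h.isStarForm hp hT; have hN := h.linkHeight_pos hp
  have hc := coneConst_pos hp
  have hS : 0 < starSum p v T := by
    have : 0 < (T - linkHeight p v) / coneConst p := div_pos (by linarith) hc
    rw [starSum]; linarith
  have hk : p ^ (2 * k) ≠ 0 := (zpow_pos hp0 _).ne'
  have e2 : p ^ (2 * k + 2) = p ^ (2 * k) * p ^ 2 := by rw [zpow_add₀ hp0.ne']; norm_cast
  have e4 : p ^ (2 * k + 4) = p ^ (2 * k) * p ^ 4 := by rw [zpow_add₀ hp0.ne']; norm_cast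
  have hL : formLen p (fun i => coords p v T k a i / starSum p v T) =
      p ^ (2 * k) / starSum p v T := by
    simp only [formLen, coords, cons_val, e2, e4]; have := h.sum
    rw [show a 1 = 1 - a 2 - a 3 by linarith]
    field_simp; ring
  constructor
  · refine (hs.isLinkForm hp0).eq_of (a := _) ?_
    convert h using 1
    rw [hL]; ext i
    fin_cases i
    · exact h.zero.symm
    · simp [coords]; field_simp
    · simp [coords, e2]; field_simp
    · simp [coords, e4]; field_simp
  · rw [hs.starTop_eq hp0, hL]
    have e : coneConst p * (coords p v T k a 0 / starSum p v T) + coords p v T k a 1 / starSum p v T +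
        coords p v T k a 2 / starSum p v T + coords p v T k a 3 / starSum p v T =
        T / starSum p v T := by
      simp only [coords, cons_val, e2, e4]; rw [h.linkHeight_eq hp]
      field_simp; ring
    rw [e]; field_simp

end IsLinkForm

namespace IsStarForm

lemma linkHeight_starDir (hp : 1 < p) (h : IsStarForm b k ε δ u) :
    linkHeight p (starDir p b) = p ^ (2 * k) * (u 1 + u 2 + u 3) / formLen p u := by
  have hp0 : 0 < p := by linarith
  have hL := (formLen_pos hp0 h.mem).ne'; rw [(h.isLinkForm hp0).linkHeight_eq hp]
  simp only [cons_val]; field_simp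

lemma linkHeight_lt (hp : 1 < p) (h : IsStarForm b k ε δ u) (h0 : u 0 ≠ 0) :
    linkHeight p (starDir p b) < starTop p b := by
  have hp0 : 0 < p := by linarith
  have hL := formLen_pos hp0 h.mem; rw [h.linkHeight_starDir hp, h.starTop_eq hp0]
  refine div_lt_div_of_pos_right (mul_lt_mul_of_pos_left ?_ (zpow_pos hp0 _)) hL
  have : 0 < coneConst p * u 0 := mul_pos (coneConst_pos hp) ((h.mem.1 0).1.lt_of_ne' h0); linarith

lemma starFun_starDir (hp : 1 < p) (h : IsStarForm b k ε δ u) (h0 : u 0 ≠ 0) :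
    starFun p (starDir p b) (starTop p b) = b := by
  have hp0 : 0 < p := by linarith
  have hL := formLen_pos hp0 h.mem; have hc := coneConst_pos hp
  have hk := zpow_pos hp0 (2 * k)
  have hs := (h.isLinkForm hp0).isStarForm hp (h.linkHeight_lt hp h0)
  have hT : (starTop p b - linkHeight p (starDir p b)) / coneConst p =
      p ^ (2 * k) * u 0 / formLen p u := by
    rw [h.linkHeight_starDir hp, h.starTop_eq hp0]; field_simp
    ring
  have hS : starSum p (starDir p b) (starTop p b) = p ^ (2 * k) / formLen p u := by
    rw [starSum, hT, h.linkHeight_starDir hp]; have := h.mem.2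
    rw [sum_univ_four] at this; rw [show u 0 = 1 - u 1 - u 2 - u 3 by linarith]
    field_simp; ring
  ext r; rw [hs.eq_sum, h.eq_sum]
  refine sum_congr rfl fun i _ => ?_
  congr 1
  rw [hS]; have e2 : p ^ (2 * k + 2) = p ^ (2 * k) * p ^ 2 := by rw [zpow_add₀ hp0.ne']; norm_cast
  have e4 : p ^ (2 * k + 4) = p ^ (2 * k) * p ^ 4 := by rw [zpow_add₀ hp0.ne']; norm_cast
  fin_cases i
  · simp only [IsLinkForm.coords, Fin.zero_eta, cons_val, hT]; field_simp
  · simp only [IsLinkForm.coords, Fin.mk_one, cons_val]; field_simp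
  · simp only [IsLinkForm.coords, Fin.reduceFinMk, cons_val, e2]; field_simp
  · simp only [IsLinkForm.coords, Fin.reduceFinMk, cons_val, e4]; field_simp

end IsStarForm
end

section
variable {p : ℝ} {v : ℝ × ℝ} {k : ℤ} {ε δ : ℤˣ} {a : Bary}

namespace IsLinkForm

lemma bounds (hp : 1 < p) (h : IsLinkForm p v k ε δ a) :
    p ^ k ≤ 2 * ‖v‖ ∧ ‖v‖ ≤ p ^ (k + 2) ∧ ‖v‖ ^ 2 ≤ p ^ 4 * linkHeight p v ∧
      linkHeight p v ≤ 4 * p ^ 4 * ‖v‖ ^ 2 := by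
  have hp0 : 0 < p := by linarith
  have hk := zpow_pos hp0 k; have h1 := h.nonneg 1
  have h2 := h.nonneg 2; have h3 := h.nonneg 3
  have hs := h.sum
  have e1 : |axisCoord k v| = p ^ k * (a 1 + p ^ 2 * a 3) := by
    rw [h.fst, mul_assoc, abs_mul, abs_unitR, one_mul, abs_of_nonneg (by positivity)]
  have e2 : |axisCoord (k + 1) v| = p ^ k * (p * a 2) := by
    rw [h.snd, zpow_add_one₀ hp0.ne', mul_assoc, abs_mul, abs_unitR, one_mul,
      abs_of_nonneg (by positivity)]
    ring
  have b1 := abs_axisCoord_le k v; have b2 := abs_axisCoord_le (k + 1) v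
  have b3 := norm_le_axisCoord k v; rw [e1] at b1 b3
  rw [e2] at b2 b3; have q1 : p ≤ p ^ 2 := by nlinarith
  have q2 : 1 ≤ p ^ 2 := by nlinarith
  have q3 : p ^ 2 ≤ p ^ 4 := by nlinarith
  have c1 : a 1 + a 3 ≤ a 1 + p ^ 2 * a 3 := by nlinarith
  have c2 : a 1 + p ^ 2 * a 3 ≤ p ^ 2 := by nlinarith
  have c3 : p * a 2 ≤ p ^ 2 := by nlinarith
  have c4 : a 2 ≤ p * a 2 := by nlinarith
  have d1 : p ^ k ≤ 2 * ‖v‖ := by nlinarith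
  have d2 : ‖v‖ ≤ p ^ k * p ^ 2 := by refine b3.trans (max_le ?_ ?_) <;> gcongr
  have n0 := norm_nonneg v
  have hN : linkHeight p v = p ^ k * p ^ k * (a 1 + p ^ 2 * a 2 + p ^ 4 * a 3) := by
    rw [h.linkHeight_eq hp, two_mul, zpow_add₀ hp0.ne']
  have f1 : 1 ≤ a 1 + p ^ 2 * a 2 + p ^ 4 * a 3 := by nlinarith
  have f2 : a 1 + p ^ 2 * a 2 + p ^ 4 * a 3 ≤ p ^ 4 := by nlinarith
  refine ⟨d1, ?_, ?_, ?_⟩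
  · rw [zpow_add₀ hp0.ne']; exact_mod_cast d2
  · rw [hN]
    calc ‖v‖ ^ 2 ≤ (p ^ k * p ^ 2) ^ 2 := by gcongr
      _ = p ^ 4 * (p ^ k * p ^ k * 1) := by ring
      _ ≤ _ := by gcongr
  · rw [hN]
    calc p ^ k * p ^ k * (a 1 + p ^ 2 * a 2 + p ^ 4 * a 3) ≤ (2 * ‖v‖) * (2 * ‖v‖) * p ^ 4 := by
          gcongr
      _ = _ := by ring

end IsLinkForm

lemma linkHeight_zero (p : ℝ) : linkHeight p 0 = 0 := by
  have : ∀ r, linkHat p 0 r = 0 := by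
    intro r; rw [linkHat]
    split_ifs
    · exact clip_of_nonpos _ (by simp)
    · exact clip_of_nonpos _ (by simp)
    · rfl
  simp [linkHeight, this]

lemma linkHeight_bounds (hp : 1 < p) (v : ℝ × ℝ) :
    ‖v‖ ^ 2 ≤ p ^ 4 * linkHeight p v ∧ linkHeight p v ≤ 4 * p ^ 4 * ‖v‖ ^ 2 := by
  rcases eq_or_ne v 0 with rfl | hv
  · simp [linkHeight_zero]
  · obtain ⟨k, ε, δ, a, h⟩ := exists_isLinkForm hp hv
    exact (h.bounds hp).2.2

lemma linkHeight_nonneg (hp : 1 < p) (v : ℝ × ℝ) : 0 ≤ linkHeight p v := by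
  have h := (linkHeight_bounds hp v).1; have : 0 < p ^ 4 := by positivity
  by_contra hcon
  push Not at hcon
  nlinarith [sq_nonneg ‖v‖]

lemma zpow_finite (hp : 1 < p) (hA : 0 < A) : {k : ℤ | A ≤ p ^ k ∧ p ^ k ≤ B}.Finite := by
  have hp0 : 0 < p := by linarith
  obtain ⟨N, hN⟩ := pow_unbounded_of_one_lt B hp; obtain ⟨N', hN'⟩ := pow_unbounded_of_one_lt A⁻¹ hp
  refine (finite_Icc (-(N' : ℤ)) N).subset ?_
  rintro k ⟨h1, h2⟩; rw [← zpow_natCast] at hN hN'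
  constructor
  · have : p ^ (-(N' : ℤ)) < p ^ k := by
      rw [zpow_neg]
      refine lt_of_lt_of_le ?_ h1
      exact inv_lt_of_inv_lt₀ hA hN'
    exact ((zpow_lt_zpow_iff_right₀ hp).1 this).le
  · exact ((zpow_lt_zpow_iff_right₀ hp).1 (h2.trans_lt hN)).le

lemma locallyFinite_linkHat (hp : 1 < p) {X : Type} [TopologicalSpace X] {f : X → ℝ × ℝ}
    (hf : Continuous f) (h0 : ∀ x, f x ≠ 0) :
    LocFin fun x => linkHat p (f x) := by
  have hp0 : 0 < p := by linarith
  intro x; have hn : 0 < ‖f x‖ := norm_pos_iff.2 (h0 x)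
  refine ⟨{y | ‖f x‖ / 2 < ‖f y‖ ∧ ‖f y‖ < 2 * ‖f x‖}, ?_, ?_⟩
  · have h1 : ∀ᶠ y in 𝓝 x, ‖f x‖ / 2 < ‖f y‖ :=
      hf.norm.continuousAt.eventually (lt_mem_nhds (by linarith))
    have h2 : ∀ᶠ y in 𝓝 x, ‖f y‖ < 2 * ‖f x‖ :=
      hf.norm.continuousAt.eventually (gt_mem_nhds (by linarith))
    exact h1.and h2
  · have hfin := zpow_finite hp (A := ‖f x‖ / (2 * p ^ 2)) (B := 4 * ‖f x‖) (by positivity)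
    refine (((hfin.prod (toFinite (univ : Set (ℤˣ × ℤˣ)))).prod
      (toFinite (univ : Set (Fin 4)))).image fun q => starTile q.1.1 q.1.2.1 q.1.2.2 q.2).subset ?_
    rintro r ⟨y, hy1, hy2, hy3⟩; obtain ⟨k, ε, δ, a, h⟩ := exists_isLinkForm hp (h0 y)
    obtain ⟨i, hi⟩ : ∃ i, starTile k ε δ i = r := by
      by_contra hcon
      push Not at hcon
      refine hy1 ?_
      change linkHat p (f y) r = 0
      rw [h.linkHat_eq hp]
      exact Finset.sum_eq_zero fun i _ => if_neg (hcon i)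
    obtain ⟨b1, b2, -⟩ := h.bounds hp
    refine ⟨((k, ε, δ), i), ⟨⟨⟨?_, by linarith⟩, mem_univ _⟩, mem_univ _⟩, hi⟩
    rw [zpow_add₀ hp0.ne'] at b2; rw [div_le_iff₀ (by positivity)]
    norm_cast at b2
    nlinarith

lemma continuous_linkHeight (hp : 1 < p) : Continuous (linkHeight p) := by
  rw [continuous_iff_continuousAt]; intro v
  rcases eq_or_ne v 0 with rfl | hv
  · rw [ContinuousAt, linkHeight_zero]
    refine squeeze_zero (linkHeight_nonneg hp) (fun v => (linkHeight_bounds hp v).2) ?_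
    have : Continuous fun v : ℝ × ℝ => 4 * p ^ 4 * ‖v‖ ^ 2 := by fun_prop
    simpa using this.tendsto 0
  · have hc : Continuous fun v : ({0}ᶜ : Set (ℝ × ℝ)) => linkHeight p v := by
      unfold linkHeight
      refine continuous_finsum (fun r => ((continuous_linkHat p r).comp
        continuous_subtype_val).div_const _) ?_
      refine (locallyFinite_linkHat hp continuous_subtype_val fun x => x.2).subset ?_
      intro r x hx h
      exact hx (by simp only [h, zero_div])
    exact (continuousOn_iff_continuous_domRestrict.2 hc).continuousAt
      (isOpen_compl_singleton.mem_nhds hv)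

lemma starSum_pos (hp : 1 < p) (hT : linkHeight p v < T) : 0 < starSum p v T := by
  have := linkHeight_nonneg hp v
  have : 0 < (T - linkHeight p v) / coneConst p := div_pos (by linarith) (coneConst_pos hp)
  rw [starSum]; linarith

lemma starFun_mem (hp : 1 < p) (hv : v ≠ 0) (hT : linkHeight p v < T) :
    starFun p v T ∈ tileComplex ∧ starFun p v T 0 ≠ 0 := by
  obtain ⟨k, ε, δ, a, h⟩ := exists_isLinkForm hp hv
  refine ⟨(h.isStarForm hp hT).mem_tileComplex, ?_⟩
  rw [starFun, if_pos rfl]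
  exact (div_pos (div_pos (by linarith) (coneConst_pos hp)) (starSum_pos hp hT)).ne'

lemma continuous_starFun (hp : 1 < p) {X : Type} [TopologicalSpace X] {f : X → ℝ × ℝ} {g : X → ℝ}
    (hf : Continuous f) (hg : Continuous g) (hT : ∀ x, linkHeight p (f x) < g x) (r : ℤ²) :
    Continuous fun x => starFun p (f x) (g x) r := by
  have hN := (continuous_linkHeight hp).comp hf
  have hS : Continuous fun x => starSum p (f x) (g x) := ((hg.sub hN).div_const _).add hN
  refine Continuous.div ?_ hS fun x => (starSum_pos hp (hT x)).ne'
  split_ifs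
  · exact (hg.sub hN).div_const _
  · exact ((continuous_linkHat p r).comp hf).div_const _

lemma locallyFinite_starFun (hp : 1 < p) {X : Type} [TopologicalSpace X] {f : X → ℝ × ℝ}
    {g : X → ℝ} (hf : Continuous f) (h0 : ∀ x, f x ≠ 0) :
    LocFin fun x => starFun p (f x) (g x) := by
  intro x; obtain ⟨U, hU, h⟩ := locallyFinite_linkHat hp hf h0 x
  refine ⟨U, hU, (h.union (finite_singleton 0)).subset ?_⟩
  rintro r ⟨y, hy, hyU⟩
  rcases eq_or_ne r 0 with rfl | hr
  · exact Or.inr rfl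
  · refine Or.inl ⟨y, fun hz => hy ?_, hyU⟩
    change starFun p (f y) (g y) r = 0
    change linkHat p (f y) r = 0 at hz
    rw [starFun, if_neg hr, hz, zero_div, zero_div]

lemma continuous_starDir_starTop (hp : 1 < p) {X : Type} [TopologicalSpace X]
    {b : X → Weights} (hc : ∀ r, Continuous fun x => b x r) (hf : LocFin b)
    (hb : ∀ x, b x ∈ tileComplex) (h0 : ∀ x, b x 0 ≠ 0) :
    Continuous fun x => (starDir p (b x), starTop p (b x)) := by
  have hp0 : 0 < p := by linarith
  have hL : Continuous fun x => starLen p (b x) := by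
    refine continuous_finsum (fun r => (hc r).mul_const _) (hf.subset fun r x hx h => hx ?_)
    simp only [h, zero_mul]
  have hL' : ∀ x, starLen p (b x) ≠ 0 := by
    intro x; obtain ⟨k, ε, δ, u, h⟩ := exists_isStarForm (hb x) (h0 x)
    exact (h.starLen_pos hp0).ne'
  refine Continuous.prodMk ((hL.inv₀ hL').smul ?_) ((hL.inv₀ hL').mul ?_)
  · refine continuous_finsum (fun r => (hc r).smul continuous_const)
      (hf.subset fun r x hx h => hx ?_)
    simp only [h, zero_smul]
  · refine continuous_finsum (fun r => (hc r).mul_const _) (hf.subset fun r x hx h => hx ?_)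
    simp only [h, zero_mul]

end

/-! ### Estimates near the axis -/

section
variable {p κ : ℝ} {b : Weights} {k : ℤ} {ε δ : ℤˣ} {u : Bary}

/-- A correction factor for the height along the axis. -/
def axisFactor (p κ ρ : ℝ) : ℝ := 1 + ((coneConst p)⁻¹ - 1) * ((2 * ρ) ^ κ / 2)

namespace IsStarForm

lemma edgeSum_eq (hP : 0 < P) (h : IsStarForm b k ε δ u) : edgeSum P b = P ^ (-k) *
    (2 * (u 0 * (u 1 + u 2 * P⁻¹ + u 3 * (P ^ 2)⁻¹) + (if ε = δ then P else (P ^ 2)⁻¹) * u 1 * u 2 +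
      P⁻¹ * u 1 * u 3 + (if ε = δ then 1 else (P ^ 3)⁻¹) * u 2 * u 3)) := by
  rw [edgeSum, h.pairSum_eq h]; simp only [weight_starTile hP]
  split_ifs <;> simp [sum_univ_four, *] <;> ring

lemma edgeSum_bounds (hp : 1 < p) (h : IsStarForm b k ε δ u) :
    ∃ Q, 0 ≤ Q ∧ Q ≤ 2 * p ^ 2 * (1 - u 0) ^ 2 ∧
      edgeSum (p ^ 2) b = (p ^ 2) ^ (-k) * (2 * u 0 * formLen p u + Q) := by
  have hp0 : 0 < p := by linarith
  have h1 := (h.mem.1 1).1; have h2 := (h.mem.1 2).1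
  have h3 := (h.mem.1 3).1; have hs := h.mem.2
  rw [sum_univ_four] at hs; have q1 : 1 ≤ p ^ 2 := by nlinarith
  have q2 : (p ^ 2)⁻¹ ≤ p ^ 2 := (inv_le_one_of_one_le₀ q1).trans q1
  set d := if ε = δ then p ^ 2 else ((p ^ 2) ^ 2)⁻¹ with hd
  set d' := if ε = δ then 1 else ((p ^ 2) ^ 3)⁻¹ with hd'
  have d0 : 0 ≤ d := by rw [hd]; split_ifs <;> positivity
  have d0' : 0 ≤ d' := by rw [hd']; split_ifs <;> positivity
  have d1 : d ≤ p ^ 2 := by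
    rw [hd]; split_ifs
    · exact le_rfl
    · exact (inv_le_one_of_one_le₀ (one_le_pow₀ q1)).trans q1
  have d1' : d' ≤ p ^ 2 := by
    rw [hd']; split_ifs
    · exact q1
    · exact (inv_le_one_of_one_le₀ (one_le_pow₀ q1)).trans q1
  refine ⟨2 * (d * (u 1 * u 2) + (p ^ 2)⁻¹ * (u 1 * u 3) + d' * (u 2 * u 3)), by positivity, ?_, ?_⟩
  · have e : 1 - u 0 = u 1 + u 2 + u 3 := by linarith
    rw [e]; have a1 : d * (u 1 * u 2) ≤ p ^ 2 * (u 1 * u 2) := by gcongr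
    have a2 : (p ^ 2)⁻¹ * (u 1 * u 3) ≤ p ^ 2 * (u 1 * u 3) := by gcongr
    have a3 : d' * (u 2 * u 3) ≤ p ^ 2 * (u 2 * u 3) := by gcongr
    have a4 : u 1 * u 2 + u 1 * u 3 + u 2 * u 3 ≤ (u 1 + u 2 + u 3) ^ 2 := by
      nlinarith [mul_nonneg h1 h2, mul_nonneg h1 h3, mul_nonneg h2 h3]
    nlinarith
  · rw [h.edgeSum_eq (by positivity), formLen, ← hd, ← hd', ← pow_mul]
    ring

lemma edgeSum_one_bounds (h : IsStarForm b k ε δ u) :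
    2 * (1 - u 0) * u 0 ≤ edgeSum 1 b ∧ edgeSum 1 b ≤ 2 * (1 - u 0) := by
  have h0 := (h.mem.1 0).1; have h1 := (h.mem.1 1).1
  have h2 := (h.mem.1 2).1; have h3 := (h.mem.1 3).1
  have hs := h.mem.2; rw [sum_univ_four] at hs
  rw [h.edgeSum_eq one_pos]; simp only [one_zpow, inv_one, mul_one, one_pow, ite_self, one_mul]
  have h12 := mul_nonneg h1 h2; have h13 := mul_nonneg h1 h3
  have h23 := mul_nonneg h2 h3; have e : u 0 = 1 - u 1 - u 2 - u 3 := by linarith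
  constructor
  · rw [e]; nlinarith
  · rw [e]; nlinarith

lemma starTop_warp_bounds (hp : 1 < p) (hκ0 : 0 < κ) (hκ1 : κ ≤ 1) (h : IsStarForm b k ε δ u)
    (h0 : 1 / 2 < u 0) :
    2 * coneConst p * exp (2 * log (p ^ 2) * coneHeight (p ^ 2) κ b) *
        (axisFactor p κ (1 - u 0) * u 0) ≤ starTop p (_root_.warp κ b) ∧
      starTop p (_root_.warp κ b) ≤
        2 * coneConst p * exp (2 * log (p ^ 2) * coneHeight (p ^ 2) κ b) *
        (axisFactor p κ (1 - u 0) * ((1 + p ^ 6 * (1 - u 0)) / u 0)) := by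
  have hp0 : 0 < p := by linarith
  have hc := coneConst_pos hp; have hP : 1 < p ^ 2 := by nlinarith
  have hF := formLen_pos hp0 h.mem; have hρ : 0 < 1 - u 0 := by linarith [(h.mem.1 0).2]
  have hsum := h.mem.2; rw [sum_univ_four] at hsum
  set c := coneConst p; set ρ := 1 - u 0 with hρ'
  obtain ⟨-, s0, s⟩ := simplexWarp_of_gt κ h.mem h0; rw [← hρ'] at s0 s
  set D := (2 * ρ) ^ (1 - κ) with hD; have hD0 : 0 < D := rpow_pos_of_pos (by linarith) _
  have hDρ : D * (2 * ρ) ^ κ = 2 * ρ := by rw [hD, ← rpow_add (by linarith)]; simp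
  have hκ' : (2 * ρ) ^ κ ≤ 1 := rpow_le_one (by linarith) (by linarith) hκ0.le
  have hρκ : 0 < (2 * ρ) ^ κ := rpow_pos_of_pos (by linarith) _
  have hA : axisFactor p κ ρ = (c * (D - ρ) + ρ) / (c * D) := by
    rw [axisFactor, show ρ = D * (2 * ρ) ^ κ / 2 by linarith]
    rw [show 2 * (D * (2 * ρ) ^ κ / 2) = 2 * ρ by linarith]
    change 1 + (c⁻¹ - 1) * _ = _
    field_simp; ring
  have hA0 : 0 < axisFactor p κ ρ := by
    rw [hA]; have : 0 < D - ρ := by nlinarith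
    positivity
  have htop : starTop p (_root_.warp κ b) = p ^ (2 * k) * (c * (D - ρ) + ρ) / formLen p u := by
    have hL : formLen p (simplexWarp κ u) = formLen p u / D := by
      rw [formLen, s 1 (by decide), s 2 (by decide), s 3 (by decide), formLen]; ring
    rw [(h.warp κ hκ0).starTop_eq hp0, hL, s0, s 1 (by decide), s 2 (by decide), s 3 (by decide)]
    change p ^ (2 * k) * (c * _ + _ + _ + _) / _ = _
    have : u 3 = ρ - u 1 - u 2 := by rw [hρ']; linarith
    rw [this]; field_simp
    ring
  obtain ⟨Q, hQ0, hQ1, hQ⟩ := h.edgeSum_bounds hp; rw [← hρ'] at hQ1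
  obtain ⟨hE1, hE2⟩ := h.edgeSum_one_bounds; rw [← hρ'] at hE1 hE2
  set E := edgeSum 1 b; have hE0 : 0 < E := lt_of_lt_of_le (by nlinarith) hE1
  have hQp : 0 < edgeSum (p ^ 2) b := edgeSum_pos (by positivity) h.mem_tileComplex
  have hexp : exp (2 * log (p ^ 2) * coneHeight (p ^ 2) κ b) =
      E ^ (1 - κ) / edgeSum (p ^ 2) b := by
    have : log (p ^ 2) ≠ 0 := (log_pos hP).ne'
    rw [coneHeight, show 2 * log (p ^ 2) * (-(log (edgeSum (p ^ 2) b) -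
      (1 - κ) * log E) / (2 * log (p ^ 2))) =
      log E * (1 - κ) - log (edgeSum (p ^ 2) b) by field_simp; ring,
      exp_sub, exp_log hQp, ← rpow_def_of_pos hE0]
  have hEκ : 0 < E ^ (1 - κ) := rpow_pos_of_pos hE0 _; set B := u 0 + Q / (2 * formLen p u) with hB
  set C := D / E ^ (1 - κ) with hC
  have key : starTop p (_root_.warp κ b) = 2 * c * exp (2 * log (p ^ 2) * coneHeight (p ^ 2) κ b) *
        (axisFactor p κ ρ * (B * C)) := by
    have hpk : (p ^ 2) ^ (-k) = (p ^ (2 * k))⁻¹ := by rw [← zpow_two_mul_eq, mul_neg, zpow_neg]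
    have hpk0 : p ^ (2 * k) ≠ 0 := (zpow_pos hp0 _).ne'
    have hne : 2 * u 0 * formLen p u + Q ≠ 0 := by
      have : 0 < 2 * u 0 * formLen p u := by positivity
      linarith
    rw [htop, hexp, hA, hQ, hB, hC, hpk]; field_simp
  have hC1 : 1 ≤ C ∧ C ≤ (u 0)⁻¹ := by
    have e : C = (2 * ρ / E) ^ (1 - κ) := by rw [hC, hD, div_rpow (by linarith) hE0.le]
    have e1 : 1 ≤ 2 * ρ / E := (one_le_div hE0).2 hE2; rw [e]
    refine ⟨one_le_rpow e1 (by linarith), ?_⟩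
    refine (rpow_le_rpow_of_exponent_le e1 (show 1 - κ ≤ 1 by linarith)).trans ?_
    rw [rpow_one, div_le_iff₀ hE0, inv_mul_eq_div, le_div_iff₀ (by linarith)]
    exact hE1
  have hB1 : u 0 ≤ B ∧ B ≤ 1 + p ^ 6 * ρ := by
    have hq : 0 ≤ Q / (2 * formLen p u) := by positivity
    refine ⟨by linarith, ?_⟩
    have hF' : ρ * (p ^ 4)⁻¹ ≤ formLen p u := by
      have h1 := (h.mem.1 1).1; have h2 := (h.mem.1 2).1
      have h4 : (p ^ 4)⁻¹ ≤ 1 := inv_le_one_of_one_le₀ (one_le_pow₀ hp.le)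
      have h5 : (p ^ 4)⁻¹ ≤ (p ^ 2)⁻¹ := inv_anti₀ (by positivity) (by nlinarith)
      rw [formLen, show ρ = u 1 + u 2 + u 3 by rw [hρ']; linarith]
      nlinarith
    have : Q / (2 * formLen p u) ≤ p ^ 6 * ρ := by
      rw [div_le_iff₀ (by positivity)]
      refine hQ1.trans ?_
      calc 2 * p ^ 2 * ρ ^ 2 = p ^ 6 * ρ * (2 * (ρ * (p ^ 4)⁻¹)) := by field_simp
        _ ≤ _ := by gcongr
    linarith [(h.mem.1 0).2]
  have hM : 0 < 2 * c * exp (2 * log (p ^ 2) * coneHeight (p ^ 2) κ b) := by positivity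
  rw [key]; constructor
  · refine mul_le_mul_of_nonneg_left (mul_le_mul_of_nonneg_left ?_ hA0.le) hM.le
    calc u 0 = u 0 * 1 := (mul_one _).symm
      _ ≤ B * C := mul_le_mul hB1.1 hC1.1 zero_le_one (by linarith [hB1.1])
  · refine mul_le_mul_of_nonneg_left (mul_le_mul_of_nonneg_left ?_ hA0.le) hM.le
    rw [div_eq_mul_inv]
    exact mul_le_mul hB1.2 hC1.2 (by linarith [hC1.1]) (by positivity)

lemma linkHeight_starDir_div (hp : 1 < p) (h : IsStarForm b k ε δ u) :
    linkHeight p (starDir p b) / starTop p b = (1 - u 0) / (coneConst p * u 0 + (1 - u 0)) := by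
  have hp0 : 0 < p := by linarith
  have hF := formLen_pos hp0 h.mem; have hs := h.mem.2
  rw [sum_univ_four] at hs
  rw [h.linkHeight_starDir hp, h.starTop_eq hp0,
    show u 1 + u 2 + u 3 = 1 - u 0 by linarith,
    show coneConst p * u 0 + u 1 + u 2 + u 3 = coneConst p * u 0 + (1 - u 0) by linarith,
    div_div_div_cancel_right₀ hF.ne', mul_div_mul_left _ _ (zpow_pos hp0 _).ne']

end IsStarForm

lemma tendsto_axisFactor (hκ : 0 < κ) {X : Type} {l : Filter X} {f : X → ℝ}
    (hf : Tendsto f l (𝓝 0)) : Tendsto (fun x => axisFactor p κ (f x)) l (𝓝 1) := by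
  have h1 : Tendsto (fun x => (2 * f x) ^ κ) l (𝓝 0) := by
    have := (hf.const_mul 2).rpow_const (p := κ) (Or.inr hκ.le)
    rwa [mul_zero, zero_rpow hκ.ne'] at this
  have h2 := ((h1.div_const 2).const_mul ((coneConst p)⁻¹ - 1)).const_add 1
  simpa [axisFactor] using h2

lemma hat_ge (x : ℝ × ℝ) : 1 - 2 * ‖x‖ ≤ hat x := by
  have h1 := norm_fst_le x; have h2 := norm_snd_le x
  have h3 := abs_add_le x.1 x.2; rw [norm_eq_abs] at h1 h2
  refine le_max_of_le_right ?_
  have : max (max |x.1| |x.2|) |x.1 + x.2| ≤ 2 * ‖x‖ :=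
    max_le (max_le (by linarith [norm_nonneg x]) (by linarith [norm_nonneg x])) (by linarith)
  linarith

lemma flowPoint_zero_ge (x : ℝ × ℝ) (l : ℝ) : 1 - 4 * 2 ^ |(⌊l⌋ : ℝ)| * ‖x‖ ≤ flowPoint x l 0 := by
  have e : flowPoint x l 0 = (1 - Int.fract l) * hat ((fibR ^ (-⌊l⌋)) x) +
      Int.fract l * hat ((fibR ^ (-⌊l⌋ - 1)) x) := by
    have h0 : x - latR 0 = x := by rw [show latR 0 = 0 by simp [latR], sub_zero]
    have : (fibR ^ (-⌊l⌋ - 1)) x = fibR⁻¹ ((fibR ^ (-⌊l⌋)) x) := by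
      rw [sub_eq_neg_add, fibR_zpow_add_apply, zpow_neg_one]
    rw [this, flowPoint, h0, flowBary, baseBary]
  have f0 := Int.fract_nonneg l; have f1 := (Int.fract_lt_one l).le
  set N : ℝ := 2 ^ |(⌊l⌋ : ℝ)| * ‖x‖ with hN; have hN0 : 0 ≤ N := by positivity
  have n1 : ‖(fibR ^ (-⌊l⌋)) x‖ ≤ N := by
    have := norm_fibR_zpow_le (-⌊l⌋) x
    rwa [Int.cast_neg, abs_neg] at this
  have n2 : ‖(fibR ^ (-⌊l⌋ - 1)) x‖ ≤ 2 * N := by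
    refine (norm_fibR_zpow_le (-⌊l⌋ - 1) x).trans ?_
    rw [hN, ← mul_assoc]
    refine mul_le_mul_of_nonneg_right ?_ (norm_nonneg _)
    calc (2 : ℝ) ^ |((-⌊l⌋ - 1 : ℤ) : ℝ)| ≤ 2 ^ (1 + |(⌊l⌋ : ℝ)|) := by
          refine rpow_le_rpow_of_exponent_le one_le_two ?_
          push_cast; rw [← abs_neg]
          have := abs_add_le (⌊l⌋ : ℝ) 1; rw [abs_one] at this
          rw [show -(-(⌊l⌋ : ℝ) - 1) = ⌊l⌋ + 1 by ring]
          linarith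
      _ = 2 * 2 ^ |(⌊l⌋ : ℝ)| := by rw [rpow_add two_pos, rpow_one]
  have g1 : 1 - 4 * N ≤ hat ((fibR ^ (-⌊l⌋)) x) := le_trans (by linarith) (hat_ge _)
  have g2 : 1 - 4 * N ≤ hat ((fibR ^ (-⌊l⌋ - 1)) x) := le_trans (by linarith) (hat_ge _)
  rw [e, mul_assoc, ← hN]
  nlinarith

lemma norm_sub_latR_ge (hx : ‖x‖ < 1 / 2) (r : ℤ²) : ‖x‖ ≤ ‖x - latR r‖ := by
  rcases eq_or_ne r 0 with rfl | hr
  · rw [show latR 0 = 0 by simp [latR], sub_zero]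
  · have h1 : 1 ≤ ‖latR r‖ := by
      rw [latR, Prod.norm_mk]
      rcases not_and_or.1 (fun h : r.1 = 0 ∧ r.2 = 0 => hr (Prod.ext h.1 h.2)) with h | h
      · refine le_max_of_le_left ?_
        rw [norm_eq_abs]; exact_mod_cast Int.one_le_abs h
      · refine le_max_of_le_right ?_
        rw [norm_eq_abs]; exact_mod_cast Int.one_le_abs h
    have h2 := norm_sub_norm_le (latR r) x; rw [norm_sub_rev] at h2
    linarith

lemma mem_offLattice_of_norm_lt (hy : ‖y.1‖ < 1 / 2) (h0 : y.1 ≠ 0) :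
    y ∈ offLattice := by
  rintro ⟨r, hr⟩; have := norm_sub_latR_ge hy r
  rw [hr, sub_self, norm_zero] at this
  exact h0 (norm_le_zero_iff.1 this)

lemma eventually_norm_lt_half (t : ℝ) :
    ∀ᶠ y : Point in 𝓝[{y | y.1 ≠ 0}] ((0 : ℝ × ℝ), t), ‖y.1‖ < 1 / 2 :=
  mem_nhdsWithin_of_mem_nhds ((continuous_fst.norm.continuousAt (x := ((0 : ℝ × ℝ), t))).eventually
    (gt_mem_nhds (by simp)))

lemma IsHeight.tendsto_bary_zero {τ : Weights → ℝ} (hτ : IsHeight τ) (t : ℝ) :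
    Tendsto (fun y => bary τ y 0) (𝓝[{y | y.1 ≠ 0}] ((0 : ℝ × ℝ), t)) (𝓝 1) := by
  obtain ⟨C, c, hc0, hc, hb⟩ := hτ.flow_bound; have hL := log_pos one_lt_two
  have hnorm := eventually_norm_lt_half t
  set e := 1 - 4 * c * log 2 with he; have he0 : 0 < e := by rw [he]; linarith
  have hlow : ∀ᶠ y : Point in 𝓝[{y | y.1 ≠ 0}] ((0 : ℝ × ℝ), t),
      1 - 4 * 2 ^ (4 * (C + |y.2|)) * ‖y.1‖ ^ e ≤ bary τ y 0 := by
    filter_upwards [hnorm, self_mem_nhdsWithin] with y hy1 hy2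
    have hoff := mem_offLattice_of_norm_lt hy1 hy2; have hpos : 0 < ‖y.1‖ := norm_pos_iff.2 hy2
    obtain ⟨h1, h2⟩ := hb y.1 hoff ‖y.1‖ hpos (norm_sub_latR_ge hy1) (flowParam τ y)
    have h3 : τ (flowPoint y.1 (flowParam τ y)) = y.2 := hτ.flowParam_spec hoff; rw [h3] at h1 h2
    set n : ℝ := ((⌊flowParam τ y⌋ : ℤ) : ℝ)
    have hlog : log ‖y.1‖ ≤ 0 := log_nonpos hpos.le (by linarith)
    have hcl : 0 ≤ -(c * log ‖y.1‖) := by nlinarith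
    have hn : |n| ≤ 4 * (C + |y.2|) - 4 * c * log ‖y.1‖ := by
      have := neg_abs_le y.2; have := le_abs_self y.2
      rcases abs_cases n with ⟨e1, e2⟩ | ⟨e1, e2⟩
      · rw [e1]; linarith
      · rw [e1] at h2 ⊢; nlinarith
    refine le_trans ?_ (flowPoint_zero_ge y.1 (flowParam τ y))
    rw [sub_le_sub_iff_left, mul_assoc, mul_assoc]
    refine mul_le_mul_of_nonneg_left ?_ (by norm_num)
    calc (2 : ℝ) ^ |n| * ‖y.1‖ ≤ 2 ^ (4 * (C + |y.2|) - 4 * c * log ‖y.1‖) * ‖y.1‖ := by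
          gcongr
          exact one_le_two
      _ = 2 ^ (4 * (C + |y.2|)) * ‖y.1‖ ^ e := by
          rw [sub_eq_add_neg, rpow_add two_pos, mul_assoc, he, sub_eq_neg_add,
            rpow_add hpos, rpow_one]
          congr 2
          rw [rpow_def_of_pos two_pos, rpow_def_of_pos hpos]; ring_nf
  refine tendsto_of_tendsto_of_tendsto_of_le_of_le' (g := fun y : Point =>
    1 - 4 * 2 ^ (4 * (C + |y.2|)) * ‖y.1‖ ^ e) (h := fun _ => 1) ?_ tendsto_const_nhds hlow ?_
  · have : Continuous fun y : Point => 1 - 4 * 2 ^ (4 * (C + |y.2|)) * ‖y.1‖ ^ e := by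
      refine continuous_const.sub ((continuous_const.mul (Continuous.rpow (by fun_prop) (by fun_prop)
        fun _ => Or.inl two_ne_zero)).mul (Continuous.rpow_const (by fun_prop) fun _ =>
          Or.inr he0.le))
    have := (this.tendsto ((0 : ℝ × ℝ), t)).mono_left (nhdsWithin_le_nhds (s := {y | y.1 ≠ 0}))
    simpa [zero_rpow he0.ne'] using this
  · filter_upwards [hnorm, self_mem_nhdsWithin] with y hy1 hy2
    exact (lt_one_of_mem_tileComplex (bary_mem (mem_offLattice_of_norm_lt hy1 hy2)) 0).le

lemma IsHeight.norm_baryCenter_le {τ : Weights → ℝ} (hτ : IsHeight τ) (R : ℝ) :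
    ∃ K, ∀ b ∈ tileComplex, 1 / 2 < b 0 → |τ b| ≤ R → ‖baryCenter b‖ ≤ K * √(1 - b 0) := by
  obtain ⟨C, c, hc0, hc, hb⟩ := hτ.bound; have hL := log_pos one_lt_two
  refine ⟨2 ^ (2 * (R + C)), fun b hbm h0 hR => ?_⟩
  obtain ⟨m, n, u, hu, rfl⟩ := hbm
  obtain ⟨i, hi⟩ := mem_range_of_spread_ne_zero (one_half_pos.trans h0).ne'; have hbi : spread m n u 0 = u i := by rw [← hi, spread_vertex]
  rw [hbi] at h0 ⊢; rw [hτ.shift m n u hu] at hR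
  have hρ : 0 < 1 - u i := by linarith [(hu.1 i).2]
  have hlog : log (1 - u i) ≤ 0 := log_nonpos hρ.le (by linarith)
  have hτ0 : |τ (spread 0 0 u)| ≤ C - c * log (1 - u i) := by
    obtain ⟨h1, j, hj⟩ := hb u hu
    have h2 : τ (spread 0 0 u) ≤ C - c * log (1 - u i) := by
      refine hj.trans (sub_le_sub_left (mul_le_mul_of_nonneg_left ?_ hc0) _)
      rcases eq_or_ne i j with rfl | hij
      · exact le_rfl
      · refine log_le_log hρ ?_
        have := Finset.add_le_sum (f := u) (fun x _ => (hu.1 x).1) (Finset.mem_univ i)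
          (Finset.mem_univ j) hij
        rw [hu.2] at this; linarith
    exact abs_le.2 ⟨by nlinarith, h2⟩
  have hn : |(n : ℝ)| ≤ 2 * (R + C) - 2 * c * log (1 - u i) := by
    obtain ⟨a1, a2⟩ := abs_le.1 hR; obtain ⟨a3, a4⟩ := abs_le.1 hτ0
    exact abs_le.2 ⟨by linarith, by linarith⟩
  have hx : baryCenter (spread m n u) =
      (fibR ^ n) (((u 2 + u 3, u 1 + u 3) : ℝ × ℝ) - latR (corner i)) := by
    have : latR m = -(fibR ^ n) (latR (corner i)) := by
      rw [← latR_fibZ_zpow, eq_neg_iff_add_eq_zero, ← latR_add, add_comm]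
      change latR (tileVertex m n i) = 0
      rw [hi]; simp [latR]
    rw [baryCenter_spread' hu, this, map_sub, sub_eq_add_neg]
  rw [hx]
  refine (norm_fibR_zpow_le _ _).trans ?_
  calc (2 : ℝ) ^ |(n : ℝ)| * ‖((u 2 + u 3, u 1 + u 3) : ℝ × ℝ) - latR (corner i)‖
      ≤ 2 ^ (2 * (R + C) - 2 * c * log (1 - u i)) * (1 - u i) := by
        gcongr
        · exact one_le_two
        · exact squareBary_sub_corner_le hu i
    _ = 2 ^ (2 * (R + C)) * (1 - u i) ^ (1 - 2 * c * log 2) := by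
        rw [sub_eq_add_neg (2 * (R + C)), rpow_add two_pos, mul_assoc,
          sub_eq_neg_add 1 (2 * c * log 2), rpow_add hρ, rpow_one]
        congr 2
        rw [rpow_def_of_pos two_pos, rpow_def_of_pos hρ]; ring_nf
    _ ≤ 2 ^ (2 * (R + C)) * √(1 - u i) := by
        rw [sqrt_eq_rpow]
        refine mul_le_mul_of_nonneg_left ?_ (by positivity)
        exact rpow_le_rpow_of_exponent_ge hρ (by linarith) (by linarith)

end

/-! ### The star of the axis -/

section
variable {p κ : ℝ}

/-- Admissible parameters for the cone structures. -/
structure IsConeParam (p κ : ℝ) : Prop where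
  one_lt : 1 < p
  pos : 0 < κ
  le_one : κ ≤ 1
  isHeight : IsHeight (coneHeight (p ^ 2) κ)

namespace IsConeParam

lemma one_lt_sq (h : IsConeParam p κ) : 1 < p ^ 2 := by nlinarith [h.one_lt]

lemma p_pos (h : IsConeParam p κ) : 0 < p := by linarith [h.one_lt]

end IsConeParam

/-- The barycentric coordinates of the cone structure. -/
def coneBary (p κ : ℝ) (y : Point) : Weights := wbary (coneHeight (p ^ 2) κ) κ y

/-- The union of the open tetrahedra, faces and edges with vertex `0`. -/
def starSource (p κ : ℝ) : Set Point := {y | y ∈ offLattice ∧ coneBary p κ y 0 ≠ 0}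

/-- The coordinates near the axis. -/
def starMap (p κ : ℝ) (y : Point) : Point :=
  open Classical in
  if y.1 = 0 then (0, 2 * coneConst p * exp (2 * log (p ^ 2) * y.2))
  else (starDir p (coneBary p κ y), starTop p (coneBary p κ y))

/-- The inverse of `starMap`. -/
def starInv (p κ : ℝ) (q : Point) : Point :=
  open Classical in
  if q.1 = 0 then (0, log (q.2 / (2 * coneConst p)) / (2 * log (p ^ 2)))
  else place (coneHeight (p ^ 2) κ) κ (starFun p q.1 q.2)

lemma zero_notMem_offLattice (hy : y ∈ offLattice) : y.1 ≠ 0 :=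
  fun h => hy ⟨0, by rw [h]; simp [latR]⟩

lemma warp_apply_of_gt {κ : ℝ} (hb : b ∈ tileComplex)
    (h : 1 / 2 < b r) : warp κ b r = 1 - (2 * (1 - b r)) ^ κ / 2 := by
  obtain ⟨m, n, u, hu, rfl⟩ := hb
  obtain ⟨i, rfl⟩ := mem_range_of_spread_ne_zero (one_half_pos.trans h).ne'; rw [spread_vertex] at h
  rw [warp_spread, spread_vertex, spread_vertex, (simplexWarp_of_gt κ hu h).2.1]
  have hρ : 0 < 1 - u i := by linarith [(hu.1 i).2]
  have h1 : (2 * (1 - u i)) ^ (1 - κ) * (2 * (1 - u i)) ^ κ = 2 * (1 - u i) := by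
    rw [← rpow_add (by linarith)]; simp
  have h2 : 0 < (2 * (1 - u i)) ^ (1 - κ) := rpow_pos_of_pos (by linarith) _
  rw [sub_right_inj, div_eq_div_iff h2.ne' two_ne_zero]; linarith

lemma tendsto_warp_apply {κ : ℝ} (hκ : 0 < κ) {X : Type} {l : Filter X} {b : X → Weights}
    (hb : ∀ᶠ x in l, b x ∈ tileComplex) (h : Tendsto (fun x => b x r) l (𝓝 1)) :
    Tendsto (fun x => warp κ (b x) r) l (𝓝 1) := by
  have h1 : Tendsto (fun x => 1 - (2 * (1 - b x r)) ^ κ / 2) l (𝓝 1) := by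
    have := ((((h.const_sub 1).const_mul 2).rpow_const (p := κ) (Or.inr hκ.le)).div_const
      2).const_sub 1
    simpa [zero_rpow hκ.ne'] using this
  refine h1.congr' ?_
  filter_upwards [hb, h.eventually (lt_mem_nhds (show (1 / 2 : ℝ) < 1 by norm_num))] with x h2 h3
  exact (warp_apply_of_gt h2 h3).symm

lemma tendsto_nhds_of_compl {X : Type} [TopologicalSpace X] {Y : Type} {f : X → Y} {x : X}
    {l : Filter Y} (s : Set X) (h : Tendsto f (𝓝[s] x) l) (h' : Tendsto f (𝓝[sᶜ] x) l) :
    Tendsto f (𝓝 x) l := by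
  rw [← nhdsWithin_univ, ← union_compl_self s, nhdsWithin_union]
  exact h.sup h'

lemma IsConeParam.isOpen_starSource (h : IsConeParam p κ) : IsOpen (starSource p κ) := by
  have h1 : ContinuousOn (fun y => coneBary p κ y 0) offLattice :=
    continuousOn_iff_continuous_domRestrict.2 (h.isHeight.continuous_wbary h.pos 0)
  exact h1.isOpen_inter_preimage isOpen_offLattice isOpen_ne

lemma IsConeParam.mem_starSource_iff (h : IsConeParam p κ)
    (hy : y ∈ offLattice) : y ∈ starSource p κ ↔ bary (coneHeight (p ^ 2) κ) y 0 ≠ 0 := by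
  rw [starSource, mem_ofPred_eq, coneBary, wbary, Ne, warp_eq_zero h.pos (bary_mem hy)]
  exact and_iff_right hy

lemma IsConeParam.eventually_starSource (h : IsConeParam p κ) (t : ℝ) :
    ∀ᶠ y in 𝓝[{y | y.1 ≠ 0}] ((0 : ℝ × ℝ), t), y ∈ starSource p κ := by
  have h1 := (h.isHeight.tendsto_bary_zero t).eventually (lt_mem_nhds one_half_lt_one)
  have h2 := eventually_norm_lt_half t
  filter_upwards [h1, h2, self_mem_nhdsWithin] with y h1 h2 h3
  rw [h.mem_starSource_iff (mem_offLattice_of_norm_lt h2 h3)]; linarith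

lemma IsConeParam.exists_isStarForm (h : IsConeParam p κ)
    (hy : y ∈ starSource p κ) : ∃ k ε δ u, IsStarForm (coneBary p κ y) k ε δ u ∧ u 0 ≠ 0 := by
  obtain ⟨k, ε, δ, u, hu⟩ := _root_.exists_isStarForm (wbary_mem h.pos hy.1) hy.2
  exact ⟨k, ε, δ, u, hu, by rw [← hu.apply_zero]; exact hy.2⟩

lemma starMap_of_mem (hy : y ∈ starSource p κ) : starMap p κ y =
    (starDir p (coneBary p κ y), starTop p (coneBary p κ y)) :=
  if_neg (zero_notMem_offLattice hy.1)

lemma locallyFinite_support_mono {X I : Type} [TopologicalSpace X] {s t : Set X} (hst : s ⊆ t)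
    {f : X → I → ℝ} (h : LocallyFinite fun r => support fun y : t => f y r) :
    LocallyFinite fun r => support fun y : s => f y r :=
  h.preimage_continuous (continuous_inclusion hst)

lemma IsConeParam.continuousOn_starMap (h : IsConeParam p κ) :
    ContinuousOn (starMap p κ) (starSource p κ) := by
  refine ContinuousOn.congr ?_ fun y hy => starMap_of_mem hy
  rw [continuousOn_iff_continuous_domRestrict]
  have h1 : ∀ r, Continuous fun y : starSource p κ => coneBary p κ y r := by
    intro r
    have h0 : ContinuousOn (fun y => coneBary p κ y r) offLattice :=
      continuousOn_iff_continuous_domRestrict.2 (h.isHeight.continuous_wbary h.pos r)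
    exact continuousOn_iff_continuous_domRestrict.1 (h0.mono fun y hy => hy.1)
  have h2 : LocallyFinite fun r => support fun y : starSource p κ => coneBary p κ y r :=
    locallyFinite_support_mono (fun y hy => hy.1) (h.isHeight.locallyFinite_wbary h.pos)
  have h3 := continuous_starDir_starTop h.one_lt h1 h2
    (fun y => wbary_mem h.pos y.2.1) fun y => y.2.2
  exact h3

lemma IsConeParam.tendsto_starMap (h : IsConeParam p κ) (t : ℝ) :
    Tendsto (starMap p κ) (𝓝 ((0 : ℝ × ℝ), t))
      (𝓝 (0, 2 * coneConst p * exp (2 * log (p ^ 2) * t))) := by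
  have hc := coneConst_pos h.one_lt
  refine tendsto_nhds_of_compl {y | y.1 ≠ 0} ?_ ?_
  · have hb1 := h.isHeight.tendsto_bary_zero t
    have hmem := h.eventually_starSource t
    have hmem' : ∀ᶠ y in 𝓝[{y | y.1 ≠ 0}] ((0 : ℝ × ℝ), t),
        bary (coneHeight (p ^ 2) κ) y ∈ tileComplex := hmem.mono fun y hy => bary_mem hy.1
    have hρ := hb1.const_sub 1; rw [sub_self] at hρ
    have hA := tendsto_axisFactor (p := p) h.pos hρ
    have hy2 : Tendsto (fun y : Point => 2 * coneConst p *
        exp (2 * log (p ^ 2) * y.2)) (𝓝[{y | y.1 ≠ 0}] ((0 : ℝ × ℝ), t))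
        (𝓝 (2 * coneConst p * exp (2 * log (p ^ 2) * t))) := by
      have : Continuous fun y : Point => 2 * coneConst p *
        exp (2 * log (p ^ 2) * y.2) := by fun_prop
      exact (this.tendsto _).mono_left nhdsWithin_le_nhds
    have hlo := hy2.mul (hA.mul hb1)
    have hhi := hy2.mul (hA.mul (((hρ.const_mul (p ^ 6)).const_add 1).div hb1 one_ne_zero))
    simp only [mul_zero, add_zero, div_one, mul_one] at hlo hhi
    have hbd : ∀ᶠ y in 𝓝[{y | y.1 ≠ 0}] ((0 : ℝ × ℝ), t), ∃ k ε δ u,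
        IsStarForm (bary (coneHeight (p ^ 2) κ) y) k ε δ u ∧
        bary (coneHeight (p ^ 2) κ) y 0 = u 0 ∧ 1 / 2 < u 0 ∧
        coneHeight (p ^ 2) κ (bary (coneHeight (p ^ 2) κ) y) = y.2 := by
      filter_upwards [hmem, hb1.eventually (lt_mem_nhds one_half_lt_one)] with y h1 h2
      obtain ⟨k, ε, δ, u, hu⟩ := _root_.exists_isStarForm (bary_mem (τ := coneHeight (p ^ 2) κ) h1.1)
        (by linarith)
      have e := hu.apply_zero
      exact ⟨k, ε, δ, u, hu, e, by rw [← e]; exact h2, h.isHeight.flowParam_spec h1.1⟩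
    have htop : Tendsto (fun y => starTop p (coneBary p κ y)) (𝓝[{y | y.1 ≠ 0}] ((0 : ℝ × ℝ), t))
        (𝓝 (2 * coneConst p * exp (2 * log (p ^ 2) * t))) := by
      refine tendsto_of_tendsto_of_tendsto_of_le_of_le' hlo hhi ?_ ?_
      · filter_upwards [hbd] with y ⟨k, ε, δ, u, h1, h2, h3, h4⟩
        have := (h1.starTop_warp_bounds h.one_lt h.pos h.le_one h3).1
        rwa [← h2, h4] at this
      · filter_upwards [hbd] with y ⟨k, ε, δ, u, h1, h2, h3, h4⟩
        have := (h1.starTop_warp_bounds h.one_lt h.pos h.le_one h3).2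
        rwa [← h2, h4] at this
    have hw : Tendsto (fun y => coneBary p κ y 0) (𝓝[{y | y.1 ≠ 0}] ((0 : ℝ × ℝ), t)) (𝓝 1) :=
      tendsto_warp_apply h.pos hmem' hb1
    have hN : Tendsto (fun y => p ^ 4 * ((1 - coneBary p κ y 0) /
        (coneConst p * coneBary p κ y 0 + (1 - coneBary p κ y 0)) * starTop p (coneBary p κ y)))
        (𝓝[{y | y.1 ≠ 0}] ((0 : ℝ × ℝ), t)) (𝓝 0) := by
      have h1 := hw.const_sub 1
      have := (((h1.div ((hw.const_mul (coneConst p)).add h1)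
        (by simpa using hc.ne')).mul htop).const_mul (p ^ 4))
      simpa using this
    have hdir : Tendsto (fun y => starDir p (coneBary p κ y)) (𝓝[{y | y.1 ≠ 0}] ((0 : ℝ × ℝ), t))
        (𝓝 0) := by
      rw [tendsto_zero_iff_norm_tendsto_zero]; have hsq := (continuous_sqrt.tendsto _).comp hN
      rw [sqrt_zero] at hsq
      refine squeeze_zero' (Eventually.of_forall fun y => norm_nonneg _) ?_ hsq
      filter_upwards [hmem] with y hy
      obtain ⟨k, ε, δ, u, hu, hu0⟩ := h.exists_isStarForm hy
      refine le_sqrt_of_sq_le ((linkHeight_bounds h.one_lt _).1.trans_eq ?_)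
      have hT : starTop p (coneBary p κ y) ≠ 0 :=
        ((linkHeight_nonneg h.one_lt _).trans_lt (hu.linkHeight_lt h.one_lt hu0)).ne'
      beta_reduce
      rw [hu.apply_zero, ← hu.linkHeight_starDir_div h.one_lt, div_mul_cancel₀ _ hT]
    refine (hdir.prodMk_nhds htop).congr' ?_
    filter_upwards [hmem] with y hy
    exact (starMap_of_mem hy).symm
  · have hc : Continuous fun y : Point => ((0 : ℝ × ℝ), 2 * coneConst p *
        exp (2 * log (p ^ 2) * y.2)) := by fun_prop
    refine ((hc.tendsto ((0 : ℝ × ℝ), t)).mono_left nhdsWithin_le_nhds).congr' ?_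
    filter_upwards [self_mem_nhdsWithin] with y hy
    exact (if_pos (not_not.1 hy)).symm

lemma IsConeParam.continuousOn_starInv (h : IsConeParam p κ) :
    ContinuousOn (starInv p κ) {q | linkHeight p q.1 < q.2 ∧ q.1 ≠ 0} := by
  refine ContinuousOn.congr (f := fun q => place (coneHeight (p ^ 2) κ) κ (starFun p q.1 q.2)) ?_
    fun q hq => by rw [starInv, if_neg hq.2]
  rw [continuousOn_iff_continuous_domRestrict]
  have e1 : Continuous fun q : {q : Point | linkHeight p q.1 < q.2 ∧ q.1 ≠ 0} => q.1.1 := by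
    fun_prop
  have e2 : Continuous fun q : {q : Point | linkHeight p q.1 < q.2 ∧ q.1 ≠ 0} => q.1.2 := by
    fun_prop
  exact h.isHeight.continuous_place (w := fun q : {q : Point | linkHeight p q.1 < q.2 ∧
    q.1 ≠ 0} => starFun p q.1.1 q.1.2) h.pos (continuous_starFun h.one_lt e1 e2 fun q => q.2.1)
    (locallyFinite_starFun h.one_lt e1 fun q => q.2.2) fun q => (starFun_mem h.one_lt q.2.2 q.2.1).1

lemma IsConeParam.tendsto_starInv (h : IsConeParam p κ) (hT : 0 < T) :
    Tendsto (starInv p κ) (𝓝 ((0 : ℝ × ℝ), T))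
      (𝓝 (0, log (T / (2 * coneConst p)) / (2 * log (p ^ 2)))) := by
  have hc := coneConst_pos h.one_lt; have hlogP := log_pos h.one_lt_sq
  have hopen : ∀ᶠ q : Point in 𝓝 ((0 : ℝ × ℝ), T), linkHeight p q.1 < q.2 := by
    refine (isOpen_lt ((continuous_linkHeight h.one_lt).comp continuous_fst)
      continuous_snd).mem_nhds ?_
    change linkHeight p 0 < T
    rwa [linkHeight_zero]
  refine tendsto_nhds_of_compl {q | q.1 ≠ 0} ?_ ?_
  · set l := 𝓝[{q | q.1 ≠ 0}] ((0 : ℝ × ℝ), T)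
    have hmem : ∀ᶠ q in l, linkHeight p q.1 < q.2 ∧ q.1 ≠ 0 := by
      filter_upwards [mem_nhdsWithin_of_mem_nhds hopen, self_mem_nhdsWithin] with q h1 h2
      exact ⟨h1, h2⟩
    have hq2 : Tendsto (fun q : Point => q.2) l (𝓝 T) :=
      (continuous_snd.tendsto _).mono_left nhdsWithin_le_nhds
    have hN : Tendsto (fun q : Point => linkHeight p q.1) l (𝓝 0) := by
      have := (((continuous_linkHeight h.one_lt).comp continuous_fst).tendsto
        ((0 : ℝ × ℝ), T)).mono_left (nhdsWithin_le_nhds (s := {q | q.1 ≠ 0}))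
      rwa [show (linkHeight p ∘ Prod.fst) ((0 : ℝ × ℝ), T) = 0 from linkHeight_zero p] at this
    have hw0 : Tendsto (fun q : Point => starFun p q.1 q.2 0) l (𝓝 1) := by
      have h1 := (hq2.sub hN).div_const (coneConst p)
      have h2 := h1.div (h1.add hN) (by simp [hT.ne', hc.ne'])
      have h3 : (T - 0) / coneConst p / ((T - 0) / coneConst p + 0) = 1 := by
        rw [sub_zero, add_zero, div_self (div_pos hT hc).ne']
      rw [h3] at h2
      exact h2.congr fun q => by rw [starFun, if_pos rfl]; rfl
    have hwm : ∀ᶠ q in l, starFun p q.1 q.2 ∈ tileComplex :=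
      hmem.mono fun q hq => (starFun_mem h.one_lt hq.2 hq.1).1
    set b : Point → Weights := fun q => warp κ⁻¹ (starFun p q.1 q.2) with hb
    have hb0 : Tendsto (fun q => b q 0) l (𝓝 1) := tendsto_warp_apply (inv_pos.2 h.pos) hwm hw0
    have hbm : ∀ᶠ q in l, b q ∈ tileComplex := hwm.mono fun q hq => warp_mem (inv_pos.2 h.pos) hq
    have hhalf := hb0.eventually (lt_mem_nhds one_half_lt_one)
    have hbd : ∀ᶠ q in l, 2 * coneConst p * exp (2 * log (p ^ 2) * coneHeight (p ^ 2) κ (b q)) *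
          (axisFactor p κ (1 - b q 0) * b q 0) ≤ q.2 ∧
        q.2 ≤ 2 * coneConst p * exp (2 * log (p ^ 2) * coneHeight (p ^ 2) κ (b q)) *
          (axisFactor p κ (1 - b q 0) * ((1 + p ^ 6 * (1 - b q 0)) / b q 0)) := by
      filter_upwards [hmem, hwm, hbm, hhalf] with q h1 h2 h3 h4
      obtain ⟨k, ε, δ, u, hu⟩ := _root_.exists_isStarForm h3 (by
        have : 1 / 2 < b q 0 := h4; linarith)
      have e : b q 0 = u 0 := hu.apply_zero
      have := hu.starTop_warp_bounds h.one_lt h.pos h.le_one (by rw [← e]; exact h4)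
      rw [← e] at this; have e2 : warp κ (b q) = starFun p q.1 q.2 := warp_warp_inv h.pos h2
      obtain ⟨k', ε', δ', a, ha⟩ := exists_isLinkForm h.one_lt h1.2
      rwa [e2, (ha.starDir_starFun h.one_lt h1.1).2] at this
    have hρ := hb0.const_sub 1; rw [sub_self] at hρ
    have hA := tendsto_axisFactor (p := p) h.pos hρ
    have hlo := (hA.mul hb0).const_mul (2 * coneConst p)
    have hhi := (hA.mul (((hρ.const_mul (p ^ 6)).const_add 1).div hb0 one_ne_zero)).const_mul
      (2 * coneConst p)
    simp only [mul_zero, add_zero, div_one, mul_one, Pi.div_apply] at hlo hhi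
    have hc2 : 0 < 2 * coneConst p := by positivity
    have hX1 := (hq2.div hhi hc2.ne').log (div_pos hT hc2).ne'
    have hX2 := (hq2.div hlo hc2.ne').log (div_pos hT hc2).ne'
    have hq0 := hq2.eventually (lt_mem_nhds hT)
    have hX : Tendsto (fun q => 2 * log (p ^ 2) * coneHeight (p ^ 2) κ (b q)) l
        (𝓝 (log (T / (2 * coneConst p)))) := by
      refine tendsto_of_tendsto_of_tendsto_of_le_of_le' hX1 hX2 ?_ ?_
      · filter_upwards [hbd, hhi.eventually (lt_mem_nhds hc2), hq0] with q h1 h2 h3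
        rw [← log_exp (2 * log (p ^ 2) * coneHeight (p ^ 2) κ (b q))]
        refine log_le_log (div_pos h3 h2) ((div_le_iff₀ h2).2 (h1.2.trans_eq ?_))
        ring
      · filter_upwards [hbd, hlo.eventually (lt_mem_nhds hc2), hq0] with q h1 h2 h3
        rw [← log_exp (2 * log (p ^ 2) * coneHeight (p ^ 2) κ (b q))]
        refine log_le_log (exp_pos _) ((le_div_iff₀ h2).2 (le_trans (le_of_eq ?_) h1.1))
        ring
    have hτ : Tendsto (fun q => coneHeight (p ^ 2) κ (b q)) l
        (𝓝 (log (T / (2 * coneConst p)) / (2 * log (p ^ 2)))) := by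
      refine (hX.div_const (2 * log (p ^ 2))).congr fun q => ?_
      field_simp
    have hx : Tendsto (fun q => baryCenter (b q)) l (𝓝 0) := by
      set R := |log (T / (2 * coneConst p)) / (2 * log (p ^ 2))| + 1
      obtain ⟨K, hK⟩ := h.isHeight.norm_baryCenter_le R; rw [tendsto_zero_iff_norm_tendsto_zero]
      have hs := ((continuous_sqrt.tendsto _).comp hρ).const_mul K; rw [sqrt_zero, mul_zero] at hs
      refine squeeze_zero' (Eventually.of_forall fun y => norm_nonneg _) ?_ hs
      filter_upwards [hbm, hhalf, hτ.abs.eventually (gt_mem_nhds (lt_add_one _))] with q h1 h2 h3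
      exact hK _ h1 h2 h3.le
    refine (hx.prodMk_nhds hτ).congr' ?_
    filter_upwards [hmem] with q hq
    exact (if_neg hq.2).symm
  · have hc : Tendsto (fun q : Point => ((0 : ℝ × ℝ),
        log (q.2 / (2 * coneConst p)) / (2 * log (p ^ 2)))) (𝓝 ((0 : ℝ × ℝ), T))
        (𝓝 (0, log (T / (2 * coneConst p)) / (2 * log (p ^ 2)))) := by
      refine tendsto_const_nhds.prodMk_nhds (Tendsto.div_const (Tendsto.log ?_ ?_) _)
      · exact (continuous_snd.tendsto ((0 : ℝ × ℝ), T)).div_const _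
      · exact (div_pos hT (by positivity)).ne'
    refine (hc.mono_left nhdsWithin_le_nhds).congr' ?_
    filter_upwards [self_mem_nhdsWithin] with q hq
    exact (if_pos (not_not.1 hq)).symm

/-- The coordinates near the axis. -/
def IsConeParam.starHomeo (h : IsConeParam p κ) : OpenPartialHomeomorph Point Point where
  toFun := starMap p κ
  invFun := starInv p κ
  source := {y | y.1 = 0} ∪ starSource p κ
  target := {q | linkHeight p q.1 < q.2}
  map_source' := by
    rintro y (hy | hy)
    · replace hy : y.1 = 0 := hy
      have hc := coneConst_pos h.one_lt; rw [starMap, if_pos hy]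
      change linkHeight p 0 < _
      rw [linkHeight_zero]
      positivity
    · obtain ⟨k, ε, δ, u, hu, hu0⟩ := h.exists_isStarForm hy
      rw [starMap_of_mem hy]
      exact hu.linkHeight_lt h.one_lt hu0
  map_target' := by
    intro q hq
    by_cases h0 : q.1 = 0
    · left
      rw [starInv, if_pos h0]; rfl
    · right
      obtain ⟨h1, h2⟩ := starFun_mem h.one_lt h0 hq; rw [starInv, if_neg h0]
      refine ⟨place_mem h.pos h1, ?_⟩
      rwa [coneBary, h.isHeight.wbary_place h.pos h1]
  left_inv' := by
    rintro y (hy | hy)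
    · replace hy : y.1 = 0 := hy
      have hc := coneConst_pos h.one_lt; have hlogP := log_pos h.one_lt_sq
      rw [starMap, if_pos hy, starInv, if_pos rfl]
      refine Prod.ext hy.symm ?_
      simp only
      rw [mul_div_cancel_left₀ _ (by positivity), log_exp, mul_div_cancel_left₀ _ (by positivity)]
    · obtain ⟨k, ε, δ, u, hu, hu0⟩ := h.exists_isStarForm hy
      rw [starMap_of_mem hy, starInv, if_neg ((hu.isLinkForm h.p_pos).ne_zero h.p_pos)]; simp only
      rw [hu.starFun_starDir h.one_lt hu0]
      exact h.isHeight.place_wbary h.pos hy.1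
  right_inv' := by
    intro q hq
    by_cases h0 : q.1 = 0
    · have hc := coneConst_pos h.one_lt
      have hlogP := log_pos h.one_lt_sq
      have hq2 : 0 < q.2 := (linkHeight_nonneg h.one_lt _).trans_lt hq
      rw [starInv, if_pos h0, starMap, if_pos rfl]
      refine Prod.ext h0.symm ?_
      simp only
      rw [mul_div_cancel₀ _ (by positivity), exp_log (by positivity),
        mul_div_cancel₀ _ (by positivity)]
    · obtain ⟨h1, h2⟩ := starFun_mem h.one_lt h0 hq
      obtain ⟨k, ε, δ, a, ha⟩ := exists_isLinkForm h.one_lt h0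
      obtain ⟨e1, e2⟩ := ha.starDir_starFun h.one_lt hq
      rw [starInv, if_neg h0, starMap, if_neg (zero_notMem_offLattice (place_mem h.pos h1)), coneBary,
        h.isHeight.wbary_place h.pos h1, e1, e2]
  open_source := by
    rw [isOpen_iff_mem_nhds]; rintro ⟨x, t⟩ (hy | hy)
    · obtain rfl : x = 0 := hy
      have h1 := h.eventually_starSource t; rw [eventually_nhdsWithin_iff] at h1
      filter_upwards [h1] with y hy
      exact (em (y.1 = 0)).imp id hy
    · exact mem_of_superset (h.isOpen_starSource.mem_nhds hy) subset_union_right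
  open_target := isOpen_lt ((continuous_linkHeight h.one_lt).comp continuous_fst) continuous_snd
  continuousOn_toFun := by
    rintro ⟨x, t⟩ (hy | hy)
    · obtain rfl : x = 0 := hy
      have := h.tendsto_starMap t
      refine ContinuousAt.continuousWithinAt ?_
      rw [ContinuousAt, starMap, if_pos rfl]
      exact this
    · exact (h.continuousOn_starMap.continuousAt
        (h.isOpen_starSource.mem_nhds hy)).continuousWithinAt
  continuousOn_invFun := by
    rintro ⟨v, T⟩ hq
    refine ContinuousAt.continuousWithinAt ?_
    by_cases h0 : v = 0
    · subst h0
      have hT : 0 < T := (linkHeight_nonneg h.one_lt _).trans_lt hq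
      rw [ContinuousAt, starInv, if_pos rfl]
      exact h.tendsto_starInv hT
    · refine h.continuousOn_starInv.continuousAt (IsOpen.mem_nhds ?_ ⟨hq, h0⟩)
      exact (isOpen_lt ((continuous_linkHeight h.one_lt).comp continuous_fst) continuous_snd).inter
        (isOpen_ne_fun continuous_fst continuous_const)

end

/-! ### Plane sectors -/

/-- The complex number with polar coordinates `r, x`. -/
def cis (r x : ℝ) : ℂ := ⟨r * cos x, r * sin x⟩

lemma continuous_cis : Continuous fun q : ℝ × ℝ => cis q.1 q.2 := by
  have : (fun q : ℝ × ℝ => cis q.1 q.2) = fun q => ((q.1 * cos q.2 : ℝ) : ℂ) +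
      ((q.1 * sin q.2 : ℝ) : ℂ) * I := by
    ext q
    apply Complex.ext <;> simp [cis, Complex.cos_ofReal_re, Complex.sin_ofReal_re]
  rw [this]
  fun_prop

lemma norm_cis {r : ℝ} (hr : 0 ≤ r) (x : ℝ) : ‖cis r x‖ = r := by
  have h : ‖cis r x‖ ^ 2 = r ^ 2 := by
    rw [Complex.sq_norm, normSq_apply, cis]
    linear_combination r ^ 2 * sin_sq_add_cos_sq x
  exact (sq_eq_sq₀ (norm_nonneg _) hr).1 h

lemma cis_mul_conj (r x r' x' : ℝ) : cis r x * conj (cis r' x') = cis (r * r') (x - x') := by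
  apply Complex.ext <;> simp [cis, cos_sub, sin_sub] <;> ring

lemma cis_zero (x : ℝ) : cis 0 x = 0 := by apply Complex.ext <;> simp [cis]

lemma arg_cis {r x : ℝ} (hr : 0 < r) (hx : x ∈ Ioc (-π) π) : (cis r x).arg = x := by
  have : cis r x = r * (Complex.cos x + Complex.sin x * I) := by
    apply Complex.ext <;> simp [cis, Complex.cos_ofReal_re, Complex.sin_ofReal_re]
  rw [this]
  exact Complex.arg_mul_cos_add_sin_mul_I hr hx

lemma cos_arg_cis (b : ℝ) {r x : ℝ} (hr : 0 < r) (hx : |x| ≤ π) :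
    cos (b * (cis r x).arg) = cos (b * x) := by
  obtain ⟨h1, h2⟩ := abs_le.1 hx
  rcases h1.eq_or_lt with h1 | h1
  · have : cis r x = cis r π := by rw [← h1]; apply Complex.ext <;> simp [cis]
    rw [this, arg_cis hr ⟨by linarith [pi_pos], le_rfl⟩, ← h1, mul_neg, cos_neg]
  · rw [arg_cis hr ⟨h1, h2⟩]

lemma exists_cis (hz : 0 ≤ z.im) : ∃ x, 0 ≤ x ∧ x ≤ π ∧ z = cis ‖z‖ x := by
  refine ⟨z.arg, Complex.arg_nonneg_iff.2 hz, arg_le_pi z, ?_⟩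
  apply Complex.ext
  · exact (Complex.norm_mul_cos_arg z).symm
  · exact (Complex.norm_mul_sin_arg z).symm

/-- The map `r e^{ix} ↦ r e^{iax}` of the upper half-plane. -/
def foldPow (a : ℝ) (z : ℂ) : ℂ := cis ‖z‖ (a * arccos (z.re / ‖z‖))

lemma foldPow_cis (a : ℝ) {r x : ℝ} (hr : 0 ≤ r) (h0 : 0 ≤ x) (h1 : x ≤ π) :
    foldPow a (cis r x) = cis r (a * x) := by
  rcases hr.eq_or_lt with rfl | hr'
  · simp [foldPow, cis_zero]
  · have : (cis r x).re / r = cos x := mul_div_cancel_left₀ _ hr'.ne'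
    rw [foldPow, norm_cis hr, this, arccos_cos h0 h1]

lemma continuous_foldPow (a : ℝ) : Continuous (foldPow a) := by
  rw [continuous_iff_continuousAt]; intro z
  rcases eq_or_ne z 0 with rfl | hz
  · have h0 : foldPow a 0 = 0 := by simp [foldPow, cis_zero]
    rw [ContinuousAt, h0, tendsto_zero_iff_norm_tendsto_zero]
    have : ∀ z, ‖foldPow a z‖ = ‖z‖ := fun z => norm_cis (norm_nonneg z) _
    simp only [this]
    simpa using continuous_norm.tendsto (0 : ℂ)
  · have h1 : ContinuousAt (fun z : ℂ => (‖z‖, a * arccos (z.re / ‖z‖))) z := by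
      refine continuous_norm.continuousAt.prodMk (ContinuousAt.const_mul ?_ a)
      exact continuous_arccos.continuousAt.comp
        (Complex.continuous_re.continuousAt.div continuous_norm.continuousAt (norm_ne_zero_iff.2 hz))
    exact continuous_cis.continuousAt.comp h1

/-- The angles of the four sectors of the link, alternating. -/
structure IsSectors (χ ψ : ℝ) : Prop where
  left_pos : 0 < χ
  right_pos : 0 < ψ
  lt_pi : χ + ψ < π

section
variable {χ ψ : ℝ}

namespace IsSectors

lemma sin_left (h : IsSectors χ ψ) : 0 < sin χ :=
  sin_pos_of_pos_of_lt_pi h.left_pos (by linarith [h.right_pos, h.lt_pi])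

lemma sin_right (h : IsSectors χ ψ) : 0 < sin ψ :=
  sin_pos_of_pos_of_lt_pi h.right_pos (by linarith [h.left_pos, h.lt_pi])

lemma sin_add_pos (h : IsSectors χ ψ) : 0 < sin (χ + ψ) :=
  sin_pos_of_pos_of_lt_pi (by linarith [h.left_pos, h.right_pos]) h.lt_pi

end IsSectors

/-- The piecewise linear map to the plane with sectors of angles `χ` and `ψ`. -/
def wedge (χ ψ : ℝ) (v : ℝ × ℝ) : ℂ :=
  ⟨max v.1 0 + v.2 * cos χ + max (-v.1) 0 * cos (χ + ψ), v.2 * sin χ + max (-v.1) 0 * sin (χ + ψ)⟩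

/-- The inverse of `wedge`. -/
def unwedge (χ ψ : ℝ) (z : ℂ) : ℝ × ℝ :=
  let q := z.im * cos χ - z.re * sin χ
  (max (-q / sin χ) 0 - max (q / sin ψ) 0,
    z.re * cos χ + z.im * sin χ - max (-q / sin χ) 0 * cos χ - max (q / sin ψ) 0 * cos ψ)

lemma continuous_wedge (χ ψ : ℝ) : Continuous (wedge χ ψ) := by
  have : wedge χ ψ = fun v : ℝ × ℝ =>
      ((max v.1 0 + v.2 * cos χ + max (-v.1) 0 * cos (χ + ψ) : ℝ) : ℂ) +
      ((v.2 * sin χ + max (-v.1) 0 * sin (χ + ψ) : ℝ) : ℂ) * I := by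
    ext v
    apply Complex.ext
    · simp only [wedge, add_re, Complex.ofReal_re, Complex.re_ofReal_mul, Complex.I_re]; ring
    · simp only [wedge, add_im, Complex.ofReal_im, Complex.im_ofReal_mul, Complex.I_im]; ring
  rw [this]
  fun_prop

lemma continuous_unwedge (χ ψ : ℝ) : Continuous (unwedge χ ψ) := by
  unfold unwedge
  fun_prop

lemma IsSectors.unwedge_wedge (h : IsSectors χ ψ) (v : ℝ × ℝ) : unwedge χ ψ (wedge χ ψ v) = v := by
  have h1 := h.sin_left; have h2 := h.sin_right
  have hq : (wedge χ ψ v).im * cos χ - (wedge χ ψ v).re * sin χ =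
      -(max v.1 0 * sin χ) + max (-v.1) 0 * sin ψ := by
    simp only [wedge, sin_add, cos_add]
    linear_combination (max (-v.1) 0 * sin ψ) * sin_sq_add_cos_sq χ
  have hr : (wedge χ ψ v).re * cos χ + (wedge χ ψ v).im * sin χ =
      max v.1 0 * cos χ + v.2 + max (-v.1) 0 * cos ψ := by
    simp only [wedge, sin_add, cos_add]
    linear_combination (v.2 + max (-v.1) 0 * cos ψ) * sin_sq_add_cos_sq χ
  rw [unwedge]; simp only [hq, hr]
  rcases le_total 0 v.1 with hv | hv
  · rw [max_eq_left hv, max_eq_right (by linarith : -v.1 ≤ 0)]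
    have e1 : -(-(v.1 * sin χ) + 0 * sin ψ) / sin χ = v.1 := by field_simp; ring
    rw [e1, max_eq_left hv, max_eq_right (div_nonpos_of_nonpos_of_nonneg (by nlinarith) h2.le)]
    ext <;> simp
  · rw [max_eq_right hv, max_eq_left (by linarith : 0 ≤ -v.1)]
    have e1 : (-(0 * sin χ) + -v.1 * sin ψ) / sin ψ = -v.1 := by field_simp; ring
    rw [e1, max_eq_left (by linarith : 0 ≤ -v.1),
      max_eq_right (div_nonpos_of_nonpos_of_nonneg (by nlinarith) h1.le)]
    ext <;> simp

lemma IsSectors.wedge_unwedge (h : IsSectors χ ψ) (z : ℂ) : wedge χ ψ (unwedge χ ψ z) = z := by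
  have h1 := h.sin_left; have h2 := h.sin_right
  have hs := sin_sq_add_cos_sq χ; set q := z.im * cos χ - z.re * sin χ with hq
  obtain ⟨a, b, ha, hb, e1, e2, e3⟩ : ∃ a b : ℝ, max (a - b) 0 = a ∧ max (-(a - b)) 0 = b ∧
      max (-q / sin χ) 0 = a ∧ max (q / sin ψ) 0 = b ∧
      q = b * sin ψ - a * sin χ := by
    rcases le_total 0 q with hv | hv
    · have hn : 0 ≤ q / sin ψ := by positivity
      refine ⟨0, q / sin ψ, ?_, ?_, ?_, max_eq_left hn, by field_simp; ring⟩
      · exact max_eq_right (by linarith)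
      · rw [max_eq_left (by linarith)]; ring
      · exact max_eq_right (div_nonpos_of_nonpos_of_nonneg (by linarith) h1.le)
    · have hn : 0 ≤ -q / sin χ := div_nonneg (by linarith) h1.le
      refine ⟨-q / sin χ, 0, ?_, ?_, max_eq_left hn, ?_, by field_simp; ring⟩
      · rw [max_eq_left (by linarith)]; ring
      · exact max_eq_right (by linarith)
      · exact max_eq_right (div_nonpos_of_nonpos_of_nonneg hv h2.le)
  have hu : unwedge χ ψ z = (a - b, z.re * cos χ + z.im * sin χ - a * cos χ -
      b * cos ψ) := by
    rw [unwedge]; simp only [← hq, e1, e2]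
  rw [hu, wedge]; simp only [ha, hb, sin_add, cos_add]
  rw [hq] at e3
  apply Complex.ext
  · simp only; linear_combination (z.re - a) * hs + sin χ * e3
  · simp only; linear_combination z.im * hs - cos χ * e3

lemma IsSectors.exists_wedge_eq (h : IsSectors χ ψ) (hv : 0 ≤ v.2) :
    ∃ r x, 0 ≤ r ∧ 0 ≤ x ∧ x ≤ χ + ψ ∧ wedge χ ψ v = cis r x := by
  have h1 := h.sin_left; have h2 := h.sin_right
  have h3 := h.sin_add_pos; have hm : 0 ≤ max (-v.1) 0 := le_max_right _ _
  have hm' : 0 ≤ max v.1 0 := le_max_right _ _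
  have hη : 0 < χ + ψ := by linarith [h.left_pos, h.right_pos]
  obtain ⟨x, hx0, hx1, hx⟩ := exists_cis (z := wedge χ ψ v) (by
    change 0 ≤ v.2 * sin χ + max (-v.1) 0 * sin (χ + ψ)
    positivity)
  rcases (norm_nonneg (wedge χ ψ v)).eq_or_lt with h0 | h0
  · exact ⟨0, 0, le_rfl, le_rfl, hη.le, by rw [cis_zero]; exact norm_eq_zero.1 h0.symm⟩
  · refine ⟨_, x, h0.le, hx0, ?_, hx⟩
    by_contra hcon
    push Not at hcon
    have hsin : 0 < sin (x - (χ + ψ)) := sin_pos_of_pos_of_lt_pi (by linarith) (by linarith)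
    have e1 := congrArg Complex.re hx; have e2 := congrArg Complex.im hx
    simp only [cis, wedge] at e1 e2
    have : ‖wedge χ ψ v‖ * sin (x - (χ + ψ)) = -(max v.1 0 * sin (χ + ψ) + v.2 * sin ψ) := by
      rw [sin_sub]
      have e3 : sin ψ = sin (χ + ψ) * cos χ - cos (χ + ψ) * sin χ := by
        rw [← sin_sub]; congr 1; ring
      rw [e3]; simp only [wedge]
      linear_combination sin (χ + ψ) * e1 - cos (χ + ψ) * e2
    have h4 : 0 < ‖wedge χ ψ v‖ * sin (x - (χ + ψ)) := mul_pos h0 hsin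
    have h5 : 0 ≤ max v.1 0 * sin (χ + ψ) + v.2 * sin ψ := by positivity
    linarith

lemma IsSectors.unwedge_cis_nonneg (h : IsSectors χ ψ) {r x : ℝ} (hr : 0 ≤ r) (h0 : 0 ≤ x)
    (h1 : x ≤ χ + ψ) : 0 ≤ (unwedge χ ψ (cis r x)).2 := by
  have s1 := h.sin_left; have s2 := h.sin_right
  have hq : (cis r x).im * cos χ - (cis r x).re * sin χ = r * sin (x - χ) := by
    simp only [cis, sin_sub]; ring
  have hr' : (cis r x).re * cos χ + (cis r x).im * sin χ = r * cos (x - χ) := by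
    simp only [cis, cos_sub]; ring
  have hpi := h.lt_pi; have l0 := h.left_pos
  have r0 := h.right_pos; rw [unwedge]
  simp only [hq, hr']
  rcases le_total x χ with hx | hx
  · have hs : sin (x - χ) ≤ 0 := sin_nonpos_of_nonpos_of_neg_pi_le (by linarith) (by linarith)
    rw [max_eq_left (div_nonneg (by nlinarith) s1.le),
      max_eq_right (div_nonpos_of_nonpos_of_nonneg (by nlinarith) s2.le)]
    have e : sin x = sin (x - χ) * cos χ + cos (x - χ) * sin χ := by rw [← sin_add]; congr 1; ring
    have hx' : 0 ≤ sin x := sin_nonneg_of_nonneg_of_le_pi h0 (by linarith)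
    have : r * cos (x - χ) - -(r * sin (x - χ)) / sin χ * cos χ -
        0 * cos ψ = r * sin x / sin χ := by
      rw [e]; field_simp; ring
    rw [this]
    positivity
  · have hs : 0 ≤ sin (x - χ) := sin_nonneg_of_nonneg_of_le_pi (by linarith) (by linarith)
    rw [max_eq_left (a := r * sin (x - χ) / sin ψ) (by positivity),
      max_eq_right (div_nonpos_of_nonpos_of_nonneg (by nlinarith) s1.le)]
    have e : sin (χ + ψ - x) = sin ψ * cos (x - χ) - cos ψ * sin (x - χ) := by
      rw [← sin_sub]; congr 1; ring
    have hx' : 0 ≤ sin (χ + ψ - x) := sin_nonneg_of_nonneg_of_le_pi (by linarith) (by linarith)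
    have : r * cos (x - χ) - 0 * cos χ - r * sin (x - χ) / sin ψ * cos ψ =
        r * sin (χ + ψ - x) / sin ψ := by
      rw [e]; field_simp; ring
    rw [this]
    positivity

/-- The map of the upper half-plane of the link. -/
def upMap (χ ψ : ℝ) (v : ℝ × ℝ) : ℂ := foldPow (π / (χ + ψ)) (wedge χ ψ v)

/-- The inverse of `upMap`. -/
def upInv (χ ψ : ℝ) (z : ℂ) : ℝ × ℝ := unwedge χ ψ (foldPow ((χ + ψ) / π) z)

namespace IsSectors

lemma add_pos (h : IsSectors χ ψ) : 0 < χ + ψ := by linarith [h.left_pos, h.right_pos]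

lemma scale_mem (h : IsSectors χ ψ) {x : ℝ} (h0 : 0 ≤ x) (h1 : x ≤ χ + ψ) :
    0 ≤ π / (χ + ψ) * x ∧ π / (χ + ψ) * x ≤ π := by
  have := h.add_pos; have hp := pi_pos
  refine ⟨by positivity, ?_⟩
  rw [div_mul_eq_mul_div, div_le_iff₀ this]
  nlinarith

lemma upMap_spec (h : IsSectors χ ψ) (hv : 0 ≤ v.2) :
    ∃ r x, 0 ≤ r ∧ 0 ≤ x ∧ x ≤ χ + ψ ∧ wedge χ ψ v = cis r x ∧
      upMap χ ψ v = cis r (π / (χ + ψ) * x) := by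
  obtain ⟨r, x, hr, h0, h1, e⟩ := h.exists_wedge_eq hv
  refine ⟨r, x, hr, h0, h1, e, ?_⟩
  rw [upMap, e, foldPow_cis _ hr h0 (h1.trans h.lt_pi.le)]

lemma upInv_upMap (h : IsSectors χ ψ) (hv : 0 ≤ v.2) :
    0 ≤ (upMap χ ψ v).im ∧ upInv χ ψ (upMap χ ψ v) = v := by
  obtain ⟨r, x, hr, h0, h1, e, e'⟩ := h.upMap_spec hv; obtain ⟨a0, a1⟩ := h.scale_mem h0 h1
  rw [e']
  refine ⟨mul_nonneg hr (sin_nonneg_of_nonneg_of_le_pi a0 a1), ?_⟩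
  have := h.add_pos; have hp := pi_pos
  rw [upInv, foldPow_cis _ hr a0 a1,
    show (χ + ψ) / π * (π / (χ + ψ) * x) = x by field_simp, ← e, h.unwedge_wedge]

lemma upMap_upInv (h : IsSectors χ ψ) (hz : 0 ≤ z.im) :
    0 ≤ (upInv χ ψ z).2 ∧ upMap χ ψ (upInv χ ψ z) = z := by
  obtain ⟨x, h0, h1, e⟩ := exists_cis hz; have hη := h.add_pos
  have hp := pi_pos; have hr := norm_nonneg z
  have a0 : 0 ≤ (χ + ψ) / π * x := by positivity
  have a1 : (χ + ψ) / π * x ≤ χ + ψ := by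
    rw [div_mul_eq_mul_div, div_le_iff₀ hp]
    nlinarith
  have e1 : upInv χ ψ z = unwedge χ ψ (cis ‖z‖ ((χ + ψ) / π * x)) := by
    conv_lhs => rw [e]
    rw [upInv, foldPow_cis _ hr h0 h1]
  rw [e1]
  refine ⟨h.unwedge_cis_nonneg hr a0 a1, ?_⟩
  rw [upMap, h.wedge_unwedge, foldPow_cis _ hr a0 (a1.trans h.lt_pi.le),
    show π / (χ + ψ) * ((χ + ψ) / π * x) = x by field_simp, ← e]

lemma upMap_real (h : IsSectors χ ψ) (t : ℝ) : upMap χ ψ (t, 0) = t := by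
  have hη := h.add_pos; have hp := pi_pos
  rcases le_total 0 t with ht | ht
  · have : wedge χ ψ (t, 0) = cis t 0 := by apply Complex.ext <;> simp [wedge, cis, ht]
    rw [upMap, this, foldPow_cis _ ht le_rfl hp.le]
    apply Complex.ext <;> simp [cis]
  · have : wedge χ ψ (t, 0) = cis (-t) (χ + ψ) := by apply Complex.ext <;> simp [wedge, cis, ht]
    rw [upMap, this, foldPow_cis _ (by linarith) hη.le h.lt_pi.le, div_mul_cancel₀ _ hη.ne']
    apply Complex.ext <;> simp [cis]

lemma upInv_real (h : IsSectors χ ψ) (t : ℝ) : upInv χ ψ t = (t, 0) := by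
  rw [← h.upMap_real t, (h.upInv_upMap le_rfl).2]

end IsSectors

lemma continuous_upMap (χ ψ : ℝ) : Continuous (upMap χ ψ) :=
  (continuous_foldPow _).comp (continuous_wedge χ ψ)

lemma continuous_upInv (χ ψ : ℝ) : Continuous (upInv χ ψ) :=
  (continuous_unwedge χ ψ).comp (continuous_foldPow _)

/-- The map from the link to the plane that is linear on sectors, up to scaling of angles. -/
def linkMap (χ ψ : ℝ) (v : ℝ × ℝ) : ℂ := if 0 ≤ v.2 then upMap χ ψ v else -upMap χ ψ (-v)

/-- The inverse of `linkMap`. -/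
def linkInv (χ ψ : ℝ) (z : ℂ) : ℝ × ℝ := if 0 ≤ z.im then upInv χ ψ z else -upInv χ ψ (-z)

namespace IsSectors

/-- The link as a plane. -/
def linkHomeo (h : IsSectors χ ψ) : (ℝ × ℝ) ≃ₜ ℂ where
  toFun := linkMap χ ψ
  invFun := linkInv χ ψ
  left_inv v := by
    rw [linkMap]
    split_ifs with hv
    · obtain ⟨h1, h2⟩ := h.upInv_upMap hv
      rw [linkInv, if_pos h1, h2]
    · obtain ⟨h1, h2⟩ := h.upInv_upMap (v := -v) (by simp; linarith)
      have h3 : ¬0 ≤ (-upMap χ ψ (-v)).im := by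
        intro hcon; have h4 : (upMap χ ψ (-v)).im = 0 := le_antisymm (by simpa using hcon) h1
        have h5 : upMap χ ψ (-v) = ((upMap χ ψ (-v)).re : ℂ) := by apply Complex.ext <;> simp [h4]
        rw [h5, h.upInv_real] at h2; have := congrArg Prod.snd h2
        simp only [Prod.snd_neg] at this; linarith
      rw [linkInv, if_neg h3, neg_neg, h2, neg_neg]
  right_inv z := by
    rw [linkInv]
    split_ifs with hz
    · obtain ⟨h1, h2⟩ := h.upMap_upInv hz
      rw [linkMap, if_pos h1, h2]
    · obtain ⟨h1, h2⟩ := h.upMap_upInv (z := -z) (by simp; linarith)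
      have h3 : ¬0 ≤ (-upInv χ ψ (-z)).2 := by
        intro hcon; have h4 : (upInv χ ψ (-z)).2 = 0 := le_antisymm (by simpa using hcon) h1
        have h5 : upInv χ ψ (-z) = ((upInv χ ψ (-z)).1, 0) := Prod.ext rfl h4
        rw [h5, h.upMap_real] at h2; have := congrArg Complex.im h2
        simp only [Complex.neg_im, Complex.ofReal_im] at this; linarith
      rw [linkMap, if_neg h3, neg_neg, h2, neg_neg]
  continuous_toFun := by
    refine continuous_if_le continuous_const continuous_snd (continuous_upMap χ ψ).continuousOn
      ((continuous_upMap χ ψ).comp continuous_neg).neg.continuousOn ?_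
    rintro ⟨a, b⟩ hv; obtain rfl : 0 = b := hv
    have : -((a, 0) : ℝ × ℝ) = (-a, 0) := by simp
    rw [this, h.upMap_real, h.upMap_real]; simp
  continuous_invFun := by
    refine continuous_if_le continuous_const Complex.continuous_im
      (continuous_upInv χ ψ).continuousOn
      ((continuous_upInv χ ψ).comp continuous_neg).neg.continuousOn ?_
    intro z hz
    have h5 : z = (z.re : ℂ) := by apply Complex.ext <;> simp [← hz]
    rw [h5, ← Complex.ofReal_neg, h.upInv_real, h.upInv_real]; simp

lemma linkMap_neg (h : IsSectors χ ψ) (v : ℝ × ℝ) : linkMap χ ψ (-v) = -linkMap χ ψ v := by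
  rcases lt_trichotomy v.2 0 with hv | hv | hv
  · rw [linkMap, if_pos (by simp; linarith), linkMap, if_neg (by linarith), neg_neg]
  · obtain ⟨a, b⟩ := v
    obtain rfl : b = 0 := hv; have : -((a, 0) : ℝ × ℝ) = (-a, 0) := by simp
    rw [this, linkMap, if_pos le_rfl, linkMap, if_pos le_rfl, h.upMap_real, h.upMap_real]; simp
  · rw [linkMap, if_neg (by simp; linarith), linkMap, if_pos hv.le, neg_neg]

lemma linkMap_pair_pos (h : IsSectors χ ψ) {x y x' y' : ℝ} (hs : s = 1 ∨ s = -1) (hx : 0 ≤ x)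
    (hy : 0 ≤ y) (hx' : 0 ≤ x') (hy' : 0 ≤ y') :
    ‖linkMap χ ψ (s * x, y)‖ * ‖linkMap χ ψ (s * x', y')‖ * cos ((χ + ψ) / π *
      (linkMap χ ψ (s * x, y) * conj (linkMap χ ψ (s * x', y'))).arg) =
      x * x' + y * y' + (x * y' + x' * y) * cos (if s = 1 then χ else ψ) := by
  have hη := h.add_pos; have hp := pi_pos
  rw [linkMap, linkMap, if_pos hy, if_pos hy']
  obtain ⟨r, t, hr, h0, h1, e1, e2⟩ := h.upMap_spec (v := (s * x, y)) hy
  obtain ⟨r', t', hr', h0', h1', e1', e2'⟩ := h.upMap_spec (v := (s * x', y')) hy'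
  rw [e2, e2', norm_cis hr, norm_cis hr', cis_mul_conj]
  have key : r * r' * cos ((χ + ψ) / π * (cis (r * r') (π / (χ + ψ) * t - π / (χ + ψ) * t')).arg) =
      (cis r t * conj (cis r' t')).re := by
    rw [cis_mul_conj]
    rcases (mul_nonneg hr hr').eq_or_lt with h2 | h2
    · simp [cis, ← h2]
    · obtain ⟨a0, a1⟩ := h.scale_mem h0 h1
      obtain ⟨a0', a1'⟩ := h.scale_mem h0' h1'
      rw [cos_arg_cis _ h2 (abs_le.2 ⟨by linarith, by linarith⟩), ← mul_sub, ← mul_assoc,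
        div_mul_div_cancel₀ hp.ne', div_self hη.ne', one_mul, cis]
  rw [key, ← e1, ← e1']; have hs1 := sin_sq_add_cos_sq χ
  have hs2 := sin_sq_add_cos_sq ψ
  rcases hs with rfl | rfl
  · have e : ∀ x y : ℝ, 0 ≤ x → wedge χ ψ (1 * x, y) = ⟨x + y * cos χ, y * sin χ⟩ := by
      intro x y hx
      apply Complex.ext <;> simp [wedge, hx]
    rw [e x y hx, e x' y' hx', if_pos rfl]; simp
    linear_combination y * y' * hs1
  · have e : ∀ x y : ℝ, 0 ≤ x → wedge χ ψ (-1 * x, y) =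
        ⟨y * cos χ + x * cos (χ + ψ), y * sin χ + x * sin (χ + ψ)⟩ := by
      intro x y hx
      apply Complex.ext <;> simp [wedge, hx]
    rw [e x y hx, e x' y' hx', if_neg (by norm_num)]
    simp [cos_add, sin_add]
    linear_combination (y * y' + y * x' * cos ψ + x * y' * cos ψ + x * x' * (sin ψ ^ 2 +
      cos ψ ^ 2)) * hs1 + x * x' * hs2

lemma linkMap_pair (h : IsSectors χ ψ) {d x y x' y' : ℝ} (hs : s = 1 ∨ s = -1)
    (hd : d = 1 ∨ d = -1) (hx : 0 ≤ x) (hy : 0 ≤ y) (hx' : 0 ≤ x') (hy' : 0 ≤ y') :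
    ‖linkMap χ ψ (s * x, d * y)‖ * ‖linkMap χ ψ (s * x', d * y')‖ * cos ((χ + ψ) / π *
      (linkMap χ ψ (s * x, d * y) * conj (linkMap χ ψ (s * x', d * y'))).arg) =
      x * x' + y * y' + (x * y' + x' * y) * cos (if s = d then χ else ψ) := by
  rcases hd with rfl | rfl
  · simpa using h.linkMap_pair_pos hs hx hy hx' hy'
  · have e : ∀ x y : ℝ, ((s * x, -1 * y) : ℝ × ℝ) = -(-s * x, y) := by intro x y; simp
    rw [e, e, h.linkMap_neg, h.linkMap_neg, norm_neg, norm_neg, map_neg, neg_mul_neg,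
      h.linkMap_pair_pos (s := -s) (by rcases hs with rfl | rfl <;> simp) hx hy hx' hy']
    congr 4
    rw [neg_eq_iff_eq_neg]

end IsSectors
end

/-! ### Cylindrical coordinates -/

/-- The multiple of `z` with norm `g`. -/
def radial (g : ℝ) (z : ℂ) : ℂ := ((g / ‖z‖ : ℝ) : ℂ) * z

lemma norm_radial {g : ℝ} (hg : 0 ≤ g) (h : z = 0 → g = 0) : ‖radial g z‖ = g := by
  rcases eq_or_ne z 0 with rfl | hz
  · simp [radial, h rfl]
  · rw [radial, norm_mul, Complex.norm_real, norm_div, norm_norm, norm_of_nonneg hg]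
    have := norm_ne_zero_iff.2 hz; field_simp

lemma radial_radial {f g : ℝ} (hg : 0 < g) : radial f (radial g z) = radial f z := by
  rcases eq_or_ne z 0 with rfl | hz
  · simp [radial]
  · have h1 : ‖radial g z‖ = g := norm_radial hg.le fun h => absurd h hz
    rw [radial, h1, radial, radial, ← mul_assoc, ← Complex.ofReal_mul, div_mul_div_cancel₀ hg.ne']

lemma radial_norm (z : ℂ) : radial ‖z‖ z = z := by
  rcases eq_or_ne z 0 with rfl | hz
  · simp [radial]
  · rw [radial, div_self (norm_ne_zero_iff.2 hz), Complex.ofReal_one, one_mul]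

lemma continuousOn_radial {X : Type} [TopologicalSpace X] {s : Set X} {g : X → ℝ} {z : X → ℂ}
    (hg : ContinuousOn g s) (hz : ContinuousOn z s) (hn : ∀ x ∈ s, 0 ≤ g x)
    (h0 : ∀ x ∈ s, z x = 0 → g x = 0) : ContinuousOn (fun x => radial (g x) (z x)) s := by
  intro x hx
  by_cases hzx : z x = 0
  · rw [ContinuousWithinAt, show radial (g x) (z x) = 0 by simp [radial, hzx],
      tendsto_zero_iff_norm_tendsto_zero]
    have h1 := hg x hx; rw [ContinuousWithinAt, h0 x hx hzx] at h1
    refine h1.congr' ?_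
    filter_upwards [self_mem_nhdsWithin] with y hy
    exact (norm_radial (hn y hy) (h0 y hy)).symm
  · exact (Complex.continuous_ofReal.continuousAt.comp_continuousWithinAt
      ((hg x hx).div (hz x hx).norm (norm_ne_zero_iff.2 hzx))).mul (hz x hx)

/-- The distance in the coordinates of the link. -/
def polDist (a : ℝ) (q q' : ℂ × ℝ) : ℝ :=
  arcosh ((q.2 + q'.2 - 2 * (‖q.1‖ * ‖q'.1‖ * cos (a * (q.1 * conj q'.1).arg))) /
    (2 * (√(q.2 - ‖q.1‖ ^ 2) * √(q'.2 - ‖q'.1‖ ^ 2))))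

/-- The domain of the coordinates of the link. -/
def polRegion : Set (ℂ × ℝ) := {q | ‖q.1‖ ^ 2 < q.2}

lemma isOpen_polRegion : IsOpen polRegion := isOpen_lt (by fun_prop) (by fun_prop)

/-- The distance from the axis. -/
def axisDist (q : ℂ × ℝ) : ℝ := arsinh (‖q.1‖ / √(q.2 - ‖q.1‖ ^ 2))

section
variable {q q' : ℂ × ℝ}

lemma pos_of_mem_polRegion (hq : q ∈ polRegion) : 0 < q.2 := (sq_nonneg ‖q.1‖).trans_lt hq

lemma sqrt_gap_pos (hq : q ∈ polRegion) : 0 < √(q.2 - ‖q.1‖ ^ 2) := sqrt_pos.2 (sub_pos.2 hq)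

lemma axisDist_nonneg (q : ℂ × ℝ) : 0 ≤ axisDist q := arsinh_nonneg_iff.2 (by positivity)

lemma sinh_axisDist (q : ℂ × ℝ) : sinh (axisDist q) = ‖q.1‖ / √(q.2 - ‖q.1‖ ^ 2) := sinh_arsinh _

lemma cosh_axisDist (hq : q ∈ polRegion) : cosh (axisDist q) = √q.2 / √(q.2 - ‖q.1‖ ^ 2) := by
  have h1 : 0 < q.2 - ‖q.1‖ ^ 2 := sub_pos.2 hq
  rw [axisDist, cosh_arsinh, ← sqrt_div (pos_of_mem_polRegion hq).le, div_pow, sq_sqrt h1.le]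
  congr 1
  field_simp; ring

lemma exp_half_log {x : ℝ} (hx : 0 < x) : exp (log x / 2) = √x := by
  rw [sqrt_eq_rpow, rpow_def_of_pos hx]; ring_nf

lemma tanh_norm_nonneg (z : ℂ) : 0 ≤ tanh ‖z‖ := by
  rw [tanh_eq_sinh_div_cosh]
  exact div_nonneg (sinh_nonneg_iff.2 (norm_nonneg _)) (cosh_pos _).le

/-- The cone as a space of cylindrical coordinates. -/
def cylinderHomeo : OpenPartialHomeomorph (ℂ × ℝ) (ℂ × ℝ) where
  toFun q := (radial (axisDist q) q.1, log q.2 / 2)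
  invFun q := (radial (exp q.2 * tanh ‖q.1‖) q.1, exp (2 * q.2))
  source := polRegion
  target := univ
  map_source' _ _ := mem_univ _
  map_target' q _ := by
    have h0 := tanh_norm_nonneg q.1; change ‖radial (exp q.2 * tanh ‖q.1‖) q.1‖ ^ 2 < exp (2 * q.2)
    rw [norm_radial (by positivity) (fun h => by simp [h]), mul_pow, two_mul, exp_add, ← sq]
    have h1 : tanh ‖q.1‖ < 1 := tanh_lt_one _; have : tanh ‖q.1‖ ^ 2 < 1 := by nlinarith
    have := pow_pos (exp_pos q.2) 2
    nlinarith
  left_inv' q hq := by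
    have hT := pos_of_mem_polRegion hq; have hs := sqrt_gap_pos hq
    refine Prod.ext ?_ ?_
    · simp only
      have hn : ‖radial (axisDist q) q.1‖ = axisDist q :=
        norm_radial (axisDist_nonneg q) fun h => by simp [axisDist, h]
      rw [hn, exp_half_log hT, tanh_eq_sinh_div_cosh, sinh_axisDist, cosh_axisDist hq,
        div_div_div_cancel_right₀ hs.ne', mul_div_cancel₀ _ (sqrt_pos.2 hT).ne']
      rcases eq_or_ne q.1 0 with h0 | h0
      · simp [h0, radial]
      · have : 0 < axisDist q := arsinh_pos_iff.2 (div_pos (norm_pos_iff.2 h0) hs)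
        rw [radial_radial this, radial_norm]
    · simp only
      rw [mul_div_cancel₀ _ two_ne_zero, exp_log hT]
  right_inv' q _ := by
    have h0 := tanh_norm_nonneg q.1
    refine Prod.ext ?_ ?_
    · simp only [axisDist]
      rw [norm_radial (by positivity) (fun h => by simp [h])]
      have hc := cosh_pos ‖q.1‖; have e := exp_pos q.2
      have h1 : exp (2 * q.2) - (exp q.2 * tanh ‖q.1‖) ^ 2 = (exp q.2 / cosh ‖q.1‖) ^ 2 := by
        have := cosh_sq ‖q.1‖; rw [tanh_eq_sinh_div_cosh, two_mul, exp_add]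
        field_simp; linarith
      rw [h1, sqrt_sq (by positivity), tanh_eq_sinh_div_cosh,
        show exp q.2 * (sinh ‖q.1‖ / cosh ‖q.1‖) / (exp q.2 / cosh ‖q.1‖) =
          sinh ‖q.1‖ by field_simp, arsinh_sinh]
      rcases eq_or_ne q.1 0 with h0 | h0
      · simp [h0, radial]
      · have h2 : 0 < sinh ‖q.1‖ := sinh_pos_iff.2 (norm_pos_iff.2 h0)
        rw [radial_radial (by positivity), radial_norm]
    · simp only
      rw [log_exp, mul_div_cancel_left₀ _ two_ne_zero]
  open_source := isOpen_polRegion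
  open_target := isOpen_univ
  continuousOn_toFun := by
    refine ContinuousOn.prodMk (continuousOn_radial ?_ continuousOn_fst
      (fun q _ => axisDist_nonneg q) fun q _ h => by simp [axisDist, h]) ?_
    · refine continuous_arsinh.comp_continuousOn (ContinuousOn.div (by fun_prop) (by fun_prop) ?_)
      exact fun q hq => (sqrt_gap_pos hq).ne'
    · exact (continuousOn_snd.log fun q hq => (pos_of_mem_polRegion hq).ne').div_const _
  continuousOn_invFun := by
    have ht : Continuous fun q : ℂ × ℝ => tanh ‖q.1‖ := by
      simp only [tanh_eq_sinh_div_cosh]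
      exact (continuous_sinh.comp (by fun_prop)).div (continuous_cosh.comp (by fun_prop))
        fun q => (cosh_pos _).ne'
    refine ContinuousOn.prodMk (continuousOn_radial ?_ continuousOn_fst (fun q _ => ?_)
      fun q _ h => by simp [h]) (by fun_prop)
    · exact ((continuous_exp.comp continuous_snd).mul ht).continuousOn
    · exact mul_nonneg (exp_pos _).le (tanh_norm_nonneg _)

lemma coneDist_cylinderHomeo (θ : ℝ) (hq : q ∈ polRegion) (hq' : q' ∈ polRegion) :
    coneDist θ (cylinderHomeo q) (cylinderHomeo q') = polDist (θ / (2 * π)) q q' := by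
  have hT := pos_of_mem_polRegion hq; have hT' := pos_of_mem_polRegion hq'
  have hs := sqrt_gap_pos hq; have hs' := sqrt_gap_pos hq'
  have hn : ∀ q : ℂ × ℝ, ‖radial (axisDist q) q.1‖ = axisDist q := fun q =>
    norm_radial (axisDist_nonneg q) fun h => by simp [axisDist, h]
  change arcosh (cosh ‖radial (axisDist q) q.1‖ * cosh ‖radial (axisDist q') q'.1‖ *
    cosh (log q.2 / 2 - log q'.2 / 2) -
    sinh ‖radial (axisDist q) q.1‖ * sinh ‖radial (axisDist q') q'.1‖ * cos (θ / (2 * π) *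
        (radial (axisDist q) q.1 * conj (radial (axisDist q') q'.1)).arg)) = _
  rw [hn, hn, cosh_axisDist hq, cosh_axisDist hq', sinh_axisDist, sinh_axisDist]
  have hcosh : cosh (log q.2 / 2 - log q'.2 / 2) = (q.2 + q'.2) / (2 * (√q.2 * √q'.2)) := by
    rw [cosh_eq, neg_sub, exp_sub, exp_sub, exp_half_log hT, exp_half_log hT']
    have h1 := sqrt_pos.2 hT; have h2 := sqrt_pos.2 hT'
    field_simp; rw [sq_sqrt hT.le, sq_sqrt hT'.le]
  have hmul : ‖q.1‖ / √(q.2 - ‖q.1‖ ^ 2) * (‖q'.1‖ / √(q'.2 - ‖q'.1‖ ^ 2)) * cos (θ / (2 * π) *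
        (radial (axisDist q) q.1 * conj (radial (axisDist q') q'.1)).arg) =
      ‖q.1‖ / √(q.2 - ‖q.1‖ ^ 2) * (‖q'.1‖ / √(q'.2 - ‖q'.1‖ ^ 2)) *
      cos (θ / (2 * π) * (q.1 * conj q'.1).arg) := by
    rcases eq_or_ne q.1 0 with h0 | h0
    · simp [h0]
    rcases eq_or_ne q'.1 0 with h0' | h0'
    · simp [h0']
    have h1 : 0 < axisDist q := arsinh_pos_iff.2 (div_pos (norm_pos_iff.2 h0) hs)
    have h1' : 0 < axisDist q' := arsinh_pos_iff.2 (div_pos (norm_pos_iff.2 h0') hs')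
    have e : radial (axisDist q) q.1 * conj (radial (axisDist q') q'.1) =
        ((axisDist q / ‖q.1‖ * (axisDist q' / ‖q'.1‖) : ℝ) : ℂ) * (q.1 * conj q'.1) := by
      rw [radial, radial, map_mul, conj_ofReal]; push_cast
      ring
    rw [e, Complex.arg_real_mul]
    exact mul_pos (div_pos h1 (norm_pos_iff.2 h0)) (div_pos h1' (norm_pos_iff.2 h0'))
  rw [hmul, hcosh, polDist]
  congr 1
  have h1 := sqrt_pos.2 hT; have h2 := sqrt_pos.2 hT'
  field_simp

lemma mul_conj_of_norm_one (he : ‖e‖ = 1) : e * conj e = 1 := by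
  rw [Complex.mul_conj, normSq_eq_norm_sq, he]; simp

lemma cis_norm_arg (z : ℂ) : cis ‖z‖ z.arg = z := by
  apply Complex.ext
  · exact Complex.norm_mul_cos_arg z
  · exact Complex.norm_mul_sin_arg z

lemma norm_pos_of_mul_re_pos (h : 0 < (z * e).re) : 0 < ‖z‖ := by
  rw [norm_pos_iff]; rintro rfl
  simp at h

/-- The chart of a sector of a cone. -/
def sectorChart (ha0 : 0 < a) (ha1 : a < 1) (he : ‖e‖ = 1) : OpenPartialHomeomorph (ℂ × ℝ) ℍ³ where
  toFun q := ⟨(cis ‖q.1‖ (a * (q.1 * conj e).arg), exp (log (q.2 - ‖q.1‖ ^ 2) / 2)), exp_pos _⟩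
  invFun p := (cis ‖p.1.1‖ (p.1.1.arg / a) * e, ‖p.1.1‖ ^ 2 + p.1.2 ^ 2)
  source := polRegion ∩ {q | 0 < (q.1 * conj e).re}
  target := {p | 0 < p.1.1.re ∧ |p.1.1.arg| < a * (π / 2)}
  map_source' := by
    rintro q ⟨-, hq⟩; have hpi := pi_pos
    have h1 : |(q.1 * conj e).arg| < π / 2 := Complex.abs_arg_lt_pi_div_two_iff.2 (Or.inl hq)
    have h2 : |a * (q.1 * conj e).arg| < a * (π / 2) := by rw [abs_mul, abs_of_pos ha0]; gcongr
    have h3 : |a * (q.1 * conj e).arg| < π / 2 := h2.trans (by nlinarith)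
    obtain ⟨h4, h5⟩ := abs_lt.1 h3; have h6 := norm_pos_of_mul_re_pos hq
    refine ⟨mul_pos h6 (cos_pos_of_mem_Ioo ⟨h4, h5⟩), ?_⟩
    change |(cis _ _).arg| < _
    rwa [arg_cis h6 ⟨by linarith, by linarith⟩]
  map_target' := by
    rintro p ⟨h1, h2⟩; have hn : 0 < ‖p.1.1‖ := norm_pos_of_mul_re_pos (e := 1) (by rwa [mul_one])
    constructor
    · change ‖cis ‖p.1.1‖ (p.1.1.arg / a) * e‖ ^ 2 < ‖p.1.1‖ ^ 2 + p.1.2 ^ 2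
      rw [norm_mul, he, mul_one, norm_cis hn.le]; have := pow_pos p.2 2
      linarith
    · change 0 < (cis ‖p.1.1‖ (p.1.1.arg / a) * e * conj e).re
      rw [mul_assoc, mul_conj_of_norm_one he, mul_one]
      refine mul_pos hn (cos_pos_of_mem_Ioo ?_)
      rw [mem_Ioo, ← abs_lt, abs_div, abs_of_pos ha0, div_lt_iff₀ ha0, mul_comm]
      exact h2
  left_inv' := by
    rintro q ⟨hq0, hq⟩; have hpi := pi_pos
    have h1 : |(q.1 * conj e).arg| < π / 2 := Complex.abs_arg_lt_pi_div_two_iff.2 (Or.inl hq)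
    have h3 : |a * (q.1 * conj e).arg| < π := by
      rw [abs_mul, abs_of_pos ha0]; nlinarith [abs_nonneg (q.1 * conj e).arg]
    obtain ⟨h4, h5⟩ := abs_lt.1 h3; have h6 := norm_pos_of_mul_re_pos hq
    refine Prod.ext ?_ ?_
    · simp only
      rw [norm_cis h6.le, arg_cis h6 ⟨h4, h5.le⟩, mul_div_cancel_left₀ _ ha0.ne']
      have : ‖q.1‖ = ‖q.1 * conj e‖ := by rw [norm_mul, RCLike.norm_conj, he, mul_one]
      rw [this, cis_norm_arg, mul_assoc, mul_comm _ e, mul_conj_of_norm_one he, mul_one]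
    · simp only
      have : 0 < q.2 - ‖q.1‖ ^ 2 := sub_pos.2 hq0
      rw [norm_cis h6.le, exp_half_log this, sq_sqrt this.le]; ring
  right_inv' := by
    rintro p ⟨h1, h2⟩; have hpi := pi_pos
    have hn : 0 < ‖p.1.1‖ := norm_pos_of_mul_re_pos (e := 1) (by rwa [mul_one])
    have h3 : |p.1.1.arg / a| < π / 2 := by
      rw [abs_div, abs_of_pos ha0, div_lt_iff₀ ha0, mul_comm]
      exact h2
    obtain ⟨h4, h5⟩ := abs_lt.1 h3
    have e1 : ‖cis ‖p.1.1‖ (p.1.1.arg / a) * e‖ = ‖p.1.1‖ := by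
      rw [norm_mul, he, mul_one, norm_cis hn.le]
    refine Subtype.ext (Prod.ext ?_ ?_)
    · simp only
      rw [e1, mul_assoc, mul_conj_of_norm_one he, mul_one, arg_cis hn ⟨by linarith, by linarith⟩,
        mul_div_cancel₀ _ ha0.ne', cis_norm_arg]
    · simp only
      rw [e1, add_sub_cancel_left, exp_half_log (pow_pos p.2 2), sqrt_sq p.2.le]
  open_source := isOpen_polRegion.inter (isOpen_lt continuous_const
    (Complex.continuous_re.comp (by fun_prop)))
  open_target := by
    have h1 : IsOpen {p : ℍ³ | 0 < p.1.1.re} :=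
      isOpen_lt continuous_const (Complex.continuous_re.comp (by fun_prop))
    have h2 : ContinuousOn (fun p : ℍ³ => |p.1.1.arg|) {p | 0 < p.1.1.re} := by
      intro p hp
      have : ContinuousAt (fun p : ℍ³ => p.1.1.arg) p :=
        (Complex.continuousAt_arg (Or.inl hp)).comp (f := fun p : ℍ³ => p.1.1) (by fun_prop)
      exact this.abs.continuousWithinAt
    exact h2.isOpen_inter_preimage h1 isOpen_Iio
  continuousOn_toFun := by
    rintro q ⟨hq0, hq⟩
    have h1 : ContinuousAt (fun q : ℂ × ℝ => (q.1 * conj e).arg) q :=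
      (Complex.continuousAt_arg (Or.inl hq)).comp (f := fun q : ℂ × ℝ => q.1 * conj e) (by fun_prop)
    have h2 : ContinuousAt (fun q : ℂ × ℝ => (‖q.1‖, a * (q.1 * conj e).arg)) q :=
      (by fun_prop : ContinuousAt (fun q : ℂ × ℝ => ‖q.1‖) q).prodMk (h1.const_mul a)
    have h3 : ContinuousAt (fun q : ℂ × ℝ => exp (log (q.2 - ‖q.1‖ ^ 2) / 2)) q := by
      refine continuous_exp.continuousAt.comp (ContinuousAt.div_const (ContinuousAt.log
        (by fun_prop) ?_) _)
      exact (sub_pos.2 hq0).ne'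
    refine ContinuousAt.continuousWithinAt ?_
    exact Topology.IsInducing.subtypeVal.continuousAt_iff.2 ((continuous_cis.continuousAt.comp h2).prodMk h3)
  continuousOn_invFun := by
    rintro p ⟨h1, h2⟩
    have h3 : ContinuousAt (fun p : ℍ³ => p.1.1.arg) p :=
      (Complex.continuousAt_arg (Or.inl h1)).comp (f := fun p : ℍ³ => p.1.1) (by fun_prop)
    have h4 : ContinuousAt (fun p : ℍ³ => (‖p.1.1‖, p.1.1.arg / a)) p :=
      (by fun_prop : ContinuousAt (fun p : ℍ³ => ‖p.1.1‖) p).prodMk (h3.div_const a)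
    refine ContinuousAt.continuousWithinAt (ContinuousAt.prodMk ?_ (by fun_prop))
    exact (continuous_cis.continuousAt.comp h4).mul continuousAt_const

lemma hdist_sectorChart (ha0 : 0 < a) (ha1 : a < 1) (he : ‖e‖ = 1)
    (hq : q ∈ (sectorChart ha0 ha1 he).source) (hq' : q' ∈ (sectorChart ha0 ha1 he).source) :
    hdist (sectorChart ha0 ha1 he q) (sectorChart ha0 ha1 he q') = polDist a q q' := by
  have key : ∀ (r x r' x' s s' : ℝ), 0 < s → 0 < s' → 1 + (‖cis r x - cis r' x'‖ ^ 2 + (s - s') ^ 2) /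
      (2 * s * s') = ((r ^ 2 + s ^ 2) + (r' ^ 2 + s' ^ 2) - 2 * (r * r' * cos (x - x'))) /
      (2 * (s * s')) := by
    intro r x r' x' s s' hs hs'; rw [Complex.sq_norm, normSq_apply]
    simp only [cis, sub_re, sub_im]; rw [cos_sub]
    field_simp
    linear_combination r ^ 2 * sin_sq_add_cos_sq x + r' ^ 2 * sin_sq_add_cos_sq x'
  have h1 : 0 < q.2 - ‖q.1‖ ^ 2 := sub_pos.2 hq.1
  have h1' : 0 < q'.2 - ‖q'.1‖ ^ 2 := sub_pos.2 hq'.1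
  have h2 := abs_lt.1 (Complex.abs_arg_lt_pi_div_two_iff.2 (Or.inl hq.2))
  have h2' := abs_lt.1 (Complex.abs_arg_lt_pi_div_two_iff.2 (Or.inl hq'.2))
  have harg : (q.1 * conj q'.1).arg = (q.1 * conj e).arg - (q'.1 * conj e).arg := by
    have e1 : q.1 * conj q'.1 = (q.1 * conj e) * conj (q'.1 * conj e) := by
      rw [map_mul, Complex.conj_conj]
      linear_combination (-(q.1 * conj q'.1)) * mul_conj_of_norm_one he
    have hne : ∀ q : ℂ × ℝ, ‖q.1 * conj e‖ = ‖q.1‖ := by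
      intro q; rw [norm_mul, RCLike.norm_conj, he, mul_one]
    have := cis_mul_conj ‖q.1 * conj e‖ (q.1 * conj e).arg ‖q'.1 * conj e‖ (q'.1 * conj e).arg
    rw [cis_norm_arg, cis_norm_arg, ← e1] at this; rw [this, hne, hne]
    exact arg_cis (mul_pos (norm_pos_of_mul_re_pos hq.2) (norm_pos_of_mul_re_pos hq'.2)) ⟨by linarith, by linarith⟩
  change arcosh (1 + (‖cis ‖q.1‖ (a * (q.1 * conj e).arg) -
    cis ‖q'.1‖ (a * (q'.1 * conj e).arg)‖ ^ 2 +
    (exp (log (q.2 - ‖q.1‖ ^ 2) / 2) - exp (log (q'.2 - ‖q'.1‖ ^ 2) / 2)) ^ 2) /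
    (2 * exp (log (q.2 - ‖q.1‖ ^ 2) / 2) * exp (log (q'.2 - ‖q'.1‖ ^ 2) / 2))) = _
  rw [key _ _ _ _ _ _ (exp_pos _) (exp_pos _), exp_half_log h1, exp_half_log h1',
    sq_sqrt h1.le, sq_sqrt h1'.le, polDist, harg, mul_sub, add_sub_cancel, add_sub_cancel]

end

/-! ### The distance in the coordinates of the link -/

/-- The angles at the axis of the triangles of the link. -/
structure IsConeAngles (p χ ψ : ℝ) : Prop extends IsSectors χ ψ where
  left : 1 + p ^ 2 - 2 * p * cos χ = (p ^ 2 - 1) ^ 2 * p ^ 2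
  right : 1 + p ^ 2 - 2 * p * cos ψ = (p ^ 2 - 1) ^ 2 * ((p ^ 2) ^ 2)⁻¹

/-- The coordinates of a point of the star, with the link as a plane. -/
def starPol (p χ ψ : ℝ) (b : Weights) : ℂ × ℝ := (linkMap χ ψ (starDir p b), starTop p b)

/-- The bilinear form of the link. -/
def polForm (a : ℝ) (q q' : ℂ × ℝ) : ℝ :=
  q.2 + q'.2 - 2 * (‖q.1‖ * ‖q'.1‖ * cos (a * (q.1 * conj q'.1).arg))

lemma polForm_self (a : ℝ) (q : ℂ × ℝ) : polForm a q q = 2 * (q.2 - ‖q.1‖ ^ 2) := by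
  have : (q.1 * conj q.1).arg = 0 := by
    rw [Complex.mul_conj, Complex.arg_ofReal_of_nonneg (Complex.normSq_nonneg _)]
  rw [polForm, this, mul_zero, cos_zero]; ring

section
variable {p χ ψ : ℝ} {b b' : Weights} {k : ℤ} {ε δ : ℤˣ} {u u' : Bary}

lemma eq_of_axisCoord {x y : ℝ} (hx : axisCoord n v = x)
    (hy : axisCoord (n + 1) v = y) : v = if Even n then (x, y) else (y, x) := by
  rw [axisCoord_add_one] at hy
  by_cases hn : Even n <;> simp only [axisCoord, hn, if_true, if_false] at hx hy ⊢
  · exact Prod.ext hx hy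
  · exact Prod.ext hy hx

lemma unitR_eq (ε : ℤˣ) : unitR ε = 1 ∨ unitR ε = -1 := by
  rcases units_eq_one_or ε with rfl | rfl <;> simp [unitR]

lemma unitR_eq_iff : unitR ε = unitR δ ↔ ε = δ := by rw [unitR, unitR, Int.cast_inj, Units.val_inj]

lemma IsStarForm.polForm_eq (hp : 1 < p) (hs : IsConeAngles p χ ψ) (h : IsStarForm b k ε δ u)
    (h' : IsStarForm b' k ε δ u') : starLen p b * starLen p b' *
      polForm ((χ + ψ) / π) (starPol p χ ψ b) (starPol p χ ψ b') =
        coneConst p * edgeForm (p ^ 2) b b' := by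
  have hp0 : 0 < p := by linarith
  have hl := h.isLinkForm hp0; have hl' := h'.isLinkForm hp0
  have hF := formLen_pos hp0 h.mem; have hF' := formLen_pos hp0 h'.mem
  have v1 := eq_of_axisCoord (hl.fst.trans (mul_assoc _ _ _)) (hl.snd.trans (mul_assoc _ _ _))
  have v2 := eq_of_axisCoord (hl'.fst.trans (mul_assoc _ _ _)) (hl'.snd.trans (mul_assoc _ _ _))
  have pos : ∀ {b ε δ u}, IsStarForm b k ε δ u →
      0 ≤ p ^ k * (u 1 / formLen p u + p ^ 2 * (u 3 * (p ^ 4)⁻¹ / formLen p u)) ∧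
        0 ≤ p ^ (k + 1) * (u 2 * (p ^ 2)⁻¹ / formLen p u) := by
    intro b ε δ u h
    have h1 := (h.isLinkForm hp0).nonneg
    have h2 := h1 2; have h3 := h1 3; replace h1 := h1 1
    simp only [cons_val] at h1 h2 h3
    constructor <;> positivity
  obtain ⟨hA, hB⟩ := pos h; obtain ⟨hA', hB'⟩ := pos h'
  simp only [cons_val] at v1 v2
  set A := p ^ k * (u 1 / formLen p u + p ^ 2 * (u 3 * (p ^ 4)⁻¹ / formLen p u)) with hAd
  set A' := p ^ k * (u' 1 / formLen p u' + p ^ 2 * (u' 3 * (p ^ 4)⁻¹ / formLen p u')) with hAd'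
  set B := p ^ (k + 1) * (u 2 * (p ^ 2)⁻¹ / formLen p u) with hBd
  set B' := p ^ (k + 1) * (u' 2 * (p ^ 2)⁻¹ / formLen p u') with hBd'
  have key : ‖linkMap χ ψ (starDir p b)‖ * ‖linkMap χ ψ (starDir p b')‖ * cos ((χ + ψ) / π *
        (linkMap χ ψ (starDir p b) * conj (linkMap χ ψ (starDir p b'))).arg) =
      A * A' + B * B' + (A * B' + A' * B) * cos (if ε = δ then χ else ψ) := by
    rw [v1, v2]
    split_ifs with hk he he
    · rw [hs.linkMap_pair (unitR_eq ε) (unitR_eq δ) hA hB hA' hB', if_pos (unitR_eq_iff.2 he)]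
    · rw [hs.linkMap_pair (unitR_eq ε) (unitR_eq δ) hA hB hA' hB', if_neg (mt unitR_eq_iff.1 he)]
    · rw [hs.linkMap_pair (unitR_eq δ) (unitR_eq ε) hB hA hB' hA', if_pos (by rw [he])]
      ring
    · rw [hs.linkMap_pair (unitR_eq δ) (unitR_eq ε) hB hA hB' hA',
        if_neg fun e => he (unitR_eq_iff.1 e.symm)]
      ring
  have hγ : 1 + p ^ 2 - 2 * p * cos (if ε = δ then χ else ψ) =
      (p ^ 2 - 1) ^ 2 * (if ε = δ then p ^ 2 else ((p ^ 2) ^ 2)⁻¹) := by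
    split_ifs
    exacts [hs.left, hs.right]
  have hd' : (if ε = δ then 1 else ((p ^ 2) ^ 3)⁻¹) =
      (if ε = δ then p ^ 2 else ((p ^ 2) ^ 2)⁻¹) / p ^ 2 := by
    split_ifs <;> field_simp
  rw [polForm, starPol, starPol]; simp only
  rw [key, edgeForm, h.pairSum_eq h']
  simp only [weight_starTile (pow_pos hp0 2), hd', sum_univ_four, Matrix.of_apply, cons_val]
  rw [h.starLen_eq hp0, h'.starLen_eq hp0, h.starTop_eq hp0, h'.starTop_eq hp0, hAd, hAd', hBd,
    hBd', coneConst]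
  generalize cos (if ε = δ then χ else ψ) = γ at hγ ⊢
  generalize (if ε = δ then p ^ 2 else ((p ^ 2) ^ 2)⁻¹) = d at hγ ⊢
  have hz : (p ^ 2) ^ (-k) = (p ^ k)⁻¹ ^ 2 := by
    rw [zpow_neg, ← zpow_natCast, ← zpow_mul, ← zpow_natCast, inv_zpow, ← zpow_mul, mul_comm]
  rw [hz, show p ^ (-2 * k) = (p ^ k)⁻¹ ^ 2 by
    rw [neg_mul, zpow_neg, mul_comm, zpow_mul, inv_pow]; rfl, show p ^ (2 * k) = (p ^ k) ^ 2 by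
    rw [mul_comm, zpow_mul]; rfl, zpow_add₀ hp0.ne', zpow_one]
  have hK := zpow_pos hp0 k; have hp1 : p ^ 2 - 1 ≠ 0 := by nlinarith
  obtain rfl : d = (1 + p ^ 2 - 2 * p * γ) / (p ^ 2 - 1) ^ 2 := by
    rw [eq_div_iff (pow_ne_zero 2 hp1), hγ, mul_comm]
  generalize p ^ k = K at hK ⊢
  have hFd : formLen p u = u 1 + u 2 * (p ^ 2)⁻¹ + u 3 * (p ^ 4)⁻¹ := rfl
  have hFd' : formLen p u' = u' 1 + u' 2 * (p ^ 2)⁻¹ + u' 3 * (p ^ 4)⁻¹ := rfl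
  generalize formLen p u = F at hF hFd ⊢
  generalize formLen p u' = F' at hF' hFd' ⊢
  field_simp; field_simp at hFd hFd'
  linear_combination ((p ^ 2 - 1) ^ 2 * u 0 + p ^ 2 * u 1 + p ^ 2 * u 2 + p ^ 2 * u 3) * hFd' +
    ((p ^ 2 - 1) ^ 2 * u' 0 + p ^ 2 * u' 1 + p ^ 2 * u' 2 + p ^ 2 * u' 3) * hFd

lemma IsStarForm.starPol_mem (hp : 1 < p) (hs : IsConeAngles p χ ψ)
    (h : IsStarForm b k ε δ u) : starPol p χ ψ b ∈ polRegion := by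
  have hp0 : 0 < p := by linarith
  have h1 := h.polForm_eq hp hs h
  have h2 : 0 < edgeForm (p ^ 2) b b := edgeSum_pos (pow_pos hp0 2) h.mem_tileComplex
  have hℓ := h.starLen_pos hp0; rw [polForm_self] at h1
  have h3 : 0 < coneConst p * edgeForm (p ^ 2) b b := mul_pos (coneConst_pos hp) h2; rw [← h1] at h3
  have := pos_of_mul_pos_right h3 (mul_pos hℓ hℓ).le
  have : ‖(starPol p χ ψ b).1‖ ^ 2 < (starPol p χ ψ b).2 := by linarith
  exact this

lemma IsStarForm.tileDist_eq (hp : 1 < p) (hs : IsConeAngles p χ ψ) (h : IsStarForm b k ε δ u)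
    (h' : IsStarForm b' k ε δ u') : tileDist (p ^ 2) b b' =
      polDist ((χ + ψ) / π) (starPol p χ ψ b) (starPol p χ ψ b') := by
  have hp0 : 0 < p := by linarith
  have g : 0 < (starPol p χ ψ b).2 - ‖(starPol p χ ψ b).1‖ ^ 2 := sub_pos.2 (h.starPol_mem hp hs)
  have g' : 0 < (starPol p χ ψ b').2 - ‖(starPol p χ ψ b').1‖ ^ 2 :=
    sub_pos.2 (h'.starPol_mem hp hs)
  have hℓ := h.starLen_pos hp0; have hℓ' := h'.starLen_pos hp0
  rw [tileDist, ← arcosh_scale (coneConst_pos hp), ← h.polForm_eq hp hs h', ← h.polForm_eq hp hs h,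
    ← h'.polForm_eq hp hs h', polForm_self, polForm_self, polDist, ← polForm]
  generalize (starPol p χ ψ b).2 - ‖(starPol p χ ψ b).1‖ ^ 2 = x at g ⊢
  generalize (starPol p χ ψ b').2 - ‖(starPol p χ ψ b').1‖ ^ 2 = y at g' ⊢
  congr 1
  have : starLen p b * starLen p b * (2 * x) * (starLen p b' * starLen p b' * (2 * y)) =
      (starLen p b * starLen p b' * (2 * (√x * √y))) ^ 2 := by
    rw [mul_pow, mul_pow _ (√x * √y), mul_pow √x, sq_sqrt g.le, sq_sqrt g'.le]; ring
  rw [this, sqrt_sq (by positivity), mul_div_mul_left _ _ (mul_pos hℓ hℓ').ne']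

end

/-! ### The cone structures -/

section
variable {p κ χ ψ : ℝ} {y y' : Point} (h : IsConeParam p κ) (hs : IsConeAngles p χ ψ)

lemma IsConeAngles.linkMap_zero (hs : IsConeAngles p χ ψ) : linkMap χ ψ 0 = 0 := by
  simpa [self_eq_neg] using hs.linkMap_neg 0

/-- The coordinates near the axis, with the link as a plane. -/
def axisHomeo : OpenPartialHomeomorph Point (ℂ × ℝ) :=
  h.starHomeo.transHomeomorph (hs.linkHomeo.prodCongr (Homeomorph.refl ℝ))

lemma axisHomeo_of_mem (hy : y ∈ starSource p κ) : axisHomeo h hs y = starPol p χ ψ (coneBary p κ y) := by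
  change (linkMap χ ψ (starMap p κ y).1, (starMap p κ y).2) = _
  rw [starMap_of_mem hy]; rfl

lemma axisHomeo_fst_ne_zero (hy : y ∈ starSource p κ) : (axisHomeo h hs y).1 ≠ 0 := by
  obtain ⟨k, ε, δ, u, hu, -⟩ := h.exists_isStarForm hy; rw [axisHomeo_of_mem h hs hy]
  intro h0
  refine (hu.isLinkForm h.p_pos).ne_zero h.p_pos (hs.linkHomeo.injective ?_)
  exact h0.trans hs.linkMap_zero.symm

lemma axisHomeo_fst_eq_zero (hy : y.1 = 0) : (axisHomeo h hs y).1 = 0 := by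
  change linkMap χ ψ (starMap p κ y).1 = 0
  rw [starMap, if_pos hy]; exact hs.linkMap_zero

lemma axisHomeo_mem (hy : y ∈ (axisHomeo h hs).source) : axisHomeo h hs y ∈ polRegion := by
  rcases hy with hy | hy
  · replace hy : y.1 = 0 := hy
    change ‖(axisHomeo h hs y).1‖ ^ 2 < (starMap p κ y).2
    have := coneConst_pos h.one_lt
    rw [axisHomeo_fst_eq_zero h hs hy, starMap, if_pos hy, norm_zero, zero_pow two_ne_zero]
    positivity
  · obtain ⟨k, ε, δ, u, hu, -⟩ := h.exists_isStarForm hy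
    rw [axisHomeo_of_mem h hs hy]
    exact hu.starPol_mem h.one_lt hs

lemma polDist_axisHomeo (hu : u ∈ idealSimplex) (hu' : u' ∈ idealSimplex) (hy : y ∈ starSource p κ)
    (hy' : y' ∈ starSource p κ) (e : bary (coneHeight (p ^ 2) κ) y = spread m n u)
    (e' : bary (coneHeight (p ^ 2) κ) y' = spread m n u') :
    polDist ((χ + ψ) / π) (axisHomeo h hs y) (axisHomeo h hs y') =
      pointDist (p ^ 2) κ (spread m n u) (spread m n u') := by
  have f : coneBary p κ y = spread m n (simplexWarp κ u) := by rw [coneBary, wbary, e, warp_spread]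
  have f' : coneBary p κ y' = spread m n (simplexWarp κ u') := by
    rw [coneBary, wbary, e', warp_spread]
  obtain ⟨k, ε, δ, v, v', hv, hv'⟩ := exists_isStarForm_pair (simplexWarp_mem h.pos hu).2.1
    (simplexWarp_mem h.pos hu').2.1 (by rw [← f]; exact hy.2)
  rw [axisHomeo_of_mem h hs hy, axisHomeo_of_mem h hs hy', f, f', ← hv.tileDist_eq h.one_lt hs hv',
    pointDist, warp_spread, warp_spread]

lemma IsConeAngles.ratio_pos (hs : IsConeAngles p χ ψ) : 0 < (χ + ψ) / π :=
  div_pos (add_pos hs.left_pos hs.right_pos) pi_pos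

lemma IsConeAngles.ratio_lt_one (hs : IsConeAngles p χ ψ) : (χ + ψ) / π < 1 :=
  (div_lt_one pi_pos).2 hs.lt_pi

/-- A chart near the axis, on a sector. -/
def starChart (he : ‖e‖ = 1) : OpenPartialHomeomorph Point ℍ³ :=
  (axisHomeo h hs).trans (sectorChart hs.ratio_pos hs.ratio_lt_one he)

lemma starChart_source (he : ‖e‖ = 1) (hy : y ∈ (starChart h hs he).source) : y ∈ starSource p κ ∧
      axisHomeo h hs y ∈ (sectorChart hs.ratio_pos hs.ratio_lt_one he).source := by
  refine ⟨hy.1.resolve_left fun h0 => ?_, hy.2⟩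
  have h1 := norm_pos_of_mul_re_pos (z := (axisHomeo h hs y).1) hy.2.2
  rw [axisHomeo_fst_eq_zero h hs h0, norm_zero] at h1
  exact h1.false

lemma isDevelopment_starChart (he : ‖e‖ = 1) :
    IsDevelopment (coneHeight (p ^ 2) κ) (pointDist (p ^ 2) κ) (starChart h hs he) where
  subset _ hy := (starChart_source h hs he hy).1.1
  dist m n u hu u' hu' z hz z' hz' ez ez' := by
    obtain ⟨h1, h2⟩ := starChart_source h hs he hz
    obtain ⟨h1', h2'⟩ := starChart_source h hs he hz'
    exact (hdist_sectorChart _ _ he h2 h2').trans (polDist_axisHomeo h hs hu hu' h1 h1' ez ez')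

lemma exists_starChart (hy : y ∈ starSource p κ) : ∃ (e : ℂ) (he : ‖e‖ = 1), y ∈ (starChart h hs he).source := by
  have h0 := norm_pos_iff.2 (axisHomeo_fst_ne_zero h hs hy)
  have hm : y ∈ (axisHomeo h hs).source := Or.inr hy
  refine ⟨((‖(axisHomeo h hs y).1‖⁻¹ : ℝ) : ℂ) * (axisHomeo h hs y).1, ?_, hm,
    axisHomeo_mem h hs hm, ?_⟩
  · rw [norm_mul, Complex.norm_real, norm_inv, norm_norm, inv_mul_cancel₀ h0.ne']
  · change 0 < ((axisHomeo h hs y).1 * conj (_ * (axisHomeo h hs y).1)).re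
    rw [map_mul, conj_ofReal, mul_left_comm, Complex.mul_conj, ← Complex.ofReal_mul,
      Complex.ofReal_re, normSq_eq_norm_sq]
    positivity

lemma hasDevelopments_cone (h : IsConeParam p κ) (hs : IsConeAngles p χ ψ) :
    HasDevelopments (coneHeight (p ^ 2) κ) (pointDist (p ^ 2) κ) := by
  intro y hy
  obtain ⟨m, n, h0, -⟩ := exists_edge_of_mem (wbary_mem (τ := coneHeight (p ^ 2) κ) h.pos hy)
  have hm : pointAct m n y ∈ starSource p κ := by
    refine ⟨pointAct_mem hy m n, ?_⟩
    rwa [coneBary, h.isHeight.wbary_pointAct hy]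
  obtain ⟨e, he, hc⟩ := exists_starChart h hs hm
  exact ⟨_, (isDevelopment_starChart h hs he).comp_pointHomeo h.isHeight
    (isTileInvariant_pointDist (pow_pos h.p_pos 2) κ) m n, hc⟩

lemma hasConeSingularity_developedSpace :
    @HasConeSingularity (2 * (χ + ψ)) (developedSpace (hasDevelopments_cone h hs)) := by
  rintro x ⟨t, ht⟩; obtain rfl : toClosed (0, t) = x := ht
  have hb : ((0 : ℝ × ℝ), t) ∈ (sheet (0, t)).source := Metric.mem_ball_self (by norm_num)
  set H := (sheet (0, t)).symm.trans ((axisHomeo h hs).trans cylinderHomeo) with hH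
  have hsrc : ∀ w, w ∈ H.source ↔
      ∃ z ∈ (sheet (0, t)).source, z ∈ (axisHomeo h hs).source ∧ toClosed z = w := by
    intro w; constructor
    · rintro ⟨h1, h2, -⟩
      exact ⟨_, (sheet (0, t)).map_target h1, h2, (sheet (0, t)).right_inv h1⟩
    · rintro ⟨z, h1, h2, rfl⟩
      have h3 : (sheet (0, t)).symm (toClosed z) = z := (sheet (0, t)).left_inv h1
      have h4 : (sheet (0, t)).symm (toClosed z) ∈ (axisHomeo h hs).source := by rwa [h3]
      exact ⟨(sheet (0, t)).map_source h1, h4, axisHomeo_mem h hs h4⟩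
  have happ : ∀ z ∈ (sheet (0, t)).source, H (toClosed z) = cylinderHomeo (axisHomeo h hs z) := by
    intro z hz; have h3 : (sheet (0, t)).symm (toClosed z) = z := (sheet (0, t)).left_inv hz
    change cylinderHomeo (axisHomeo h hs ((sheet (0, t)).symm (toClosed z))) = _
    rw [h3]
  refine ⟨H, (hsrc _).2 ⟨_, hb, Or.inl rfl, rfl⟩, fun w hw => ?_, fun x hx => ?_⟩
  · obtain ⟨z, h1, h2, rfl⟩ := (hsrc w).1 hw
    rw [happ z h1, toClosed_mem_bundleCore]
    have hr : ∀ q, (cylinderHomeo q).1 = radial (axisDist q) q.1 := fun q => rfl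
    rw [hr]
    rcases h2 with h2 | h2
    · rw [axisHomeo_fst_eq_zero h hs h2]
      exact iff_of_true (fun hcon => zero_notMem_offLattice hcon h2) (by simp [radial])
    · refine iff_of_false (not_not.2 h2.1) fun h0 => ?_
      have h3 := axisHomeo_fst_ne_zero h hs h2
      have h4 : axisHomeo h hs z ∈ polRegion := axisHomeo_mem h hs (Or.inr h2)
      have h5 := norm_radial (axisDist_nonneg (axisHomeo h hs z)) fun e => absurd e h3
      rw [h0, norm_zero] at h5
      exact (arsinh_pos_iff.2 (div_pos (norm_pos_iff.2 h3) (sqrt_gap_pos h4))).ne h5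
  · obtain ⟨y, h1, h2, hy⟩ := (hsrc _).1 hx
    have hoff : y ∈ offLattice := toClosed_mem_range.1 ⟨x, hy.symm⟩
    have hst : y ∈ starSource p κ := h2.resolve_left (zero_notMem_offLattice hoff)
    obtain ⟨e, he, hc⟩ := exists_starChart h hs hst
    obtain ⟨N, hN, hNc, hd⟩ := developedSpace_hdist h.isHeight
      (isTileInvariant_pointDist (pow_pos h.p_pos 2) κ) (hasDevelopments_cone h hs)
      (isDevelopment_starChart h hs he) hc hy.symm
    refine ⟨_, exists_nhds_lift hy.symm (inter_mem hN ((sheet (0, t)).open_source.mem_nhds h1)),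
      ?_, ?_, ?_⟩
    · rintro x' ⟨z, hz, hx'⟩
      exact (hd z hz.1 x' hx').1
    · rintro _ ⟨x', ⟨z, hz, hx'⟩, rfl⟩
      exact (hsrc _).2 ⟨z, hz.2, (hNc hz.1).1, hx'.symm⟩
    · rintro x₁ ⟨z₁, hz₁, e₁⟩ x₂ ⟨z₂, hz₂, e₂⟩
      have m₁ := (starChart_source h hs he (hNc hz₁.1)).2
      have m₂ := (starChart_source h hs he (hNc hz₂.1)).2
      rw [e₁, e₂, happ z₁ hz₁.2, happ z₂ hz₂.2, coneDist_cylinderHomeo _ m₁.1 m₂.1,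
        mul_div_mul_left _ _ two_ne_zero, ← hdist_sectorChart hs.ratio_pos hs.ratio_lt_one he m₁ m₂]
      exact (hd z₁ hz₁.1 x₁ e₁).2 z₂ hz₂.1 x₂ e₂

end

/-! ### Shape parameters -/

lemma Complex.sqrt_mul_sqrt (w : ℂ) : w.sqrt * w.sqrt = w := by
  rcases eq_or_ne w 0 with rfl | hw
  · simp
  · rw [_root_.sqrt_eq_exp hw, ← Complex.exp_add, add_halves, Complex.exp_log hw]

lemma Complex.sqrt_re_pos {w : ℂ} (hw : w ∈ slitPlane) : 0 < w.sqrt.re := by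
  have h' := (Complex.mem_slitPlane_iff_arg.1 hw).1
  rw [_root_.sqrt_eq_exp (Complex.slitPlane_ne_zero hw), Complex.exp_re]
  refine mul_pos (exp_pos _) (cos_pos_of_mem_Ioo ?_)
  have e : (Complex.log w / 2).im = w.arg / 2 := by
    rw [← Complex.log_im]; exact Complex.div_ofNat_im _ 2
  have h1 := Complex.neg_pi_lt_arg w; have h2 := lt_of_le_of_ne (arg_le_pi w) h'
  rw [e]
  constructor <;> linarith

lemma Complex.conj_sqrt {w : ℂ} (hw : w ∈ slitPlane) : conj w.sqrt = (conj w).sqrt := by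
  have h0 := Complex.slitPlane_ne_zero hw
  rw [_root_.sqrt_eq_exp h0, _root_.sqrt_eq_exp (by simpa using h0), ← Complex.exp_conj,
    Complex.log_conj _ (Complex.mem_slitPlane_iff_arg.1 hw).1, map_div₀, conj_ofNat]

section
variable {η : ℝ}

lemma shape₂_eq (η : ℝ) : shape₂ η = shape₁ (-η) := by
  rw [shape₂, shape₁, Complex.ofReal_neg, neg_mul]

lemma disc_re (η : ℝ) : (4 - (2 - Complex.exp (η * I)) ^ 2).re =
    4 * cos η - 2 * cos η ^ 2 + 1 := by
  have := sin_sq_add_cos_sq η; rw [exp_mul_I]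
  simp [pow_two, Complex.cos_ofReal_re, Complex.sin_ofReal_re]
  linarith

lemma disc_im (η : ℝ) : (4 - (2 - Complex.exp (η * I)) ^ 2).im =
    2 * sin η * (2 - cos η) := by
  rw [exp_mul_I]; simp [pow_two, Complex.cos_ofReal_re, Complex.sin_ofReal_re]
  ring

lemma disc_mem (hη : η ∈ Ioo (-π) π) :
    4 - (2 - Complex.exp (η * I)) ^ 2 ∈ slitPlane := by
  rw [Complex.mem_slitPlane_iff, disc_re, disc_im]
  rcases eq_or_ne η 0 with rfl | h0
  · left; norm_num
  · right
    refine mul_ne_zero (mul_ne_zero two_ne_zero ?_) (by linarith [cos_le_one η])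
    exact fun h => h0 ((sin_eq_zero_iff_of_lt_of_lt hη.1 hη.2).1 h)

lemma continuousOn_shape₁ : ContinuousOn shape₁ (Ioo (-π) π) := by
  have hw : Continuous fun η : ℝ => 4 - (2 - Complex.exp (η * I)) ^ 2 := by fun_prop
  have h : ContinuousOn (fun η : ℝ => (4 - (2 - Complex.exp (η * I)) ^ 2).sqrt)
      (Ioo (-π) π) := fun η hη =>
    (hw.continuousAt.cpow continuousAt_const (disc_mem hη)).continuousWithinAt
  unfold shape₁ shapeRoot
  refine ContinuousOn.div_const (ContinuousOn.add (by fun_prop) (continuousOn_const.mul h)) _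

lemma neg_mem_Ioo (hη : η ∈ Ioo (-π) π) : -η ∈ Ioo (-π) π := ⟨neg_lt_neg hη.2, neg_lt.1 hη.1⟩

lemma continuousOn_shape₂ : ContinuousOn shape₂ (Ioo (-π) π) :=
  (continuousOn_shape₁.comp continuous_neg.continuousOn fun _ h => neg_mem_Ioo h).congr
    fun η _ => shape₂_eq η

lemma shape₁_zero : shape₁ 0 = Complex.exp (π / 3 * I) := by
  have h3 : (4 - (2 - 1) ^ 2 : ℂ) = ((3 : ℝ) : ℂ) := by push_cast; norm_num
  have e : (π / 3 : ℂ) = ((π / 3 : ℝ) : ℂ) := by push_cast; ring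
  rw [shape₁, shapeRoot, Complex.ofReal_zero, zero_mul, Complex.exp_zero, h3,
    Complex.sqrt_of_nonneg (by exact_mod_cast (by norm_num : (0 : ℝ) ≤ 3)), e, exp_mul_I, ← Complex.ofReal_cos,
    ← Complex.ofReal_sin, cos_pi_div_three, sin_pi_div_three, Complex.ofReal_re]
  push_cast; ring

lemma shape₂_zero : shape₂ 0 = Complex.exp (π / 3 * I) := by
  rw [shape₂_eq, neg_zero, shape₁_zero]

lemma shapeRoot_spec (B : ℂ) : shapeRoot B ^ 2 - (2 - B) * shapeRoot B + 1 = 0 := by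
  have := Complex.sqrt_mul_sqrt (4 - (2 - B) ^ 2); rw [shapeRoot]
  linear_combination (-1 / 4 : ℂ) * this + (4 - (2 - B) ^ 2).sqrt ^ 2 / 4 * Complex.I_sq

lemma shape₁_spec (η : ℝ) : shape₁ η ^ 2 - (2 - Complex.exp (η * I)) * shape₁ η + 1 = 0 :=
  shapeRoot_spec _

lemma shape₁_im_pos (hη : η ∈ Ioo (-π) π) : 0 < (shape₁ η).im := by
  have h1 := Complex.sqrt_re_pos (disc_mem hη)
  have h2 := Complex.sqrt_mul_sqrt (4 - (2 - Complex.exp (η * I)) ^ 2)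
  have h3 := congrArg Complex.re h2; have h4 := congrArg Complex.im h2
  rw [Complex.mul_re, disc_re] at h3; rw [Complex.mul_im, disc_im] at h4
  have e : (shape₁ η).im = ((4 - (2 - Complex.exp (η * I)) ^ 2).sqrt.re - sin η) / 2 := by
    have h5 : (Complex.exp (η * I)).im = sin η := Complex.exp_ofReal_mul_I_im η
    rw [shape₁, shapeRoot, Complex.div_ofNat_im, add_im, sub_im, h5, Complex.I_mul_im]
    simp
    ring
  rw [e]
  generalize (4 - (2 - Complex.exp (η * I)) ^ 2).sqrt.re = x at *
  generalize (4 - (2 - Complex.exp (η * I)) ^ 2).sqrt.im = y at *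
  by_contra! hcon
  have h5 : x ≤ sin η := by linarith
  have h6 := cos_le_one η
  have h7 : 2 - cos η ≤ y := by
    by_contra! hlt
    nlinarith
  have h8 := sin_sq_add_cos_sq η
  nlinarith

lemma conj_shape₁_neg (hη : η ∈ Ioo (-π) π) : conj (shape₁ (-η)) * shape₁ η = 1 := by
  have e : conj (Complex.exp ((-η : ℝ) * I)) = Complex.exp (η * I) := by
    rw [← Complex.exp_conj, map_mul, Complex.conj_I, conj_ofReal]; push_cast
    ring_nf
  have h1 := Complex.conj_sqrt (disc_mem (neg_mem_Ioo hη))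
  rw [map_sub, map_pow, map_sub, e, conj_ofNat, conj_ofNat] at h1
  have h2 := Complex.sqrt_mul_sqrt (4 - (2 - Complex.exp (η * I)) ^ 2)
  rw [shape₁, shape₁, shapeRoot, shapeRoot, map_div₀, map_add, map_sub, map_mul, h1, e,
    Complex.conj_I, conj_ofNat]
  linear_combination (1 / 4 : ℂ) * h2 -
    (4 - (2 - Complex.exp (η * I)) ^ 2).sqrt ^ 2 / 4 * Complex.I_sq

lemma ne_zero_of_im_pos (hz : 0 < z.im) : z ≠ 0 :=
  fun h => by simpa [hz.ne'] using congrArg Complex.im h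

lemma one_sub_ne_zero_of_im_pos (hz : 0 < z.im) : 1 - z ≠ 0 :=
  fun h => by simpa [hz.ne'] using congrArg Complex.im h

lemma shape'_im_pos (hz : 0 < z.im) : 0 < (shape' z).im := by
  rw [shape', one_div, Complex.inv_im]
  exact div_pos (by simpa) (Complex.normSq_pos.2 (one_sub_ne_zero_of_im_pos hz))

lemma shape''_im_pos (hz : 0 < z.im) : 0 < (shape'' z).im := by
  rw [shape'', one_div, sub_im, Complex.inv_im, one_im, zero_sub, neg_div, neg_neg]
  exact div_pos hz (Complex.normSq_pos.2 (ne_zero_of_im_pos hz))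

lemma log_im_mem (hz : 0 < z.im) : (Complex.log z).im ∈ Ioo 0 π := by
  rw [Complex.log_im]
  refine ⟨(Complex.arg_nonneg_iff.2 hz.le).lt_of_ne fun h => ?_, (arg_le_pi z).lt_of_ne fun h => ?_⟩
  · exact hz.ne (Complex.arg_eq_zero_iff.1 h.symm).2.symm
  · exact hz.ne' (Complex.arg_eq_pi_iff.1 h).2

/-- The dihedral angles at a vertex have sum `π`. -/
lemma log_add_log_add_log (hz : 0 < z.im) :
    Complex.log z + Complex.log (shape' z) + Complex.log (shape'' z) = π * I := by
  have h0 := ne_zero_of_im_pos hz; have h1 := one_sub_ne_zero_of_im_pos hz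
  have h : Complex.exp (Complex.log z + Complex.log (shape' z) + Complex.log (shape'' z) -
      π * I) = 1 := by
    rw [Complex.exp_sub, Complex.exp_add, Complex.exp_add, Complex.exp_log h0,
      Complex.exp_log (ne_zero_of_im_pos (shape'_im_pos hz)),
      Complex.exp_log (ne_zero_of_im_pos (shape''_im_pos hz)), Complex.exp_pi_mul_I, shape', shape'']
    field_simp; ring
  obtain ⟨n, hn⟩ := Complex.exp_eq_one_iff.1 h; have h2 := congrArg Complex.im hn
  have a := log_im_mem hz; have b := log_im_mem (shape'_im_pos hz)
  have c := log_im_mem (shape''_im_pos hz); rw [sub_im, add_im, add_im] at h2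
  simp at h2 a b c
  have hpi := pi_pos
  have h3 : (n : ℝ) < 1 := by by_contra! hc; nlinarith
  have h4 : (-1 : ℝ) < n := by by_contra! hc; nlinarith
  have hn0 : n = 0 := by
    have : n < 1 := by exact_mod_cast h3
    have : -1 < n := by exact_mod_cast h4
    omega
  rw [hn0, Int.cast_zero, zero_mul, sub_eq_zero] at hn
  exact hn

lemma log_shape''_sub (hη : η ∈ Ioo (-π) π) :
    Complex.log (shape'' (shape₁ η)) - Complex.log (shape' (shape₁ η)) = η * I := by
  have hz := shape₁_im_pos hη; have h0 := ne_zero_of_im_pos hz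
  have h1 := one_sub_ne_zero_of_im_pos hz; have hs := shape₁_spec η
  have b := log_im_mem (shape'_im_pos hz); have c := log_im_mem (shape''_im_pos hz)
  have h : Complex.exp (Complex.log (shape'' (shape₁ η)) - Complex.log (shape' (shape₁ η))) =
      Complex.exp (η * I) := by
    rw [Complex.exp_sub, Complex.exp_log (ne_zero_of_im_pos (shape'_im_pos hz)),
      Complex.exp_log (ne_zero_of_im_pos (shape''_im_pos hz)), shape', shape'']
    field_simp
    linear_combination -hs
  rw [← Complex.log_exp (x := Complex.log (shape'' (shape₁ η)) - Complex.log (shape' (shape₁ η))),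
    h, Complex.log_exp]
  · simpa using hη.1
  · simpa using hη.2.le
  · rw [sub_im]; linarith [b.2, c.1]
  · rw [sub_im]; linarith [b.1, c.2]

lemma holonomyMu₁_shape₁ (hη : η ∈ Ioo (-π) π) : holonomyMu₁ (shape₁ η) = 2 * η * I := by
  rw [holonomyMu₁, log_shape''_sub hη, mul_assoc]

lemma holonomyMu₂_shape₂ (hη : η ∈ Ioo (-π) π) : holonomyMu₂ (shape₂ η) = 2 * η * I := by
  rw [holonomyMu₂, shape₂_eq, ← neg_sub, log_shape''_sub (neg_mem_Ioo hη)]; push_cast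
  ring

lemma holonomyEdge_shape (hη : η ∈ Ioo (-π) π) :
    holonomyEdge (shape₁ η) (shape₂ η) = 2 * π * I := by
  have hz := shape₁_im_pos hη; have hc := conj_shape₁_neg hη
  have h0 := ne_zero_of_im_pos hz; have h1 := log_add_log_add_log hz
  have h2 := log_shape''_sub hη
  have key : ∀ w z : ℂ, 0 < z.im → conj w * z = 1 → Complex.log w = -conj (Complex.log z) := by
    intro w z hz h; have hpi : z.arg ≠ π := fun h => hz.ne' (Complex.arg_eq_pi_iff.1 h).2
    have e : w = conj z⁻¹ := by rw [← eq_inv_of_mul_eq_one_left h, Complex.conj_conj]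
    have hpi' : (z⁻¹).arg ≠ π := by
      rw [Complex.arg_inv, if_neg hpi]; have := Complex.neg_pi_lt_arg z
      linarith
    rw [e, Complex.log_conj _ hpi', Complex.log_inv _ hpi, map_neg]
  have e1 := key _ _ hz hc
  have e2 := key (shape' (shape₁ (-η))) (shape'' (shape₁ η)) (shape''_im_pos hz) (by
    have h3 : 1 - conj (shape₁ (-η)) ≠ 0 := by
      rw [← map_one conj, ← map_sub, Ne, map_eq_zero]
      exact one_sub_ne_zero_of_im_pos (shape₁_im_pos (neg_mem_Ioo hη))
    rw [shape', shape'', map_div₀, map_sub, map_one, ← eq_one_div_of_mul_eq_one_left hc]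
    exact one_div_mul_cancel h3)
  have h3 := congrArg conj h1; have h4 := congrArg conj h2
  simp only [map_add, map_sub, map_mul, conj_ofReal, Complex.conj_I] at h3 h4
  rw [holonomyEdge, shape₂_eq, e1, e2]
  linear_combination h1 - h2 - h3 - h4

lemma norm_one_sub_shape₁ (η : ℝ) : ‖1 - shape₁ η‖ ^ 2 = ‖shape₁ η‖ := by
  have hs := shape₁_spec η
  have : (1 - shape₁ η) ^ 2 = -(Complex.exp (η * I) * shape₁ η) := by linear_combination hs
  rw [← norm_pow, this, norm_neg, norm_mul, Complex.norm_exp_ofReal_mul_I, one_mul]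

lemma norm_shape₂ (hη : η ∈ Ioo (-π) π) : ‖shape₂ η‖ = ‖shape₁ η‖⁻¹ := by
  have := congrArg norm (conj_shape₁_neg hη)
  rw [norm_mul, RCLike.norm_conj, norm_one, ← shape₂_eq] at this
  exact eq_inv_of_mul_eq_one_left this

/-- The cone angle in terms of the modulus of the shape parameter. -/
lemma cos_eq_of_norm_shape₁ (hη : η ∈ Ioo (-π) π) : cos η =
    2 - (‖shape₁ η‖ + ‖shape₁ η‖⁻¹) * (‖shape₁ η‖ + ‖shape₁ η‖⁻¹ - 1) / 2 := by
  have h0 := ne_zero_of_im_pos (shape₁_im_pos hη); have hs := shape₁_spec η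
  have h1 : shape₁ η + (shape₁ η)⁻¹ = 2 - Complex.exp (η * I) := by
    field_simp
    linear_combination hs
  have h2 := congrArg Complex.re h1
  have h3 : (Complex.exp (η * I)).re = cos η := Complex.exp_ofReal_mul_I_re η
  have h4 := norm_one_sub_shape₁ η
  rw [add_re, Complex.inv_re, sub_re, h3, Complex.re_ofNat, normSq_eq_norm_sq] at h2
  have h5 := Complex.sq_norm_sub_sq_re (shape₁ η)
  have h6 : ‖1 - shape₁ η‖ ^ 2 = 1 - 2 * (shape₁ η).re + ‖shape₁ η‖ ^ 2 := by
    rw [← normSq_eq_norm_sq, normSq_apply, sub_re, sub_im, Complex.one_re, one_im]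
    linear_combination -h5
  have hr := norm_pos_iff.2 h0
  generalize ‖shape₁ η‖ = r at *
  have h7 : (shape₁ η).re = (r ^ 2 - r + 1) / 2 := by linarith
  rw [h7] at h2; field_simp at h2 ⊢
  linear_combination h2

end

lemma exists_isConeAngles {p η : ℝ} (hp : 1 < p) (hp2 : p ^ 2 < p + 1) (hη0 : 0 ≤ η)
    (hη1 : η ≤ π) (hη : cos η = 2 - (p ^ 2 + (p ^ 2)⁻¹) * (p ^ 2 + (p ^ 2)⁻¹ - 1) / 2) :
    ∃ χ ψ, IsConeAngles p χ ψ ∧ χ + ψ = η := by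
  set x := (1 + p ^ 2 - (p ^ 2 - 1) ^ 2 * p ^ 2) / (2 * p) with hx
  set y := (1 + p ^ 2 - (p ^ 2 - 1) ^ 2 * ((p ^ 2) ^ 2)⁻¹) / (2 * p) with hy
  have hp0 : 0 < p := by linarith
  have hD : 0 < (p ^ 2 - 1) ^ 2 * ((p ^ 2 + p - 1) * (p ^ 2 + p + 1) * (1 + p - p ^ 2) *
      (1 + p ^ 2 - p)) / (4 * p ^ 2) := by
    have h1 : 0 < p ^ 2 - 1 := by nlinarith
    have h2 : 0 < p ^ 2 + p - 1 := by linarith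
    have h3 : 0 < 1 + p - p ^ 2 := by linarith
    have h4 : 0 < 1 + p ^ 2 - p := by nlinarith
    positivity
  have ex : 1 - x ^ 2 = (p ^ 2 - 1) ^ 2 * ((p ^ 2 + p - 1) * (p ^ 2 + p + 1) * (1 + p - p ^ 2) *
      (1 + p ^ 2 - p)) / (4 * p ^ 2) := by
    rw [hx]; field_simp; ring
  have ey : 1 - x ^ 2 = (p ^ 2) ^ 4 * (1 - y ^ 2) := by rw [hx, hy]; field_simp; ring
  have hx1 : |x| < 1 := by rw [← sq_lt_one_iff_abs_lt_one]; linarith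
  have hy1 : |y| < 1 := by
    rw [← sq_lt_one_iff_abs_lt_one]
    have : 0 < (p ^ 2) ^ 4 * (1 - y ^ 2) := by rw [← ey, ex]; exact hD
    linarith [pos_of_mul_pos_right this (by positivity)]
  obtain ⟨hx1, hx2⟩ := abs_lt.1 hx1; obtain ⟨hy1, hy2⟩ := abs_lt.1 hy1
  have hxy : -x < y := by
    have : x + y = (p ^ 2 + 1) * (2 - (p ^ 2 + (p ^ 2)⁻¹ - 2) * (p ^ 2 + (p ^ 2)⁻¹ - 1)) / (2 * p) := by
      rw [hx, hy]; field_simp; ring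
    have hT : p ^ 2 + (p ^ 2)⁻¹ < 3 := by
      rw [← sub_pos]
      have : 3 - (p ^ 2 + (p ^ 2)⁻¹) = (1 + p - p ^ 2) * (p ^ 2 + p - 1) / p ^ 2 := by
        field_simp; ring
      rw [this]; have h2 : 0 < p ^ 2 + p - 1 := by nlinarith
      have h3 : 0 < 1 + p - p ^ 2 := by linarith
      positivity
    have hT2 : 0 < (p ^ 2)⁻¹ := by positivity
    have hp1 : 1 < p ^ 2 := by nlinarith
    have : 0 < x + y := by
      rw [this]
      refine div_pos (mul_pos (by positivity) ?_) (by positivity)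
      nlinarith
    linarith
  have hcx : cos (arccos x) = x := cos_arccos hx1.le hx2.le
  have hcy : cos (arccos y) = y := cos_arccos hy1.le hy2.le
  have hlt : arccos x + arccos y < π := by
    have := arccos_lt_arccos (neg_le_neg hx2.le) hxy hy2.le; rw [arccos_neg] at this
    linarith
  have h0x : 0 < arccos x := arccos_pos.2 hx2; have h0y : 0 < arccos y := arccos_pos.2 hy2
  refine ⟨arccos x, arccos y, ⟨⟨h0x, h0y, hlt⟩, ?_, ?_⟩, ?_⟩
  · rw [hcx, hx]; field_simp; ring
  · rw [hcy, hy]; field_simp; ring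
  · refine injOn_cos ⟨(add_pos h0x h0y).le, hlt.le⟩ ⟨hη0, hη1⟩ ?_
    have hs : √(1 - x ^ 2) * √(1 - y ^ 2) = (1 - x ^ 2) * ((p ^ 2) ^ 2)⁻¹ := by
      have : 1 - y ^ 2 = (1 - x ^ 2) * (((p ^ 2) ^ 2)⁻¹) ^ 2 := by rw [ey]; field_simp
      rw [this, sqrt_mul (by rw [ex]; exact hD.le), sqrt_sq (by positivity), ← mul_assoc,
        mul_self_sqrt (by rw [ex]; exact hD.le)]
    rw [cos_add, hcx, hcy, sin_arccos, sin_arccos, hs, hη, hx, hy]; field_simp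
    ring

lemma exists_isConeParam {p : ℝ} (hp : 1 < p) : ∃ κ, IsConeParam p κ := by
  have h1 : 1 < p ^ 2 := by nlinarith
  have h2 := log_pos h1; have h3 := log_pos one_lt_two
  obtain ⟨κ, h4, h5⟩ : ∃ κ, 0 < κ ∧ κ < min (min 1 ((p ^ 2) ^ 2 - p ^ 2))
      (log (p ^ 2) / (2 * log 2)) :=
    exists_between (lt_min (lt_min one_pos (by nlinarith)) (by positivity))
  obtain ⟨h5, h6⟩ := lt_min_iff.1 h5; obtain ⟨h5, h7⟩ := lt_min_iff.1 h5
  refine ⟨κ, hp, h4, h5.le, isHeight_coneHeight h1 h4 h5.le h7.le ?_⟩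
  rw [lt_div_iff₀ (by positivity)] at h6
  linarith

lemma exists_coneStructure {η : ℝ} (hη : η ∈ Ioo (-π) π) :
    ∃ _ : ChartedSpace ℍ³ BundleLR, IsHyperbolicConeStructure (2 * |η|) ∧
      HasGeometricIdealTriangulation ![shape₁ η, shape₂ η] BundleLR := by
  have hz := shape₁_im_pos hη; have hr := norm_pos_iff.2 (ne_zero_of_im_pos hz)
  have hn := norm_shape₂ hη
  have model : ∀ P : ℝ, 0 < P → (‖shape₁ η‖ = P ∨ ‖shape₁ η‖ = P⁻¹) →
      ∀ i, ∃ coord σ, IsTileModel P (![shape₁ η, shape₂ η] i) coord σ := by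
    intro P hP h i
    fin_cases i
    · exact exists_isTileModel hP hz.ne' (norm_one_sub_shape₁ η) h
    · refine exists_isTileModel hP (z := shape₂ η) ?_ ?_ ?_
      · rw [shape₂_eq]; exact (shape₁_im_pos (neg_mem_Ioo hη)).ne'
      · rw [shape₂_eq]; exact norm_one_sub_shape₁ (-η)
      · rw [hn, inv_eq_iff_eq_inv, inv_inj]; exact h.symm
  rcases eq_or_ne η 0 with rfl | h0
  · have h1 : ‖shape₁ 0‖ = 1 := by
      rw [shape₁_zero, show (π / 3 : ℂ) = ((π / 3 : ℝ) : ℂ) by push_cast; rfl,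
        Complex.norm_exp_ofReal_mul_I]
    choose coord σ hm using model 1 one_pos (Or.inl h1)
    have hdev := hasDevelopments_one isHeight_cuspHeight one_pos
    refine ⟨developedSpace hdev, ⟨?_, ?_, ?_⟩, ?_⟩
    · exact developedSpace_hasGroupoid isHeight_cuspHeight (isTileInvariant_pointDist one_pos 1) hdev
    · intro h; simp at h
    · exact fun _ => geodesicallyComplete_developedSpace isHeight_cuspHeight one_pos hdev
    · exact hasGeometricIdealTriangulation isHeight_cuspHeight one_pos one_pos hdev hm
  · obtain ⟨P, hP, hPr, hcos⟩ : ∃ P : ℝ, 1 ≤ P ∧ (‖shape₁ η‖ = P ∨ ‖shape₁ η‖ = P⁻¹) ∧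
        cos η = 2 - (P + P⁻¹) * (P + P⁻¹ - 1) / 2 := by
      have hc := cos_eq_of_norm_shape₁ hη
      rcases le_total 1 ‖shape₁ η‖ with h | h
      · exact ⟨_, h, Or.inl rfl, hc⟩
      · refine ⟨‖shape₁ η‖⁻¹, (one_le_inv₀ hr).2 h, Or.inr (inv_inv _).symm, ?_⟩
        rwa [inv_inv, add_comm ‖shape₁ η‖⁻¹]
    have hP0 : 0 < P := by linarith
    have hPi : 0 < P⁻¹ := inv_pos.2 hP0
    have hP1 : 1 < P := by
      refine hP.lt_of_ne fun h => h0 ?_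
      rw [← h] at hcos
      exact (cos_eq_one_iff_of_lt_of_lt (by linarith [hη.1, pi_pos])
        (by linarith [hη.2, pi_pos])).1 (by rw [hcos]; norm_num)
    have hcos' : -1 < cos η := by
      rw [← cos_abs, ← cos_pi]
      exact cos_lt_cos_of_nonneg_of_le_pi (abs_nonneg _) le_rfl (abs_lt.2 hη)
    have hT : P + P⁻¹ < 3 := by nlinarith
    obtain ⟨p, hp, rfl⟩ : ∃ p : ℝ, 1 < p ∧ p ^ 2 = P :=
      ⟨√P, by rwa [lt_sqrt zero_le_one, one_pow], sq_sqrt hP0.le⟩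
    have hp2 : p ^ 2 < p + 1 := by
      by_contra! h
      have h1 : 1 ≤ p - p⁻¹ := by
        have : p - p⁻¹ = (p ^ 2 - 1) / p := by field_simp
        rw [this, le_div_iff₀ (by linarith)]
        linarith
      have h2 : p ^ 2 + (p ^ 2)⁻¹ = (p - p⁻¹) ^ 2 + 2 := by field_simp; ring
      nlinarith
    obtain ⟨χ, ψ, hs, hsum⟩ := exists_isConeAngles hp hp2 (abs_nonneg η) (abs_lt.2 hη).le
      (by rw [cos_abs, hcos])
    obtain ⟨κ, h⟩ := exists_isConeParam hp
    choose coord σ hm using model (p ^ 2) hP0 hPr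
    refine ⟨developedSpace (hasDevelopments_cone h hs), ⟨?_, ?_, ?_⟩, ?_⟩
    · exact developedSpace_hasGroupoid h.isHeight (isTileInvariant_pointDist hP0 κ) _
    · intro _
      rw [← hsum]
      exact hasConeSingularity_developedSpace h hs
    · intro h; simp [h0] at h
    · exact hasGeometricIdealTriangulation h.isHeight hP0 h.pos _ hm

theorem mainTheorem3 :
    -- `z₁`, `z₂` are the continuous branches through the complete structure
    (ContinuousOn shape₁ (Set.Ioo (-Real.pi) Real.pi) ∧
      ContinuousOn shape₂ (Set.Ioo (-Real.pi) Real.pi) ∧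
      shape₁ 0 = Complex.exp (Real.pi / 3 * Complex.I) ∧
      shape₂ 0 = Complex.exp (Real.pi / 3 * Complex.I)) ∧
    (∀ η ∈ Set.Ioo (-Real.pi) Real.pi,
      -- they solve the quadratic equations, the cone-angle equations and the edge equation
      shape₁ η ^ 2 - (2 - Complex.exp (η * Complex.I)) * shape₁ η + 1 = 0 ∧
      shape₂ η ^ 2 - (2 - Complex.exp (-(η * Complex.I))) * shape₂ η + 1 = 0 ∧
      holonomyMu₁ (shape₁ η) = 2 * η * Complex.I ∧
      holonomyMu₂ (shape₂ η) = 2 * η * Complex.I ∧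
      holonomyEdge (shape₁ η) (shape₂ η) = 2 * Real.pi * Complex.I ∧
      -- they have positive imaginary part
      0 < (shape₁ η).im ∧ 0 < (shape₂ η).im ∧
      -- they are the shapes of a geometric ideal triangulation of the cone manifold
      ∃ _ : ChartedSpace HyperbolicSpace3 BundleLR,
        IsHyperbolicConeStructure (2 * |η|) ∧
        HasGeometricIdealTriangulation ![shape₁ η, shape₂ η] BundleLR) ∧
    -- all cone angles in `[0, 2π)` are realized
    (∀ θ ∈ Set.Ico 0 (2 * Real.pi),
      ∃ _ : ChartedSpace HyperbolicSpace3 BundleLR, IsHyperbolicConeStructure θ) := by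
  refine ⟨⟨continuousOn_shape₁, continuousOn_shape₂, shape₁_zero, shape₂_zero⟩,
    fun η hη => ⟨shapeRoot_spec _, shapeRoot_spec _, holonomyMu₁_shape₁ hη, holonomyMu₂_shape₂ hη,
      holonomyEdge_shape hη, shape₁_im_pos hη, ?_, exists_coneStructure hη⟩, fun θ hθ => ?_⟩
  · rw [shape₂_eq]; exact shape₁_im_pos (neg_mem_Ioo hη)
  · obtain ⟨C, hC, -⟩ := exists_coneStructure (η := θ / 2)
      ⟨by linarith [hθ.1, pi_pos], by linarith [hθ.2]⟩
    rw [abs_of_nonneg (by linarith [hθ.1]), mul_div_cancel₀ _ two_ne_zero] at hC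
    exact ⟨C, hC⟩
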